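/- **Theorem 3.1.** Let $\Omega\subset\mathbb R^2$ be a bounded domain with $C^\infty$ boundary such that $\partial\Omega$ is connected, i.e. a simple closed curve, of length $|\partial\Omega|$. Let $\gamma$ be a $|\partial\Omega|$-periodic arclength parametrization of $\partial\Omega$, $\nu(s)$ the outer unit normal of $\Omega$ at $\gamma(s)$ and $\kappa(s)=-\langle\gamma''(s),\nu(s)\rangle$ the curvature. For $\varepsilon>0$ let $\omega_\varepsilon=\{x\in\Omega:\operatorname{dist}(x,\partial\Omega)<\varepsilon\}$, let $\varepsilon_0$ be the supremum of all $\varepsilon>0$ such that every point of $\omega_\varepsilon$ has a unique nearest point on $\partial\Omega$, and put $\Phi_\varepsilon(s,t)=\gamma(s)-\varepsilon t\,\nu(s)$ for $t\in[0,1]$. Fix $\mu>0$ and $b>0$. Let $\mathcal H_\varepsilon=L^2(\partial\omega_\varepsilon;\varepsilon^{-2}d\sigma)$, with $\sigma$ the arclength measure, and $\mathcal H_0=L^2((0,|\partial\Omega|),2\,ds)$ (real-valued functions). Then $\varepsilon_0>0$, and the following holds. 1. For every $\varepsilon\in(0,\varepsilon_0)$ there is exactly one bounded linear map $\mathcal E_\varepsilon:\mathcal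 H_0\to\mathcal H_\varepsilon$ with $(\mathcal E_\varepsilon u)(\Phi_\varepsilon(s,0))=(\mathcal E_\varepsilon u)(\Phi_\varepsilon(s,1))=\varepsilon u(s)$ for a.e. $s$, for all $u\in\mathcal H_0$; moreover $\|\mathcal E_\varepsilon u\|_{\mathcal H_\varepsilon}\to\|u\|_{\mathcal H_0}$ as $\varepsilon\to0$ for every $u\in\mathcal H_0$. 2. For every $\varepsilon\in(0,\varepsilon_0)$ there is exactly one bounded linear operator $B_\varepsilon$ on $\mathcal H_\varepsilon$ such that, for each $f\in\mathcal H_\varepsilon$, the problem: find $u\in H^2(\omega_\varepsilon)$ with $$\int_{\omega_\varepsilon}D^2u:D^2\varphi\,dx+\mu\int_{\partial\omega_\varepsilon}\partial_\nu u\,\partial_\nu\varphi\,d\sigma+\varepsilon b\int_{\partial\omega_\varepsilon}u\varphi\,d\sigma=\int_{\partial\omega_\varepsilon}f\varphi\,d\sigma\qquad\text{for all }\varphi\in H^2(\omega_\varepsilon)$$ (boundary values in the sense of traces, $\partial_\nu$ the derivative in the direction of the outer normal of $\omega_\varepsilon$) is solvable, and $B_\varepsilon f=\varepsilon u|_{\partial\omega_\varepsilon}$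 for its solution $u$. 3. There is exactly one bounded linear operator $B_0$ on $\mathcal H_0$ such that, for each $f\in\mathcal H_0$, the problem $u''''-2(\kappa^2u')'+2bu=2f$ on $(0,|\partial\Omega|)$ with periodic boundary conditions is weakly solvable, that is, there is $u\in H^2_p$ with $$\int_0^{|\partial\Omega|}\bigl(u''\phi''+2\kappa^2u'\phi'+2bu\phi\bigr)ds=2\int_0^{|\partial\Omega|}f\phi\,ds\qquad\text{for all }\phi\in H^2_p,$$ and $B_0f=u$ for its solution $u$. Here $H^2_p$ is the closure in $H^2((0,|\partial\Omega|))$ of the smooth $|\partial\Omega|$-periodic functions. 4. $B_\varepsilon$ converges compactly to $B_0$ as $\varepsilon\to0$, with respect to the connecting maps $\mathcal E_\varepsilon$. That is: all $B_\varepsilon$, $\varepsilon\in(0,\varepsilon_0)$, and $B_0$ are compact; whenever $f_\varepsilon\in\mathcal H_\varepsilon$ and $f\in\mathcal H_0$ satisfy $\|f_\varepsilon-\mathcal E_\varepsilon f\|_{\mathcal H_\varepsilon}\to0$ as $\varepsilon\to0$, then $\|B_\varepsilon f_\varepsilon-\mathcal E_\varepsilon B_0f\|_{\mathcal H_\varepsilon}\to0$;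 and for every family $f_\varepsilon\in\mathcal H_\varepsilon$ with $\|f_\varepsilon\|_{\mathcal H_\varepsilon}=1$ for $\varepsilon\in(0,\varepsilon_0)$, every sequence $\varepsilon_n\to0$ in $(0,\varepsilon_0)$ has a subsequence $\varepsilon_{n_k}$ for which there is $g\in\mathcal H_0$ with $\|B_{\varepsilon_{n_k}}f_{\varepsilon_{n_k}}-\mathcal E_{\varepsilon_{n_k}}g\|_{\mathcal H_{\varepsilon_{n_k}}}\to0$. -/

import Mathlib

open MeasureTheory Filter Set Topology
open scoped ContDiff ENNReal

noncomputable section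

namespace ThinSteklov

/-- The Euclidean plane. -/
abbrev E2 : Type := EuclideanSpace ℝ (Fin 2)

/-! ### Plane domains with smooth boundary -/

/-- `D` has a smooth (`C^∞`) boundary: near each boundary point, `D` is the sublevel set `ψ < 0` of
a smooth function with non-vanishing differential. -/
def HasSmoothBoundary (D : Set E2) : Prop :=
  ∀ x ∈ frontier D, ∃ U ∈ 𝓝 x, ∃ ψ : E2 → ℝ,
    ContDiff ℝ ∞ ψ ∧ fderiv ℝ ψ x ≠ 0 ∧ ∀ y ∈ U, (y ∈ D ↔ ψ y < 0)

/-- `γ` is an arclength parametrization of the closed simple curve `∂Ω`, extended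
`L`-periodically; `L` is then the length `|∂Ω|`. -/
structure IsArclengthParam (Ω : Set E2) (L : ℝ) (γ : ℝ → E2) : Prop where
  pos : 0 < L
  smooth : ContDiff ℝ ∞ γ
  periodic : Function.Periodic γ L
  unit_speed : ∀ s, ‖deriv γ s‖ = 1
  injOn : InjOn γ (Ico 0 L)
  range_eq : range γ = frontier Ω

/-- `n` is the outer unit normal of `D` at `x`: the half-plane `⟨y - x, n⟩ < 0` is tangent to `D`
at `x`. -/
def IsOuterUnitNormal (D : Set E2) (x n : E2) : Prop :=
  ‖n‖ = 1 ∧ ∀ c > 0, ∀ᶠ y in 𝓝 x,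
    (inner ℝ (y - x) n < -(c * ‖y - x‖) → y ∈ D) ∧
    (c * ‖y - x‖ < inner ℝ (y - x) n → y ∉ D)

/-- A set has at most one outer unit normal at a point. -/
theorem IsOuterUnitNormal.unique {D : Set E2} {x n n' : E2}
    (h : IsOuterUnitNormal D x n) (h' : IsOuterUnitNormal D x n') : n = n' := by
  by_contra hne
  set v : E2 := n' - n with hv
  set a : ℝ := 1 - inner ℝ n n' with ha
  have hnn : inner ℝ n n = (1 : ℝ) := by rw [real_inner_self_eq_norm_sq, h.1]; norm_num
  have hnn' : inner ℝ n' n' = (1 : ℝ) := by rw [real_inner_self_eq_norm_sq, h'.1]; norm_num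
  have hvpos : 0 < ‖v‖ := norm_pos_iff.2 (sub_ne_zero.2 (Ne.symm hne))
  have h1 : inner ℝ v n = -a := by
    rw [hv, inner_sub_left, hnn, real_inner_comm, ha]; ring
  have h2 : inner ℝ v n' = a := by rw [hv, inner_sub_left, hnn', ha]
  have hvv : ‖v‖ ^ 2 = 2 * a := by
    rw [← real_inner_self_eq_norm_sq]
    nth_rewrite 2 [hv]
    rw [inner_sub_right, h1, h2]; ring
  have hapos : 0 < a := by nlinarith [sq_pos_of_pos hvpos]
  obtain ⟨c, hc, hca⟩ : ∃ c : ℝ, 0 < c ∧ c * ‖v‖ < a :=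
    ⟨a / (2 * ‖v‖), by positivity, by field_simp; linarith⟩
  have hev := (h.2 c hc).and (h'.2 c hc)
  have ht : Tendsto (fun t : ℝ => x + t • v) (𝓝[>] 0) (𝓝 x) := by
    have : Continuous fun t : ℝ => x + t • v := by fun_prop
    have h0 := this.tendsto 0
    simp only [zero_smul, add_zero] at h0
    exact h0.mono_left nhdsWithin_le_nhds
  obtain ⟨t, ⟨hA, hB⟩, htpos⟩ := ((ht.eventually hev).and self_mem_nhdsWithin).exists
  have htp : 0 < t := htpos
  have hmul := mul_lt_mul_of_pos_left hca htp
  simp only [add_sub_cancel_left, inner_smul_left, norm_smul, Real.norm_eq_abs, abs_of_pos htp,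
    h1, h2, RCLike.conj_to_real] at hA hB
  exact hB.2 (by nlinarith) (hA.1 (by nlinarith))

open Classical in
/-- The outer unit normal of `D` at `x` (where it exists, in particular at every boundary point
of a domain with smooth boundary). -/
def outerNormal (D : Set E2) (x : E2) : E2 :=
  if h : ∃ n, IsOuterUnitNormal D x n then h.choose else 0

/-- The thin set `ω_ε = {x ∈ Ω : dist(x, ∂Ω) < ε}`. -/
def thinSet (Ω : Set E2) (ε : ℝ) : Set E2 :=
  {x | x ∈ Ω ∧ Metric.infDist x (frontier Ω) < ε}

/-- The maximal tubular radius: the supremum of all `ε > 0` such that each point of `ω_ε`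
has a unique nearest point on `∂Ω`. -/
def tubularRadius (Ω : Set E2) : ℝ :=
  sSup {ε : ℝ | 0 < ε ∧ ∀ x ∈ thinSet Ω ε,
    ∃! y, y ∈ frontier Ω ∧ dist x y = Metric.infDist x (frontier Ω)}

/-- The map `Φ_ε(s,t) = γ(s) - ε t ν(s)`, where `ν(s)` is the outer unit normal of `Ω` at `γ(s)`. -/
def fermi (Ω : Set E2) (γ : ℝ → E2) (ε s t : ℝ) : E2 :=
  γ s - (ε * t) • outerNormal Ω (γ s)

/-- The curvature `κ(s)` of `∂Ω` with respect to the outer normal (positive for convex `Ω`). -/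
def curvature (Ω : Set E2) (γ : ℝ → E2) (s : ℝ) : ℝ :=
  -inner ℝ (deriv (deriv γ) s) (outerNormal Ω (γ s))

/-- The arclength measure `dσ` on the boundary of `D` (one-dimensional Hausdorff measure). -/
def bdryMeasure (D : Set E2) : Measure E2 :=
  (Measure.hausdorffMeasure 1).restrict (frontier D)

/-! ### The Sobolev space `H²(D)` and traces -/

/-- The classical partial derivative `∂φ/∂x_i`. -/
def pderiv (i : Fin 2) (φ : E2 → ℝ) (x : E2) : ℝ :=
  fderiv ℝ φ x (EuclideanSpace.single i 1)

/-- `g` is the weak partial derivative `∂f/∂x_i` in the open set `D`. -/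
def IsWeakPartial (D : Set E2) (i : Fin 2) (f g : E2 → ℝ) : Prop :=
  ∀ φ : E2 → ℝ, ContDiff ℝ ∞ φ → HasCompactSupport φ → tsupport φ ⊆ D →
    ∫ x in D, f x * pderiv i φ x = -∫ x in D, g x * φ x

/-- An element of `H²(D)`: an `L²` function on `D` whose weak partial derivatives of orders one and
two exist and lie in `L²(D)`. The derivatives are determined almost everywhere by the function. -/
structure H2 (D : Set E2) where
  val : E2 → ℝ
  grad : Fin 2 → E2 → ℝ
  hess : Fin 2 → Fin 2 → E2 → ℝ
  memLp_val : MemLp val 2 (volume.restrict D)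
  memLp_grad : ∀ i, MemLp (grad i) 2 (volume.restrict D)
  memLp_hess : ∀ i j, MemLp (hess i j) 2 (volume.restrict D)
  weak_grad : ∀ i, IsWeakPartial D i val (grad i)
  weak_hess : ∀ i j, IsWeakPartial D j (grad i) (hess i j)

/-- `g ∈ L²(∂D)` is the trace of the `H¹(D)` function `w` with weak gradient `dw`: the trace is the
continuous extension of the restriction map `φ ↦ φ|_∂D` from functions smooth up to the boundary. -/
def HasTrace (D : Set E2) (w : E2 → ℝ) (dw : Fin 2 → E2 → ℝ) (g : E2 → ℝ) : Prop :=
  MemLp g 2 (bdryMeasure D) ∧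
  ∃ φ : ℕ → E2 → ℝ, (∀ n, ContDiff ℝ ∞ (φ n)) ∧
    Tendsto (fun n => eLpNorm (fun x => φ n x - w x) 2 (volume.restrict D)) atTop (𝓝 0) ∧
    (∀ i, Tendsto (fun n => eLpNorm (fun x => pderiv i (φ n) x - dw i x) 2 (volume.restrict D))
      atTop (𝓝 0)) ∧
    Tendsto (fun n => eLpNorm (fun x => φ n x - g x) 2 (bdryMeasure D)) atTop (𝓝 0)

/-- `u₀` and `u₁` are the boundary values `u|_∂D` and `∂_ν u|_∂D` of `u ∈ H²(D)` in the sense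
of traces. -/
def HasBoundaryValues (D : Set E2) (u : H2 D) (u₀ u₁ : E2 → ℝ) : Prop :=
  HasTrace D u.val u.grad u₀ ∧
  ∃ t : Fin 2 → E2 → ℝ, (∀ i, HasTrace D (u.grad i) (u.hess i) (t i)) ∧
    u₁ =ᵐ[bdryMeasure D] fun x => ∑ i, t i x * outerNormal D x i

/-! ### The shifted Steklov problem on the thin set -/

/-- `u ∈ H²(ω_ε)`, with boundary values `u₀` and normal derivative `u₁`, is a weak solution of the
shifted biharmonic Steklov problem with boundary datum `f`. -/
def IsSteklovSolution (Ω : Set E2) (μ b ε : ℝ) (f : E2 → ℝ)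
    (u : H2 (thinSet Ω ε)) (u₀ u₁ : E2 → ℝ) : Prop :=
  HasBoundaryValues (thinSet Ω ε) u u₀ u₁ ∧
  ∀ (φ : H2 (thinSet Ω ε)) (φ₀ φ₁ : E2 → ℝ), HasBoundaryValues (thinSet Ω ε) φ φ₀ φ₁ →
    (∫ x in thinSet Ω ε, ∑ i, ∑ j, u.hess i j x * φ.hess i j x)
      + μ * (∫ x, u₁ x * φ₁ x ∂(bdryMeasure (thinSet Ω ε)))
      + ε * b * (∫ x, u₀ x * φ₀ x ∂(bdryMeasure (thinSet Ω ε)))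
    = ∫ x, f x * φ₀ x ∂(bdryMeasure (thinSet Ω ε))

/-- The space `H_ε = L²(∂ω_ε; ε⁻² dσ)`. -/
abbrev Heps (Ω : Set E2) (ε : ℝ) : Type :=
  Lp ℝ 2 (ENNReal.ofReal ((ε ^ 2)⁻¹) • bdryMeasure (thinSet Ω ε))

/-- `B` is the operator `B_ε f = ε u`, where `u` is the solution of the shifted Steklov problem
with datum `f`. -/
def IsSteklovResolvent (Ω : Set E2) (μ b ε : ℝ) (B : Heps Ω ε →L[ℝ] Heps Ω ε) : Prop :=
  ∀ f : Heps Ω ε,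
    (∃ u u₀ u₁, IsSteklovSolution Ω μ b ε f u u₀ u₁) ∧
    ∀ u u₀ u₁, IsSteklovSolution Ω μ b ε f u u₀ u₁ →
      B f =ᵐ[bdryMeasure (thinSet Ω ε)] fun x => ε * u₀ x

/-! ### The one-dimensional limit problem -/

/-- An element of `H²_p(0,L)`, the closure in `H²(0,L)` of the smooth `L`-periodic functions, with
its first and second (weak) derivative. -/
structure H2p (L : ℝ) where
  val : ℝ → ℝ
  d1 : ℝ → ℝ
  d2 : ℝ → ℝ
  memLp_val : MemLp val 2 (volume.restrict (Ioo 0 L))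
  memLp_d1 : MemLp d1 2 (volume.restrict (Ioo 0 L))
  memLp_d2 : MemLp d2 2 (volume.restrict (Ioo 0 L))
  approx : ∃ φ : ℕ → ℝ → ℝ, (∀ n, ContDiff ℝ ∞ (φ n)) ∧ (∀ n, Function.Periodic (φ n) L) ∧
    Tendsto (fun n => eLpNorm (fun s => φ n s - val s) 2 (volume.restrict (Ioo 0 L)))
      atTop (𝓝 0) ∧
    Tendsto (fun n => eLpNorm (fun s => deriv (φ n) s - d1 s) 2 (volume.restrict (Ioo 0 L)))
      atTop (𝓝 0) ∧
    Tendsto (fun n => eLpNorm (fun s => deriv (deriv (φ n)) s - d2 s) 2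
      (volume.restrict (Ioo 0 L))) atTop (𝓝 0)

/-- `u ∈ H²_p(0,L)` is a weak solution of `u'''' - 2 (κ² u')' + 2 b u = 2 f` with periodic boundary
conditions. -/
def IsLimitSolution (L : ℝ) (κ : ℝ → ℝ) (b : ℝ) (f : ℝ → ℝ) (u : H2p L) : Prop :=
  ∀ φ : H2p L,
    (∫ s in Ioo 0 L, (u.d2 s * φ.d2 s + 2 * κ s ^ 2 * (u.d1 s * φ.d1 s)
      + 2 * b * (u.val s * φ.val s)))
    = 2 * ∫ s in Ioo 0 L, f s * φ.val s

/-- The space `H_0 = L²((0,L), 2 ds)`. -/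
abbrev Hzero (L : ℝ) : Type :=
  Lp ℝ 2 ((2 : ℝ≥0∞) • (volume.restrict (Ioo 0 L) : Measure ℝ))

/-- `B₀` is the operator `B_0 f = u`, where `u` is the solution of the limit problem with
datum `f`. -/
def IsLimitResolvent (L : ℝ) (κ : ℝ → ℝ) (b : ℝ) (B₀ : Hzero L →L[ℝ] Hzero L) : Prop :=
  ∀ f : Hzero L,
    (∃ u, IsLimitSolution L κ b f u) ∧
    ∀ u, IsLimitSolution L κ b f u → B₀ f =ᵐ[volume.restrict (Ioo 0 L)] u.val

/-- `E` is the connecting map `E_ε`: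
`(E_ε u ∘ Φ_ε)(s,0) = (E_ε u ∘ Φ_ε)(s,1) = ε u(s)`. -/
def IsConnectingMap (Ω : Set E2) (L : ℝ) (γ : ℝ → E2) (ε : ℝ)
    (E : Hzero L →L[ℝ] Heps Ω ε) : Prop :=
  ∀ u : Hzero L, ∀ᵐ s ∂(volume.restrict (Ioo 0 L)),
    E u (fermi Ω γ ε s 0) = ε * u s ∧ E u (fermi Ω γ ε s 1) = ε * u s

/-! ### Compact convergence along a connecting system -/

section Convergence

variable {H₀ : Type*} {H : ℝ → Type*} [NormedAddCommGroup H₀] [NormedSpace ℝ H₀]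
  [∀ ε, NormedAddCommGroup (H ε)] [∀ ε, NormedSpace ℝ (H ε)]

/-- `E` is a connecting system: `‖E_ε f‖ → ‖f‖` as `ε → 0`, for all `f`. -/
def IsConnectingSystem (E : ∀ ε, H₀ →L[ℝ] H ε) : Prop :=
  ∀ f : H₀, Tendsto (fun ε => ‖E ε f‖) (𝓝[>] 0) (𝓝 ‖f‖)

/-- The family `f_ε` `E`-converges to `f₀` as `ε → 0`. -/
def EConverges (E : ∀ ε, H₀ →L[ℝ] H ε) (f : ∀ ε, H ε) (f₀ : H₀) : Prop :=
  Tendsto (fun ε => ‖f ε - E ε f₀‖) (𝓝[>] 0) (𝓝 0)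

/-- The operators `B_ε` `E`-converge to `B₀` as `ε → 0`. -/
def OpEConverges (E : ∀ ε, H₀ →L[ℝ] H ε) (B : ∀ ε, H ε →L[ℝ] H ε) (B₀ : H₀ →L[ℝ] H₀) : Prop :=
  ∀ (f : ∀ ε, H ε) (f₀ : H₀), EConverges E f f₀ → EConverges E (fun ε => B ε (f ε)) (B₀ f₀)

/-- The family `f_ε`, `0 < ε < ε₀`, is precompact: each sequence `ε_n → 0` has a subsequence along
which it `E`-converges. -/
def EPrecompact (ε₀ : ℝ) (E : ∀ ε, H₀ →L[ℝ] H ε) (f : ∀ ε, H ε) : Prop :=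
  ∀ e : ℕ → ℝ, (∀ n, e n ∈ Ioo 0 ε₀) → Tendsto e atTop (𝓝 0) →
    ∃ k : ℕ → ℕ, StrictMono k ∧ ∃ f₀ : H₀,
      Tendsto (fun j => ‖f (e (k j)) - E (e (k j)) f₀‖) atTop (𝓝 0)

/-- The compact operators `B_ε`, `0 < ε < ε₀`, converge compactly to the compact operator `B₀`
as `ε → 0`. -/
def ConvergesCompactly (ε₀ : ℝ) (E : ∀ ε, H₀ →L[ℝ] H ε) (B : ∀ ε, H ε →L[ℝ] H ε)
    (B₀ : H₀ →L[ℝ] H₀) : Prop :=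
  (∀ ε ∈ Ioo 0 ε₀, IsCompactOperator (B ε)) ∧
  IsCompactOperator B₀ ∧
  OpEConverges E B B₀ ∧
  ∀ f : ∀ ε, H ε, (∀ ε ∈ Ioo 0 ε₀, ‖f ε‖ = 1) → EPrecompact ε₀ E (fun ε => B ε (f ε))

end Convergence

end ThinSteklov

end

open ThinSteklov

open MeasureTheory Filter Set Topology
open scoped ContDiff ENNReal

noncomputable section

namespace ThinSteklov

/-! In the coordinates x = γ(s) − εtν(s) the thin set becomes the fixed strip (0, L) × (0, 1), with
area element εJ ds dt, where J = 1 − εtκ(s). In the moving frame (γ', ν) a function in H² has the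
components W (its value), r and q (tangential and normal derivative) and a, b, c (tangential, mixed
and normal second derivative). The chain rule and the Frenet formulas link them: W_s = Jr, W_t =
−εq; r_s = Ja − κq, r_t = −εb; q_s = Jb + κr, q_t = −εc. After division by ε the Steklov form is the
integral of J(a² + 2b² + c²) over the strip, plus μ/ε times the integral of q² over both boundary
curves, plus the shift parameter times the integral of W² over both curves (with weight J on the
inner one).

The coefficient μ/ε forces q = O(√ε). Then q_s = Jb + κr is small in the weak sense, so b is close
to −κr, and the term 2b² turns into 2κ²u'². Further a is close to u'', and c disappears because
functions constant along the normals have c = 0. The two boundary curves together give the factor 2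
in the zero order term and in the load. This is the limit form.

Geometry. The tubular radius is defined by uniqueness of nearest points only, whereas normal
coordinates are needed for every ε below it. `exists_infDist_ge` moves away from the boundary at
unit speed, `ray_mem_and_infDist` deduces that nearest points propagate along normals, and
`one_sub_mul_curvature_pos` excludes focal points. `isTube_thinSet` collects the outcome: area
formula, boundary measure, normals, and smooth extension of functions of (s, t).

Existence, uniqueness and compactness for fixed ε. Sobolev functions with traces are realized as
closures of smooth functions in products of L² spaces, so identities need only be checked on smooth
functions. Solvability is the projection theorem (`exists_variational_solution`). All compactness
comes from the operator of taking primitives (`isCompactOperator_volterra`): averages over t of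
Sobolev functions are primitives in s, and traces are combinations of such averages.

Convergence follows the pattern "stability plus consistency", without weak limits. Stability is
`exists_field_bound`: the energy controls all components, uniformly in ε. Each thin field F has a
companion `limitData` in H²_p, whose values are O(ε)-close to both traces of F
(`exists_norm_trace_sub_le`). Consistency is `exists_abs_energy_sub_le`: for smooth periodic ψ
extended constantly along the normals, the energy against F equals the limit form of ψ against the
companion of F up to O(√ε). If ψ approximates the limit solution, w is its extension and v is the
thin solution, then testing with v − w bounds the energy of v − w by a small number times its norm,
and stability makes v − w small. Precompactness is easier: the companions of normalized families are
bounded in H²_p, which embeds compactly into L². -/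

/-! ### Weighted composition operators on `L²` -/

/-- `f ↦ w * (f ∘ Φ)` maps `L²(ν)` to `L²(ν')` with norm at most `C`. -/
structure IsWComp {α β : Type*} [MeasurableSpace α] [MeasurableSpace β] (ν : Measure α)
    (ν' : Measure β) (Φ : β → α) (w : β → ℝ) (C : ℝ) : Prop where
  nonneg : 0 ≤ C
  qmp : Measure.QuasiMeasurePreserving Φ ν' ν
  memLp : ∀ f : α → ℝ, MemLp f 2 ν → MemLp (fun y => w y * f (Φ y)) 2 ν'
  bound : ∀ f : α → ℝ, MemLp f 2 ν →
    eLpNorm (fun y => w y * f (Φ y)) 2 ν' ≤ ENNReal.ofReal C * eLpNorm f 2 ν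

section WComp

variable {α β : Type*} [MeasurableSpace α] [MeasurableSpace β] {ν : Measure α}
    {ν' : Measure β} {Φ : β → α} {w : β → ℝ} {C : ℝ}

/-- A bounded weight and a domination of the image measure give a weighted composition operator. -/
theorem IsWComp.of_map_le (hΦ : Measurable Φ) (hw : Measurable w) {c K : ℝ} (hc : 0 ≤ c)
    (hK : 0 ≤ K) (hwc : ∀ᵐ y ∂ν', |w y| ≤ c)
    (hmap : Measure.map Φ ν' ≤ ENNReal.ofReal (K ^ 2) • ν) : IsWComp ν ν' Φ w (c * K) := by
  have hq : Measure.QuasiMeasurePreserving Φ ν' ν :=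
    ⟨hΦ, (Measure.absolutelyContinuous_of_le hmap).trans
      (Measure.smul_absolutelyContinuous)⟩
  have hb : ∀ f : α → ℝ, MemLp f 2 ν →
      eLpNorm (fun y => w y * f (Φ y)) 2 ν' ≤ ENNReal.ofReal (c * K) * eLpNorm f 2 ν := by
    intro f hf
    have hf' : AEStronglyMeasurable f (Measure.map Φ ν') := hf.1.mono_ac hq.absolutelyContinuous
    calc eLpNorm (fun y => w y * f (Φ y)) 2 ν'
        ≤ ENNReal.ofReal c * eLpNorm (f ∘ Φ) 2 ν' := by
          refine eLpNorm_le_mul_eLpNorm_of_ae_le_mul ?_ 2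
          filter_upwards [hwc] with y hy
          rw [norm_mul]
          exact mul_le_mul_of_nonneg_right hy (norm_nonneg _)
      _ = ENNReal.ofReal c * eLpNorm f 2 (Measure.map Φ ν') := by
          rw [eLpNorm_map_measure hf' hΦ.aemeasurable]
      _ ≤ ENNReal.ofReal c * eLpNorm f 2 (ENNReal.ofReal (K ^ 2) • ν) := by
          gcongr
      _ = ENNReal.ofReal c * (ENNReal.ofReal K * eLpNorm f 2 ν) := by
          rw [eLpNorm_smul_measure_of_ne_top (by norm_num)]
          rw [smul_eq_mul]
          congr 2
          have : ((1 : ℝ≥0∞) / 2).toReal = 1 / 2 := by simp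
          rw [this, ENNReal.ofReal_rpow_of_nonneg (by positivity) (by norm_num), ← Real.sqrt_eq_rpow,
            Real.sqrt_sq hK]
      _ = _ := by rw [ENNReal.ofReal_mul hc, mul_assoc]
  refine ⟨by positivity, hq, fun f hf => ⟨?_, ?_⟩, hb⟩
  · exact hw.aestronglyMeasurable.mul (hf.1.comp_quasiMeasurePreserving hq)
  · exact (hb f hf).trans_lt (ENNReal.mul_lt_top ENNReal.ofReal_lt_top hf.2)

/-- The bounded operator `f ↦ w * (f ∘ Φ)`. -/
def IsWComp.op (h : IsWComp ν ν' Φ w C) : Lp ℝ 2 ν →L[ℝ] Lp ℝ 2 ν' :=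
  LinearMap.mkContinuous
    { toFun := fun f => (h.memLp f (Lp.memLp f)).toLp _
      map_add' := by
        intro f g
        refine Lp.ext ?_
        filter_upwards [(h.memLp _ (Lp.memLp (f + g))).coeFn_toLp, h.qmp.ae (Lp.coeFn_add f g),
          (h.memLp _ (Lp.memLp f)).coeFn_toLp, (h.memLp _ (Lp.memLp g)).coeFn_toLp,
          Lp.coeFn_add ((h.memLp f (Lp.memLp f)).toLp _) ((h.memLp g (Lp.memLp g)).toLp _)]
          with y h1 h2 h3 h4 h5
        rw [h1, h5, Pi.add_apply, h3, h4, h2, Pi.add_apply, mul_add]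
      map_smul' := by
        intro a f
        refine Lp.ext ?_
        filter_upwards [(h.memLp _ (Lp.memLp (a • f))).coeFn_toLp, h.qmp.ae (Lp.coeFn_smul a f),
          (h.memLp _ (Lp.memLp f)).coeFn_toLp,
          Lp.coeFn_smul a ((h.memLp f (Lp.memLp f)).toLp _)]
          with y h1 h2 h3 h5
        rw [h1, RingHom.id_apply, h5, Pi.smul_apply, h3, h2, Pi.smul_apply, smul_eq_mul,
          smul_eq_mul]
        ring } C (by
        intro f
        change ‖(h.memLp f (Lp.memLp f)).toLp _‖ ≤ C * ‖f‖
        rw [Lp.norm_toLp, Lp.norm_def]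
        have := ENNReal.toReal_mono (ENNReal.mul_ne_top ENNReal.ofReal_ne_top
          (Lp.eLpNorm_ne_top f)) (h.bound f (Lp.memLp f))
        rwa [ENNReal.toReal_mul, ENNReal.toReal_ofReal h.nonneg] at this)

theorem IsWComp.coeFn_op (h : IsWComp ν ν' Φ w C) (f : Lp ℝ 2 ν) :
    h.op f =ᵐ[ν'] fun y => w y * f (Φ y) :=
  (h.memLp f (Lp.memLp f)).coeFn_toLp

theorem IsWComp.op_toLp (h : IsWComp ν ν' Φ w C) {f : α → ℝ} (hf : MemLp f 2 ν) :
    h.op (hf.toLp f) = (h.memLp f hf).toLp _ := by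
  refine Lp.ext ?_
  filter_upwards [h.coeFn_op (hf.toLp f), (h.memLp f hf).coeFn_toLp, h.qmp.ae hf.coeFn_toLp]
    with y h1 h2 h3
  rw [h1, h2, h3]

end WComp

/-- The inner product of `L²` functions given by representatives. -/
theorem inner_toLp {α : Type*} [MeasurableSpace α] {ν : Measure α} {f g : α → ℝ}
    (hf : MemLp f 2 ν) (hg : MemLp g 2 ν) :
    inner ℝ (hf.toLp f) (hg.toLp g) = ∫ x, f x * g x ∂ν := by
  rw [L2.inner_def]
  refine integral_congr_ae ?_
  filter_upwards [hf.coeFn_toLp, hg.coeFn_toLp] with x h1 h2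
  rw [h1, h2]
  simp [mul_comm]

theorem inner_eq_integral {α : Type*} [MeasurableSpace α] {ν : Measure α} (f g : Lp ℝ 2 ν) :
    inner ℝ f g = ∫ x, f x * g x ∂ν := by
  rw [L2.inner_def]
  refine integral_congr_ae (Eventually.of_forall fun x => ?_)
  simp [mul_comm]

/-! ### Solvability of coercive problems -/

/-- A variational problem with bilinear form `⟨A u, A v⟩`, where `A` is bounded below, is
solvable by a bounded operator. -/
theorem exists_variational_solution {V X Z : Type*} [NormedAddCommGroup V] [NormedSpace ℝ V]
    [CompleteSpace V] [NormedAddCommGroup X] [InnerProductSpace ℝ X] [CompleteSpace X]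
    [NormedAddCommGroup Z] [NormedSpace ℝ Z] (A : V →L[ℝ] X) (C : ℝ)
    (hA : ∀ v, ‖v‖ ≤ C * ‖A v‖) (j : Z →L[ℝ] X) :
    ∃ S : Z →L[ℝ] V, ∀ f v, inner ℝ (A (S f)) (A v) = inner ℝ (j f) (A v) := by
  have hanti : AntilipschitzWith (Real.toNNReal C) A := by
    refine AddMonoidHomClass.antilipschitz_of_bound A fun x => (hA x).trans ?_
    gcongr
    exact Real.le_coe_toNNReal C
  -- An operator bounded below has closed range, so `j f` can be projected orthogonally onto the
  -- range of `A`; the solution is the preimage of the projection, and orthogonality of the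
  -- remainder is the variational equation.
  have hcl : IsClosed (range A) := hanti.isClosed_range A.uniformContinuous
  let e := A.equivRange hanti.injective hcl
  have : CompleteSpace (LinearMap.range A.toLinearMap) := by
    have : IsClosed (LinearMap.range A.toLinearMap : Set X) := hcl
    exact this.completeSpace_coe
  let P := (LinearMap.range A.toLinearMap).orthogonalProjectionOnto
  refine ⟨(e.symm : _ →L[ℝ] V) ∘L P ∘L j, fun f v => ?_⟩
  have h1 : A (e.symm (P (j f))) = (P (j f) : X) := by
    have := e.apply_symm_apply (P (j f))
    exact congrArg Subtype.val this
  have h2 : A v ∈ LinearMap.range A.toLinearMap := ⟨v, rfl⟩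
  change inner ℝ (A (e.symm (P (j f)))) (A v) = _
  rw [h1]
  have := Submodule.starProjection_inner_eq_zero (K := LinearMap.range A.toLinearMap) (j f) (A v) h2
  rw [inner_sub_left, sub_eq_zero] at this
  exact this.symm

/-! ### The interval: primitives as a compact operator -/

/-- Lebesgue measure on `(0, L)`. -/
abbrev muI (L : ℝ) : Measure ℝ := volume.restrict (Ioo 0 L)

/-- `L²(0, L)`. -/
abbrev LI (L : ℝ) : Type := Lp ℝ 2 (muI L)

theorem memLp_I {L : ℝ} {f : ℝ → ℝ} (hf : Continuous f) : MemLp f 2 (muI L) := by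
  obtain ⟨C, hC⟩ := isCompact_Icc.exists_bound_of_continuousOn (s := Icc 0 L) hf.continuousOn
  refine MemLp.of_bound hf.aestronglyMeasurable C ?_
  filter_upwards [ae_restrict_mem measurableSet_Ioo] with s hs
  exact hC s (Ioo_subset_Icc_self hs)

/-- The class of a continuous function in `L²(0, L)`. -/
def cI (L : ℝ) (f : ℝ → ℝ) (hf : Continuous f) : LI L := (memLp_I hf).toLp f

theorem coeFn_cI {L : ℝ} {f : ℝ → ℝ} (hf : Continuous f) : cI L f hf =ᵐ[muI L] f :=
  (memLp_I hf).coeFn_toLp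

/-- The constant function `1`. -/
def oneI (L : ℝ) : LI L := cI L (fun _ => 1) continuous_const

theorem coeFn_oneI {L : ℝ} : oneI L =ᵐ[muI L] fun _ => 1 := coeFn_cI _

/-- The indicator function of `(0, s]`, as an element of `L²(0, L)`. -/
def kerI (L s : ℝ) : LI L :=
  indicatorConstLp 2 (measurableSet_Iic (a := s)) (measure_ne_top (muI L) _) (1 : ℝ)

theorem inner_kerI {L : ℝ} (s : ℝ) (g : LI L) :
    inner ℝ (kerI L s) g = ∫ σ in Iic s, g σ ∂(muI L) := by
  rw [kerI, L2.inner_indicatorConstLp_one]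

/-- The difference is the indicator of (s, s'], whose norm is the root of its measure. By duality
primitives of L² functions are Hölder continuous with exponent 1/2. -/
theorem norm_kerI_sub_le {L s s' : ℝ} (h : s ≤ s') :
    ‖kerI L s' - kerI L s‖ ≤ Real.sqrt (s' - s) := by
  have hd : kerI L s' - kerI L s =
      indicatorConstLp 2 (measurableSet_Ioc (a := s) (b := s')) (measure_ne_top (muI L) _)
        (1 : ℝ) := by
    refine Lp.ext ?_
    filter_upwards [Lp.coeFn_sub (kerI L s') (kerI L s),
      indicatorConstLp_coeFn (p := 2) (hs := measurableSet_Iic (a := s))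
        (hμs := measure_ne_top (muI L) _) (c := (1 : ℝ)),
      indicatorConstLp_coeFn (p := 2) (hs := measurableSet_Iic (a := s'))
        (hμs := measure_ne_top (muI L) _) (c := (1 : ℝ)),
      indicatorConstLp_coeFn (p := 2) (hs := measurableSet_Ioc (a := s) (b := s'))
        (hμs := measure_ne_top (muI L) _) (c := (1 : ℝ))] with σ h1 h2 h3 h4
    rw [h1, Pi.sub_apply, kerI, kerI, h2, h3, h4]
    by_cases ha : σ ≤ s
    · have hb := ha.trans h
      simp [ha, hb, not_lt.2 ha]
    · by_cases hb : σ ≤ s'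
      · simp [ha, hb, not_le.1 ha]
      · simp [ha, hb]
  rw [hd, norm_indicatorConstLp (by norm_num) (by norm_num)]
  have h1 : (muI L).real (Ioc s s') ≤ s' - s := by
    calc (muI L).real (Ioc s s') ≤ (volume : Measure ℝ).real (Ioc s s') := by
          refine ENNReal.toReal_mono (by simp) (Measure.restrict_apply_le _ _)
      _ = s' - s := by rw [Real.volume_real_Ioc_of_le h]
  rw [Real.sqrt_eq_rpow]
  simp only [norm_one, one_mul, ENNReal.toReal_ofNat]
  exact Real.rpow_le_rpow measureReal_nonneg h1 (by norm_num)

/-- The primitive `∫₀ˢ g`. -/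
def prim {L : ℝ} (g : LI L) (s : ℝ) : ℝ := ∫ σ in Iic s, g σ ∂(muI L)

theorem abs_prim_sub_le {L s s' : ℝ} (h : s ≤ s') (g : LI L) :
    |prim g s' - prim g s| ≤ Real.sqrt (s' - s) * ‖g‖ := by
  rw [prim, prim, ← inner_kerI, ← inner_kerI, ← inner_sub_left]
  exact (abs_real_inner_le_norm _ _).trans (by gcongr; exact norm_kerI_sub_le h)

theorem prim_zero {L : ℝ} (g : LI L) : prim g 0 = 0 := by
  have : (muI L).restrict (Iic 0) = 0 := by
    rw [Measure.restrict_restrict measurableSet_Iic]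
    have : Iic 0 ∩ Ioo 0 L = ∅ := by ext x; simp; intro a b; linarith
    simp [this]
  simp [prim, this]

theorem abs_prim_le {L s : ℝ} (hs : s ∈ Icc 0 L) (g : LI L) :
    |prim g s| ≤ Real.sqrt L * ‖g‖ := by
  have := abs_prim_sub_le hs.1 g
  rw [prim_zero, sub_zero, sub_zero] at this
  exact this.trans (by gcongr; exact hs.2)

theorem continuous_prim {L : ℝ} (g : LI L) : Continuous (prim g) := by
  refine continuous_iff_continuousAt.2 fun s => ?_
  rw [ContinuousAt, tendsto_iff_dist_tendsto_zero]
  refine squeeze_zero (fun _ => dist_nonneg) (g := fun x => Real.sqrt |x - s| * ‖g‖) ?_ ?_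
  · intro x
    rw [Real.dist_eq]
    rcases le_total x s with h | h
    · rw [abs_sub_comm, abs_sub_comm x, abs_of_nonneg (sub_nonneg.2 h)]
      exact abs_prim_sub_le h g
    · rw [abs_of_nonneg (sub_nonneg.2 h)]
      exact abs_prim_sub_le h g
  · have : Continuous fun x : ℝ => Real.sqrt |x - s| * ‖g‖ := by fun_prop
    simpa using this.tendsto s

/-- The length of a possibly empty interval is `max L 0`; with it `volterra` needs no sign
assumption on `L`. -/
theorem sqrt_measure_univ_I (L : ℝ) :
    ((measureUnivNNReal (muI L) : ℝ)) ^ ((2 : ℝ≥0∞).toReal)⁻¹ = Real.sqrt (max L 0) := by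
  rw [Real.sqrt_eq_rpow]
  congr 1
  · simp only [measureUnivNNReal, Measure.restrict_apply_univ, Real.volume_Ioo, sub_zero]
    exact ENNReal.toReal_ofReal'
  · norm_num

theorem norm_le_of_ae_I {L : ℝ} (f : LI L) {C : ℝ} (hC : 0 ≤ C) (h : ∀ᵐ s ∂(muI L), |f s| ≤ C) :
    ‖f‖ ≤ Real.sqrt (max L 0) * C := by
  have := Lp.norm_le_of_ae_bound hC (f := f) (by simpa using h)
  rwa [sqrt_measure_univ_I] at this

/-- The operator `g ↦ ∫₀ˢ g` on `L²(0, L)`. -/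
def volterra (L : ℝ) : LI L →L[ℝ] LI L :=
  LinearMap.mkContinuous
    { toFun := fun g => cI L (prim g) (continuous_prim g)
      map_add' := by
        intro f g
        refine Lp.ext ?_
        filter_upwards [coeFn_cI (L := L) (continuous_prim (f + g)),
          coeFn_cI (L := L) (continuous_prim f), coeFn_cI (L := L) (continuous_prim g),
          Lp.coeFn_add (cI L _ (continuous_prim f)) (cI L _ (continuous_prim g))] with s h1 h2 h3 h4
        rw [h1, h4, Pi.add_apply, h2, h3, prim, prim, prim, ← inner_kerI, ← inner_kerI,
          ← inner_kerI, inner_add_right]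
      map_smul' := by
        intro a f
        refine Lp.ext ?_
        filter_upwards [coeFn_cI (L := L) (continuous_prim (a • f)),
          coeFn_cI (L := L) (continuous_prim f),
          Lp.coeFn_smul a (cI L _ (continuous_prim f))] with s h1 h2 h4
        rw [h1, RingHom.id_apply, h4, Pi.smul_apply, h2, prim, prim, ← inner_kerI, ← inner_kerI,
          inner_smul_right, smul_eq_mul] } (Real.sqrt (max L 0) * Real.sqrt L) (by
        intro f
        change ‖cI L _ (continuous_prim f)‖ ≤ _
        rw [mul_assoc]
        refine norm_le_of_ae_I _ (by positivity) ?_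
        filter_upwards [coeFn_cI (L := L) (continuous_prim f), ae_restrict_mem measurableSet_Ioo]
          with s h1 h2
        rw [h1]
        exact abs_prim_le (Ioo_subset_Icc_self h2) f)

theorem coeFn_volterra {L : ℝ} (g : LI L) : volterra L g =ᵐ[muI L] prim g :=
  coeFn_cI (continuous_prim g)

theorem isCompactOperator_smulRight {E F : Type*} [NormedAddCommGroup E] [NormedSpace ℝ E]
    [NormedAddCommGroup F] [NormedSpace ℝ F] (f : E →L[ℝ] ℝ) (x : F) :
    IsCompactOperator (f.smulRight x : E →L[ℝ] F) := by
  have h1 : IsCompactOperator (id : ℝ → ℝ) := isCompactOperator_id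
  exact (h1.clm_comp (ContinuousLinearMap.toSpanSingleton ℝ x)).comp_clm f

/-- The operator `g ↦ ∫₀ˢ g` is compact. -/
theorem isCompactOperator_volterra {L : ℝ} (hL : 0 < L) : IsCompactOperator (volterra L) := by
  -- On each of `N + 1` equal cells the primitive is replaced by its value at the left end point.
  -- This has finite rank, and Hölder continuity bounds the error pointwise by the root of the cell
  -- length, so that the primitive is a norm limit of finite rank operators.
  let T : ℕ → LI L →L[ℝ] LI L := fun N => ∑ k ∈ Finset.range (N + 1),
    (innerSL ℝ (kerI L (k * (L / (N + 1))))).smulRight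
      (indicatorConstLp 2 (measurableSet_Ico (a := (k : ℝ) * (L / (N + 1)))
        (b := ((k : ℝ) + 1) * (L / (N + 1)))) (measure_ne_top (muI L) _) (1 : ℝ))
  have hTc : ∀ N, IsCompactOperator (T N) := by
    intro N
    have : T N ∈ compactOperator (RingHom.id ℝ) (LI L) (LI L) :=
      Submodule.sum_mem _ fun k _ => isCompactOperator_smulRight _ _
    exact this
  have hT : ∀ N, ‖T N - volterra L‖ ≤ Real.sqrt (max L 0) * Real.sqrt (L / (N + 1)) := by
    intro N
    refine ContinuousLinearMap.opNorm_le_bound _ (by positivity) fun g => ?_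
    rw [mul_assoc]
    refine norm_le_of_ae_I _ (by positivity) ?_
    have hTN : T N g = ∑ k ∈ Finset.range (N + 1), (prim g (k * (L / (N + 1)))) •
      (indicatorConstLp 2 (measurableSet_Ico (a := (k : ℝ) * (L / (N + 1)))
        (b := ((k : ℝ) + 1) * (L / (N + 1)))) (measure_ne_top (muI L) _) (1 : ℝ)) := by
      simp only [T, sum_apply, ContinuousLinearMap.smulRight_apply,
        innerSL_apply_apply, inner_kerI, prim]
    have hcoe : ∀ᵐ s ∂(muI L), (T N g) s = ∑ k ∈ Finset.range (N + 1),
        (prim g (k * (L / (N + 1)))) * (Ico ((k : ℝ) * (L / (N + 1)))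
          (((k : ℝ) + 1) * (L / (N + 1)))).indicator (fun _ => (1 : ℝ)) s := by
      rw [hTN]
      have h1 : ∀ᵐ s ∂(muI L), ∀ k ∈ Finset.range (N + 1), ((prim g (k * (L / (N + 1)))) •
        (indicatorConstLp 2 (measurableSet_Ico (a := (k : ℝ) * (L / (N + 1)))
        (b := ((k : ℝ) + 1) * (L / (N + 1)))) (measure_ne_top (muI L) _) (1 : ℝ)) : LI L) s =
        (prim g (k * (L / (N + 1)))) * (Ico ((k : ℝ) * (L / (N + 1)))
          (((k : ℝ) + 1) * (L / (N + 1)))).indicator (fun _ => (1 : ℝ)) s := by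
        refine (Finset.eventually_all _).2 fun k _ => ?_
        filter_upwards [Lp.coeFn_smul (prim g (k * (L / (N + 1))))
          (indicatorConstLp 2 (measurableSet_Ico (a := (k : ℝ) * (L / (N + 1)))
          (b := ((k : ℝ) + 1) * (L / (N + 1)))) (measure_ne_top (muI L) _) (1 : ℝ)),
          indicatorConstLp_coeFn (p := 2) (hs := measurableSet_Ico (a := (k : ℝ) * (L / (N + 1)))
          (b := ((k : ℝ) + 1) * (L / (N + 1)))) (hμs := measure_ne_top (muI L) _) (c := (1 : ℝ))]
          with s h1 h2
        rw [h1, Pi.smul_apply, h2, smul_eq_mul]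
      filter_upwards [h1, Lp.coeFn_finsetSum (Finset.range (N + 1)) (fun k : ℕ =>
        ((prim g (k * (L / (N + 1)))) •
        (indicatorConstLp 2 (measurableSet_Ico (a := (k : ℝ) * (L / (N + 1)))
        (b := ((k : ℝ) + 1) * (L / (N + 1)))) (measure_ne_top (muI L) _) (1 : ℝ)) : LI L))]
        with s h1 h2
      rw [h2, Finset.sum_apply]
      exact Finset.sum_congr rfl h1
    filter_upwards [hcoe, coeFn_volterra g, Lp.coeFn_sub (T N g) (volterra L g),
      ae_restrict_mem measurableSet_Ioo] with s h1 h2 h3 hs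
    have hd : 0 < L / (N + 1) := by positivity
    rw [sub_apply, h3, Pi.sub_apply, h1, h2]
    set d := L / (N + 1)
    set k₀ := ⌊s / d⌋₊
    have hk1 : (k₀ : ℝ) * d ≤ s := by
      rw [← le_div_iff₀ hd]; exact Nat.floor_le (div_nonneg hs.1.le hd.le)
    have hk2 : s < ((k₀ : ℝ) + 1) * d := by
      rw [← div_lt_iff₀ hd]; exact Nat.lt_floor_add_one _
    have hk3 : k₀ ∈ Finset.range (N + 1) := by
      rw [Finset.mem_range]
      have : (k₀ : ℝ) < (N + 1 : ℕ) := by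
        push_cast
        have h5 : (k₀ : ℝ) * d < (N + 1) * d := by
          have : ((N : ℝ) + 1) * d = L := by simp only [d]; field_simp
          rw [this]; exact hk1.trans_lt hs.2
        exact lt_of_mul_lt_mul_right h5 hd.le
      exact_mod_cast this
    rw [Finset.sum_eq_single_of_mem k₀ hk3]
    · rw [indicator_of_mem (mem_Ico.2 ⟨hk1, hk2⟩), mul_one, abs_sub_comm]
      refine (abs_prim_sub_le hk1 g).trans ?_
      gcongr
      linarith
    · intro k _ hk
      rw [indicator_of_notMem, mul_zero]
      rintro ⟨h5, h6⟩
      apply hk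
      have a1 : (k : ℝ) < k₀ + 1 := lt_of_mul_lt_mul_right (h5.trans_lt hk2) hd.le
      have a2 : (k₀ : ℝ) < k + 1 := lt_of_mul_lt_mul_right (hk1.trans_lt h6) hd.le
      have a3 : k < k₀ + 1 := by exact_mod_cast a1
      have a4 : k₀ < k + 1 := by exact_mod_cast a2
      omega
  refine isCompactOperator_of_tendsto (l := atTop) (F := T) ?_ (Eventually.of_forall hTc)
  rw [tendsto_iff_norm_sub_tendsto_zero]
  refine squeeze_zero (fun _ => norm_nonneg _) hT ?_
  have h1 : Tendsto (fun N : ℕ => L / ((N : ℝ) + 1)) atTop (𝓝 0) :=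
    tendsto_const_nhds.div_atTop (tendsto_natCast_atTop_atTop.atTop_add tendsto_const_nhds)
  have h2 := (Real.continuous_sqrt.tendsto 0).comp h1
  simpa using h2.const_mul (Real.sqrt (max L 0))

/-- The mean value of a function on `(0, L)`. -/
def meanI (L : ℝ) : LI L →L[ℝ] ℝ := L⁻¹ • innerSL ℝ (oneI L)

theorem meanI_apply {L : ℝ} (f : LI L) : meanI L f = L⁻¹ * inner ℝ (oneI L) f := rfl

theorem inner_oneI_oneI {L : ℝ} (hL : 0 < L) : inner ℝ (oneI L) (oneI L) = L := by
  rw [oneI, cI, inner_toLp]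
  simp [hL.le]

theorem meanI_oneI {L : ℝ} (hL : 0 < L) : meanI L (oneI L) = 1 := by
  rw [meanI_apply, inner_oneI_oneI hL, inv_mul_cancel₀ hL.ne']

/-- The primitive with mean value zero. -/
def primI (L : ℝ) : LI L →L[ℝ] LI L :=
  volterra L - ((meanI L).comp (volterra L)).smulRight (oneI L)

theorem primI_apply {L : ℝ} (g : LI L) :
    primI L g = volterra L g - meanI L (volterra L g) • oneI L := rfl

theorem isCompactOperator_primI {L : ℝ} (hL : 0 < L) : IsCompactOperator (primI L) :=
  (isCompactOperator_volterra hL).sub (isCompactOperator_smulRight _ _)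

/-- A function with `f = c + ∫ g` is determined by `g` and its mean value. -/
theorem eq_primI_add_of_eq {L : ℝ} (hL : 0 < L) {f g : LI L} {c : ℝ}
    (h : f = volterra L g + c • oneI L) : f = primI L g + meanI L f • oneI L := by
  have hm : meanI L f = meanI L (volterra L g) + c := by
    rw [h, map_add, map_smul, meanI_oneI hL, smul_eq_mul, mul_one]
  rw [hm, primI_apply, add_smul, h]
  abel

/-! ### One-dimensional Hausdorff measure on a simple curve -/

/-- Mean value inequality for σ ↦ c(σ) − σw. On an arc where the velocity stays near `w` the curve
is almost affine, hence expands distances by factors between ‖w‖ − η and ‖w‖ + η. -/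
theorem norm_sub_sub_smul_le {c : ℝ → E2} (hc : ContDiff ℝ 1 c) {a b η : ℝ} {w : E2}
    (hw : ∀ σ ∈ Icc a b, ‖deriv c σ - w‖ ≤ η) {s s' : ℝ} (hs : s ∈ Icc a b) (hs' : s' ∈ Icc a b) :
    ‖c s - c s' - (s - s') • w‖ ≤ η * |s - s'| := by
  have hd : ∀ σ, HasDerivAt (fun σ => c σ - σ • w) (deriv c σ - w) σ := by
    intro σ
    have h1 := (hc.differentiable (by norm_num) σ).hasDerivAt
    have h2 := h1.sub ((hasDerivAt_id σ).smul_const w)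
    rw [one_smul] at h2
    exact h2
  have := (convex_Icc a b).norm_image_sub_le_of_norm_hasDerivWithin_le
    (fun σ _ => (hd σ).hasDerivWithinAt) hw hs' hs
  calc _ = ‖c s - s • w - (c s' - s' • w)‖ := by congr 1; rw [sub_smul]; abel
    _ ≤ _ := this

theorem hausdorff_image_le_aux {c : ℝ → E2} (hc : ContDiff ℝ 1 c) {a b η : ℝ} {w : E2}
    (hη : 0 ≤ η) (hw : ∀ σ ∈ Icc a b, ‖deriv c σ - w‖ ≤ η) {A : Set ℝ} (hA : A ⊆ Icc a b) :
    Measure.hausdorffMeasure 1 (c '' A) ≤ ENNReal.ofReal (‖w‖ + η) * volume A := by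
  have hl : LipschitzOnWith (Real.toNNReal (‖w‖ + η)) c A := by
    refine LipschitzOnWith.of_dist_le_mul fun s hs s' hs' => ?_
    rw [Real.coe_toNNReal _ (by positivity), dist_eq_norm, dist_eq_norm, Real.norm_eq_abs]
    have h1 := norm_sub_sub_smul_le hc hw (hA hs) (hA hs')
    have h2 := norm_sub_norm_le (c s - c s') ((s - s') • w)
    rw [norm_smul, Real.norm_eq_abs] at h2
    nlinarith
  have := hl.hausdorffMeasure_image_le (d := 1) zero_le_one
  rwa [ENNReal.rpow_one, hausdorffMeasure_real] at this

/-- If ‖w‖ > η, then `c` is injective on `A` with inverse Lipschitz of constant (‖w‖ − η)⁻¹, and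
Lipschitz maps do not increase Hausdorff measure beyond their constant. Otherwise the left-hand side
is zero. -/
theorem le_hausdorff_image_aux {c : ℝ → E2} (hc : ContDiff ℝ 1 c) {a b η : ℝ} {w : E2}
    (hw : ∀ σ ∈ Icc a b, ‖deriv c σ - w‖ ≤ η) {A : Set ℝ} (hA : A ⊆ Icc a b) :
    ENNReal.ofReal (‖w‖ - η) * volume A ≤ Measure.hausdorffMeasure 1 (c '' A) := by
  rcases le_or_gt ‖w‖ η with h | h
  · rw [ENNReal.ofReal_of_nonpos (by linarith), zero_mul]; exact zero_le
  have hpos : 0 < ‖w‖ - η := by linarith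
  have hlow : ∀ s ∈ A, ∀ s' ∈ A, (‖w‖ - η) * |s - s'| ≤ ‖c s - c s'‖ := by
    intro s hs s' hs'
    have h1 := norm_sub_sub_smul_le hc hw (hA hs) (hA hs')
    have h2 := norm_sub_norm_le ((s - s') • w) (c s - c s')
    rw [norm_smul, Real.norm_eq_abs, norm_sub_rev ((s - s') • w)] at h2
    nlinarith
  have hinj : InjOn c A := by
    intro s hs s' hs' he
    have := hlow s hs s' hs'
    rw [he, sub_self, norm_zero] at this
    have h0 : |s - s'| ≤ 0 := nonpos_of_mul_nonpos_right this hpos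
    linarith [abs_nonpos_iff.1 h0]
  have hl : LipschitzOnWith (Real.toNNReal (‖w‖ - η)⁻¹) (Function.invFunOn c A) (c '' A) := by
    refine LipschitzOnWith.of_dist_le_mul ?_
    rintro _ ⟨s, hs, rfl⟩ _ ⟨s', hs', rfl⟩
    rw [Real.coe_toNNReal _ (by positivity), hinj.leftInvOn_invFunOn hs,
      hinj.leftInvOn_invFunOn hs', Real.dist_eq, dist_eq_norm, inv_mul_eq_div, le_div_iff₀ hpos,
      mul_comm]
    exact hlow s hs s' hs'
  have h1 := hl.hausdorffMeasure_image_le (d := 1) zero_le_one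
  rw [ENNReal.rpow_one, hausdorffMeasure_real, hinj.leftInvOn_invFunOn.image_image] at h1
  calc ENNReal.ofReal (‖w‖ - η) * volume A
      ≤ ENNReal.ofReal (‖w‖ - η) * (ENNReal.ofReal (‖w‖ - η)⁻¹ *
        Measure.hausdorffMeasure 1 (c '' A)) := by gcongr; exact h1
    _ = _ := by
      rw [← mul_assoc, ← ENNReal.ofReal_mul hpos.le, mul_inv_cancel₀ hpos.ne', ENNReal.ofReal_one,
        one_mul]

/-- Both quantities lie between ‖w‖ − η and ‖w‖ + η times the measure of `A`. -/
theorem hausdorff_image_near_lintegral {c : ℝ → E2} (hc : ContDiff ℝ 1 c) {a b η : ℝ} {w : E2}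
    (hη : 0 ≤ η) (hw : ∀ σ ∈ Icc a b, ‖deriv c σ - w‖ ≤ η) {A : Set ℝ} (hA : A ⊆ Icc a b)
    (hAm : MeasurableSet A) :
    Measure.hausdorffMeasure 1 (c '' A) ≤
      (∫⁻ s in A, ENNReal.ofReal ‖deriv c s‖) + ENNReal.ofReal (2 * η) * volume A ∧
    (∫⁻ s in A, ENNReal.ofReal ‖deriv c s‖) ≤
      Measure.hausdorffMeasure 1 (c '' A) + ENNReal.ofReal (2 * η) * volume A := by
  have hlo : ∀ s ∈ A, ‖w‖ - η ≤ ‖deriv c s‖ := fun s hs => by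
    have := norm_sub_norm_le w (deriv c s)
    rw [norm_sub_rev] at this
    linarith [hw s (hA hs)]
  have hhi : ∀ s ∈ A, ‖deriv c s‖ ≤ ‖w‖ + η := fun s hs => by
    linarith [norm_sub_norm_le (deriv c s) w, hw s (hA hs)]
  have hle : ENNReal.ofReal (‖w‖ + η) ≤ ENNReal.ofReal (‖w‖ - η) + ENNReal.ofReal (2 * η) := by
    calc _ = ENNReal.ofReal ((‖w‖ - η) + 2 * η) := by congr 1; ring
      _ ≤ _ := ENNReal.ofReal_add_le
  constructor
  · calc _ ≤ ENNReal.ofReal (‖w‖ + η) * volume A := hausdorff_image_le_aux hc hη hw hA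
      _ ≤ (ENNReal.ofReal (‖w‖ - η) + ENNReal.ofReal (2 * η)) * volume A := by gcongr
      _ = (∫⁻ _ in A, ENNReal.ofReal (‖w‖ - η)) + ENNReal.ofReal (2 * η) * volume A := by
        rw [add_mul, setLIntegral_const]
      _ ≤ _ := by
        gcongr ?_ + _
        exact setLIntegral_mono' hAm fun s hs => ENNReal.ofReal_le_ofReal (hlo s hs)
  · calc _ ≤ ∫⁻ _ in A, ENNReal.ofReal (‖w‖ + η) :=
        setLIntegral_mono' hAm fun s hs => ENNReal.ofReal_le_ofReal (hhi s hs)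
      _ = ENNReal.ofReal (‖w‖ + η) * volume A := setLIntegral_const _ _
      _ ≤ (ENNReal.ofReal (‖w‖ - η) + ENNReal.ofReal (2 * η)) * volume A := by gcongr
      _ = ENNReal.ofReal (‖w‖ - η) * volume A + ENNReal.ofReal (2 * η) * volume A := add_mul _ _ _
      _ ≤ _ := by gcongr; exact le_hausdorff_image_aux hc hw hA

/-- The length of a piece of a simple `C¹` curve. -/
theorem hausdorff_image_eq_lintegral {c : ℝ → E2} (hc : ContDiff ℝ 1 c) {L : ℝ} (hL : 0 < L)
    (hinj : InjOn c (Ico 0 L)) {A : Set ℝ} (hA : A ⊆ Ico 0 L) (hAm : MeasurableSet A) :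
    Measure.hausdorffMeasure 1 (c '' A) = ∫⁻ s in A, ENNReal.ofReal ‖deriv c s‖ := by
  have key : ∀ η : ℝ, 0 < η →
      Measure.hausdorffMeasure 1 (c '' A) ≤
        (∫⁻ s in A, ENNReal.ofReal ‖deriv c s‖) + ENNReal.ofReal (2 * η) * volume A ∧
      (∫⁻ s in A, ENNReal.ofReal ‖deriv c s‖) ≤
        Measure.hausdorffMeasure 1 (c '' A) + ENNReal.ofReal (2 * η) * volume A := by
    intro η hη
    -- Uniform continuity gives a subdivision into cells on which the velocity oscillates by at most
    -- η. Both sides are additive over the cells (the Hausdorff measure because `c` is injective),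
    -- and so are the error terms; in the end η tends to zero.
    have hcont : Continuous (deriv c) := hc.continuous_deriv le_rfl
    have huc := isCompact_Icc.uniformContinuousOn_of_continuous (s := Icc 0 L) hcont.continuousOn
    obtain ⟨δ, hδ, hδη⟩ := Metric.uniformContinuousOn_iff.1 huc η hη
    obtain ⟨N, hN⟩ := exists_nat_gt (L / δ)
    set d := L / (N + 1) with hd_def
    have hd : 0 < d := by positivity
    have hdδ : d < δ := by
      rw [hd_def, div_lt_iff₀ (by positivity)]
      rw [div_lt_iff₀ hδ] at hN
      nlinarith
    have hNd : ((N : ℝ) + 1) * d = L := by rw [hd_def]; field_simp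
    let P : ℕ → Set ℝ := fun k => A ∩ Ico (k * d) ((k + 1) * d)
    have hPm : ∀ k, MeasurableSet (P k) := fun k => hAm.inter measurableSet_Ico
    have hdisj : ∀ k l : ℕ, k ≠ l → Disjoint (P k) (P l) := by
      intro k l hkl
      rw [Set.disjoint_left]
      rintro s ⟨_, h1, h2⟩ ⟨_, h3, h4⟩
      have a1 : (k : ℝ) < l + 1 := lt_of_mul_lt_mul_right (h1.trans_lt h4) hd.le
      have a2 : (l : ℝ) < k + 1 := lt_of_mul_lt_mul_right (h3.trans_lt h2) hd.le
      have a3 : k < l + 1 := by exact_mod_cast a1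
      have a4 : l < k + 1 := by exact_mod_cast a2
      omega
    have hun : A = ⋃ k ∈ Finset.range (N + 1), P k := by
      ext s
      simp only [mem_iUnion, exists_prop, P, mem_inter_iff]
      constructor
      · intro hs
        refine ⟨⌊s / d⌋₊, ?_, hs, ?_, ?_⟩
        · rw [Finset.mem_range, Nat.floor_lt (div_nonneg (hA hs).1 hd.le), div_lt_iff₀ hd]
          push_cast
          rw [hNd]; exact (hA hs).2
        · rw [← le_div_iff₀ hd]; exact Nat.floor_le (div_nonneg (hA hs).1 hd.le)
        · rw [← div_lt_iff₀ hd]; exact Nat.lt_floor_add_one _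
      · rintro ⟨k, _, hs, _⟩; exact hs
    have hloc : ∀ k ∈ Finset.range (N + 1), _ := fun k hk =>
      hausdorff_image_near_lintegral hc (a := k * d) (b := (k + 1) * d) (w := deriv c (k * d))
        hη.le (by
          intro σ hσ
          have hk1 : (k : ℝ) + 1 ≤ N + 1 := by
            have := Finset.mem_range.1 hk
            exact_mod_cast this
          have hk2 : ((k : ℝ) + 1) * d ≤ L := by rw [← hNd]; gcongr
          have hk0 : (0 : ℝ) ≤ k * d := by positivity
          rw [← dist_eq_norm]
          refine (hδη σ ⟨hk0.trans hσ.1, hσ.2.trans hk2⟩ (k * d) ⟨hk0, by linarith⟩ ?_).le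
          rw [Real.dist_eq, abs_of_nonneg (by linarith [hσ.1])]
          linarith [hσ.2]) (A := P k)
        (fun s hs => ⟨hs.2.1, hs.2.2.le⟩) (hPm k)
    have e1 : Measure.hausdorffMeasure 1 (c '' A) =
        ∑ k ∈ Finset.range (N + 1), Measure.hausdorffMeasure 1 (c '' (P k)) := by
      conv_lhs => rw [hun, image_iUnion₂]
      refine measure_biUnion_finset ?_ ?_
      · intro k _ l _ hkl
        have hPk : ∀ k, P k ⊆ Ico 0 L := fun k s hs => hA hs.1
        exact (hdisj k l hkl).image hinj (hPk k) (hPk l)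
      · intro k _
        exact (hPm k).image_of_continuousOn_injOn hc.continuous.continuousOn
          (hinj.mono fun s hs => hA hs.1)
    have e2 : (∫⁻ s in A, ENNReal.ofReal ‖deriv c s‖) =
        ∑ k ∈ Finset.range (N + 1), ∫⁻ s in P k, ENNReal.ofReal ‖deriv c s‖ := by
      conv_lhs => rw [hun]
      exact lintegral_biUnion_finset (fun k _ l _ hkl => hdisj k l hkl) (fun k _ => hPm k) _
    have e3 : volume A = ∑ k ∈ Finset.range (N + 1), volume (P k) := by
      conv_lhs => rw [hun]
      exact measure_biUnion_finset (fun k _ l _ hkl => hdisj k l hkl) (fun k _ => hPm k)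
    rw [e1, e2, e3, Finset.mul_sum, ← Finset.sum_add_distrib, ← Finset.sum_add_distrib]
    exact ⟨Finset.sum_le_sum fun k hk => (hloc k hk).1, Finset.sum_le_sum fun k hk => (hloc k hk).2⟩
  have hAL : volume A ≤ ENNReal.ofReal L := by
    calc volume A ≤ volume (Ico 0 L) := measure_mono hA
      _ = _ := by simp
  have hsmall : ∀ e : NNReal, 0 < e → ENNReal.ofReal (2 * (e / (2 * L))) * volume A ≤ e := by
    intro e he
    calc _ ≤ ENNReal.ofReal (2 * (e / (2 * L))) * ENNReal.ofReal L := by gcongr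
      _ = ENNReal.ofReal e := by
        rw [← ENNReal.ofReal_mul (by positivity)]; congr 1; field_simp
      _ = e := by simp
  refine le_antisymm ?_ ?_
  · refine ENNReal.le_of_forall_pos_le_add fun e he _ => ?_
    have he' : (0 : ℝ) < e := he
    exact ((key (e / (2 * L)) (by positivity)).1).trans (by gcongr; exact hsmall e he)
  · refine ENNReal.le_of_forall_pos_le_add fun e he _ => ?_
    have he' : (0 : ℝ) < e := he
    exact ((key (e / (2 * L)) (by positivity)).2).trans (by gcongr; exact hsmall e he)

/-- The Hausdorff measure on a simple curve is the image of the speed. -/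
theorem restrict_hausdorff_image {c : ℝ → E2} (hc : ContDiff ℝ 1 c) {L : ℝ} (hL : 0 < L)
    (hinj : InjOn c (Ico 0 L)) :
    (Measure.hausdorffMeasure 1 : Measure E2).restrict (c '' Ico 0 L) =
      Measure.map c ((muI L).withDensity fun s => ENNReal.ofReal ‖deriv c s‖) := by
  ext B hB
  have hBm : MeasurableSet (c ⁻¹' B) := hc.continuous.measurable hB
  rw [Measure.restrict_apply hB, Measure.map_apply hc.continuous.measurable hB,
    withDensity_apply _ hBm, muI, Measure.restrict_congr_set Ioo_ae_eq_Ico,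
    Measure.restrict_restrict hBm, ← hausdorff_image_eq_lintegral hc hL hinj inter_subset_right
      (hBm.inter measurableSet_Ico), inter_comm B, ← image_inter_preimage, inter_comm]

/-! ### Outer normals -/

theorem inner_E2 (x y : E2) : inner ℝ x y = x 0 * y 0 + x 1 * y 1 := by
  simp [PiLp.inner_apply, Fin.sum_univ_two, mul_comm]

/-- Expansion of a plane vector in an orthonormal basis. -/
theorem eq_inner_smul_add {a b : E2} (ha : ‖a‖ = 1) (hb : ‖b‖ = 1) (hab : inner ℝ a b = (0 : ℝ))
    (v : E2) : v = (inner ℝ a v : ℝ) • a + (inner ℝ b v : ℝ) • b := by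
  have ho : Orthonormal ℝ ![a, b] := by
    rw [orthonormal_iff_ite]
    have hba : inner ℝ b a = (0 : ℝ) := by rw [real_inner_comm, hab]
    intro i j
    fin_cases i <;> fin_cases j <;>
      simp [hab, hba, ha, hb]
  have hs : Submodule.span ℝ (range ![a, b]) = ⊤ :=
    ho.linearIndependent.span_eq_top_of_card_eq_finrank' (by simp)
  have := (OrthonormalBasis.mk ho hs.ge).sum_repr' v
  simpa [Fin.sum_univ_two] using this.symm

theorem IsOuterUnitNormal.outerNormal_eq {D : Set E2} {x n : E2} (h : IsOuterUnitNormal D x n) :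
    outerNormal D x = n := by
  have he : ∃ n, IsOuterUnitNormal D x n := ⟨n, h⟩
  rw [outerNormal, dif_pos he]
  exact he.choose_spec.unique h

/-- The normalized gradient of a defining function is the outer unit normal. -/
theorem isOuterUnitNormal_of_hasFDerivAt {D : Set E2} {x g : E2} {ψ : E2 → ℝ}
    (hψ : HasFDerivAt ψ (innerSL ℝ g) x) (hg : g ≠ 0) (h0 : ψ x = 0)
    (h : ∀ᶠ y in 𝓝 x, y ∈ D ↔ ψ y < 0) : IsOuterUnitNormal D x (‖g‖⁻¹ • g) := by
  have hgp : 0 < ‖g‖ := norm_pos_iff.2 hg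
  refine ⟨by rw [norm_smul, norm_inv, norm_norm, inv_mul_cancel₀ hgp.ne'], fun c hc => ?_⟩
  have hlo := hψ.isLittleO.def (c := c * ‖g‖) (by positivity)
  filter_upwards [h, hlo] with y hy hlo
  rw [h0, sub_zero, Real.norm_eq_abs, abs_le, innerSL_apply_apply] at hlo
  have hin : inner ℝ (y - x) (‖g‖⁻¹ • g) = ‖g‖⁻¹ * inner ℝ g (y - x) := by
    rw [inner_smul_right, real_inner_comm]
  rw [hin]
  constructor
  · intro hlt
    rw [hy]
    have : inner ℝ g (y - x) < -(c * ‖y - x‖) * ‖g‖ := by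
      rwa [inv_mul_lt_iff₀ hgp, mul_comm] at hlt
    nlinarith [hlo.2]
  · intro hlt
    rw [hy, not_lt]
    have : c * ‖y - x‖ * ‖g‖ < inner ℝ g (y - x) := by
      rwa [lt_inv_mul_iff₀ hgp, mul_comm] at hlt
    nlinarith [hlo.1]

/-- Near a boundary point, the outer normal is the normalized gradient of a smooth function which
vanishes on the boundary. -/
theorem exists_gradient_normal {Ω : Set E2} (hO : IsOpen Ω) (hS : HasSmoothBoundary Ω) {x : E2}
    (hx : x ∈ frontier Ω) : ∃ (ψ : E2 → ℝ) (g : E2 → E2), ContDiff ℝ ∞ ψ ∧ ContDiff ℝ ∞ g ∧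
      (∀ y, HasFDerivAt ψ (innerSL ℝ (g y)) y) ∧ ∀ᶠ y in 𝓝 x, g y ≠ 0 ∧ (y ∈ frontier Ω →
        ψ y = 0 ∧ IsOuterUnitNormal Ω y (‖g y‖⁻¹ • g y)) := by
  obtain ⟨U, hU, ψ, hψ, hd, hUψ⟩ := hS x hx
  let g : E2 → E2 := fun y => (InnerProductSpace.toDual ℝ E2).symm (fderiv ℝ ψ y)
  have hg : ContDiff ℝ ∞ g :=
    (InnerProductSpace.toDual ℝ E2).symm.contDiff.comp (hψ.fderiv_right (by simp))
  have hgd : ∀ y, HasFDerivAt ψ (innerSL ℝ (g y)) y := by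
    intro y
    have h1 := (hψ.differentiable (by simp) y).hasFDerivAt
    have : innerSL ℝ (g y) = fderiv ℝ ψ y := by
      ext v
      rw [innerSL_apply_apply]
      exact InnerProductSpace.toDual_symm_apply
    rwa [this]
  refine ⟨ψ, g, hψ, hg, hgd, ?_⟩
  have hgx : g x ≠ 0 := by
    intro h
    apply hd
    rw [← (hgd x).fderiv.symm, h, map_zero]
  have hU' : ∀ᶠ y in 𝓝 x, y ∈ Ω ↔ ψ y < 0 := by filter_upwards [hU] with y hy using hUψ y hy
  filter_upwards [hg.continuous.continuousAt.eventually_ne hgx, hU'.eventually_nhds]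
    with y hgy hy
  refine ⟨hgy, fun hyF => ?_⟩
  -- A positive value would keep a neighbourhood of `y` outside Ω, although `y` is in the closure; a
  -- negative one would put `y` in the open set Ω, which contains none of its boundary points.
  have hy0 : ψ y = 0 := by
    refine le_antisymm ?_ ?_
    · by_contra hpos
      have h1 : ∀ᶠ z in 𝓝 y, 0 < ψ z :=
        hψ.continuous.continuousAt.eventually (lt_mem_nhds (not_le.1 hpos))
      have h2 : ∃ᶠ z in 𝓝 y, z ∈ Ω := mem_closure_iff_frequently.1 (frontier_subset_closure hyF)
      obtain ⟨z, hz1, hz2, hz3⟩ := (h2.and_eventually (h1.and hy)).exists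
      linarith [hz3.1 hz1]
    · have : y ∉ Ω := by
        intro hyΩ
        have := hO.inter_frontier_eq
        exact (this ▸ ⟨hyΩ, hyF⟩ : y ∈ (∅ : Set E2))
      rw [hy.self_of_nhds] at this
      exact not_lt.1 this
  exact ⟨hy0, isOuterUnitNormal_of_hasFDerivAt (hgd y) hgy hy0 hy⟩

/-! ### The moving frame along the boundary curve -/

section Param

variable {Ω : Set E2} {L : ℝ} {γ : ℝ → E2}

theorem IsArclengthParam.mem_frontier (hγ : IsArclengthParam Ω L γ) (s : ℝ) :
    γ s ∈ frontier Ω := hγ.range_eq ▸ mem_range_self s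

theorem IsArclengthParam.hasDerivAt (hγ : IsArclengthParam Ω L γ) (s : ℝ) :
    HasDerivAt γ (deriv γ s) s := (hγ.smooth.differentiable (by simp) s).hasDerivAt

theorem IsArclengthParam.contDiff_deriv (hγ : IsArclengthParam Ω L γ) :
    ContDiff ℝ ∞ (deriv γ) := (contDiff_infty_iff_deriv.1 hγ.smooth).2

theorem IsArclengthParam.hasDerivAt_deriv (hγ : IsArclengthParam Ω L γ) (s : ℝ) :
    HasDerivAt (deriv γ) (deriv (deriv γ) s) s :=
  (hγ.contDiff_deriv.differentiable (by simp) s).hasDerivAt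

/-- A defining function provides a normal at each boundary point, so the default value in
`outerNormal` does not occur along the curve. -/
theorem isOuterUnitNormal_param (hO : IsOpen Ω) (hS : HasSmoothBoundary Ω)
    (hγ : IsArclengthParam Ω L γ) (s : ℝ) :
    IsOuterUnitNormal Ω (γ s) (outerNormal Ω (γ s)) := by
  obtain ⟨ψ, g, -, -, -, h⟩ := exists_gradient_normal hO hS (hγ.mem_frontier s)
  have := (h.self_of_nhds.2 (hγ.mem_frontier s)).2
  rwa [this.outerNormal_eq]

/-- Smoothness is local, and locally the normal is the normalized gradient of one defining function
composed with γ. -/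
theorem contDiff_outerNormal (hO : IsOpen Ω) (hS : HasSmoothBoundary Ω)
    (hγ : IsArclengthParam Ω L γ) : ContDiff ℝ ∞ fun s => outerNormal Ω (γ s) := by
  refine contDiff_iff_contDiffAt.2 fun s => ?_
  obtain ⟨ψ, g, -, hg, -, h⟩ := exists_gradient_normal hO hS (hγ.mem_frontier s)
  have hgs : g (γ s) ≠ 0 := h.self_of_nhds.1
  have h1 : ContDiffAt ℝ ∞ (fun σ => ‖g (γ σ)‖⁻¹ • g (γ σ)) s := by
    have h2 : ContDiffAt ℝ ∞ (fun σ => g (γ σ)) s := (hg.comp hγ.smooth).contDiffAt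
    exact ((h2.norm ℝ hgs).inv (norm_ne_zero_iff.2 hgs)).smul h2
  refine h1.congr_of_eventuallyEq ?_
  filter_upwards [hγ.smooth.continuous.continuousAt.eventually h] with σ hσ
  exact ((hσ.2 (hγ.mem_frontier σ)).2).outerNormal_eq

/-- A defining function vanishes along the curve, hence so does its derivative, which is the product
of its gradient with γ'. -/
theorem inner_outerNormal_deriv (hO : IsOpen Ω) (hS : HasSmoothBoundary Ω)
    (hγ : IsArclengthParam Ω L γ) (s : ℝ) : inner ℝ (outerNormal Ω (γ s)) (deriv γ s) = (0 : ℝ) := by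
  obtain ⟨ψ, g, -, -, hgd, h⟩ := exists_gradient_normal hO hS (hγ.mem_frontier s)
  rw [((h.self_of_nhds.2 (hγ.mem_frontier s)).2).outerNormal_eq, inner_smul_left]
  have h1 : HasDerivAt (fun σ => ψ (γ σ)) (innerSL ℝ (g (γ s)) (deriv γ s)) s :=
    (hgd (γ s)).comp_hasDerivAt s (hγ.hasDerivAt s)
  have h2 : (fun σ => ψ (γ σ)) =ᶠ[𝓝 s] fun _ => 0 := by
    filter_upwards [hγ.smooth.continuous.continuousAt.eventually h] with σ hσ
    exact (hσ.2 (hγ.mem_frontier σ)).1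
  have h3 := (h2.deriv_eq.symm.trans h1.deriv)
  rw [deriv_const, innerSL_apply_apply] at h3
  rw [← h3, mul_zero]

theorem inner_deriv_deriv (hγ : IsArclengthParam Ω L γ) (s : ℝ) :
    inner ℝ (deriv γ s) (deriv (deriv γ) s) = (0 : ℝ) := by
  have h1 := (hγ.hasDerivAt_deriv s).inner ℝ (hγ.hasDerivAt_deriv s)
  have h2 : (fun σ => inner ℝ (deriv γ σ) (deriv γ σ)) = fun _ => (1 : ℝ) := by
    ext σ; rw [real_inner_self_eq_norm_sq, hγ.unit_speed]; norm_num
  rw [h2] at h1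
  have h3 := h1.unique (hasDerivAt_const s (1 : ℝ))
  rw [real_inner_comm (deriv γ s)] at h3
  linarith

/-- The Frenet formula for the second derivative. -/
theorem deriv_deriv_eq (hO : IsOpen Ω) (hS : HasSmoothBoundary Ω)
    (hγ : IsArclengthParam Ω L γ) (s : ℝ) :
    deriv (deriv γ) s = -(curvature Ω γ s) • outerNormal Ω (γ s) := by
  have hn := (isOuterUnitNormal_param hO hS hγ s).1
  have h1 := eq_inner_smul_add (hγ.unit_speed s) hn
    (by rw [real_inner_comm]; exact inner_outerNormal_deriv hO hS hγ s) (deriv (deriv γ) s)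
  rw [inner_deriv_deriv hγ, zero_smul, zero_add] at h1
  rw [curvature, neg_neg, real_inner_comm]
  exact h1

/-- The Frenet formula for the normal. -/
theorem deriv_outerNormal (hO : IsOpen Ω) (hS : HasSmoothBoundary Ω)
    (hγ : IsArclengthParam Ω L γ) (s : ℝ) :
    deriv (fun s => outerNormal Ω (γ s)) s = curvature Ω γ s • deriv γ s := by
  have hn : ∀ s, ‖outerNormal Ω (γ s)‖ = 1 := fun s => (isOuterUnitNormal_param hO hS hγ s).1
  set n := fun s => outerNormal Ω (γ s) with hn_def
  have hnd : HasDerivAt n (deriv n s) s :=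
    ((contDiff_outerNormal hO hS hγ).differentiable (by simp) s).hasDerivAt
  have h1 := eq_inner_smul_add (hγ.unit_speed s) (hn s)
    (by rw [real_inner_comm]; exact inner_outerNormal_deriv hO hS hγ s) (deriv n s)
  have h2 : inner ℝ (n s) (deriv n s) = (0 : ℝ) := by
    have h1 := hnd.inner ℝ hnd
    have h2 : (fun σ => inner ℝ (n σ) (n σ)) = fun _ => (1 : ℝ) := by
      ext σ; rw [real_inner_self_eq_norm_sq, hn]; norm_num
    rw [h2] at h1
    have h3 := h1.unique (hasDerivAt_const s (1 : ℝ))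
    rw [real_inner_comm (n s)] at h3
    linarith
  have h3 : inner ℝ (deriv γ s) (deriv n s) = curvature Ω γ s := by
    have h1 := hnd.inner ℝ (hγ.hasDerivAt_deriv s)
    have h2 : (fun σ => inner ℝ (n σ) (deriv γ σ)) = fun _ => (0 : ℝ) := by
      ext σ; exact inner_outerNormal_deriv hO hS hγ σ
    rw [h2] at h1
    have h3 := h1.unique (hasDerivAt_const s (0 : ℝ))
    rw [curvature, real_inner_comm]
    rw [real_inner_comm] at h3
    linarith
  change inner ℝ (outerNormal Ω (γ s)) (deriv n s) = (0 : ℝ) at h2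
  rw [h3, h2, zero_smul, add_zero] at h1
  exact h1

theorem contDiff_curvature (hO : IsOpen Ω) (hS : HasSmoothBoundary Ω)
    (hγ : IsArclengthParam Ω L γ) : ContDiff ℝ ∞ (curvature Ω γ) := by
  have h1 : ContDiff ℝ ∞ (deriv (deriv γ)) := (contDiff_infty_iff_deriv.1 hγ.contDiff_deriv).2
  exact (h1.inner ℝ (contDiff_outerNormal hO hS hγ)).neg

end Param

/-! ### The distance to the boundary and the tubular radius -/

/-- Every point of `ω_ε` has a unique nearest boundary point. -/
def IsTubular (Ω : Set E2) (ε : ℝ) : Prop :=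
  0 < ε ∧ ∀ x ∈ thinSet Ω ε, ∃! y, y ∈ frontier Ω ∧ dist x y = Metric.infDist x (frontier Ω)

/-- An open ball around an interior point which does not reach the boundary stays inside. -/
theorem ball_infDist_subset {Ω : Set E2} {x : E2} (hx : x ∈ Ω) :
    Metric.ball x (Metric.infDist x (frontier Ω)) ⊆ Ω := by
  intro y hy
  by_contra hyn
  have hpre : IsPreconnected (Metric.ball x (Metric.infDist x (frontier Ω))) :=
    (convex_ball x _).isPreconnected
  have hpos : 0 < Metric.infDist x (frontier Ω) := Metric.pos_of_mem_ball hy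
  have hdis : ∀ z ∈ Metric.ball x (Metric.infDist x (frontier Ω)), z ∉ frontier Ω := by
    intro z hz hzF
    have := Metric.infDist_le_dist_of_mem (x := x) hzF
    rw [Metric.mem_ball, dist_comm] at hz
    linarith
  -- A connected ball that misses the boundary is covered by the interior and the exterior, two
  -- disjoint open sets, and cannot meet both.
  have h1 := hpre (interior Ω) (closure Ω)ᶜ isOpen_interior isClosed_closure.isOpen_compl
    (by
      intro z hz
      by_cases h : z ∈ closure Ω
      · left
        by_contra h'
        exact hdis z hz ⟨h, h'⟩
      · right; exact h)
    ⟨x, Metric.mem_ball_self hpos, by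
      by_contra h'
      exact hdis x (Metric.mem_ball_self hpos) ⟨subset_closure hx, h'⟩⟩
    ⟨y, hy, fun h => hdis y hy ⟨h, fun h' => hyn (interior_subset h')⟩⟩
  obtain ⟨z, _, hz1, hz2⟩ := h1
  exact hz2 (interior_subset_closure hz1)

/-! ### Nearest points and the propagation of distance along rays -/

section Distance

variable {Ω : Set E2}

theorem isCompact_frontier_of_isBounded (hB : Bornology.IsBounded Ω) : IsCompact (frontier Ω) :=
  Metric.isCompact_of_isClosed_isBounded isClosed_frontier (hB.closure.subset frontier_subset_closure)

theorem infDist_frontier_pos (hO : IsOpen Ω) (hne : (frontier Ω).Nonempty) {x : E2} (hx : x ∈ Ω) :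
    0 < Metric.infDist x (frontier Ω) := by
  rw [← isClosed_frontier.notMem_iff_infDist_pos hne]
  intro h
  have := hO.inter_frontier_eq
  exact (this ▸ ⟨hx, h⟩ : x ∈ (∅ : Set E2))

theorem mem_of_closure_of_infDist_pos {x : E2} (hx : x ∈ closure Ω)
    (h : 0 < Metric.infDist x (frontier Ω)) : x ∈ Ω := by
  by_contra hn
  have : x ∈ frontier Ω := ⟨hx, fun h' => hn (interior_subset h')⟩
  rw [Metric.infDist_zero_of_mem this] at h
  exact lt_irrefl _ h

/-- Moving away from a unique nearest point increases the distance at almost unit speed. -/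
theorem eventually_infDist_add_le (hB : Bornology.IsBounded Ω) {y p : E2}
    (hp : p ∈ frontier Ω) (hyp : dist y p = Metric.infDist y (frontier Ω))
    (huniq : ∀ q ∈ frontier Ω, dist y q = Metric.infDist y (frontier Ω) → q = p)
    (hpos : 0 < dist y p) {η : ℝ} (hη : 0 < η) (hη1 : η < 1) :
    ∀ᶠ δ in 𝓝[>] (0 : ℝ), dist y p + (1 - η) * δ ≤
      Metric.infDist (y + δ • ((dist y p)⁻¹ • (y - p))) (frontier Ω) := by
  set ρ := dist y p with hρ
  set m : E2 := ρ⁻¹ • (y - p) with hm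
  have hm1 : ‖m‖ = 1 := by
    rw [hm, norm_smul, norm_inv, ← dist_eq_norm, ← hρ, Real.norm_of_nonneg hpos.le,
      inv_mul_cancel₀ hpos.ne']
  have hmp : inner ℝ m (y - p) = ρ := by
    rw [hm, inner_smul_left, real_inner_self_eq_norm_sq, ← dist_eq_norm, ← hρ]
    simp only [conj_trivial]
    field_simp
  -- `K` holds the boundary points that are not well behind `y` in the direction `m` of motion. It
  -- is compact and omits the unique nearest point, so its distance from `y` exceeds ρ by a fixed
  -- amount and small steps do no harm. From the remaining boundary points a step δ gains at least
  -- (1 − η)δ, by expanding the square of the distance.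
  let K : Set E2 := frontier Ω ∩ {q | inner ℝ m (y - q) ≤ (1 - η) * ρ}
  have hK : IsCompact K := by
    refine (isCompact_frontier_of_isBounded hB).inter_right ?_
    exact isClosed_le (by fun_prop) continuous_const
  obtain ⟨ρ', hρ', hK'⟩ := hK.exists_forall_le' (f := fun q => dist y q) (a := ρ)
    (by fun_prop) (by
      rintro q ⟨hq1, hq2⟩
      have h1 : ρ ≤ dist y q := hyp ▸ Metric.infDist_le_dist_of_mem hq1
      refine lt_of_le_of_ne h1 fun h => ?_
      have := huniq q hq1 (by rw [← hyp, h])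
      rw [mem_ofPred_eq, this, hmp] at hq2
      nlinarith)
  have hev : ∀ᶠ δ in 𝓝[>] (0 : ℝ), δ < (ρ' - ρ) / 2 := by
    have : (0 : ℝ) < (ρ' - ρ) / 2 := by linarith
    exact nhdsWithin_le_nhds (gt_mem_nhds this)
  filter_upwards [hev, self_mem_nhdsWithin] with δ h1 h2
  have h2 : 0 < δ := h2
  rw [Metric.le_infDist ⟨p, hp⟩]
  intro q hq
  by_cases hqK : inner ℝ m (y - q) ≤ (1 - η) * ρ
  · have h3 := hK' q ⟨hq, hqK⟩
    have h4 : dist y q ≤ dist y (y + δ • m) + dist (y + δ • m) q := dist_triangle _ _ _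
    have h5 : dist y (y + δ • m) = δ := by
      rw [dist_self_add_right, norm_smul, hm1, mul_one, Real.norm_of_nonneg h2.le]
    nlinarith
  · rw [not_le] at hqK
    have h3 : ρ ≤ dist y q := hyp ▸ Metric.infDist_le_dist_of_mem hq
    have h4 : dist (y + δ • m) q ^ 2 = dist y q ^ 2 + 2 * (δ * inner ℝ m (y - q)) + δ ^ 2 := by
      rw [dist_eq_norm, dist_eq_norm, show y + δ • m - q = (y - q) + δ • m by abel,
        norm_add_sq_real, norm_smul, hm1, inner_smul_right, real_inner_comm, mul_one, Real.norm_eq_abs,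
        sq_abs]
    refine abs_le_of_sq_le_sq' ?_ dist_nonneg |>.2
    rw [h4]
    have h6 : δ * ((1 - η) * ρ) ≤ δ * inner ℝ m (y - q) := by gcongr
    have h7 : ρ ^ 2 ≤ dist y q ^ 2 := by gcongr
    have h8 : (1 - η) ^ 2 * δ ^ 2 ≤ 1 * δ ^ 2 := by
      gcongr
      nlinarith
    nlinarith

/-- Inside the tubular neighbourhood, points at a larger distance from the boundary can be reached
along a path of minimal length. -/
theorem exists_infDist_ge (hO : IsOpen Ω) (hB : Bornology.IsBounded Ω)
    (hne : (frontier Ω).Nonempty) {ε : ℝ} (hε : IsTubular Ω ε) {x : E2} (hx : x ∈ Ω) {H : ℝ}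
    (hH : 0 ≤ H) (hxH : Metric.infDist x (frontier Ω) + H < ε) :
    ∃ y ∈ Ω, dist y x ≤ H ∧ Metric.infDist x (frontier Ω) + H ≤ Metric.infDist y (frontier Ω) := by
  set d₀ := Metric.infDist x (frontier Ω) with hd₀
  have hd₀pos : 0 < d₀ := infDist_frontier_pos hO hne hx
  have hcl : IsCompact (closure Ω) := hB.isCompact_closure
  have hcontd : Continuous fun y => Metric.infDist y (frontier Ω) := Metric.continuous_infDist_pt _
  have hstep : ∀ η : ℝ, 0 < η → η < 1 → ∃ y ∈ closure Ω, dist y x ≤ H ∧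
      d₀ + (1 - η) * H ≤ Metric.infDist y (frontier Ω) := by
    intro η hη hη1
    -- Continuous induction on the distance `h` travelled: the set is closed by compactness, and
    -- `eventually_infDist_add_le`, applicable since the points reached stay in the tubular range,
    -- lets it grow to the right.
    let S : Set ℝ := {h | ∃ y ∈ closure Ω, dist y x ≤ h ∧
      d₀ + (1 - η) * h ≤ Metric.infDist y (frontier Ω)}
    have hS : Icc 0 H ⊆ S := by
      refine IsClosed.Icc_subset_of_forall_exists_gt ?_ ?_ ?_
      · have h1 : IsCompact ((Icc 0 H ×ˢ closure Ω) ∩ {q : ℝ × E2 | dist q.2 x ≤ q.1 ∧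
            d₀ + (1 - η) * q.1 ≤ Metric.infDist q.2 (frontier Ω)}) := by
          refine (isCompact_Icc.prod hcl).inter_right (IsClosed.inter
            (isClosed_le (f := fun q : ℝ × E2 => dist q.2 x) (g := fun q => q.1) ?_ ?_)
            (isClosed_le (f := fun q : ℝ × E2 => d₀ + (1 - η) * q.1)
              (g := fun q => Metric.infDist q.2 (frontier Ω)) ?_ (hcontd.comp continuous_snd)))
          all_goals fun_prop
        have h2 : S ∩ Icc 0 H = Prod.fst '' ((Icc 0 H ×ˢ closure Ω) ∩ {q : ℝ × E2 |
            dist q.2 x ≤ q.1 ∧ d₀ + (1 - η) * q.1 ≤ Metric.infDist q.2 (frontier Ω)}) := by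
          ext h
          constructor
          · rintro ⟨⟨y, hy, hy1, hy2⟩, hh⟩
            exact ⟨(h, y), ⟨⟨hh, hy⟩, hy1, hy2⟩, rfl⟩
          · rintro ⟨⟨h', y⟩, ⟨⟨hh, hy⟩, hy1, hy2⟩, rfl⟩
            exact ⟨⟨y, hy, hy1, hy2⟩, hh⟩
        rw [h2]
        exact (h1.image continuous_fst).isClosed
      · exact ⟨x, subset_closure hx, by simp, by simp [hd₀]⟩
      · rintro h ⟨⟨y, hy, hy1, hy2⟩, hh0, hhH⟩ b hb
        have hypos : 0 < Metric.infDist y (frontier Ω) := by nlinarith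
        have hyΩ : y ∈ Ω := mem_of_closure_of_infDist_pos hy hypos
        have hyle : Metric.infDist y (frontier Ω) ≤ d₀ + h := by
          have := Metric.infDist_le_infDist_add_dist (s := frontier Ω) (x := y) (y := x)
          linarith
        obtain ⟨p, ⟨hp1, hp2⟩, hp3⟩ := hε.2 y ⟨hyΩ, by linarith⟩
        have hpp : 0 < dist y p := hp2 ▸ hypos
        have hev := eventually_infDist_add_le hB hp1 hp2 (fun q hq hq' => hp3 q ⟨hq, hq'⟩) hpp hη hη1
        have hm1 : ‖(dist y p)⁻¹ • (y - p)‖ = 1 := by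
          rw [norm_smul, norm_inv, ← dist_eq_norm, Real.norm_of_nonneg hpp.le,
            inv_mul_cancel₀ hpp.ne']
        have hin : ∀ᶠ δ in 𝓝[>] (0 : ℝ), y + δ • ((dist y p)⁻¹ • (y - p)) ∈ Ω := by
          have hc : Continuous fun δ : ℝ => y + δ • ((dist y p)⁻¹ • (y - p)) := by fun_prop
          refine nhdsWithin_le_nhds (hc.continuousAt.eventually (hO.mem_nhds ?_))
          simpa using hyΩ
        have hb' : ∀ᶠ δ in 𝓝[>] (0 : ℝ), δ < b - h :=
          nhdsWithin_le_nhds (gt_mem_nhds (sub_pos.2 hb))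
        obtain ⟨δ, ⟨⟨h1, h2⟩, h3⟩, h4⟩ :=
          (((hev.and hin).and hb').and self_mem_nhdsWithin).exists
        have h4 : 0 < δ := h4
        refine ⟨h + δ, ⟨y + δ • ((dist y p)⁻¹ • (y - p)), subset_closure h2, ?_, ?_⟩, by linarith,
          by linarith⟩
        · calc _ ≤ dist (y + δ • ((dist y p)⁻¹ • (y - p))) y + dist y x := dist_triangle _ _ _
            _ ≤ δ + h := by
              gcongr
              rw [dist_self_add_left, norm_smul, hm1, mul_one, Real.norm_of_nonneg h4.le]
            _ = h + δ := add_comm _ _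
        · nlinarith [hp2]
    exact hS (right_mem_Icc.2 hH)
  -- A point of the ball with maximal distance from the boundary does at least as well as the points
  -- found for each η, so the loss η disappears.
  obtain ⟨y, hy, hmax⟩ := (hcl.inter_right Metric.isClosed_closedBall).exists_isMaxOn
    (s := closure Ω ∩ Metric.closedBall x H) ⟨x, subset_closure hx, Metric.mem_closedBall_self hH⟩
    hcontd.continuousOn
  have hge : d₀ + H ≤ Metric.infDist y (frontier Ω) := by
    refine le_of_forall_pos_lt_add fun e he => ?_
    obtain ⟨η, hη, hη1, hηe⟩ : ∃ η : ℝ, 0 < η ∧ η < 1 ∧ η * H < e := by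
      refine ⟨min (1 / 2) (e / (2 * (H + 1))), by positivity, by
        refine (min_le_left _ _).trans_lt (by norm_num), ?_⟩
      calc min (1 / 2) (e / (2 * (H + 1))) * H ≤ e / (2 * (H + 1)) * H := by
            gcongr; exact min_le_right _ _
        _ < e := by
          rw [div_mul_eq_mul_div, div_lt_iff₀ (by positivity)]
          nlinarith
    obtain ⟨z, hz, hz1, hz2⟩ := hstep η hη hη1
    have := hmax ⟨hz, hz1⟩
    rw [mem_ofPred_eq] at this
    nlinarith
  exact ⟨y, mem_of_closure_of_infDist_pos hy.1 (by linarith), hy.2, hge⟩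

/-- The nearest point property propagates along normal rays. -/
theorem ray_mem_and_infDist (hO : IsOpen Ω) (hB : Bornology.IsBounded Ω)
    {ε : ℝ} (hε : IsTubular Ω ε) {x p : E2} (hx : x ∈ Ω) (hp : p ∈ frontier Ω)
    (hxp : dist x p = Metric.infDist x (frontier Ω)) {T : ℝ} (hT : 0 < T) (hTε : T < ε) :
    p + (T / dist x p) • (x - p) ∈ Ω ∧
      Metric.infDist (p + (T / dist x p) • (x - p)) (frontier Ω) = T := by
  have hpos : 0 < dist x p := hxp ▸ infDist_frontier_pos hO ⟨p, hp⟩ hx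
  have hdist : dist (p + (T / dist x p) • (x - p)) p = T := by
    rw [dist_self_add_left, norm_smul, ← dist_eq_norm, Real.norm_of_nonneg (by positivity),
      div_mul_cancel₀ _ hpos.ne']
  rcases le_or_gt (dist x p) T with h | h
  -- Beyond `x`: the point `y` at depth at least `T` is at distance at most `T` from `p` through
  -- `x`, which forces equality in the triangle inequality. By strict convexity `x` is on the
  -- segment from `p` to `y`, so `y` is the point of the ray at parameter `T`.
  · obtain ⟨y, hyΩ, hy1, hy2⟩ := exists_infDist_ge hO hB ⟨p, hp⟩ hε hx (H := T - dist x p)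
      (by linarith) (by linarith)
    rw [← hxp] at hy2
    have h1 : dist p y = T := by
      have h2 := Metric.infDist_le_dist_of_mem (x := y) hp
      have h3 := dist_triangle y x p
      rw [dist_comm p]
      linarith
    have h2 : dist p x + dist x y = dist p y := by
      have h2 := Metric.infDist_le_dist_of_mem (x := y) hp
      have h3 := dist_triangle p x y
      rw [dist_comm p x, dist_comm x y] at *
      linarith
    obtain ⟨r, hr, hrx⟩ := dist_add_dist_eq_iff.1 h2
    have h3 : x - p = r • (y - p) := by
      rw [← hrx, AffineMap.lineMap_apply]; simp
    have h4 : dist x p = r * T := by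
      rw [dist_eq_norm, h3, norm_smul, ← dist_eq_norm, dist_comm, h1, Real.norm_of_nonneg hr.1]
    have hyeq : p + (T / dist x p) • (x - p) = y := by
      rw [h3, smul_smul]
      have : T / dist x p * r = 1 := by
        rw [div_mul_eq_mul_div, div_eq_one_iff_eq hpos.ne', h4, mul_comm]
      rw [this, one_smul]; abel
    rw [hyeq]
    refine ⟨hyΩ, le_antisymm ?_ (by linarith)⟩
    rw [← h1, dist_comm]
    exact Metric.infDist_le_dist_of_mem hp
  -- Between `p` and `x`: the point is in the ball about `x` that touches the boundary at `p`, and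
  -- its depth follows from the triangle inequality.
  · have h1 : dist (p + (T / dist x p) • (x - p)) x = dist x p - T := by
      have : p + (T / dist x p) • (x - p) - x = (T / dist x p - 1) • (x - p) := by
        rw [sub_smul, one_smul]; abel
      rw [dist_eq_norm, this, norm_smul, ← dist_eq_norm x p, Real.norm_eq_abs, abs_of_neg, neg_sub,
        sub_mul, one_mul, div_mul_cancel₀ _ hpos.ne']
      rw [sub_neg, div_lt_one hpos]; exact h
    refine ⟨ball_infDist_subset hx ?_, le_antisymm ?_ ?_⟩
    · rw [Metric.mem_ball, h1, ← hxp]; linarith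
    · nth_rewrite 2 [← hdist]
      exact Metric.infDist_le_dist_of_mem hp
    · have := Metric.infDist_le_infDist_add_dist (s := frontier Ω) (x := x)
        (y := p + (T / dist x p) • (x - p))
      rw [dist_comm x (p + (T / dist x p) • (x - p)), h1] at this
      linarith

/-- A tubular ε beyond the largest distance to the boundary would allow `exists_infDist_ge` to leave
a deepest point for a deeper one. Boundedness is needed since the supremum of an unbounded set would
take the default value zero. -/
theorem bddAbove_isTubular (hO : IsOpen Ω) (hB : Bornology.IsBounded Ω)
    (hne : (frontier Ω).Nonempty) (hΩ : Ω.Nonempty) : BddAbove {ε | IsTubular Ω ε} := by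
  obtain ⟨x, hx, hmax⟩ := hB.isCompact_closure.exists_isMaxOn hΩ.closure
    (f := fun y => Metric.infDist y (frontier Ω)) (Metric.continuous_infDist_pt _).continuousOn
  obtain ⟨z, hz⟩ := hΩ
  have hxpos : 0 < Metric.infDist x (frontier Ω) :=
    (infDist_frontier_pos hO hne hz).trans_le (hmax (subset_closure hz))
  refine ⟨Metric.infDist x (frontier Ω), fun ε hε => ?_⟩
  by_contra hlt
  rw [not_le] at hlt
  obtain ⟨y, hyΩ, -, hy⟩ := exists_infDist_ge hO hB hne hε
    (mem_of_closure_of_infDist_pos hx hxpos) (H := (ε - Metric.infDist x (frontier Ω)) / 2)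
    (by linarith) (by linarith)
  have := hmax (subset_closure hyΩ)
  rw [mem_ofPred_eq] at this
  linarith

end Distance

/-! ### Normal coordinates -/

section Normal

variable {Ω : Set E2} {L : ℝ} {γ : ℝ → E2}

theorem IsArclengthParam.periodic_deriv (hγ : IsArclengthParam Ω L γ) :
    Function.Periodic (deriv γ) L := by
  intro s
  rw [← deriv_comp_add_const]
  congr 1
  ext1 σ
  exact hγ.periodic σ

theorem IsArclengthParam.eq_add_of_eq (hγ : IsArclengthParam Ω L γ) {s s' : ℝ}
    (h : γ s = γ s') : ∃ k : ℤ, s' = s + k * L := by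
  have h1 : ∀ σ, γ (toIcoMod hγ.pos 0 σ) = γ σ := fun σ => by
    rw [← self_sub_toIcoDiv_zsmul]; exact hγ.periodic.sub_zsmul_eq _
  have h2 : toIcoMod hγ.pos 0 s = toIcoMod hγ.pos 0 s' := by
    refine hγ.injOn ?_ ?_ (by rw [h1, h1, h])
    · simpa using toIcoMod_mem_Ico hγ.pos 0 s
    · simpa using toIcoMod_mem_Ico hγ.pos 0 s'
  rw [← self_sub_toIcoDiv_zsmul, ← self_sub_toIcoDiv_zsmul] at h2
  refine ⟨toIcoDiv hγ.pos 0 s' - toIcoDiv hγ.pos 0 s, ?_⟩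
  simp only [zsmul_eq_mul] at h2
  push_cast
  linarith

/-- By compactness: over parameter pairs whose difference is between ρ and L − ρ the two points
never coincide, hence keep a positive distance. -/
theorem IsArclengthParam.exists_close (hγ : IsArclengthParam Ω L γ) {ρ : ℝ} (hρ : 0 < ρ) :
    ∃ η > 0, ∀ s s', dist (γ s) (γ s') < η → ∃ k : ℤ, |s' + k * L - s| < ρ := by
  let C : Set (ℝ × ℝ) := (Icc 0 L ×ˢ Icc 0 (2 * L)) ∩ {p | ρ ≤ p.2 - p.1 ∧ p.2 - p.1 ≤ L - ρ}
  have hC : IsCompact C := by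
    refine (isCompact_Icc.prod isCompact_Icc).inter_right (IsClosed.inter
      (isClosed_le (f := fun p : ℝ × ℝ => ρ) (g := fun p => p.2 - p.1) ?_ ?_)
      (isClosed_le (f := fun p : ℝ × ℝ => p.2 - p.1) (g := fun p => L - ρ) ?_ ?_)) <;> fun_prop
  have hcont := hγ.smooth.continuous
  obtain ⟨η, hη, hCη⟩ := hC.exists_forall_le' (f := fun p => dist (γ p.1) (γ p.2)) (a := 0)
    (by fun_prop) (by
      rintro ⟨s, s'⟩ ⟨-, h1, h2⟩
      simp only at h1 h2
      refine dist_pos.2 fun h => ?_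
      obtain ⟨k, hk⟩ := hγ.eq_add_of_eq h
      have h3 : (0 : ℝ) < k * L := by linarith
      have h4 : (k : ℝ) * L < 1 * L := by linarith
      have h5 : (0 : ℝ) < k := pos_of_mul_pos_left h3 hγ.pos.le
      have h6 : (k : ℝ) < 1 := lt_of_mul_lt_mul_right h4 hγ.pos.le
      have h7 : (0 : ℤ) < k := by exact_mod_cast h5
      have h8 : k < (1 : ℤ) := by exact_mod_cast h6
      omega)
  refine ⟨η, hη, fun s s' h => ?_⟩
  have hL := hγ.pos
  obtain ⟨a, ha1, ha2, k, hk⟩ : ∃ a : ℝ, 0 ≤ a ∧ a < L ∧ ∃ k : ℤ, a = s - k * L := by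
    have := toIcoMod_mem_Ico hL 0 s
    rw [zero_add] at this
    refine ⟨toIcoMod hL 0 s, this.1, this.2, toIcoDiv hL 0 s, ?_⟩
    rw [← self_sub_toIcoDiv_zsmul, zsmul_eq_mul]
  obtain ⟨a', ha1', ha2', k', hk'⟩ : ∃ a' : ℝ, a ≤ a' ∧ a' < a + L ∧ ∃ k : ℤ, a' = s' - k * L := by
    have := toIcoMod_mem_Ico hL a s'
    refine ⟨toIcoMod hL a s', this.1, this.2, toIcoDiv hL a s', ?_⟩
    rw [← self_sub_toIcoDiv_zsmul, zsmul_eq_mul]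
  have hga : γ a = γ s := by
    rw [hk]; have := hγ.periodic.sub_zsmul_eq (x := s) k; rwa [zsmul_eq_mul] at this
  have hga' : γ a' = γ s' := by
    rw [hk']; have := hγ.periodic.sub_zsmul_eq (x := s') k'; rwa [zsmul_eq_mul] at this
  rcases lt_or_ge (a' - a) ρ with h1 | h1
  · refine ⟨k - k', ?_⟩
    push_cast
    rw [abs_lt]
    constructor <;> nlinarith
  · rcases le_or_gt (a' - a) (L - ρ) with h2 | h2
    · exfalso
      have h3 := hCη (a, a') ⟨⟨⟨ha1, ha2.le⟩, ⟨by linarith, by linarith⟩⟩, h1, h2⟩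
      simp only [hga, hga'] at h3
      linarith
    -- Here the second parameter is almost a full period ahead of the first one, and one more period
    -- has to be subtracted.
    · refine ⟨k - k' - 1, ?_⟩
      push_cast
      rw [abs_lt]
      constructor <;> nlinarith

theorem IsArclengthParam.hasDerivAt_inner (hγ : IsArclengthParam Ω L γ) (x : E2) (s : ℝ) :
    HasDerivAt (fun σ => inner ℝ (x - γ σ) (deriv γ σ))
      (inner ℝ (x - γ s) (deriv (deriv γ) s) - 1) s := by
  have h1 := ((hasDerivAt_const s x).sub (hγ.hasDerivAt s)).inner ℝ (hγ.hasDerivAt_deriv s)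
  refine h1.congr_deriv ?_
  rw [zero_sub, inner_neg_left, real_inner_self_eq_norm_sq, hγ.unit_speed]
  simp [sub_eq_add_neg]

/-- A point near the boundary lies on at most one short normal segment. -/
theorem IsArclengthParam.exists_unique_foot (hγ : IsArclengthParam Ω L γ) :
    ∃ e > 0, ∀ (x : E2) (s s' : ℝ), dist x (γ s) < e → dist x (γ s') < e →
      inner ℝ (x - γ s) (deriv γ s) = (0 : ℝ) → inner ℝ (x - γ s') (deriv γ s') = (0 : ℝ) →
      γ s = γ s' := by
  have hL := hγ.pos
  have hc2 : Continuous (deriv (deriv γ)) :=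
    (contDiff_infty_iff_deriv.1 hγ.contDiff_deriv).2.continuous
  have hper2 : Function.Periodic (deriv (deriv γ)) L := by
    intro s
    rw [← deriv_comp_add_const]
    congr 1
    ext1 σ
    exact hγ.periodic_deriv σ
  obtain ⟨K, hK⟩ : ∃ K, ∀ s, ‖deriv (deriv γ) s‖ ≤ K := by
    obtain ⟨K, hK⟩ := isCompact_Icc.exists_bound_of_continuousOn (s := Icc 0 L) hc2.continuousOn
    refine ⟨K, fun s => ?_⟩
    obtain ⟨y, hy, hys⟩ := hper2.exists_mem_Ico₀ hL s
    rw [hys]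
    exact hK y (Ico_subset_Icc_self hy)
  have hK0 : 0 ≤ K := (norm_nonneg _).trans (hK 0)
  -- The choice gives 2ρK < 1. For `x` within ρ of γ(s), the function σ ↦ ⟨x − γ(σ), γ'(σ)⟩ then has
  -- negative derivative ⟨x − γ, γ''⟩ − 1 on [s − ρ, s + ρ], so it vanishes at most once there;
  -- `exists_close` brings the second foot into this interval.
  set ρ := 1 / (4 * (K + 1)) with hρ
  have hρpos : 0 < ρ := by positivity
  have hρK : 2 * ρ * K < 1 := by
    rw [hρ]
    rw [show 2 * (1 / (4 * (K + 1))) * K = (2 * K) / (4 * (K + 1)) by ring,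
      div_lt_one (by positivity)]
    linarith
  obtain ⟨η, hη, hclose⟩ := hγ.exists_close hρpos
  refine ⟨min (η / 2) ρ, by positivity, fun x s s' h1 h2 h3 h4 => ?_⟩
  have h5 : dist (γ s) (γ s') < η := by
    have := dist_triangle_left (γ s) (γ s') x
    have := min_le_left (η / 2) ρ
    linarith
  obtain ⟨k, hk⟩ := hclose s s' h5
  have hγk : γ (s' + k * L) = γ s' := by
    have := (hγ.periodic.int_mul k) s'; exact this
  have hγk' : deriv γ (s' + k * L) = deriv γ s' := by
    have := (hγ.periodic_deriv.int_mul k) s'; exact this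
  have hlip : LipschitzWith 1 γ := by
    refine lipschitzWith_of_nnnorm_deriv_le (hγ.smooth.differentiable (by simp)) fun σ => ?_
    rw [← NNReal.coe_le_coe, coe_nnnorm, hγ.unit_speed, NNReal.coe_one]
  have hanti : StrictAntiOn (fun σ => inner ℝ (x - γ σ) (deriv γ σ) : ℝ → ℝ)
      (Icc (s - ρ) (s + ρ)) := by
    refine strictAntiOn_of_deriv_neg (convex_Icc _ _) ?_ fun σ hσ => ?_
    · exact fun σ _ => (hγ.hasDerivAt_inner x σ).continuousAt.continuousWithinAt
    · rw [(hγ.hasDerivAt_inner x σ).deriv]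
      rw [interior_Icc] at hσ
      have h6 : dist x (γ σ) ≤ 2 * ρ := by
        have h7 := dist_triangle x (γ s) (γ σ)
        have h8 := hlip.dist_le_mul s σ
        rw [NNReal.coe_one, one_mul, Real.dist_eq] at h8
        have h9 : |s - σ| ≤ ρ := by rw [abs_le]; constructor <;> linarith [hσ.1, hσ.2]
        have := min_le_right (η / 2) ρ
        linarith
      have h7 : inner ℝ (x - γ σ) (deriv (deriv γ) σ) ≤ 2 * ρ * K := by
        refine (real_inner_le_norm _ _).trans ?_
        rw [← dist_eq_norm]
        exact mul_le_mul h6 (hK σ) (norm_nonneg _) (by positivity)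
      linarith
  rw [abs_lt] at hk
  have := hanti.injOn (x₁ := s) (x₂ := s' + k * L) ⟨by linarith, by linarith⟩
    ⟨by linarith, by linarith⟩ (by simp only [hγk, hγk', h3, h4])
  rw [this, hγk]

theorem IsArclengthParam.inner_eq_zero_of_nearest (hγ : IsArclengthParam Ω L γ) {x : E2} {s : ℝ}
    (h : dist x (γ s) = Metric.infDist x (frontier Ω)) :
    inner ℝ (x - γ s) (deriv γ s) = (0 : ℝ) := by
  have h1 : HasDerivAt (fun σ => ‖x - γ σ‖ ^ 2) (2 * inner ℝ (x - γ s) (0 - deriv γ s)) s :=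
    ((hasDerivAt_const s x).sub (hγ.hasDerivAt s)).norm_sq
  have h2 : IsLocalMin (fun σ => ‖x - γ σ‖ ^ 2) s := by
    refine Eventually.of_forall fun σ => ?_
    change ‖x - γ s‖ ^ 2 ≤ ‖x - γ σ‖ ^ 2
    rw [← dist_eq_norm, ← dist_eq_norm, h]
    gcongr
    exact Metric.infDist_nonneg
    exact Metric.infDist_le_dist_of_mem (hγ.mem_frontier σ)
  have h3 := h2.hasDerivAt_eq_zero h1
  rw [zero_sub, inner_neg_right] at h3
  linarith

theorem exists_nearest (hB : Bornology.IsBounded Ω) (hγ : IsArclengthParam Ω L γ) (x : E2) :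
    ∃ s, dist x (γ s) = Metric.infDist x (frontier Ω) := by
  obtain ⟨y, hy, hxy⟩ := (isCompact_frontier_of_isBounded hB).exists_infDist_eq_dist
    ⟨_, hγ.mem_frontier 0⟩ x
  rw [← hγ.range_eq] at hy
  obtain ⟨s, rfl⟩ := hy
  exact ⟨s, hxy.symm⟩

/-- Nearest points are feet of normals, by the first order condition, and close to the boundary feet
are unique. -/
theorem exists_isTubular (hB : Bornology.IsBounded Ω) (hγ : IsArclengthParam Ω L γ) :
    ∃ ε, IsTubular Ω ε := by
  obtain ⟨e, he, hfoot⟩ := hγ.exists_unique_foot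
  refine ⟨e, he, fun x hx => ?_⟩
  obtain ⟨s, hs⟩ := exists_nearest hB hγ x
  refine ⟨γ s, ⟨hγ.mem_frontier s, hs⟩, ?_⟩
  rintro y ⟨hy, hxy⟩
  rw [← hγ.range_eq] at hy
  obtain ⟨s', rfl⟩ := hy
  exact hfoot x s' s (hxy ▸ hx.2) (hs ▸ hx.2) (hγ.inner_eq_zero_of_nearest hxy)
    (hγ.inner_eq_zero_of_nearest hs)

/-- Normal coordinates `γ(s) - t ν(s)`. -/
def normalMap (Ω : Set E2) (γ : ℝ → E2) (s t : ℝ) : E2 := γ s - t • outerNormal Ω (γ s)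

/-- For some small depth the point is in Ω by the definition of the outer normal, and its nearest
boundary point is γ(s) by uniqueness of feet. From there `ray_mem_and_infDist` reaches every depth
below ε. -/
theorem normalMap_mem_and_infDist (hO : IsOpen Ω) (hB : Bornology.IsBounded Ω)
    (hS : HasSmoothBoundary Ω) (hγ : IsArclengthParam Ω L γ) {ε : ℝ} (hε : IsTubular Ω ε)
    (s : ℝ) {T : ℝ} (hT : 0 < T) (hTε : T < ε) :
    normalMap Ω γ s T ∈ Ω ∧ Metric.infDist (normalMap Ω γ s T) (frontier Ω) = T := by
  obtain ⟨e, he, hfoot⟩ := hγ.exists_unique_foot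
  have hn := isOuterUnitNormal_param hO hS hγ s
  have hcont : Continuous fun t : ℝ => normalMap Ω γ s t := by unfold normalMap; fun_prop
  have hev : ∀ᶠ t in 𝓝[>] (0 : ℝ), normalMap Ω γ s t ∈ Ω := by
    have h0 : Tendsto (fun t : ℝ => normalMap Ω γ s t) (𝓝[>] 0) (𝓝 (γ s)) := by
      have := hcont.tendsto 0
      simp only [normalMap, zero_smul, sub_zero] at this
      exact this.mono_left nhdsWithin_le_nhds
    filter_upwards [h0.eventually (hn.2 (1 / 2) (by norm_num)), self_mem_nhdsWithin] with t ht ht0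
    have ht0 : 0 < t := ht0
    refine ht.1 ?_
    rw [normalMap, sub_sub_cancel_left, inner_neg_left, inner_smul_left, norm_neg, norm_smul,
      real_inner_self_eq_norm_sq, hn.1, Real.norm_of_nonneg ht0.le]
    simp only [conj_trivial]
    linarith
  obtain ⟨t, ⟨ht1, ht2⟩, ht3⟩ := ((hev.and (nhdsWithin_le_nhds (gt_mem_nhds he))).and
    self_mem_nhdsWithin).exists
  have ht3 : 0 < t := ht3
  have hd : dist (normalMap Ω γ s t) (γ s) = t := by
    rw [normalMap, dist_self_sub_left, norm_smul, hn.1, mul_one, Real.norm_of_nonneg ht3.le]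
  have hd' : dist (normalMap Ω γ s t) (γ s) = Metric.infDist (normalMap Ω γ s t) (frontier Ω) := by
    obtain ⟨s', hs'⟩ := exists_nearest hB hγ (normalMap Ω γ s t)
    have h1 : dist (normalMap Ω γ s t) (γ s') < e := by
      rw [hs']
      refine (Metric.infDist_le_dist_of_mem (hγ.mem_frontier s)).trans_lt ?_
      rw [hd]; exact ht2
    have h2 := hfoot (normalMap Ω γ s t) s s' (by rw [hd]; exact ht2) h1 (by
      rw [normalMap, sub_sub_cancel_left, inner_neg_left, inner_smul_left,
        inner_outerNormal_deriv hO hS hγ, mul_zero, neg_zero])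
      (hγ.inner_eq_zero_of_nearest hs')
    rw [h2, hs']
  have := ray_mem_and_infDist hO hB hε ht1 (hγ.mem_frontier s) hd' hT hTε
  have heq : γ s + (T / dist (normalMap Ω γ s t) (γ s)) • (normalMap Ω γ s t - γ s) =
      normalMap Ω γ s T := by
    rw [hd, normalMap, normalMap, sub_sub_cancel_left, smul_neg, smul_smul,
      div_mul_cancel₀ _ ht3.ne', sub_eq_add_neg]
  rwa [heq] at this

theorem infDist_normalMap (hO : IsOpen Ω) (hB : Bornology.IsBounded Ω)
    (hS : HasSmoothBoundary Ω) (hγ : IsArclengthParam Ω L γ) {ε : ℝ} (hε : IsTubular Ω ε)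
    (s : ℝ) {T : ℝ} (hT : 0 ≤ T) (hTε : T < ε) :
    Metric.infDist (normalMap Ω γ s T) (frontier Ω) = T := by
  rcases hT.eq_or_lt with rfl | h
  · rw [normalMap, zero_smul, sub_zero, Metric.infDist_zero_of_mem (hγ.mem_frontier s)]
  · exact (normalMap_mem_and_infDist hO hB hS hγ hε s h hTε).2

/-- At a nearest point γ(s) the vector x − γ(s) is normal to the curve, so only its sign has to be
decided. -/
theorem exists_eq_normalMap (hO : IsOpen Ω) (hB : Bornology.IsBounded Ω)
    (hS : HasSmoothBoundary Ω) (hγ : IsArclengthParam Ω L γ) {ε : ℝ} (hε : IsTubular Ω ε)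
    {x : E2} (hx : x ∈ Ω) : ∃ s, x = normalMap Ω γ s (Metric.infDist x (frontier Ω)) := by
  obtain ⟨s, hs⟩ := exists_nearest hB hγ x
  have hn := isOuterUnitNormal_param hO hS hγ s
  have hperp := hγ.inner_eq_zero_of_nearest hs
  have hpos := infDist_frontier_pos hO ⟨_, hγ.mem_frontier s⟩ hx
  have hexp := eq_inner_smul_add (hγ.unit_speed s) hn.1
    (by rw [real_inner_comm]; exact inner_outerNormal_deriv hO hS hγ s) (x - γ s)
  rw [real_inner_comm, hperp, zero_smul, zero_add] at hexp
  set a : ℝ := inner ℝ (outerNormal Ω (γ s)) (x - γ s) with ha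
  have habs : |a| = Metric.infDist x (frontier Ω) := by
    rw [← hs, dist_eq_norm, hexp, norm_smul, hn.1, mul_one, Real.norm_eq_abs]
  refine ⟨s, ?_⟩
  rcases le_or_gt a 0 with h | h
  · rw [abs_of_nonpos h] at habs
    rw [normalMap, ← habs, neg_smul, sub_neg_eq_add, ← hexp]
    abel
  -- If x − γ(s) pointed outwards, the ray from γ(s) through `x` would be in Ω near γ(s) by
  -- `ray_mem_and_infDist`, whereas points in the direction of the outer normal are not.
  · exfalso
    rw [abs_of_pos h] at habs
    have h0 : Tendsto (fun t : ℝ => γ s + t • outerNormal Ω (γ s)) (𝓝[>] 0) (𝓝 (γ s)) := by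
      have hc : Continuous fun t : ℝ => γ s + t • outerNormal Ω (γ s) := by fun_prop
      have := hc.tendsto 0
      simp only [zero_smul, add_zero] at this
      exact this.mono_left nhdsWithin_le_nhds
    obtain ⟨T, ⟨hT1, hT2⟩, hT3⟩ := (((h0.eventually (hn.2 (1 / 2) (by norm_num))).and
      (nhdsWithin_le_nhds (gt_mem_nhds hε.1))).and self_mem_nhdsWithin).exists
    have hT3 : 0 < T := hT3
    refine hT1.2 ?_ ?_
    · rw [add_sub_cancel_left, inner_smul_left, norm_smul, real_inner_self_eq_norm_sq, hn.1,
        Real.norm_of_nonneg hT3.le]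
      simp only [conj_trivial]
      linarith
    · have := (ray_mem_and_infDist hO hB hε hx (hγ.mem_frontier s) hs hT3 hT2).1
      rw [hs, hexp, smul_smul, ← habs, div_mul_cancel₀ _ h.ne'] at this
      exact this

/-- The depth is recovered as the distance to the boundary, and γ(s) as the unique nearest boundary
point. -/
theorem normalMap_injective (hO : IsOpen Ω) (hB : Bornology.IsBounded Ω)
    (hS : HasSmoothBoundary Ω) (hγ : IsArclengthParam Ω L γ) {ε : ℝ} (hε : IsTubular Ω ε)
    {s s' t t' : ℝ} (ht : 0 ≤ t) (htε : t < ε) (ht' : 0 ≤ t') (htε' : t' < ε)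
    (h : normalMap Ω γ s t = normalMap Ω γ s' t') : t = t' ∧ ∃ k : ℤ, s' = s + k * L := by
  have h1 : t = t' := by
    rw [← infDist_normalMap hO hB hS hγ hε s ht htε, h, infDist_normalMap hO hB hS hγ hε s' ht' htε']
  subst h1
  refine ⟨rfl, hγ.eq_add_of_eq ?_⟩
  rcases ht.eq_or_lt with rfl | hpos
  · simpa [normalMap] using h
  · obtain ⟨hm, hd⟩ := normalMap_mem_and_infDist hO hB hS hγ hε s hpos htε
    have hdist : ∀ σ, dist (normalMap Ω γ σ t) (γ σ) = t := fun σ => by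
      rw [normalMap, dist_self_sub_left, norm_smul, (isOuterUnitNormal_param hO hS hγ σ).1, mul_one,
        Real.norm_of_nonneg ht]
    exact (hε.2 _ ⟨hm, by rw [hd]; exact htε⟩).unique
      ⟨hγ.mem_frontier s, by rw [hd, hdist]⟩ ⟨hγ.mem_frontier s', by rw [hd, h, hdist]⟩

/-- There are no focal points inside the tubular neighbourhood. -/
theorem one_sub_mul_curvature_pos (hO : IsOpen Ω) (hB : Bornology.IsBounded Ω)
    (hS : HasSmoothBoundary Ω) (hγ : IsArclengthParam Ω L γ) {ε : ℝ} (hε : IsTubular Ω ε)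
    (s : ℝ) {T : ℝ} (hT : 0 ≤ T) (hTε : T < ε) : 0 < 1 - T * curvature Ω γ s := by
  obtain ⟨T', hT1, hT2⟩ := exists_between hTε
  have hT'pos : 0 < T' := hT.trans_lt hT1
  -- At depth T', slightly larger than `T`, the function σ ↦ −‖z − γ(σ)‖²/2 has a maximum at `s` and
  -- second derivative T'κ − 1 there. If this were positive, `s` would also be a local minimum, the
  -- function would be locally constant, and the second derivative would vanish. So T'κ ≤ 1, and
  -- strictness at `T` comes from T < T'.
  set z := normalMap Ω γ s T' with hz
  have hn := isOuterUnitNormal_param hO hS hγ s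
  have hf1 : ∀ σ, HasDerivAt (fun σ => -(2⁻¹ : ℝ) * ‖z - γ σ‖ ^ 2)
      (inner ℝ (z - γ σ) (deriv γ σ)) σ := by
    intro σ
    have h1 : HasDerivAt (fun σ => ‖z - γ σ‖ ^ 2) (2 * inner ℝ (z - γ σ) (0 - deriv γ σ)) σ :=
      ((hasDerivAt_const σ z).sub (hγ.hasDerivAt σ)).norm_sq
    refine (h1.const_mul (-(2⁻¹ : ℝ))).congr_deriv ?_
    rw [zero_sub, inner_neg_right]; ring
  have hf1' : deriv (fun σ => -(2⁻¹ : ℝ) * ‖z - γ σ‖ ^ 2) =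
      fun σ => inner ℝ (z - γ σ) (deriv γ σ) := funext fun σ => (hf1 σ).deriv
  have hzγ : z - γ s = -(T' • outerNormal Ω (γ s)) := by
    rw [hz, normalMap, sub_sub_cancel_left]
  have hval : deriv (deriv fun σ => -(2⁻¹ : ℝ) * ‖z - γ σ‖ ^ 2) s = T' * curvature Ω γ s - 1 := by
    rw [hf1', (hγ.hasDerivAt_inner z s).deriv, hzγ, deriv_deriv_eq hO hS hγ, inner_neg_left,
      inner_smul_left, inner_smul_right, real_inner_self_eq_norm_sq, hn.1]
    simp
  have hle : T' * curvature Ω γ s ≤ 1 := by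
    by_contra hlt
    rw [not_le] at hlt
    have hlm := isLocalMin_of_deriv_deriv_pos (f := fun σ => -(2⁻¹ : ℝ) * ‖z - γ σ‖ ^ 2) (x₀ := s)
      (by rw [hval]; linarith)
      (by
        rw [hf1']
        change inner ℝ (z - γ s) (deriv γ s) = (0 : ℝ)
        rw [hzγ, inner_neg_left, inner_smul_left, inner_outerNormal_deriv hO hS hγ]; simp)
      (hf1 s).continuousAt
    have hd : ∀ σ, T' ≤ ‖z - γ σ‖ := fun σ => by
      rw [← (normalMap_mem_and_infDist hO hB hS hγ hε s hT'pos hT2).2, ← dist_eq_norm]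
      exact Metric.infDist_le_dist_of_mem (hγ.mem_frontier σ)
    have hd0 : ‖z - γ s‖ = T' := by
      rw [hzγ, norm_neg, norm_smul, hn.1, mul_one, Real.norm_of_nonneg hT'pos.le]
    have hconst : (fun σ => -(2⁻¹ : ℝ) * ‖z - γ σ‖ ^ 2) =ᶠ[𝓝 s] fun _ => -(2⁻¹ : ℝ) * T' ^ 2 := by
      filter_upwards [hlm] with σ hσ
      rw [hd0] at hσ
      have h1 : T' ^ 2 ≤ ‖z - γ σ‖ ^ 2 := by gcongr; exact hd σ
      linarith
    have h2 : deriv (deriv fun σ => -(2⁻¹ : ℝ) * ‖z - γ σ‖ ^ 2) s = 0 := by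
      rw [hconst.deriv.deriv_eq]; simp
    rw [hval] at h2
    linarith
  rcases le_or_gt (curvature Ω γ s) 0 with h | h
  · nlinarith
  · nlinarith

/-- The room between ε and the tubular ε' is needed to have normal coordinates on both sides of the
inner boundary curve of the thin set. -/
theorem isTubular_of_lt (hO : IsOpen Ω) (hne : Ω.Nonempty) (hB : Bornology.IsBounded Ω)
    (hγ : IsArclengthParam Ω L γ) :
    0 < tubularRadius Ω ∧ ∀ ε < tubularRadius Ω, ∃ ε', ε < ε' ∧ IsTubular Ω ε' := by
  have hF : (frontier Ω).Nonempty := ⟨_, hγ.mem_frontier 0⟩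
  obtain ⟨e, he⟩ := exists_isTubular hB hγ
  have hbdd := bddAbove_isTubular hO hB hF hne
  refine ⟨he.1.trans_le (le_csSup hbdd he), fun ε hε => ?_⟩
  obtain ⟨ε', h1, h2⟩ := exists_lt_of_lt_csSup ⟨e, he⟩ hε
  exact ⟨ε', h2, h1⟩

end Normal

/-! ### The tube around the boundary -/

/-- Lebesgue measure on the reference strip `(0, L) × (0, 1)`. -/
abbrev muQ (L : ℝ) : Measure (ℝ × ℝ) := (muI L).prod (volume.restrict (Ioo 0 1))

/-- The parametrization `γ(s) - ε t n(s)` of a tube. -/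
def tubeMap (γ n : ℝ → E2) (ε : ℝ) (p : ℝ × ℝ) : E2 := γ p.1 - (ε * p.2) • n p.1

/-- The Jacobian `1 - ε t κ(s)`. -/
def tubeJac (κ : ℝ → ℝ) (ε : ℝ) (p : ℝ × ℝ) : ℝ := 1 - ε * p.2 * κ p.1

/-- `D` is the tube of width `ε` on the inner side of the closed curve `γ` with normal `n` and
curvature `κ`. -/
structure IsTube (L : ℝ) (γ n : ℝ → E2) (κ : ℝ → ℝ) (ε : ℝ) (D : Set E2) : Prop where
  L_pos : 0 < L
  eps_pos : 0 < ε
  smooth_curve : ContDiff ℝ ∞ γ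
  smooth_normal : ContDiff ℝ ∞ n
  smooth_curvature : ContDiff ℝ ∞ κ
  periodic_curve : Function.Periodic γ L
  periodic_normal : Function.Periodic n L
  periodic_curvature : Function.Periodic κ L
  norm_deriv : ∀ s, ‖deriv γ s‖ = 1
  norm_normal : ∀ s, ‖n s‖ = 1
  inner_normal : ∀ s, inner ℝ (n s) (deriv γ s) = (0 : ℝ)
  deriv_normal : ∀ s, deriv n s = κ s • deriv γ s
  deriv_deriv : ∀ s, deriv (deriv γ) s = -(κ s) • n s
  jac_pos : ∀ s, ∀ t ∈ Icc (0 : ℝ) 1, 0 < tubeJac κ ε (s, t)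
  isOpen : IsOpen D
  bounded : Bornology.IsBounded D
  area : Measure.map (tubeMap γ n ε)
    ((muQ L).withDensity fun p => ENNReal.ofReal (ε * tubeJac κ ε p)) = volume.restrict D
  bdry : bdryMeasure D = Measure.map γ (muI L) + Measure.map (fun s => tubeMap γ n ε (s, 1))
    ((muI L).withDensity fun s => ENNReal.ofReal (tubeJac κ ε (s, 1)))
  normal_outer : ∀ s, outerNormal D (γ s) = n s
  normal_inner : ∀ s, outerNormal D (tubeMap γ n ε (s, 1)) = -n s
  extend : ∀ F : ℝ × ℝ → ℝ, ContDiff ℝ ∞ F → (∀ s t, F (s + L, t) = F (s, t)) →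
    ∃ H : E2 → ℝ, ContDiff ℝ ∞ H ∧ ∀ s, ∀ t ∈ Icc (0 : ℝ) 1, H (tubeMap γ n ε (s, t)) = F (s, t)
  injOn_outer : InjOn γ (Ico 0 L)
  injOn_inner : InjOn (fun s => tubeMap γ n ε (s, 1)) (Ico 0 L)
  disjoint_curves : ∀ s s', γ s ≠ tubeMap γ n ε (s', 1)
  frontier_eq : frontier D = γ '' Ico 0 L ∪ (fun s => tubeMap γ n ε (s, 1)) '' Ico 0 L

theorem exists_mem_Ico_add_int_mul {L : ℝ} (hL : 0 < L) (a s : ℝ) :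
    ∃ s' ∈ Ico a (a + L), ∃ k : ℤ, s = s' + k * L := by
  refine ⟨toIcoMod hL a s, toIcoMod_mem_Ico hL a s, toIcoDiv hL a s, ?_⟩
  rw [← self_sub_toIcoDiv_zsmul, zsmul_eq_mul]; ring

/-! ### The differential of the tube coordinates and its determinant -/

section Coordinates

variable {L ε : ℝ} {γ n : ℝ → E2} {κ : ℝ → ℝ}

/-- The differential of the tube coordinates. -/
def tubeDeriv (γ n : ℝ → E2) (κ : ℝ → ℝ) (ε : ℝ) (p : ℝ × ℝ) : ℝ × ℝ →L[ℝ] E2 :=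
  (ContinuousLinearMap.fst ℝ ℝ ℝ).smulRight (tubeJac κ ε p • deriv γ p.1) -
    (ContinuousLinearMap.snd ℝ ℝ ℝ).smulRight (ε • n p.1)

theorem tubeDeriv_apply (p v : ℝ × ℝ) :
    tubeDeriv γ n κ ε p v = v.1 • (tubeJac κ ε p • deriv γ p.1) - v.2 • (ε • n p.1) := rfl

theorem hasFDerivAt_tubeMap (hγ : ContDiff ℝ ∞ γ) (hn : ContDiff ℝ ∞ n)
    (hdn : ∀ s, deriv n s = κ s • deriv γ s) (p : ℝ × ℝ) :
    HasFDerivAt (tubeMap γ n ε) (tubeDeriv γ n κ ε p) p := by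
  have h1 : HasFDerivAt (fun q : ℝ × ℝ => γ q.1) _ p :=
    ((hγ.differentiable (by simp) p.1).hasDerivAt.hasFDerivAt).comp p hasFDerivAt_fst
  have h2 : HasFDerivAt (fun q : ℝ × ℝ => n q.1) _ p :=
    ((hn.differentiable (by simp) p.1).hasDerivAt.hasFDerivAt).comp p hasFDerivAt_fst
  have h3 : HasFDerivAt (fun q : ℝ × ℝ => ε * q.2) _ p :=
    (hasFDerivAt_snd (𝕜 := ℝ) (p := p)).const_mul ε
  refine (h1.sub (h3.smul h2)).congr_fderiv (ContinuousLinearMap.ext fun v => ?_)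
  rw [tubeDeriv_apply, tubeJac]
  simp [hdn, smul_smul]
  module

theorem contDiff_tubeMap (hγ : ContDiff ℝ ∞ γ) (hn : ContDiff ℝ ∞ n) :
    ContDiff ℝ ∞ (tubeMap γ n ε) :=
  (hγ.comp contDiff_fst).sub ((contDiff_const.mul contDiff_snd).smul (hn.comp contDiff_fst))

theorem tubeMap_add_int_mul (hγ : Function.Periodic γ L) (hn : Function.Periodic n L)
    (s t : ℝ) (k : ℤ) : tubeMap γ n ε (s + k * L, t) = tubeMap γ n ε (s, t) := by
  have h1 : γ (s + k * L) = γ s := (hγ.int_mul k) s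
  have h2 : n (s + k * L) = n s := (hn.int_mul k) s
  rw [tubeMap, tubeMap, h1, h2]

theorem injective_tubeDeriv (hγ1 : ∀ s, ‖deriv γ s‖ = 1) (hn1 : ∀ s, ‖n s‖ = 1)
    (hnγ : ∀ s, inner ℝ (n s) (deriv γ s) = (0 : ℝ)) (hε : ε ≠ 0) {p : ℝ × ℝ}
    (hp : tubeJac κ ε p ≠ 0) : Function.Injective (tubeDeriv γ n κ ε p) := by
  rw [injective_iff_map_eq_zero]
  intro v hv
  rw [tubeDeriv_apply] at hv
  have hγn : inner ℝ (deriv γ p.1) (n p.1) = (0 : ℝ) := by rw [real_inner_comm, hnγ]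
  have h1 := congrArg (fun w => inner ℝ (deriv γ p.1) w) hv
  have h2 := congrArg (fun w => inner ℝ (n p.1) w) hv
  simp only [inner_sub_right, inner_smul_right, real_inner_self_eq_norm_sq, hγ1, hn1, hnγ, hγn,
    inner_zero_right] at h1 h2
  ext
  · simpa [hp] using h1
  · simpa [hε] using h2

/-- The coordinate map `e` turns the differential into an endomorphism of the plane, so that it has
a determinant. What remains is the determinant of the frame, whose square is one by Lagrange's
identity for two orthonormal vectors. -/
theorem det_tubeDeriv_comp (hγ1 : ∀ s, ‖deriv γ s‖ = 1) (hn1 : ∀ s, ‖n s‖ = 1)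
    (hnγ : ∀ s, inner ℝ (n s) (deriv γ s) = (0 : ℝ)) (hε : 0 < ε) {p : ℝ × ℝ}
    (hp : 0 < tubeJac κ ε p) (e : E2 →L[ℝ] ℝ × ℝ) (he : ∀ x, e x = (x 0, x 1)) :
    |((tubeDeriv γ n κ ε p).comp e).det| = ε * tubeJac κ ε p := by
  have h1 : ((tubeDeriv γ n κ ε p).comp e).det =
      ε * tubeJac κ ε p * (n p.1 0 * deriv γ p.1 1 - n p.1 1 * deriv γ p.1 0) := by
    rw [ContinuousLinearMap.det,
      ← LinearMap.det_toMatrix (EuclideanSpace.basisFun (Fin 2) ℝ).toBasis, Matrix.det_fin_two]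
    simp [LinearMap.toMatrix_apply, tubeDeriv_apply, he]
    ring
  have h2 : (n p.1 0 * deriv γ p.1 1 - n p.1 1 * deriv γ p.1 0) ^ 2 = 1 := by
    have a1 := real_inner_self_eq_norm_sq (deriv γ p.1)
    have a2 := real_inner_self_eq_norm_sq (n p.1)
    have a3 := hnγ p.1
    rw [inner_E2] at a1 a2 a3
    rw [hγ1] at a1
    rw [hn1] at a2
    have : (n p.1 0 * deriv γ p.1 1 - n p.1 1 * deriv γ p.1 0) ^ 2 =
      (n p.1 0 * n p.1 0 + n p.1 1 * n p.1 1) *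
        (deriv γ p.1 0 * deriv γ p.1 0 + deriv γ p.1 1 * deriv γ p.1 1) -
        (n p.1 0 * deriv γ p.1 0 + n p.1 1 * deriv γ p.1 1) ^ 2 := by ring
    rw [this, a1, a2, a3]; norm_num
  rw [← sq_abs] at h2
  rw [h1, abs_mul, abs_of_pos (by positivity),
    (pow_eq_one_iff_of_nonneg (abs_nonneg _) two_ne_zero).1 h2, mul_one]

end Coordinates

/-! ### Smooth extension off the tube, and the area formula -/

section Extension

variable {L ε : ℝ} {γ n : ℝ → E2} {κ : ℝ → ℝ}

/-- Smooth functions of the tube coordinates extend to smooth functions on the plane. -/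
theorem exists_contDiff_extension (hL : 0 < L) (hε : ε ≠ 0) (hγ : ContDiff ℝ ∞ γ)
    (hn : ContDiff ℝ ∞ n) (hκ : Continuous κ)
    (hγp : Function.Periodic γ L) (hnp : Function.Periodic n L) (hγ1 : ∀ s, ‖deriv γ s‖ = 1)
    (hn1 : ∀ s, ‖n s‖ = 1) (hnγ : ∀ s, inner ℝ (n s) (deriv γ s) = (0 : ℝ))
    (hdn : ∀ s, deriv n s = κ s • deriv γ s)
    (hjac : ∀ s, ∀ t ∈ Icc (0 : ℝ) 1, tubeJac κ ε (s, t) ≠ 0)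
    (hinj : ∀ s s', ∀ t ∈ Icc (0 : ℝ) 1, ∀ t' ∈ Icc (0 : ℝ) 1,
      tubeMap γ n ε (s, t) = tubeMap γ n ε (s', t') → t = t' ∧ ∃ k : ℤ, s' = s + k * L)
    (F : ℝ × ℝ → ℝ) (hF : ContDiff ℝ ∞ F) (hFp : ∀ s t, F (s + L, t) = F (s, t)) :
    ∃ H : E2 → ℝ, ContDiff ℝ ∞ H ∧ ∀ s, ∀ t ∈ Icc (0 : ℝ) 1, H (tubeMap γ n ε (s, t)) = F (s, t) := by
  have hFk : ∀ s t, ∀ k : ℤ, F (s + k * L, t) = F (s, t) := fun s t k => by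
    have : Function.Periodic (fun s => F (s, t)) L := fun s => hFp s t
    exact (this.int_mul k) s
  have hΦ : ContDiff ℝ ∞ (tubeMap γ n ε) := contDiff_tubeMap hγ hn
  have hΦk : ∀ s t, ∀ k : ℤ, tubeMap γ n ε (s + k * L, t) = tubeMap γ n ε (s, t) := fun s t k =>
    tubeMap_add_int_mul hγp hnp s t k
  -- The set of admissible values at `y`: it fixes the value on the closed tube and is everything
  -- elsewhere. It is convex, so local smooth solutions can be glued by a partition of unity.
  let T : E2 → Set ℝ := fun y => {v | ∀ s, ∀ t ∈ Icc (0 : ℝ) 1, tubeMap γ n ε (s, t) = y → v = F (s, t)}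
  have hT : ∀ y, Convex ℝ (T y) := by
    intro y v hv w hw a b _ _ hab s t ht h
    rw [hv s t ht h, hw s t ht h, ← add_smul, hab, one_smul]
  have hloc : ∀ x : E2, ∃ U ∈ 𝓝 x, ∃ g : E2 → ℝ, ContDiffOn ℝ ∞ g U ∧ ∀ y ∈ U, g y ∈ T y := by
    intro x
    by_cases hx : ∃ s, ∃ t ∈ Icc (0 : ℝ) 1, tubeMap γ n ε (s, t) = x
    · obtain ⟨s₀, t₀, ht₀, rfl⟩ := hx
      have heq : ∀ p, tubeJac κ ε p ≠ 0 → ∃ A : (ℝ × ℝ) ≃L[ℝ] E2,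
          (A : ℝ × ℝ →L[ℝ] E2) = tubeDeriv γ n κ ε p := by
        intro p hp
        have hi := injective_tubeDeriv (γ := γ) (n := n) (κ := κ) hγ1 hn1 hnγ hε hp
        refine ⟨(LinearEquiv.ofInjectiveOfFinrankEq (tubeDeriv γ n κ ε p : ℝ × ℝ →ₗ[ℝ] E2) hi
          (by simp)).toContinuousLinearEquiv, ?_⟩
        exact ContinuousLinearMap.ext fun v => rfl
      obtain ⟨A, hA⟩ := heq (s₀, t₀) (hjac s₀ t₀ ht₀)
      let e := hΦ.contDiffAt.toOpenPartialHomeomorph (tubeMap γ n ε)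
        (by rw [hA]; exact hasFDerivAt_tubeMap hγ hn hdn (s₀, t₀)) (by simp)
      have hes : (s₀, t₀) ∈ e.source := ContDiffAt.mem_toOpenPartialHomeomorph_source _ _ _
      have hec : ∀ p, e p = tubeMap γ n ε p := fun p => rfl
      have hjc : Continuous (tubeJac κ ε) := by unfold tubeJac; fun_prop
      let W : Set (ℝ × ℝ) := e.source ∩ {p | tubeJac κ ε p ≠ 0}
      have hW : IsOpen W := e.open_source.inter (isOpen_ne_fun hjc continuous_const)
      have hWmem : (s₀, t₀) ∈ W := ⟨hes, hjac s₀ t₀ ht₀⟩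
      let U₁ : Set E2 := e '' W
      have hU₁ : IsOpen U₁ := e.isOpen_image_of_subset_source hW inter_subset_left
      -- The part of one period of the closed strip outside the domain `W` of the local inverse. By
      -- injectivity modulo `L` its compact image misses the given point; off this image all
      -- parameters of a tube point are in `W` up to a period, and the local inverse gives the
      -- correct value.
      let K : Set (ℝ × ℝ) := (Icc (s₀ - L / 2) (s₀ + L / 2) ×ˢ Icc 0 1) \ W
      have hK : IsCompact K := (isCompact_Icc.prod isCompact_Icc).diff hW
      have hKx : tubeMap γ n ε (s₀, t₀) ∉ tubeMap γ n ε '' K := by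
        rintro ⟨⟨s, t⟩, ⟨⟨hs, ht⟩, hnW⟩, h⟩
        obtain ⟨rfl, k, hk⟩ := hinj _ _ t ht t₀ ht₀ h
        apply hnW
        have hk1 : |(k : ℝ) * L| ≤ 1 / 2 * L := by
          rw [abs_le]; constructor <;> linarith [hs.1, hs.2]
        rw [abs_mul, abs_of_pos hL] at hk1
        have hk2 : |(k : ℝ)| ≤ 1 / 2 := le_of_mul_le_mul_right hk1 hL
        have hk3 : k = 0 := by
          have : |(k : ℝ)| < 1 := by linarith
          rw [← Int.cast_abs] at this
          have h4 : |k| < 1 := by exact_mod_cast this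
          exact Int.abs_lt_one_iff.1 h4
        rw [hk3] at hk
        simp only [Int.cast_zero, zero_mul, add_zero] at hk
        rw [← hk]; exact hWmem
      refine ⟨U₁ ∩ (tubeMap γ n ε '' K)ᶜ, ?_, F ∘ e.symm, ?_, ?_⟩
      · refine (hU₁.inter (hK.image hΦ.continuous).isClosed.isOpen_compl).mem_nhds ⟨?_, hKx⟩
        exact ⟨_, hWmem, rfl⟩
      · rintro _ ⟨⟨p, hp, rfl⟩, -⟩
        obtain ⟨A', hA'⟩ := heq p hp.2
        have h1 : ContDiffAt ℝ ∞ e.symm (e p) := by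
          refine e.contDiffAt_symm (f₀' := A') (e.map_source hp.1) ?_ ?_
          · rw [e.left_inv hp.1, hA']
            exact hasFDerivAt_tubeMap hγ hn hdn p
          · exact hΦ.contDiffAt
        exact (hF.contDiffAt.comp _ h1).contDiffWithinAt
      · rintro y ⟨-, hyK⟩ s t ht rfl
        obtain ⟨s', hs', k, hk⟩ := exists_mem_Ico_add_int_mul hL (s₀ - L / 2) s
        have hmem : (s', t) ∈ W := by
          by_contra hnW
          refine hyK ⟨(s', t), ⟨⟨⟨hs'.1, by linarith [hs'.2]⟩, ht⟩, hnW⟩, ?_⟩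
          rw [hk, hΦk]
        have h2 : e.symm (tubeMap γ n ε (s, t)) = (s', t) := by
          rw [hk, hΦk, ← hec, e.left_inv hmem.1]
        rw [Function.comp_apply, h2, hk, hFk]
    · have hC : IsCompact (tubeMap γ n ε '' (Icc 0 L ×ˢ Icc 0 1)) :=
        (isCompact_Icc.prod isCompact_Icc).image hΦ.continuous
      refine ⟨(tubeMap γ n ε '' (Icc 0 L ×ˢ Icc 0 1))ᶜ, hC.isClosed.isOpen_compl.mem_nhds ?_,
        fun _ => 0, contDiffOn_const, ?_⟩
      · rintro ⟨⟨s, t⟩, ⟨hs, ht⟩, h⟩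
        exact hx ⟨s, t, ht, h⟩
      · rintro y hy s t ht rfl
        exfalso
        apply hy
        obtain ⟨s', hs', k, hk⟩ := exists_mem_Ico_add_int_mul hL 0 s
        rw [zero_add] at hs'
        exact ⟨(s', t), ⟨Ico_subset_Icc_self hs', ht⟩, by rw [hk, hΦk]⟩
  obtain ⟨g, hg⟩ := exists_contMDiffMap_forall_mem_convex_of_local (n := (⊤ : ℕ∞))
    (modelWithCornersSelf ℝ E2) hT (fun x => by
      obtain ⟨U, hU, g, hg, hgT⟩ := hloc x
      exact ⟨U, hU, g, hg.contMDiffOn, hgT⟩)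
  exact ⟨g, g.contMDiff.contDiff, fun s t ht => hg _ s t ht rfl⟩

/-- The area formula in tube coordinates. -/
theorem map_tubeMap_eq_restrict (hε : 0 < ε) (hγ : ContDiff ℝ ∞ γ)
    (hn : ContDiff ℝ ∞ n) (hκ : Continuous κ) (hγ1 : ∀ s, ‖deriv γ s‖ = 1)
    (hn1 : ∀ s, ‖n s‖ = 1) (hnγ : ∀ s, inner ℝ (n s) (deriv γ s) = (0 : ℝ))
    (hdn : ∀ s, deriv n s = κ s • deriv γ s)
    (hjac : ∀ s, ∀ t ∈ Icc (0 : ℝ) 1, 0 < tubeJac κ ε (s, t))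
    (hinj : InjOn (tubeMap γ n ε) (Ico 0 L ×ˢ Ioo 0 1)) :
    Measure.map (tubeMap γ n ε)
      ((muQ L).withDensity fun p => ENNReal.ofReal (ε * tubeJac κ ε p)) =
      volume.restrict (tubeMap γ n ε '' (Ico 0 L ×ˢ Ioo 0 1)) := by
  have hΦ : ContDiff ℝ ∞ (tubeMap γ n ε) := contDiff_tubeMap hγ hn
  let e : E2 →L[ℝ] ℝ × ℝ := (EuclideanSpace.proj 0).prod (EuclideanSpace.proj 1)
  have he : ∀ x, e x = (x 0, x 1) := fun x => rfl
  have hmp : MeasurePreserving e (volume : Measure E2) volume :=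
    (volume_preserving_finTwoArrow ℝ).comp (PiLp.volume_preserving_ofLp (Fin 2))
  have hinj_e : Function.Injective e := by
    intro x y hxy
    rw [he, he, Prod.mk.injEq] at hxy
    ext i
    fin_cases i
    · exact hxy.1
    · exact hxy.2
  have hsurj_e : Function.Surjective e := fun p => ⟨!₂[p.1, p.2], by simp [he]⟩
  set P : Set (ℝ × ℝ) := Ico 0 L ×ˢ Ioo 0 1 with hP
  have hPm : MeasurableSet P := measurableSet_Ico.prod measurableSet_Ioo
  have h1 := map_withDensity_abs_det_fderiv_eq_addHaar (volume : Measure E2)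
    (s := e ⁻¹' P) (f := tubeMap γ n ε ∘ e)
    (f' := fun x => (tubeDeriv γ n κ ε (e x)).comp e) (e.continuous.measurable hPm).nullMeasurableSet
    (fun x _ => ((hasFDerivAt_tubeMap hγ hn hdn (e x)).comp x e.hasFDerivAt).hasFDerivWithinAt)
    (hinj.comp hinj_e.injOn fun x hx => hx)
  rw [image_comp, image_preimage_eq _ hsurj_e] at h1
  rw [← h1]
  have hJm : Measurable fun p => ENNReal.ofReal (ε * tubeJac κ ε p) := by
    unfold tubeJac; fun_prop
  have hQ : muQ L = volume.restrict P := by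
    rw [muQ, muI, Measure.restrict_congr_set Ioo_ae_eq_Ico, Measure.prod_restrict, hP]
    rfl
  ext A hA
  rw [Measure.map_apply hΦ.continuous.measurable hA,
    Measure.map_apply (hΦ.continuous.comp e.continuous).measurable hA,
    withDensity_apply _ (hΦ.continuous.measurable hA),
    withDensity_apply _ ((hΦ.continuous.comp e.continuous).measurable hA), hQ,
    Measure.restrict_restrict (hΦ.continuous.measurable hA),
    Measure.restrict_restrict ((hΦ.continuous.comp e.continuous).measurable hA), preimage_comp,
    ← preimage_inter,
    ← hmp.setLIntegral_comp_preimage ((hΦ.continuous.measurable hA).inter hPm) hJm]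
  refine setLIntegral_congr_fun (e.continuous.measurable ((hΦ.continuous.measurable hA).inter hPm))
    fun x hx => ?_
  have hx2 : e x ∈ P := hx.2
  simp only
  rw [det_tubeDeriv_comp hγ1 hn1 hnγ hε (hjac _ _ ⟨hx2.2.1.le, hx2.2.2.le⟩) e he]

end Extension

/-! ### The thin set is a tube -/

section ThinSet

variable {Ω : Set E2} {L : ℝ} {γ : ℝ → E2}

/-- For small width, the thin set is a tube. -/
theorem isTube_thinSet (hO : IsOpen Ω) (hB : Bornology.IsBounded Ω)
    (hS : HasSmoothBoundary Ω) (hγ : IsArclengthParam Ω L γ) {ε ε' : ℝ} (hε' : IsTubular Ω ε')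
    (hε : 0 < ε) (hεε' : ε < ε') :
    IsTube L γ (fun s => outerNormal Ω (γ s)) (curvature Ω γ) ε (thinSet Ω ε) := by
  set n : ℝ → E2 := fun s => outerNormal Ω (γ s) with hn_def
  set κ := curvature Ω γ with hκ_def
  have hL := hγ.pos
  have hN := isOuterUnitNormal_param hO hS hγ
  have hn : ContDiff ℝ ∞ n := contDiff_outerNormal hO hS hγ
  have hκ : ContDiff ℝ ∞ κ := contDiff_curvature hO hS hγ
  have hn1 : ∀ s, ‖n s‖ = 1 := fun s => (hN s).1
  have hnγ : ∀ s, inner ℝ (n s) (deriv γ s) = (0 : ℝ) := inner_outerNormal_deriv hO hS hγ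
  have hnp : Function.Periodic n L := fun s => by simp only [n, hγ.periodic s]
  have hdn : ∀ s, deriv n s = κ s • deriv γ s := deriv_outerNormal hO hS hγ
  have hper2 : Function.Periodic (deriv (deriv γ)) L := by
    intro s
    rw [← deriv_comp_add_const]
    congr 1
    ext1 σ
    exact hγ.periodic_deriv σ
  have hκp : Function.Periodic κ L := fun s => by
    simp only [κ, curvature, hγ.periodic s, hper2 s]
  have hmap : ∀ s t, tubeMap γ n ε (s, t) = normalMap Ω γ s (ε * t) := fun s t => rfl
  have hlt : ∀ t ∈ Icc (0 : ℝ) 1, 0 ≤ ε * t ∧ ε * t < ε' := fun t ht =>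
    ⟨mul_nonneg hε.le ht.1, (mul_le_of_le_one_right hε.le ht.2).trans_lt hεε'⟩
  have hjac : ∀ s, ∀ t ∈ Icc (0 : ℝ) 1, 0 < tubeJac κ ε (s, t) := fun s t ht =>
    one_sub_mul_curvature_pos hO hB hS hγ hε' s (hlt t ht).1 (hlt t ht).2
  have hinj : ∀ s s', ∀ t ∈ Icc (0 : ℝ) 1, ∀ t' ∈ Icc (0 : ℝ) 1,
      tubeMap γ n ε (s, t) = tubeMap γ n ε (s', t') → t = t' ∧ ∃ k : ℤ, s' = s + k * L := by
    intro s s' t ht t' ht' h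
    obtain ⟨h1, h2⟩ := normalMap_injective hO hB hS hγ hε' (hlt t ht).1 (hlt t ht).2
      (hlt t' ht').1 (hlt t' ht').2 h
    exact ⟨mul_left_cancel₀ hε.ne' h1, h2⟩
  have hmod : ∀ s ∈ Ico 0 L, ∀ s' ∈ Ico 0 L, (∃ k : ℤ, s' = s + k * L) → s = s' := by
    rintro s hs s' hs' ⟨k, hk⟩
    have h1 : (k : ℝ) * L < 1 * L := by linarith [hs.1, hs'.2]
    have h2 : (-1 : ℝ) * L < k * L := by linarith [hs.2, hs'.1]
    have h3 : (k : ℝ) < 1 := lt_of_mul_lt_mul_right h1 hL.le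
    have h4 : (-1 : ℝ) < k := lt_of_mul_lt_mul_right h2 hL.le
    have h5 : k < 1 := by exact_mod_cast h3
    have h6 : -1 < k := by exact_mod_cast h4
    have h7 : k = 0 := by omega
    rw [hk, h7]; simp
  have hΦ : ContDiff ℝ ∞ (tubeMap γ n ε) := contDiff_tubeMap hγ.smooth hn
  have hdist : ∀ s, ∀ t ∈ Icc (0 : ℝ) 1,
      Metric.infDist (tubeMap γ n ε (s, t)) (frontier Ω) = ε * t := fun s t ht =>
    infDist_normalMap hO hB hS hγ hε' s (hlt t ht).1 (hlt t ht).2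
  have hD : thinSet Ω ε = tubeMap γ n ε '' (Ico 0 L ×ˢ Ioo 0 1) := by
    ext x
    constructor
    · rintro ⟨hx, hxε⟩
      obtain ⟨s, hs⟩ := exists_eq_normalMap hO hB hS hγ hε' hx
      have hpos := infDist_frontier_pos hO ⟨_, hγ.mem_frontier 0⟩ hx
      obtain ⟨s', hs', k, hk⟩ := exists_mem_Ico_add_int_mul hL 0 s
      rw [zero_add] at hs'
      refine ⟨(s', Metric.infDist x (frontier Ω) / ε), ⟨hs', by positivity,
        (div_lt_one hε).2 hxε⟩, ?_⟩
      rw [← tubeMap_add_int_mul hγ.periodic hnp s' _ k, ← hk, hmap, mul_div_cancel₀ _ hε.ne', ← hs]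
    · rintro ⟨⟨s, t⟩, ⟨-, ht⟩, rfl⟩
      have ht' : t ∈ Icc (0 : ℝ) 1 := Ioo_subset_Icc_self ht
      refine ⟨(normalMap_mem_and_infDist hO hB hS hγ hε' s (mul_pos hε ht.1) (hlt t ht').2).1, ?_⟩
      rw [hdist s t ht']
      exact mul_lt_of_lt_one_right hε ht.2
  have hDo : IsOpen (thinSet Ω ε) :=
    hO.inter (isOpen_lt (Metric.continuous_infDist_pt _) continuous_const)
  have hinj_outer : InjOn γ (Ico 0 L) := hγ.injOn
  have hinj_inner : InjOn (fun s => tubeMap γ n ε (s, 1)) (Ico 0 L) := fun s hs s' hs' h =>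
    hmod s hs s' hs' (hinj s s' 1 (by simp) 1 (by simp) h).2
  have hγ0 : ∀ s, γ s = tubeMap γ n ε (s, 0) := fun s => by simp [tubeMap]
  have hnot : ∀ s, ∀ t ∈ Icc (0 : ℝ) 1, tubeMap γ n ε (s, t) ∈ thinSet Ω ε → 0 < t ∧ t < 1 := by
    intro s t ht h
    have h1 := infDist_frontier_pos hO ⟨_, hγ.mem_frontier 0⟩ h.1
    have h2 := h.2
    rw [hdist s t ht] at h1 h2
    exact ⟨pos_of_mul_pos_right h1 hε.le, by nlinarith⟩
  have hfront : frontier (thinSet Ω ε) =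
      γ '' Ico 0 L ∪ (fun s => tubeMap γ n ε (s, 1)) '' Ico 0 L := by
    have hcl : closure (thinSet Ω ε) = tubeMap γ n ε '' (Icc 0 L ×ˢ Icc 0 1) := by
      refine subset_antisymm ?_ ?_
      · refine closure_minimal ?_ ((isCompact_Icc.prod isCompact_Icc).image hΦ.continuous).isClosed
        rw [hD]
        exact image_mono (prod_mono Ico_subset_Icc_self Ioo_subset_Icc_self)
      · rw [hD]
        have : (Icc 0 L ×ˢ Icc 0 1 : Set (ℝ × ℝ)) = closure (Ico 0 L ×ˢ Ioo 0 1) := by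
          rw [closure_prod_eq, closure_Ico hL.ne, closure_Ioo zero_ne_one]
        rw [this]
        exact image_closure_subset_closure_image hΦ.continuous
    rw [hDo.frontier_eq, hcl]
    ext x
    constructor
    · rintro ⟨⟨⟨s, t⟩, ⟨hs, ht⟩, rfl⟩, hx⟩
      obtain ⟨s', hs', k, hk⟩ := exists_mem_Ico_add_int_mul hL 0 s
      rw [zero_add] at hs'
      rw [hk, tubeMap_add_int_mul hγ.periodic hnp] at hx ⊢
      rcases ht.1.eq_or_lt with rfl | h0
      · left; exact ⟨s', hs', hγ0 s'⟩
      · rcases ht.2.eq_or_lt with rfl | h1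
        · right; exact ⟨s', hs', rfl⟩
        · exfalso
          apply hx
          rw [hD]
          exact ⟨(s', t), ⟨hs', h0, h1⟩, rfl⟩
    · rintro (⟨s, hs, rfl⟩ | ⟨s, hs, rfl⟩)
      · rw [hγ0]
        refine ⟨⟨(s, 0), ⟨Ico_subset_Icc_self hs, by simp⟩, rfl⟩, fun h => ?_⟩
        exact lt_irrefl _ (hnot s 0 (by simp) h).1
      · refine ⟨⟨(s, 1), ⟨Ico_subset_Icc_self hs, by simp⟩, rfl⟩, fun h => ?_⟩
        exact lt_irrefl _ (hnot s 1 (by simp) h).2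
  have hdisj : ∀ s s', γ s ≠ tubeMap γ n ε (s', 1) := by
    intro s s' h
    rw [hγ0] at h
    exact zero_ne_one (hinj s s' 0 (by simp) 1 (by simp) h).1
  have hinner_deriv : ∀ s, HasDerivAt (fun s => tubeMap γ n ε (s, 1))
      (tubeJac κ ε (s, 1) • deriv γ s) s := by
    intro s
    have h1 := (hγ.hasDerivAt s).sub
      (((hn.differentiable (by simp) s).hasDerivAt).const_smul (ε * 1))
    refine h1.congr_deriv ?_
    rw [hdn, tubeJac]
    module
  have hinner_smooth : ContDiff ℝ 1 (fun s => tubeMap γ n ε (s, 1)) :=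
    (hΦ.comp (contDiff_id.prodMk contDiff_const)).of_le (by simp)
  refine ⟨hL, hε, hγ.smooth, hn, hκ, hγ.periodic, hnp, hκp, hγ.unit_speed, hn1, hnγ, hdn,
    deriv_deriv_eq hO hS hγ, hjac, hDo, hB.subset fun x hx => hx.1, ?_, ?_, ?_, ?_, ?_,
    hinj_outer, hinj_inner, hdisj, hfront⟩
  · rw [hD]
    refine map_tubeMap_eq_restrict hε hγ.smooth hn hκ.continuous hγ.unit_speed hn1 hnγ hdn hjac ?_
    rintro ⟨s, t⟩ ⟨hs, ht⟩ ⟨s', t'⟩ ⟨hs', ht'⟩ h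
    obtain ⟨h1, h2⟩ := hinj s s' t (Ioo_subset_Icc_self ht) t' (Ioo_subset_Icc_self ht') h
    exact Prod.ext (hmod s hs s' hs' h2) h1
  · rw [bdryMeasure, hfront, Measure.restrict_union ?_ ?_,
      restrict_hausdorff_image (hγ.smooth.of_le (by simp)) hL hinj_outer,
      restrict_hausdorff_image hinner_smooth hL hinj_inner]
    · congr 2
      · have : (fun s => ENNReal.ofReal ‖deriv γ s‖) = 1 := by
          ext s; rw [hγ.unit_speed]; simp
        rw [this, withDensity_one]
      · congr 1
        ext s
        rw [(hinner_deriv s).deriv, norm_smul, hγ.unit_speed, mul_one,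
          Real.norm_of_nonneg (hjac s 1 (by simp)).le]
    · rw [Set.disjoint_left]
      rintro _ ⟨s, _, rfl⟩ ⟨s', _, h⟩
      exact hdisj s s' h.symm
    · exact measurableSet_Ico.image_of_continuousOn_injOn hinner_smooth.continuous.continuousOn
        hinj_inner
  · intro s
    refine IsOuterUnitNormal.outerNormal_eq ⟨hn1 s, fun c hc => ?_⟩
    have h1 : ∀ᶠ y in 𝓝 (γ s), Metric.infDist y (frontier Ω) < ε := by
      refine (Metric.continuous_infDist_pt _).continuousAt.eventually (gt_mem_nhds ?_)
      change Metric.infDist (γ s) (frontier Ω) < ε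
      rw [Metric.infDist_zero_of_mem (hγ.mem_frontier s)]
      exact hε
    filter_upwards [(hN s).2 c hc, h1] with y hy hy1
    exact ⟨fun h => ⟨hy.1 h, hy1⟩, fun h h' => hy.2 h h'.1⟩
  · intro s
    refine IsOuterUnitNormal.outerNormal_eq ⟨by rw [norm_neg, hn1], fun c hc => ?_⟩
    -- Two circles touch at the inner boundary point `x`. The disc of radius ε about γ(s) contains
    -- only points at distance less than ε from the boundary; the disc of radius T − ε about the
    -- point at depth `T` on the same normal contains only points at distance more than ε. Near `x`
    -- each disc contains the corresponding cone around ±ν, which makes −ν the outer normal of the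
    -- thin set.
    obtain ⟨T, hT1, hT2⟩ := exists_between hεε'
    set x := tubeMap γ n ε (s, 1) with hx
    have hxeq : x = γ s - ε • n s := by rw [hx, tubeMap, mul_one]
    have hxd : Metric.infDist x (frontier Ω) = ε := by
      rw [hx, hdist s 1 (by simp), mul_one]
    have hxΩ : x ∈ Ω := by
      have := (normalMap_mem_and_infDist hO hB hS hγ hε' s hε hεε').1
      rwa [hxeq]
    have e1 : ∀ᶠ y in 𝓝 x, ‖y - x‖ < 2 * ε * c := by
      have : (0 : ℝ) < 2 * ε * c := by positivity
      filter_upwards [Metric.ball_mem_nhds x this] with y hy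
      rwa [← dist_eq_norm]
    have e2 : ∀ᶠ y in 𝓝 x, ‖y - x‖ < 2 * (T - ε) * c := by
      have : (0 : ℝ) < 2 * (T - ε) * c := by
        have : 0 < T - ε := by linarith
        positivity
      filter_upwards [Metric.ball_mem_nhds x this] with y hy
      rwa [← dist_eq_norm]
    filter_upwards [e1, e2, hO.mem_nhds hxΩ] with y hy1 hy2 hyΩ
    rw [inner_neg_right]
    have hyx := norm_nonneg (y - x)
    constructor
    · intro h
      refine ⟨hyΩ, ?_⟩
      refine (Metric.infDist_le_dist_of_mem (hγ.mem_frontier s)).trans_lt ?_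
      rw [dist_eq_norm]
      refine lt_of_pow_lt_pow_left₀ 2 hε.le ?_
      rw [show y - γ s = (y - x) - ε • n s by rw [hxeq]; abel, norm_sub_sq_real, norm_smul, hn1,
        inner_smul_right, mul_one, Real.norm_of_nonneg hε.le]
      have h3 : c * ‖y - x‖ < inner ℝ (y - x) (n s) := by linarith
      rcases hyx.eq_or_lt with h0 | h0
      · rw [← h0] at h3 ⊢
        nlinarith
      · nlinarith
    · intro h hyD
      obtain ⟨-, hyε⟩ := hyD
      have hTpos : 0 < T - ε := by linarith
      have h1 : Metric.infDist (normalMap Ω γ s T) (frontier Ω) = T :=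
        infDist_normalMap hO hB hS hγ hε' s (by linarith) hT2
      have h2 := Metric.infDist_le_infDist_add_dist (s := frontier Ω) (x := normalMap Ω γ s T)
        (y := y)
      rw [h1] at h2
      have h3 : dist (normalMap Ω γ s T) y < T - ε := by
        rw [dist_comm, dist_eq_norm]
        refine lt_of_pow_lt_pow_left₀ 2 hTpos.le ?_
        have : y - normalMap Ω γ s T = (y - x) + (T - ε) • n s := by
          rw [hxeq, normalMap, sub_smul]; simp only [n]; abel
        rw [this, norm_add_sq_real, norm_smul, hn1, inner_smul_right, mul_one,
          Real.norm_of_nonneg hTpos.le]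
        rcases hyx.eq_or_lt with h0 | h0
        · rw [← h0] at h ⊢
          nlinarith
        · nlinarith
      linarith
  · exact fun F hF hFp => exists_contDiff_extension hL hε.ne' hγ.smooth hn hκ.continuous hγ.periodic
      hnp hγ.unit_speed hn1 hnγ hdn (fun s t ht => (hjac s t ht).ne') hinj F hF hFp

end ThinSet

/-! ### Classes in `L²` and multiplication operators -/

section Classes

variable {α : Type*} [MeasurableSpace α] {ν : Measure α}

open Classical in
/-- The class of `f` in `L²(ν)` (zero if `f` is not square integrable). -/
def l2cls (ν : Measure α) (f : α → ℝ) : Lp ℝ 2 ν :=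
  if h : MemLp f 2 ν then h.toLp f else 0

theorem l2cls_eq {f : α → ℝ} (h : MemLp f 2 ν) : l2cls ν f = h.toLp f := dif_pos h

theorem coeFn_l2cls {f : α → ℝ} (h : MemLp f 2 ν) : l2cls ν f =ᵐ[ν] f := by
  rw [l2cls_eq h]; exact h.coeFn_toLp

theorem l2cls_coeFn (f : Lp ℝ 2 ν) : l2cls ν f = f := by
  rw [l2cls_eq (Lp.memLp f), Lp.toLp_coeFn]

theorem l2cls_congr {f g : α → ℝ} (h : f =ᵐ[ν] g) : l2cls ν f = l2cls ν g := by
  by_cases hf : MemLp f 2 ν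
  · rw [l2cls_eq hf, l2cls_eq (hf.ae_eq h), MemLp.toLp_eq_toLp_iff]
    exact h
  · have hg : ¬ MemLp g 2 ν := fun hg => hf (hg.ae_eq h.symm)
    rw [l2cls, l2cls, dif_neg hf, dif_neg hg]

theorem eq_l2cls {f : Lp ℝ 2 ν} {g : α → ℝ} (h : f =ᵐ[ν] g) : f = l2cls ν g := by
  rw [← l2cls_congr h, l2cls_coeFn]

theorem l2cls_add {f g : α → ℝ} (hf : MemLp f 2 ν) (hg : MemLp g 2 ν) :
    l2cls ν f + l2cls ν g = l2cls ν (fun x => f x + g x) := by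
  refine eq_l2cls ?_
  filter_upwards [Lp.coeFn_add (l2cls ν f) (l2cls ν g), coeFn_l2cls hf, coeFn_l2cls hg]
    with x h1 h2 h3
  rw [h1, Pi.add_apply, h2, h3]

theorem l2cls_sub {f g : α → ℝ} (hf : MemLp f 2 ν) (hg : MemLp g 2 ν) :
    l2cls ν f - l2cls ν g = l2cls ν (fun x => f x - g x) := by
  refine eq_l2cls ?_
  filter_upwards [Lp.coeFn_sub (l2cls ν f) (l2cls ν g), coeFn_l2cls hf, coeFn_l2cls hg]
    with x h1 h2 h3
  rw [h1, Pi.sub_apply, h2, h3]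

theorem l2cls_smul (c : ℝ) {f : α → ℝ} (hf : MemLp f 2 ν) :
    c • l2cls ν f = l2cls ν (fun x => c * f x) := by
  refine eq_l2cls ?_
  filter_upwards [Lp.coeFn_smul c (l2cls ν f), coeFn_l2cls hf] with x h1 h2
  rw [h1, Pi.smul_apply, h2, smul_eq_mul]

theorem inner_l2cls {f g : α → ℝ} (hf : MemLp f 2 ν) (hg : MemLp g 2 ν) :
    inner ℝ (l2cls ν f) (l2cls ν g) = ∫ x, f x * g x ∂ν := by
  rw [l2cls_eq hf, l2cls_eq hg, inner_toLp]

theorem norm_sq_l2cls {f : α → ℝ} (hf : MemLp f 2 ν) : ‖l2cls ν f‖ ^ 2 = ∫ x, f x ^ 2 ∂ν := by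
  rw [← real_inner_self_eq_norm_sq, inner_l2cls hf hf]
  simp only [sq]

theorem norm_sq_eq_integral (f : Lp ℝ 2 ν) : ‖f‖ ^ 2 = ∫ x, f x ^ 2 ∂ν := by
  rw [← real_inner_self_eq_norm_sq, inner_eq_integral]
  simp only [sq]

/-- Measurable, essentially bounded weights. -/
structure IsBddWeight (ν : Measure α) (w : α → ℝ) : Prop where
  measurable : Measurable w
  bound : ∃ C, 0 ≤ C ∧ ∀ᵐ x ∂ν, |w x| ≤ C

theorem IsBddWeight.isWComp {w : α → ℝ} (hw : IsBddWeight ν w) : ∃ C, IsWComp ν ν id w C := by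
  obtain ⟨C, hC, hb⟩ := hw.bound
  refine ⟨C * 1, IsWComp.of_map_le measurable_id hw.measurable hC zero_le_one hb ?_⟩
  simp

open Classical in
/-- Multiplication by a bounded weight on `L²(ν)`. -/
def mulOp (ν : Measure α) (w : α → ℝ) : Lp ℝ 2 ν →L[ℝ] Lp ℝ 2 ν :=
  if h : IsBddWeight ν w then h.isWComp.choose_spec.op else 0

theorem coeFn_mulOp {w : α → ℝ} (hw : IsBddWeight ν w) (f : Lp ℝ 2 ν) :
    mulOp ν w f =ᵐ[ν] fun x => w x * f x := by
  rw [mulOp, dif_pos hw]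
  exact IsWComp.coeFn_op _ f

theorem mulOp_l2cls {w f : α → ℝ} (hw : IsBddWeight ν w) (hf : MemLp f 2 ν) :
    mulOp ν w (l2cls ν f) = l2cls ν (fun x => w x * f x) := by
  refine eq_l2cls ?_
  filter_upwards [coeFn_mulOp hw (l2cls ν f), coeFn_l2cls hf] with x h1 h2
  rw [h1, h2]

theorem norm_mulOp_le {w : α → ℝ} (hw : IsBddWeight ν w) {C : ℝ} (hC : ∀ᵐ x ∂ν, |w x| ≤ C)
    (f : Lp ℝ 2 ν) : ‖mulOp ν w f‖ ≤ C * ‖f‖ := by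
  refine Lp.norm_le_mul_norm_of_ae_le_mul ?_
  filter_upwards [coeFn_mulOp hw f, hC] with x h1 h2
  rw [h1, norm_mul]
  exact mul_le_mul_of_nonneg_right h2 (norm_nonneg _)

theorem inner_mulOp_left {w : α → ℝ} (hw : IsBddWeight ν w) (f g : Lp ℝ 2 ν) :
    inner ℝ (mulOp ν w f) g = inner ℝ f (mulOp ν w g) := by
  rw [inner_eq_integral, inner_eq_integral]
  refine integral_congr_ae ?_
  filter_upwards [coeFn_mulOp hw f, coeFn_mulOp hw g] with x h1 h2
  rw [h1, h2]; ring

end Classes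

/-! ### The reference strip -/

instance : IsProbabilityMeasure (volume.restrict (Ioo (0 : ℝ) 1)) :=
  ⟨by simp⟩

/-- `L²` of the reference strip. -/
abbrev LQ (L : ℝ) : Type := Lp ℝ 2 (muQ L)

section Strip

variable {L : ℝ}

theorem ae_muQ_mem (L : ℝ) : ∀ᵐ p ∂(muQ L), p ∈ Ioo 0 L ×ˢ Ioo (0 : ℝ) 1 := by
  rw [muQ, muI, Measure.prod_restrict]
  exact ae_restrict_mem (measurableSet_Ioo.prod measurableSet_Ioo)

theorem exists_bound_Q (L : ℝ) {f : ℝ × ℝ → ℝ} (hf : Continuous f) :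
    ∃ C, 0 ≤ C ∧ ∀ p ∈ Icc 0 L ×ˢ Icc (0 : ℝ) 1, |f p| ≤ C := by
  obtain ⟨C, hC⟩ := (isCompact_Icc.prod isCompact_Icc).exists_bound_of_continuousOn
    (s := Icc 0 L ×ˢ Icc (0 : ℝ) 1) hf.continuousOn
  exact ⟨max C 0, le_max_right _ _, fun p hp => (hC p hp).trans (le_max_left _ _)⟩

theorem exists_bound_I (L : ℝ) {f : ℝ → ℝ} (hf : Continuous f) :
    ∃ C, 0 ≤ C ∧ ∀ p ∈ Icc 0 L, |f p| ≤ C := by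
  obtain ⟨C, hC⟩ := isCompact_Icc.exists_bound_of_continuousOn (s := Icc 0 L) hf.continuousOn
  exact ⟨max C 0, le_max_right _ _, fun p hp => (hC p hp).trans (le_max_left _ _)⟩

theorem ae_bound_Q {f : ℝ × ℝ → ℝ} {C : ℝ} (h : ∀ p ∈ Icc 0 L ×ˢ Icc (0 : ℝ) 1, |f p| ≤ C) :
    ∀ᵐ p ∂(muQ L), |f p| ≤ C := by
  filter_upwards [ae_muQ_mem L] with p hp
  exact h p ⟨Ioo_subset_Icc_self hp.1, Ioo_subset_Icc_self hp.2⟩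

theorem ae_bound_I {f : ℝ → ℝ} {C : ℝ} (h : ∀ p ∈ Icc 0 L, |f p| ≤ C) :
    ∀ᵐ p ∂(muI L), |f p| ≤ C := by
  filter_upwards [ae_restrict_mem measurableSet_Ioo] with p hp
  exact h p (Ioo_subset_Icc_self hp)

theorem isBddWeight_Q {f : ℝ × ℝ → ℝ} (hf : Continuous f) : IsBddWeight (muQ L) f := by
  obtain ⟨C, hC, h⟩ := exists_bound_Q L hf
  exact ⟨hf.measurable, C, hC, ae_bound_Q h⟩

theorem isBddWeight_I {f : ℝ → ℝ} (hf : Continuous f) : IsBddWeight (muI L) f := by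
  obtain ⟨C, hC, h⟩ := exists_bound_I L hf
  exact ⟨hf.measurable, C, hC, ae_bound_I h⟩

theorem memLp_Q {f : ℝ × ℝ → ℝ} (hf : Continuous f) : MemLp f 2 (muQ L) := by
  obtain ⟨C, hC, h⟩ := exists_bound_Q L hf
  exact MemLp.of_bound hf.aestronglyMeasurable C (ae_bound_Q h)

theorem measurePreserving_fst_Q (L : ℝ) : MeasurePreserving Prod.fst (muQ L) (muI L) :=
  measurePreserving_fst

/-- Weights depending on the transversal variable only. -/
theorem isWComp_ext {ρ : ℝ → ℝ} (hρ : Measurable ρ) {c : ℝ} (hc : 0 ≤ c) (hb : ∀ t, |ρ t| ≤ c) :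
    IsWComp (muI L) (muQ L) Prod.fst (fun p => ρ p.2) (c * 1) := by
  refine IsWComp.of_map_le measurable_fst (hρ.comp measurable_snd) hc zero_le_one
    (Eventually.of_forall fun p => hb p.2) ?_
  rw [(measurePreserving_fst_Q L).map_eq]; simp

/-- The extension of a function on `(0, L)` to the strip, constant in the transversal variable. -/
def extI (L : ℝ) : LI L →L[ℝ] LQ L :=
  (isWComp_ext (L := L) (ρ := fun _ => 1) measurable_const zero_le_one (fun _ => by simp)).op

theorem coeFn_extI (g : LI L) : extI L g =ᵐ[muQ L] fun p => g p.1 := by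
  filter_upwards [(isWComp_ext (L := L) (ρ := fun _ => 1) measurable_const zero_le_one
    (fun _ => by simp)).coeFn_op g] with p hp
  rw [extI, hp, one_mul]

theorem norm_extI (g : LI L) : ‖extI L g‖ = ‖g‖ := by
  have h1 : extI L g = Lp.compMeasurePreserving Prod.fst (measurePreserving_fst_Q L) g := by
    refine Lp.ext ?_
    filter_upwards [coeFn_extI g, Lp.coeFn_compMeasurePreserving g (measurePreserving_fst_Q L)]
      with p h1 h2
    rw [h1, h2]; rfl
  rw [h1, Lp.norm_compMeasurePreserving]

/-- The average over the transversal variable. -/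
def avI (L : ℝ) : LQ L →L[ℝ] LI L := (extI L).adjoint

theorem inner_avI (A : LQ L) (g : LI L) : inner ℝ (avI L A) g = inner ℝ A (extI L g) :=
  ContinuousLinearMap.adjoint_inner_left _ _ _

theorem norm_avI_le (A : LQ L) : ‖avI L A‖ ≤ ‖A‖ := by
  have h1 : ‖avI L A‖ ^ 2 ≤ ‖A‖ * ‖avI L A‖ := by
    rw [← real_inner_self_eq_norm_sq, inner_avI]
    exact (real_inner_le_norm _ _).trans (by rw [norm_extI])
  rcases (norm_nonneg (avI L A)).eq_or_lt with h | h
  · rw [← h]; exact norm_nonneg _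
  · nlinarith

end Strip

/-! ### Sobolev functions on the reference strip -/

/-- Smooth functions on the plane, periodic in the first variable. -/
structure IsSmoothPeriodic (L : ℝ) (a : ℝ × ℝ → ℝ) : Prop where
  smooth : ContDiff ℝ ∞ a
  periodic : ∀ s t, a (s + L, t) = a (s, t)

/-- The derivative in the longitudinal variable. -/
def dS (a : ℝ × ℝ → ℝ) (p : ℝ × ℝ) : ℝ := fderiv ℝ a p (1, 0)

/-- The derivative in the transversal variable. -/
def dT (a : ℝ × ℝ → ℝ) (p : ℝ × ℝ) : ℝ := fderiv ℝ a p (0, 1)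

section Smooth

variable {L : ℝ} {a b : ℝ × ℝ → ℝ}

theorem hasDerivAt_dS (ha : Differentiable ℝ a) (s t : ℝ) :
    HasDerivAt (fun s => a (s, t)) (dS a (s, t)) s :=
  (ha (s, t)).hasFDerivAt.comp_hasDerivAt s ((hasDerivAt_id s).prodMk (hasDerivAt_const s t))

theorem hasDerivAt_dT (ha : Differentiable ℝ a) (s t : ℝ) :
    HasDerivAt (fun t => a (s, t)) (dT a (s, t)) t :=
  (ha (s, t)).hasFDerivAt.comp_hasDerivAt t ((hasDerivAt_const t s).prodMk (hasDerivAt_id t))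

theorem IsSmoothPeriodic.differentiable (ha : IsSmoothPeriodic L a) : Differentiable ℝ a :=
  ha.smooth.differentiable (by simp)

theorem IsSmoothPeriodic.continuous (ha : IsSmoothPeriodic L a) : Continuous a :=
  ha.smooth.continuous

theorem IsSmoothPeriodic.contDiff_dS (ha : IsSmoothPeriodic L a) : ContDiff ℝ ∞ (dS a) :=
  (ha.smooth.fderiv_right (m := ∞) (by simp)).clm_apply contDiff_const

theorem IsSmoothPeriodic.contDiff_dT (ha : IsSmoothPeriodic L a) : ContDiff ℝ ∞ (dT a) :=
  (ha.smooth.fderiv_right (m := ∞) (by simp)).clm_apply contDiff_const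

theorem IsSmoothPeriodic.dS (ha : IsSmoothPeriodic L a) : IsSmoothPeriodic L (dS a) := by
  refine ⟨ha.contDiff_dS, fun s t => ?_⟩
  have h1 := (hasDerivAt_dS ha.differentiable (s + L) t).comp_add_const s L
  simp only [ha.periodic] at h1
  exact h1.unique (hasDerivAt_dS ha.differentiable s t)

theorem IsSmoothPeriodic.dT (ha : IsSmoothPeriodic L a) : IsSmoothPeriodic L (dT a) := by
  refine ⟨ha.contDiff_dT, fun s t => ?_⟩
  have h1 := hasDerivAt_dT ha.differentiable (s + L) t
  simp only [ha.periodic] at h1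
  exact h1.unique (hasDerivAt_dT ha.differentiable s t)

theorem IsSmoothPeriodic.add (ha : IsSmoothPeriodic L a) (hb : IsSmoothPeriodic L b) :
    IsSmoothPeriodic L (fun p => a p + b p) :=
  ⟨ha.smooth.add hb.smooth, fun s t => by rw [ha.periodic, hb.periodic]⟩

theorem IsSmoothPeriodic.mul (ha : IsSmoothPeriodic L a) (hb : IsSmoothPeriodic L b) :
    IsSmoothPeriodic L (fun p => a p * b p) :=
  ⟨ha.smooth.mul hb.smooth, fun s t => by rw [ha.periodic, hb.periodic]⟩

theorem isSmoothPeriodic_const (c : ℝ) : IsSmoothPeriodic L (fun _ => c) :=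
  ⟨contDiff_const, fun _ _ => rfl⟩

theorem isSmoothPeriodic_snd : IsSmoothPeriodic L (fun p => p.2) :=
  ⟨contDiff_snd, fun _ _ => rfl⟩

theorem isSmoothPeriodic_fst {m : ℝ → ℝ} (hm : ContDiff ℝ ∞ m) (hp : Function.Periodic m L) :
    IsSmoothPeriodic L (fun p => m p.1) :=
  ⟨hm.comp contDiff_fst, fun s _ => hp s⟩

theorem dS_mul (ha : Differentiable ℝ a) (hb : Differentiable ℝ b) (p : ℝ × ℝ) :
    dS (fun p => a p * b p) p = dS a p * b p + a p * dS b p := by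
  rw [dS, fderiv_fun_mul (ha p) (hb p), dS, dS]
  simp; ring

theorem dT_mul (ha : Differentiable ℝ a) (hb : Differentiable ℝ b) (p : ℝ × ℝ) :
    dT (fun p => a p * b p) p = dT a p * b p + a p * dT b p := by
  rw [dT, fderiv_fun_mul (ha p) (hb p), dT, dT]
  simp; ring

theorem dS_fst {m : ℝ → ℝ} (hm : ContDiff ℝ ∞ m) (p : ℝ × ℝ) :
    dS (fun p => m p.1) p = deriv m p.1 :=
  (hasDerivAt_dS ((hm.comp contDiff_fst).differentiable (by simp)) p.1 p.2).unique
    (hm.differentiable (by simp) p.1).hasDerivAt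

theorem dT_fst {m : ℝ → ℝ} (hm : ContDiff ℝ ∞ m) (p : ℝ × ℝ) :
    dT (fun p => m p.1) p = 0 :=
  (hasDerivAt_dT ((hm.comp contDiff_fst).differentiable (by simp)) p.1 p.2).unique
    (hasDerivAt_const p.2 (m p.1))

theorem integrable_Q {f : ℝ × ℝ → ℝ} (hf : Continuous f) : Integrable f (muQ L) :=
  (memLp_Q hf).integrable (by norm_num)

theorem integrable_I {f : ℝ → ℝ} (hf : Continuous f) : Integrable f (muI L) :=
  (memLp_I hf).integrable (by norm_num)

theorem integral_muI (hL : 0 < L) (f : ℝ → ℝ) : ∫ s, f s ∂(muI L) = ∫ s in (0 : ℝ)..L, f s := by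
  rw [muI, intervalIntegral.integral_of_le hL.le, integral_Ioc_eq_integral_Ioo]

theorem integral_unit (f : ℝ → ℝ) : ∫ t in Ioo (0 : ℝ) 1, f t = ∫ t in (0 : ℝ)..1, f t := by
  rw [intervalIntegral.integral_of_le zero_le_one, integral_Ioc_eq_integral_Ioo]

/-- The integral over the strip of a longitudinal derivative vanishes. -/
theorem integral_dS (hL : 0 < L) (ha : IsSmoothPeriodic L a) : ∫ p, dS a p ∂(muQ L) = 0 := by
  rw [muQ, integral_prod_symm _ (integrable_Q ha.dS.continuous)]
  refine integral_eq_zero_of_ae (Eventually.of_forall fun t => ?_)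
  change ∫ s, dS a (s, t) ∂(muI L) = 0
  rw [integral_muI hL, intervalIntegral.integral_eq_sub_of_hasDerivAt
    (fun s _ => hasDerivAt_dS ha.differentiable s t)
    ((ha.dS.continuous.comp (by fun_prop)).intervalIntegrable _ _)]
  have := ha.periodic 0 t
  rw [zero_add] at this
  rw [this, sub_self]

theorem integral_dT_unit (ha : Differentiable ℝ a) (hc : Continuous (dT a)) (s : ℝ) :
    ∫ t in Ioo (0 : ℝ) 1, dT a (s, t) = a (s, 1) - a (s, 0) := by
  rw [integral_unit]
  exact intervalIntegral.integral_eq_sub_of_hasDerivAt (fun t _ => hasDerivAt_dT ha s t)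
    ((hc.comp (by fun_prop)).intervalIntegrable _ _)

theorem integral_dT (ha : IsSmoothPeriodic L a) :
    ∫ p, dT a p ∂(muQ L) = ∫ s, (a (s, 1) - a (s, 0)) ∂(muI L) := by
  rw [muQ, integral_prod _ (integrable_Q ha.dT.continuous)]
  exact integral_congr_ae (Eventually.of_forall fun s =>
    integral_dT_unit ha.differentiable ha.dT.continuous s)

theorem continuous_integral_unit {f : ℝ × ℝ → ℝ} (hf : Continuous f) :
    Continuous fun s => ∫ t in Ioo (0 : ℝ) 1, f (s, t) := by
  simp_rw [integral_unit]
  exact intervalIntegral.continuous_parametric_intervalIntegral_of_continuous' (by exact hf) 0 1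

/-- Fubini identifies the adjoint of the constant extension with integration over the transversal
variable. -/
theorem avI_l2cls {f : ℝ × ℝ → ℝ} (hf : Continuous f) :
    avI L (l2cls (muQ L) f) = l2cls (muI L) fun s => ∫ t in Ioo (0 : ℝ) 1, f (s, t) := by
  refine ext_inner_right ℝ fun g => ?_
  rw [inner_avI, inner_eq_integral, inner_eq_integral]
  have h1 : (∫ p, (l2cls (muQ L) f) p * (extI L g) p ∂(muQ L)) =
      ∫ p, f p * g p.1 ∂(muQ L) := by
    refine integral_congr_ae ?_
    filter_upwards [coeFn_l2cls (memLp_Q (L := L) hf), coeFn_extI g] with p h1 h2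
    rw [h1, h2]
  have hint : Integrable (fun p => f p * g p.1) (muQ L) := by
    have h2 : MemLp (fun p : ℝ × ℝ => g p.1) 2 (muQ L) :=
      (Lp.memLp g).comp_measurePreserving (measurePreserving_fst_Q L)
    exact (memLp_Q hf).integrable_mul h2
  rw [h1, muQ, integral_prod _ hint]
  refine integral_congr_ae ?_
  filter_upwards [coeFn_l2cls (memLp_I (L := L) (continuous_integral_unit hf))] with s hs
  rw [hs]
  exact integral_mul_const _ _

end Smooth

/-- The data of a smooth function on the strip: the function, its derivatives, and its values on
the two sides. -/
abbrev StripData (L : ℝ) : Type := LQ L × LQ L × LQ L × LI L × LI L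

/-- The class of a smooth function on the strip. -/
def smoothStrip (L : ℝ) (a : ℝ × ℝ → ℝ) : StripData L :=
  (l2cls (muQ L) a, l2cls (muQ L) (dS a), l2cls (muQ L) (dT a),
    l2cls (muI L) (fun s => a (s, 0)), l2cls (muI L) (fun s => a (s, 1)))

theorem smoothStrip_add {L : ℝ} {a b : ℝ × ℝ → ℝ} (ha : IsSmoothPeriodic L a)
    (hb : IsSmoothPeriodic L b) :
    smoothStrip L a + smoothStrip L b = smoothStrip L (fun p => a p + b p) := by
  have hca := ha.continuous
  have hcb := hb.continuous
  simp only [smoothStrip, Prod.mk_add_mk]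
  rw [l2cls_add (memLp_Q hca) (memLp_Q hcb), l2cls_add (memLp_Q ha.dS.continuous)
    (memLp_Q hb.dS.continuous), l2cls_add (memLp_Q ha.dT.continuous) (memLp_Q hb.dT.continuous),
    l2cls_add (memLp_I (by fun_prop)) (memLp_I (by fun_prop)),
    l2cls_add (memLp_I (by fun_prop)) (memLp_I (by fun_prop))]
  congr 3
  · funext p
    simp only [dS]
    rw [fderiv_fun_add (ha.differentiable p) (hb.differentiable p)]; rfl
  · congr 1
    funext p
    simp only [dT]
    rw [fderiv_fun_add (ha.differentiable p) (hb.differentiable p)]; rfl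

theorem smoothStrip_smul {L : ℝ} {a : ℝ × ℝ → ℝ} (ha : IsSmoothPeriodic L a) (c : ℝ) :
    c • smoothStrip L a = smoothStrip L (fun p => c * a p) := by
  have hca := ha.continuous
  simp only [smoothStrip, Prod.smul_mk]
  rw [l2cls_smul c (memLp_Q hca), l2cls_smul c (memLp_Q ha.dS.continuous),
    l2cls_smul c (memLp_Q ha.dT.continuous),
    l2cls_smul c (memLp_I (by fun_prop)), l2cls_smul c (memLp_I (by fun_prop))]
  congr 3
  · funext p
    rw [dS, dS, fderiv_const_mul (ha.differentiable p)]; rfl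
  · congr 1
    funext p
    rw [dT, dT, fderiv_const_mul (ha.differentiable p)]; rfl

/-- The classes of smooth functions on the strip. -/
def smoothStrips (L : ℝ) : Submodule ℝ (StripData L) where
  carrier := {x | ∃ a, IsSmoothPeriodic L a ∧ smoothStrip L a = x}
  add_mem' := by
    rintro _ _ ⟨a, ha, rfl⟩ ⟨b, hb, rfl⟩
    exact ⟨_, ha.add hb, (smoothStrip_add ha hb).symm⟩
  zero_mem' := by
    refine ⟨_, (isSmoothPeriodic_const 0).mul (isSmoothPeriodic_const 0), ?_⟩
    rw [← smoothStrip_smul (isSmoothPeriodic_const 0), zero_smul]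
  smul_mem' := by
    rintro c _ ⟨a, ha, rfl⟩
    exact ⟨_, (isSmoothPeriodic_const c).mul ha, (smoothStrip_smul ha c).symm⟩

/-- `A` is a Sobolev function on the strip with derivatives `As`, `At` and boundary values
`G₀`, `G₁`. -/
def IsStrip (L : ℝ) (x : StripData L) : Prop := x ∈ (smoothStrips L).topologicalClosure

/-! ### Identities and inequalities for Sobolev functions on the strip -/

section StripFacts

variable {L : ℝ} {x y : StripData L}

/-- A closed condition on strip data holds everywhere once it holds for smooth periodic functions.
All calculus on the strip is reduced to the smooth case in this way. -/
theorem IsStrip.induction {P : StripData L → Prop} (hx : IsStrip L x) (hP : IsClosed {x | P x})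
    (h : ∀ a, IsSmoothPeriodic L a → P (smoothStrip L a)) : P x := by
  have h1 : closure (smoothStrips L : Set (StripData L)) ⊆ {x | P x} := by
    refine closure_minimal ?_ hP
    rintro _ ⟨a, ha, rfl⟩
    exact h a ha
  exact h1 hx

theorem IsStrip.add (hx : IsStrip L x) (hy : IsStrip L y) : IsStrip L (x + y) :=
  Submodule.add_mem _ hx hy

theorem isStrip_smooth {a : ℝ × ℝ → ℝ} (ha : IsSmoothPeriodic L a) :
    IsStrip L (smoothStrip L a) :=
  Submodule.le_topologicalClosure _ ⟨a, ha, rfl⟩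

theorem isClosed_isStrip : IsClosed {x : StripData L | IsStrip L x} :=
  Submodule.isClosed_topologicalClosure _

/-- Multiplication of strip data by a smooth function. -/
def mulStrip (L : ℝ) (m : ℝ × ℝ → ℝ) (x : StripData L) : StripData L :=
  (mulOp (muQ L) m x.1, mulOp (muQ L) (dS m) x.1 + mulOp (muQ L) m x.2.1,
    mulOp (muQ L) (dT m) x.1 + mulOp (muQ L) m x.2.2.1,
    mulOp (muI L) (fun s => m (s, 0)) x.2.2.2.1, mulOp (muI L) (fun s => m (s, 1)) x.2.2.2.2)

theorem IsStrip.mul {m : ℝ × ℝ → ℝ} (hm : IsSmoothPeriodic L m) (hx : IsStrip L x) :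
    IsStrip L (mulStrip L m x) := by
  refine hx.induction (P := fun x => IsStrip L (mulStrip L m x)) ?_ ?_
  · refine isClosed_isStrip.preimage ?_
    unfold mulStrip
    fun_prop
  · intro a ha
    have h1 := isStrip_smooth (hm.mul ha)
    have hca := ha.continuous
    have hcm := hm.continuous
    have hq : ∀ {f g : ℝ × ℝ → ℝ}, Continuous f → Continuous g →
        MemLp (fun p => f p * g p) 2 (muQ L) := fun hf hg => memLp_Q (hf.mul hg)
    convert h1 using 1
    simp only [mulStrip, smoothStrip]
    rw [mulOp_l2cls (isBddWeight_Q hcm) (memLp_Q hca),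
      mulOp_l2cls (isBddWeight_Q hm.dS.continuous) (memLp_Q hca),
      mulOp_l2cls (isBddWeight_Q hcm) (memLp_Q ha.dS.continuous),
      mulOp_l2cls (isBddWeight_Q hm.dT.continuous) (memLp_Q hca),
      mulOp_l2cls (isBddWeight_Q hcm) (memLp_Q ha.dT.continuous),
      mulOp_l2cls (isBddWeight_I (by fun_prop)) (memLp_I (by fun_prop)),
      mulOp_l2cls (isBddWeight_I (by fun_prop)) (memLp_I (by fun_prop)),
      l2cls_add (hq hm.dS.continuous hca) (hq hcm ha.dS.continuous),
      l2cls_add (hq hm.dT.continuous hca) (hq hcm ha.dT.continuous)]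
    congr 3
    · funext p
      rw [dS_mul hm.differentiable ha.differentiable]
    · congr 1
      funext p
      rw [dT_mul hm.differentiable ha.differentiable]

/-- Integration by parts in the longitudinal variable. -/
theorem IsStrip.inner_dS_add (hL : 0 < L) (hx : IsStrip L x) (hy : IsStrip L y) :
    inner ℝ x.2.1 y.1 + inner ℝ x.1 y.2.1 = (0 : ℝ) := by
  refine hx.induction (P := fun x => inner ℝ x.2.1 y.1 + inner ℝ x.1 y.2.1 = (0 : ℝ))
    (isClosed_eq (by fun_prop) continuous_const) fun a ha => ?_
  refine hy.induction (P := fun y => inner ℝ (smoothStrip L a).2.1 y.1 +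
    inner ℝ (smoothStrip L a).1 y.2.1 = (0 : ℝ))
    (isClosed_eq (by fun_prop) continuous_const) fun b hb => ?_
  have hca := ha.continuous
  have hcb := hb.continuous
  simp only [smoothStrip]
  rw [inner_l2cls (memLp_Q ha.dS.continuous) (memLp_Q hcb),
    inner_l2cls (memLp_Q hca) (memLp_Q hb.dS.continuous),
    ← integral_add (integrable_Q (f := fun p => dS a p * b p) (ha.dS.continuous.mul hcb))
      (integrable_Q (f := fun p => a p * dS b p) (hca.mul hb.dS.continuous)),
    ← integral_dS hL (ha.mul hb)]
  exact integral_congr_ae (Eventually.of_forall fun p =>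
    (dS_mul ha.differentiable hb.differentiable p).symm)

/-- The value on the lower side in terms of averages. -/
theorem IsStrip.lower_eq (hx : IsStrip L x) :
    x.2.2.2.1 = avI L x.1 - avI L (mulOp (muQ L) (fun p => 1 - p.2) x.2.2.1) := by
  refine hx.induction (P := fun x => x.2.2.2.1 =
    avI L x.1 - avI L (mulOp (muQ L) (fun p => 1 - p.2) x.2.2.1))
    (isClosed_eq (by fun_prop) (by fun_prop)) fun a ha => ?_
  have hca := ha.continuous
  have hct := ha.dT.continuous
  simp only [smoothStrip]
  rw [mulOp_l2cls (isBddWeight_Q (by fun_prop)) (memLp_Q hct), avI_l2cls hca,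
    avI_l2cls (by fun_prop), l2cls_sub (memLp_I (continuous_integral_unit hca))
      (memLp_I (continuous_integral_unit (f := fun p => (1 - p.2) * dT a p) (by fun_prop)))]
  congr 1
  funext s
  -- The fundamental theorem of calculus for (1 − t)a(s, t), which vanishes at t = 1. The weight is
  -- written as `1 + -1 * p.2` to fit the closure rules for smooth periodic functions.
  have h1 : IsSmoothPeriodic L (fun p => (1 + -1 * p.2) * a p) :=
    ((isSmoothPeriodic_const 1).add ((isSmoothPeriodic_const (-1)).mul isSmoothPeriodic_snd)).mul ha
  have h2 := integral_dT_unit h1.differentiable h1.dT.continuous s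
  rw [← integral_sub (by exact integrable_I (L := 1) (by fun_prop))
    (by exact integrable_I (L := 1) (by fun_prop))]
  have h3 : ∀ t, dT (fun p => (1 + -1 * p.2) * a p) (s, t) =
      -(a (s, t) - (1 - t) * dT a (s, t)) := fun t =>
    (hasDerivAt_dT h1.differentiable s t).unique (by
      have := (((hasDerivAt_id t).const_mul (-1)).const_add 1).mul
        (hasDerivAt_dT ha.differentiable s t)
      exact this.congr_deriv (by simp only [id]; ring))
  simp_rw [h3] at h2
  rw [integral_neg] at h2
  linarith

/-- The difference of the values on the two sides. -/
theorem IsStrip.upper_sub_lower (hx : IsStrip L x) :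
    x.2.2.2.2 - x.2.2.2.1 = avI L x.2.2.1 := by
  refine hx.induction (P := fun x => x.2.2.2.2 - x.2.2.2.1 = avI L x.2.2.1)
    (isClosed_eq (by fun_prop) (by fun_prop)) fun a ha => ?_
  have hca := ha.continuous
  simp only [smoothStrip]
  rw [avI_l2cls ha.dT.continuous, l2cls_sub (memLp_I (by fun_prop)) (memLp_I (by fun_prop))]
  congr 1
  funext s
  exact (integral_dT_unit ha.differentiable ha.dT.continuous s).symm

theorem IsStrip.norm_upper_sub_lower_le (hx : IsStrip L x) :
    ‖x.2.2.2.2 - x.2.2.2.1‖ ≤ ‖x.2.2.1‖ := by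
  rw [hx.upper_sub_lower]; exact norm_avI_le _

theorem norm_mulOp_one_sub_le (A : LQ L) : ‖mulOp (muQ L) (fun p => 1 - p.2) A‖ ≤ ‖A‖ := by
  have := norm_mulOp_le (ν := muQ L) (w := fun p => 1 - p.2) (isBddWeight_Q (by fun_prop)) (C := 1)
    (ae_bound_Q fun p hp => by rw [abs_of_nonneg (by linarith [hp.2.2])]; linarith [hp.2.1]) A
  rwa [one_mul] at this

theorem IsStrip.norm_lower_sub_avI_le (hx : IsStrip L x) :
    ‖x.2.2.2.1 - avI L x.1‖ ≤ ‖x.2.2.1‖ := by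
  rw [hx.lower_eq, sub_sub_cancel_left, norm_neg]
  exact (norm_avI_le _).trans (norm_mulOp_one_sub_le _)

/-- A Sobolev function is close to its value on the lower side. -/
theorem IsStrip.norm_sub_extI_le (hx : IsStrip L x) :
    ‖x.1 - extI L x.2.2.2.1‖ ≤ 2 * ‖x.2.2.1‖ := by
  refine hx.induction (P := fun x => ‖x.1 - extI L x.2.2.2.1‖ ≤ 2 * ‖x.2.2.1‖)
    (isClosed_le (by fun_prop) (by fun_prop)) fun a ha => ?_
  have hca := ha.continuous
  have hct := ha.dT.continuous
  simp only [smoothStrip]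
  have hlow : IsSmoothPeriodic L (fun p => a p + -1 * a (p.1, 0)) :=
    ha.add ((isSmoothPeriodic_const (-1)).mul
      ⟨ha.smooth.comp (by fun_prop), fun s t => ha.periodic s 0⟩)
  set d : ℝ × ℝ → ℝ := fun p => a p + -1 * a (p.1, 0) with hd
  have hcd := hlow.continuous
  have hdt : dT d = dT a := by
    funext p
    refine (hasDerivAt_dT hlow.differentiable p.1 p.2).unique ?_
    exact (hasDerivAt_dT ha.differentiable p.1 p.2).add_const (-1 * a (p.1, 0))
  have hcls : l2cls (muQ L) a - extI L (l2cls (muI L) fun s => a (s, 0)) = l2cls (muQ L) d := by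
    refine eq_l2cls ?_
    filter_upwards [Lp.coeFn_sub (l2cls (muQ L) a) (extI L (l2cls (muI L) fun s => a (s, 0))),
      coeFn_extI (l2cls (muI L) fun s => a (s, 0)), coeFn_l2cls (memLp_Q (L := L) hca),
      (measurePreserving_fst_Q L).quasiMeasurePreserving.ae
        (coeFn_l2cls (memLp_I (L := L) (f := fun s => a (s, 0)) (by fun_prop)))] with p h1 h2 h3 h4
    rw [h1, Pi.sub_apply, h2, h3, h4, hd]
    ring
  rw [hcls]
  set D := l2cls (muQ L) d with hD
  set E := l2cls (muQ L) (dT a) with hE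
  -- The function (1 − t)d² vanishes for t = 0 and t = 1, so the integral of its t-derivative is
  -- zero. Hence ‖d‖² equals twice the integral of (1 − t)d d_t, which is at most 2‖d‖‖d_t‖.
  have h1 : IsSmoothPeriodic L (fun p => (1 + -1 * p.2) * (d p * d p)) :=
    ((isSmoothPeriodic_const 1).add ((isSmoothPeriodic_const (-1)).mul isSmoothPeriodic_snd)).mul
      (hlow.mul hlow)
  have h2 := integral_dT h1
  have h3 : ∀ p, dT (fun p => (1 + -1 * p.2) * (d p * d p)) p =
      2 * (((1 - p.2) * d p) * dT a p) - d p * d p := fun p =>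
    (hasDerivAt_dT h1.differentiable p.1 p.2).unique (by
      have hdd := hasDerivAt_dT hlow.differentiable p.1 p.2
      have := (((hasDerivAt_id p.2).const_mul (-1)).const_add 1).mul (hdd.mul hdd)
      exact this.congr_deriv (by simp only [id, hdt, Pi.mul_apply]; ring))
  simp_rw [h3] at h2
  have hz : ∀ s, d (s, 0) = 0 := fun s => by simp [hd]
  simp only [hz] at h2
  rw [integral_sub (integrable_Q (by fun_prop)) (integrable_Q (by fun_prop)),
    integral_const_mul] at h2
  have h4 : inner ℝ (mulOp (muQ L) (fun p => 1 - p.2) D) E =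
      ∫ p, ((1 - p.2) * d p) * dT a p ∂(muQ L) := by
    rw [hD, mulOp_l2cls (isBddWeight_Q (by fun_prop)) (memLp_Q hcd), hE,
      inner_l2cls (memLp_Q (by fun_prop)) (memLp_Q hct)]
  have h5 : ‖D‖ ^ 2 = ∫ p, d p * d p ∂(muQ L) := by
    rw [hD, norm_sq_l2cls (memLp_Q hcd)]; simp only [sq]
  rw [← h4, ← h5] at h2
  have h6 := real_inner_le_norm (mulOp (muQ L) (fun p => 1 - p.2) D) E
  have h7 := norm_mulOp_one_sub_le D
  have h8 : ‖D‖ ^ 2 ≤ 2 * (‖D‖ * ‖E‖) := by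
    have : ‖mulOp (muQ L) (fun p => 1 - p.2) D‖ * ‖E‖ ≤ ‖D‖ * ‖E‖ := by gcongr
    simp at h2
    linarith
  rcases (norm_nonneg D).eq_or_lt with h | h
  · rw [← h]; positivity
  · nlinarith

/-- The average of a Sobolev function is a primitive. -/
theorem IsStrip.avI_eq (hL : 0 < L) (hx : IsStrip L x) :
    avI L x.1 = primI L (avI L x.2.1) + meanI L (avI L x.1) • oneI L := by
  refine hx.induction (P := fun x =>
    avI L x.1 = primI L (avI L x.2.1) + meanI L (avI L x.1) • oneI L)
    (isClosed_eq (by fun_prop) (by fun_prop)) fun a ha => ?_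
  have hca := ha.continuous
  have hcs := ha.dS.continuous
  simp only [smoothStrip]
  refine eq_primI_add_of_eq hL (c := ∫ t in Ioo (0 : ℝ) 1, a (0, t)) ?_
  rw [avI_l2cls hca, avI_l2cls hcs]
  set g := l2cls (muI L) (fun s => ∫ t in Ioo (0 : ℝ) 1, dS a (s, t)) with hg
  symm
  refine eq_l2cls ?_
  filter_upwards [Lp.coeFn_add (volterra L g) ((∫ t in Ioo (0 : ℝ) 1, a (0, t)) • oneI L),
    coeFn_volterra g, Lp.coeFn_smul (∫ t in Ioo (0 : ℝ) 1, a (0, t)) (oneI L), coeFn_oneI (L := L),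
    ae_restrict_mem measurableSet_Ioo] with s h1 h2 h3 h4 hs
  rw [h1, Pi.add_apply, h2, h3, Pi.smul_apply, h4, smul_eq_mul, mul_one, prim]
  have h5 : ∫ σ in Iic s, g σ ∂(muI L) =
      ∫ σ, (∫ t in Ioo (0 : ℝ) 1, dS a (σ, t)) ∂(muI s) := by
    have : ∫ σ in Iic s, g σ ∂(muI L) =
        ∫ σ in Iic s, (∫ t in Ioo (0 : ℝ) 1, dS a (σ, t)) ∂(muI L) :=
      integral_congr_ae (ae_restrict_of_ae
        (coeFn_l2cls (memLp_I (continuous_integral_unit hcs))))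
    rw [this, muI, Measure.restrict_restrict measurableSet_Iic, muI,
      ← integral_Ioc_eq_integral_Ioo]
    have h6 : Iic s ∩ Ioo 0 L = Ioc 0 s := by
      ext σ; simp only [mem_inter_iff, mem_Iic, mem_Ioo, mem_Ioc]
      exact ⟨fun h => ⟨h.2.1, h.1⟩, fun h => ⟨h.2, h.1, h.2.trans_lt hs.2⟩⟩
    rw [h6]
  have h8 : ∀ t, ∫ σ, dS a (σ, t) ∂(muI s) = a (s, t) - a (0, t) := fun t => by
    rw [integral_muI hs.1, intervalIntegral.integral_eq_sub_of_hasDerivAt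
      (fun s _ => hasDerivAt_dS ha.differentiable s t)
      ((hcs.comp (by fun_prop)).intervalIntegrable _ _)]
  rw [h5, integral_integral_swap (f := fun σ t => dS a (σ, t)) (integrable_Q (L := s) hcs)]
  simp_rw [h8]
  rw [integral_sub (by exact integrable_I (L := 1) (by fun_prop))
    (by exact integrable_I (L := 1) (by fun_prop)), sub_add_cancel]

end StripFacts

/-! ### Traces and second order Sobolev functions as closed subspaces of `L²` spaces -/

/-- The space `L²(D)`. -/
abbrev LD (D : Set E2) : Type := Lp ℝ 2 (volume.restrict D : Measure E2)

/-- The space `L²(∂D)`. -/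
abbrev LB (D : Set E2) : Type := Lp ℝ 2 (bdryMeasure D)

/-- Functions with gradient and trace. -/
abbrev TraceData (D : Set E2) : Type := LD D × (Fin 2 → LD D) × LB D

/-- Functions with gradient and Hessian, and their traces. -/
abbrev H2Data (D : Set E2) : Type := TraceData D × (Fin 2 → TraceData D)

/-- Bounded open sets with boundary of finite length. -/
structure IsTame (D : Set E2) : Prop where
  isOpen : IsOpen D
  bounded : Bornology.IsBounded D
  finite : bdryMeasure D univ ≠ ⊤

theorem tendsto_l2cls_iff {α : Type*} [MeasurableSpace α] {ν : Measure α} {f : ℕ → α → ℝ}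
    {g : α → ℝ} (hf : ∀ n, MemLp (f n) 2 ν) (hg : MemLp g 2 ν) :
    Tendsto (fun n => l2cls ν (f n)) atTop (𝓝 (l2cls ν g)) ↔
      Tendsto (fun n => eLpNorm (fun x => f n x - g x) 2 ν) atTop (𝓝 0) := by
  simp_rw [l2cls_eq (hf _), l2cls_eq hg]
  exact Lp.tendsto_Lp_iff_tendsto_eLpNorm'' f hf g hg

theorem memLp_of_bounded_support {ν : Measure E2} (hν : ν univ ≠ ⊤) {K : Set E2}
    (hK : Bornology.IsBounded K) (h : ∀ᵐ x ∂ν, x ∈ K) {f : E2 → ℝ} (hf : Continuous f) :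
    MemLp f 2 ν := by
  have : IsFiniteMeasure ν := ⟨hν.lt_top⟩
  obtain ⟨C, hC⟩ := hK.isCompact_closure.exists_bound_of_continuousOn hf.continuousOn
  refine MemLp.of_bound hf.aestronglyMeasurable C ?_
  filter_upwards [h] with x hx
  exact hC x (subset_closure hx)

theorem isBddWeight_of_bounded_support {ν : Measure E2} {K : Set E2}
    (hK : Bornology.IsBounded K) (h : ∀ᵐ x ∂ν, x ∈ K) {f : E2 → ℝ} (hf : Continuous f) :
    IsBddWeight ν f := by
  obtain ⟨C, hC⟩ := hK.isCompact_closure.exists_bound_of_continuousOn hf.continuousOn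
  refine ⟨hf.measurable, max C 0, le_max_right _ _, ?_⟩
  filter_upwards [h] with x hx
  exact (hC x (subset_closure hx)).trans (le_max_left _ _)

section Tame

variable {D : Set E2}

theorem ae_mem_frontier (D : Set E2) : ∀ᵐ x ∂(bdryMeasure D), x ∈ frontier D :=
  ae_restrict_mem isClosed_frontier.measurableSet

theorem IsTame.bounded_frontier (hD : IsTame D) : Bornology.IsBounded (frontier D) :=
  hD.bounded.closure.subset frontier_subset_closure

theorem IsTame.memLp (hD : IsTame D) {f : E2 → ℝ} (hf : Continuous f) :
    MemLp f 2 (volume.restrict D) := by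
  refine memLp_of_bounded_support ?_ hD.bounded
    (ae_restrict_mem hD.isOpen.measurableSet) hf
  rw [Measure.restrict_apply_univ]
  exact hD.bounded.measure_lt_top.ne

theorem IsTame.memLp_bdry (hD : IsTame D) {f : E2 → ℝ} (hf : Continuous f) :
    MemLp f 2 (bdryMeasure D) :=
  memLp_of_bounded_support hD.finite hD.bounded_frontier (ae_mem_frontier D) hf

theorem IsTame.isBddWeight_bdry (hD : IsTame D) {f : E2 → ℝ} (hf : Continuous f) :
    IsBddWeight (bdryMeasure D) f :=
  isBddWeight_of_bounded_support hD.bounded_frontier (ae_mem_frontier D) hf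

theorem contDiff_pderiv {φ : E2 → ℝ} (hφ : ContDiff ℝ ∞ φ) (i : Fin 2) :
    ContDiff ℝ ∞ (pderiv i φ) :=
  (hφ.fderiv_right (m := ∞) (by simp)).clm_apply contDiff_const

theorem continuous_pderiv {φ : E2 → ℝ} (hφ : ContDiff ℝ ∞ φ) (i : Fin 2) :
    Continuous (pderiv i φ) := (contDiff_pderiv hφ i).continuous

theorem pderiv_pderiv_comm {φ : E2 → ℝ} (hφ : ContDiff ℝ ∞ φ) (i j : Fin 2) (x : E2) :
    pderiv i (pderiv j φ) x = pderiv j (pderiv i φ) x := by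
  have h1 : DifferentiableAt ℝ (fderiv ℝ φ) x :=
    (hφ.fderiv_right (m := ∞) (by simp)).differentiable (by simp) x
  have h2 : ∀ v w, fderiv ℝ (fun y => fderiv ℝ φ y v) x w = fderiv ℝ (fderiv ℝ φ) x w v := by
    intro v w
    rw [fderiv_clm_apply h1 (differentiableAt_const v)]
    simp
  have h3 : IsSymmSndFDerivAt ℝ φ x := hφ.contDiffAt.isSymmSndFDerivAt
    (by rw [minSmoothness_of_isRCLikeNormedField]; exact WithTop.coe_le_coe.2 (le_top (a := (2 : ℕ∞))))
  change fderiv ℝ (fun y => fderiv ℝ φ y _) x _ = fderiv ℝ (fun y => fderiv ℝ φ y _) x _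
  rw [h2, h2, h3]

/-- The data of a smooth function. -/
def smoothTrace (D : Set E2) (φ : E2 → ℝ) : TraceData D :=
  (l2cls _ φ, fun i => l2cls _ (pderiv i φ), l2cls _ φ)

theorem smoothTrace_add (hD : IsTame D) {φ ψ : E2 → ℝ} (hφ : ContDiff ℝ ∞ φ)
    (hψ : ContDiff ℝ ∞ ψ) :
    smoothTrace D φ + smoothTrace D ψ = smoothTrace D (fun x => φ x + ψ x) := by
  simp only [smoothTrace, Prod.mk_add_mk]
  rw [l2cls_add (hD.memLp hφ.continuous) (hD.memLp hψ.continuous),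
    l2cls_add (hD.memLp_bdry hφ.continuous) (hD.memLp_bdry hψ.continuous)]
  congr 2
  funext i
  rw [Pi.add_apply, l2cls_add (hD.memLp (continuous_pderiv hφ i))
    (hD.memLp (continuous_pderiv hψ i))]
  congr 1
  funext x
  simp only [pderiv]
  rw [fderiv_fun_add (hφ.differentiable (by simp) x) (hψ.differentiable (by simp) x)]; rfl

theorem smoothTrace_smul (hD : IsTame D) {φ : E2 → ℝ} (hφ : ContDiff ℝ ∞ φ) (c : ℝ) :
    c • smoothTrace D φ = smoothTrace D (fun x => c * φ x) := by
  simp only [smoothTrace, Prod.smul_mk]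
  rw [l2cls_smul c (hD.memLp hφ.continuous), l2cls_smul c (hD.memLp_bdry hφ.continuous)]
  congr 2
  funext i
  rw [Pi.smul_apply, l2cls_smul c (hD.memLp (continuous_pderiv hφ i))]
  congr 1
  funext x
  simp only [pderiv]
  rw [fderiv_const_mul (hφ.differentiable (by simp) x)]; rfl

/-- The closure of the data of smooth functions. -/
def IsTraceData (D : Set E2) (x : TraceData D) : Prop :=
  x ∈ closure {x | ∃ φ, ContDiff ℝ ∞ φ ∧ smoothTrace D φ = x}

theorem isTraceData_smooth {φ : E2 → ℝ} (hφ : ContDiff ℝ ∞ φ) : IsTraceData D (smoothTrace D φ) :=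
  subset_closure ⟨φ, hφ, rfl⟩

theorem isClosed_isTraceData : IsClosed {x : TraceData D | IsTraceData D x} := isClosed_closure

theorem IsTraceData.induction {x : TraceData D} {P : TraceData D → Prop} (hx : IsTraceData D x)
    (hP : IsClosed {x | P x}) (h : ∀ φ, ContDiff ℝ ∞ φ → P (smoothTrace D φ)) : P x := by
  refine closure_minimal ?_ hP hx
  rintro _ ⟨a, ha, rfl⟩
  exact h a ha

/-- The submodule of functions in `H¹(D)` with traces. -/
def traceSub (hD : IsTame D) : Submodule ℝ (TraceData D) :=
  Submodule.topologicalClosure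
    { carrier := {x | ∃ φ, ContDiff ℝ ∞ φ ∧ smoothTrace D φ = x}
      add_mem' := by
        rintro _ _ ⟨a, ha, rfl⟩ ⟨b, hb, rfl⟩
        exact ⟨_, ha.add hb, (smoothTrace_add hD ha hb).symm⟩
      zero_mem' := by
        refine ⟨fun _ => 0 * 0, contDiff_const, ?_⟩
        rw [← smoothTrace_smul hD (φ := fun _ => 0) contDiff_const, zero_smul]
      smul_mem' := by
        rintro c _ ⟨a, ha, rfl⟩
        exact ⟨_, contDiff_const.mul ha, (smoothTrace_smul hD ha c).symm⟩ }

/-- The three limits in `HasTrace` amount to one limit in a product of L² spaces, so having a trace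
becomes membership in a closed subspace of a Banach space. -/
theorem hasTrace_iff (hD : IsTame D) {w : E2 → ℝ} {dw : Fin 2 → E2 → ℝ} {g : E2 → ℝ}
    (hw : MemLp w 2 (volume.restrict D)) (hdw : ∀ i, MemLp (dw i) 2 (volume.restrict D))
    (hg : MemLp g 2 (bdryMeasure D)) :
    HasTrace D w dw g ↔ IsTraceData D (l2cls _ w, fun i => l2cls _ (dw i), l2cls _ g) := by
  rw [IsTraceData, mem_closure_iff_seq_limit]
  constructor
  · rintro ⟨-, φ, hφ, h1, h2, h3⟩
    refine ⟨fun n => smoothTrace D (φ n), fun n => ⟨φ n, hφ n, rfl⟩, ?_⟩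
    refine Tendsto.prodMk_nhds ?_ (Tendsto.prodMk_nhds (tendsto_pi_nhds.2 fun i => ?_) ?_)
    · exact (tendsto_l2cls_iff (fun n => hD.memLp (hφ n).continuous) hw).2 h1
    · exact (tendsto_l2cls_iff (fun n => hD.memLp (continuous_pderiv (hφ n) i)) (hdw i)).2 (h2 i)
    · exact (tendsto_l2cls_iff (fun n => hD.memLp_bdry (hφ n).continuous) hg).2 h3
  · rintro ⟨x, hx, hlim⟩
    choose φ hφ hφx using hx
    obtain rfl : (fun n => smoothTrace D (φ n)) = x := funext hφx
    refine ⟨hg, φ, hφ, ?_, fun i => ?_, ?_⟩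
    · exact (tendsto_l2cls_iff (fun n => hD.memLp (hφ n).continuous) hw).1
        ((continuous_fst.tendsto _).comp hlim)
    · exact (tendsto_l2cls_iff (fun n => hD.memLp (continuous_pderiv (hφ n) i)) (hdw i)).1
        ((((continuous_apply i).comp (continuous_fst.comp continuous_snd)).tendsto _).comp hlim)
    · exact (tendsto_l2cls_iff (fun n => hD.memLp_bdry (hφ n).continuous) hg).1
        (((continuous_snd.comp continuous_snd).tendsto _).comp hlim)

theorem setIntegral_eq_integral_of_tsupport {f : E2 → ℝ} (h : tsupport f ⊆ D) :
    ∫ x in D, f x = ∫ x, f x := by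
  refine setIntegral_eq_integral_of_forall_compl_eq_zero fun x hx => ?_
  by_contra h0
  exact hx (h (subset_tsupport _ h0))

theorem integral_mul_pderiv {φ ψ : E2 → ℝ} (hφ : ContDiff ℝ ∞ φ) (hψ : ContDiff ℝ ∞ ψ)
    (hc : HasCompactSupport ψ) (hs : tsupport ψ ⊆ D) (i : Fin 2) :
    ∫ x in D, φ x * pderiv i ψ x = -∫ x in D, pderiv i φ x * ψ x := by
  have hs' : tsupport (pderiv i ψ) ⊆ tsupport ψ :=
    (tsupport_fderiv_apply_subset ℝ _)
  have hc' : HasCompactSupport (pderiv i ψ) := hc.fderiv_apply ℝ _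
  rw [setIntegral_eq_integral_of_tsupport
      (f := fun x => φ x * pderiv i ψ x) ((tsupport_mul_subset_right).trans (hs'.trans hs)),
    setIntegral_eq_integral_of_tsupport
      (f := fun x => pderiv i φ x * ψ x) ((tsupport_mul_subset_right).trans hs)]
  refine integral_mul_fderiv_eq_neg_fderiv_mul_of_integrable ?_ ?_ ?_
    (fun x _ => hφ.differentiable (by simp) x) (fun x _ => hψ.differentiable (by simp) x)
  · exact ((continuous_pderiv hφ i).mul hψ.continuous).integrable_of_hasCompactSupport
      hc.mul_left
  · exact (hφ.continuous.mul (continuous_pderiv hψ i)).integrable_of_hasCompactSupport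
      hc'.mul_left
  · exact (hφ.continuous.mul hψ.continuous).integrable_of_hasCompactSupport hc.mul_left

/-- Tested against a fixed function, integration by parts is a closed condition, and it holds for
smooth functions. Hence every element of the closure yields an honest Sobolev function. -/
theorem IsTraceData.isWeakPartial (hD : IsTame D) {x : TraceData D} (hx : IsTraceData D x)
    (i : Fin 2) : IsWeakPartial D i x.1 (x.2.1 i) := by
  intro ψ hψ hc hs
  have key : inner ℝ x.1 (l2cls _ (pderiv i ψ)) = -(inner ℝ (x.2.1 i) (l2cls _ ψ) : ℝ) := by
    refine hx.induction (P := fun x : TraceData D =>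
      inner ℝ x.1 (l2cls _ (pderiv i ψ)) = -(inner ℝ (x.2.1 i) (l2cls _ ψ) : ℝ))
      (isClosed_eq (by fun_prop) (by fun_prop)) fun φ hφ => ?_
    simp only [smoothTrace]
    rw [inner_l2cls (hD.memLp hφ.continuous) (hD.memLp (continuous_pderiv hψ i)),
      inner_l2cls (hD.memLp (continuous_pderiv hφ i)) (hD.memLp hψ.continuous)]
    exact integral_mul_pderiv hφ hψ hc hs i
  rw [inner_eq_integral, inner_eq_integral] at key
  have h1 : ∫ y in D, x.1 y * pderiv i ψ y = ∫ y in D, x.1 y * l2cls (volume.restrict D) (pderiv i ψ) y := by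
    refine integral_congr_ae ?_
    filter_upwards [coeFn_l2cls (hD.memLp (continuous_pderiv hψ i))] with y hy
    rw [hy]
  have h2 : ∫ y in D, x.2.1 i y * ψ y = ∫ y in D, x.2.1 i y * l2cls (volume.restrict D) ψ y := by
    refine integral_congr_ae ?_
    filter_upwards [coeFn_l2cls (hD.memLp hψ.continuous)] with y hy
    rw [hy]
  rw [h1, h2, key]

/-- Functions in `H²(D)` with the traces of the function and of its gradient. -/
structure IsH2Data (D : Set E2) (v : H2Data D) : Prop where
  fst : IsTraceData D v.1
  snd : ∀ i, IsTraceData D (v.2 i)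
  eq : ∀ i, (v.2 i).1 = v.1.2.1 i

/-- The space of functions in `H²(D)` with traces. -/
def h2Sub (hD : IsTame D) : Submodule ℝ (H2Data D) where
  carrier := {v | IsH2Data D v}
  add_mem' := by
    intro v w hv hw
    refine ⟨(traceSub hD).add_mem hv.fst hw.fst, fun i => (traceSub hD).add_mem (hv.snd i) (hw.snd i),
      fun i => ?_⟩
    simp [hv.eq, hw.eq]
  zero_mem' := ⟨(traceSub hD).zero_mem, fun _ => (traceSub hD).zero_mem, fun _ => rfl⟩
  smul_mem' := by
    intro c v hv
    refine ⟨(traceSub hD).smul_mem c hv.fst, fun i => (traceSub hD).smul_mem c (hv.snd i),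
      fun i => ?_⟩
    simp [hv.eq]

theorem isClosed_h2Sub (hD : IsTame D) : IsClosed (h2Sub hD : Set (H2Data D)) := by
  have h1 : (h2Sub hD : Set (H2Data D)) = {v | IsTraceData D v.1} ∩
      ((⋂ i, {v | IsTraceData D (v.2 i)}) ∩ ⋂ i, {v | (v.2 i).1 = v.1.2.1 i}) := by
    ext v
    simp only [mem_inter_iff, mem_iInter]
    exact ⟨fun h => ⟨h.fst, h.snd, h.eq⟩, fun h => ⟨h.1, h.2.1, h.2.2⟩⟩
  rw [h1]
  refine (isClosed_isTraceData.preimage continuous_fst).inter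
    ((isClosed_iInter fun i => isClosed_isTraceData.preimage (by fun_prop)).inter
      (isClosed_iInter fun i => isClosed_eq (by fun_prop) (by fun_prop)))

/-- The data of a smooth function. -/
def smoothH2 (D : Set E2) (φ : E2 → ℝ) : H2Data D :=
  (smoothTrace D φ, fun i => smoothTrace D (pderiv i φ))

theorem isH2Data_smooth {φ : E2 → ℝ} (hφ : ContDiff ℝ ∞ φ) : IsH2Data D (smoothH2 D φ) :=
  ⟨isTraceData_smooth hφ, fun i => isTraceData_smooth (contDiff_pderiv hφ i), fun _ => rfl⟩

/-- Weak second derivatives are symmetric. -/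
theorem IsH2Data.hess_symm (hD : IsTame D) {v : H2Data D} (hv : IsH2Data D v) (i j : Fin 2) :
    (v.2 i).2.1 j = (v.2 j).2.1 i := by
  -- Both derivatives are moved onto the test function, where they commute.
  have key : ∀ (k l : Fin 2) (ψ : E2 → ℝ), ContDiff ℝ ∞ ψ → HasCompactSupport ψ → tsupport ψ ⊆ D →
      ∫ x in D, (v.2 k).2.1 l x * ψ x = ∫ x in D, v.1.1 x * pderiv k (pderiv l ψ) x := by
    intro k l ψ hψ hc hs
    have h1 := (hv.snd k).isWeakPartial hD l ψ hψ hc hs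
    have h2 := hv.fst.isWeakPartial hD k (pderiv l ψ) (contDiff_pderiv hψ l)
      (hc.fderiv_apply ℝ _) ((tsupport_fderiv_apply_subset ℝ _).trans hs)
    rw [hv.eq k] at h1
    linarith
  have h3 := hD.isOpen.ae_eq_zero_of_integral_contDiff_smul_eq_zero (μ := volume.restrict D)
    (f := ⇑((v.2 i).2.1 j - (v.2 j).2.1 i)) ?_ ?_
  · rw [← sub_eq_zero]
    refine Lp.ext ?_
    filter_upwards [h3, ae_restrict_mem hD.isOpen.measurableSet, Lp.coeFn_zero ℝ 2 _]
      with x hx hxD h0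
    rw [hx hxD, h0]; rfl
  · exact ((Lp.memLp _).locallyIntegrable (by norm_num)).locallyIntegrableOn _
  · intro ψ hψ hc hs
    have hmem : MemLp ψ 2 (volume.restrict D) := hD.memLp hψ.continuous
    have h4 : ∫ x in D, ψ x • ((v.2 i).2.1 j - (v.2 j).2.1 i) x =
        ∫ x in D, ((v.2 i).2.1 j x * ψ x - (v.2 j).2.1 i x * ψ x) := by
      refine integral_congr_ae ?_
      filter_upwards [Lp.coeFn_sub ((v.2 i).2.1 j) ((v.2 j).2.1 i)] with x hx
      rw [hx, Pi.sub_apply, smul_eq_mul]; ring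
    rw [h4, integral_sub (f := fun x => (v.2 i).2.1 j x * ψ x) (g := fun x => (v.2 j).2.1 i x * ψ x)
        ((Lp.memLp _).integrable_mul hmem) ((Lp.memLp _).integrable_mul hmem),
      key i j ψ hψ hc hs, key j i ψ hψ hc hs]
    simp_rw [pderiv_pderiv_comm hψ i j]
    exact sub_self _

/-- The `H²` function underlying the data. -/
def IsH2Data.toH2 (hD : IsTame D) {v : H2Data D} (hv : IsH2Data D v) : H2 D where
  val := v.1.1
  grad i := v.1.2.1 i
  hess i j := (v.2 i).2.1 j
  memLp_val := Lp.memLp _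
  memLp_grad _ := Lp.memLp _
  memLp_hess _ _ := Lp.memLp _
  weak_grad := hv.fst.isWeakPartial hD
  weak_hess i j := by
    have := (hv.snd i).isWeakPartial hD j
    rwa [hv.eq i] at this

theorem IsH2Data.hasBoundaryValues (hD : IsTame D) {v : H2Data D} (hv : IsH2Data D v) :
    HasBoundaryValues D (hv.toH2 hD) v.1.2.2
      (fun x => ∑ i, (v.2 i).2.2 x * outerNormal D x i) := by
  refine ⟨(hasTrace_iff hD (Lp.memLp _) (fun i => Lp.memLp _) (Lp.memLp _)).2 ?_,
    fun i => (v.2 i).2.2, fun i =>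
    (hasTrace_iff hD (Lp.memLp _) (fun i => Lp.memLp _) (Lp.memLp _)).2 ?_, EventuallyEq.rfl⟩
  · simp only [l2cls_coeFn]
    exact hv.fst
  · simp only [l2cls_coeFn, ← hv.eq]
    exact hv.snd i

/-- The data of an `H²` function with given boundary values. -/
theorem exists_isH2Data (hD : IsTame D) {u : H2 D} {u₀ u₁ : E2 → ℝ}
    (h : HasBoundaryValues D u u₀ u₁) :
    ∃ v : H2Data D, IsH2Data D v ∧ (∀ i j, (v.2 i).2.1 j =ᵐ[volume.restrict D] u.hess i j) ∧
      v.1.2.2 =ᵐ[bdryMeasure D] u₀ ∧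
      (fun x => ∑ i, (v.2 i).2.2 x * outerNormal D x i) =ᵐ[bdryMeasure D] u₁ := by
  obtain ⟨h0, t, ht, h1⟩ := h
  refine ⟨((l2cls _ u.val, fun i => l2cls _ (u.grad i), l2cls _ u₀),
    fun i => (l2cls _ (u.grad i), fun j => l2cls _ (u.hess i j), l2cls _ (t i))),
    ⟨(hasTrace_iff hD u.memLp_val u.memLp_grad h0.1).1 h0,
      fun i => (hasTrace_iff hD (u.memLp_grad i) (u.memLp_hess i) (ht i).1).1 (ht i),
      fun _ => rfl⟩, fun i j => coeFn_l2cls (u.memLp_hess i j), coeFn_l2cls h0.1, ?_⟩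
  have h2 : ∀ᵐ x ∂(bdryMeasure D), ∀ i, l2cls _ (t i) x = t i x :=
    ae_all_iff.2 fun i => coeFn_l2cls (ht i).1
  filter_upwards [h2, h1] with x hx hx1
  rw [hx1]
  exact Finset.sum_congr rfl fun i _ => by rw [hx i]

end Tame

/-! ### Transfer to the reference strip -/

theorem IsWComp.op_l2cls {α β : Type*} [MeasurableSpace α] [MeasurableSpace β] {ν : Measure α}
    {ν' : Measure β} {Φ : β → α} {w : β → ℝ} {C : ℝ} (h : IsWComp ν ν' Φ w C) {f : α → ℝ}
    (hf : MemLp f 2 ν) : h.op (l2cls ν f) = l2cls ν' (fun y => w y * f (Φ y)) := by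
  rw [l2cls_eq hf, h.op_toLp hf, l2cls_eq]

theorem le_smul_withDensity {α : Type*} [MeasurableSpace α] {ν : Measure α} {g : α → ℝ} {c : ℝ}
    (hc : 0 < c) (hg : ∀ᵐ x ∂ν, c ≤ g x) :
    ν ≤ ENNReal.ofReal c⁻¹ • ν.withDensity fun x => ENNReal.ofReal (g x) := by
  rw [← withDensity_smul' _ _ ENNReal.ofReal_ne_top]
  conv_lhs => rw [← withDensity_one (μ := ν)]
  refine withDensity_mono ?_
  filter_upwards [hg] with x hx
  rw [Pi.one_apply, Pi.smul_apply, smul_eq_mul, ← ENNReal.ofReal_mul (by positivity),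
    ENNReal.one_le_ofReal, inv_mul_eq_div, one_le_div hc]
  exact hx

theorem integral_withDensity_ofReal {α : Type*} [MeasurableSpace α] {ν : Measure α} {g : α → ℝ}
    (hg : Measurable g) (h0 : ∀ᵐ x ∂ν, 0 ≤ g x) (f : α → ℝ) :
    ∫ x, f x ∂(ν.withDensity fun x => ENNReal.ofReal (g x)) = ∫ x, g x * f x ∂ν := by
  rw [integral_withDensity_eq_integral_toReal_smul hg.ennreal_ofReal
    (Eventually.of_forall fun _ => ENNReal.ofReal_lt_top)]
  refine integral_congr_ae ?_
  filter_upwards [h0] with x hx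
  rw [ENNReal.toReal_ofReal hx, smul_eq_mul]

/-! ### Components of vector and matrix fields with respect to a frame -/

section Frames

variable {L : ℝ}

/-- The component in direction `a` of a vector field on the strip. -/
def linQ (a : ℝ → E2) (x : Fin 2 → LQ L) : LQ L := ∑ i, mulOp (muQ L) (fun p => a p.1 i) (x i)

/-- The component in direction `a` of a vector field on the interval. -/
def linI (a : ℝ → E2) (x : Fin 2 → LI L) : LI L := ∑ i, mulOp (muI L) (fun s => a s i) (x i)

/-- The `(a, b)` component of a matrix field on the strip. -/
def quadQ (a b : ℝ → E2) (x : Fin 2 → Fin 2 → LQ L) : LQ L := linQ a fun i => linQ b (x i)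

theorem isBddWeight_coordQ {a : ℝ → E2} (ha : Continuous a) (i : Fin 2) :
    IsBddWeight (muQ L) (fun p => a p.1 i) := isBddWeight_Q (by fun_prop)

theorem isBddWeight_coordI {a : ℝ → E2} (ha : Continuous a) (i : Fin 2) :
    IsBddWeight (muI L) (fun s => a s i) := isBddWeight_I (by fun_prop)

theorem coeFn_linQ {a : ℝ → E2} (ha : Continuous a) (x : Fin 2 → LQ L) :
    linQ a x =ᵐ[muQ L] fun p => a p.1 0 * x 0 p + a p.1 1 * x 1 p := by
  rw [linQ, Fin.sum_univ_two]
  filter_upwards [Lp.coeFn_add (mulOp (muQ L) (fun p => a p.1 0) (x 0))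
    (mulOp (muQ L) (fun p => a p.1 1) (x 1)), coeFn_mulOp (isBddWeight_coordQ ha 0) (x 0),
    coeFn_mulOp (isBddWeight_coordQ ha 1) (x 1)] with p h1 h2 h3
  rw [h1, Pi.add_apply, h2, h3]

theorem coeFn_linI {a : ℝ → E2} (ha : Continuous a) (x : Fin 2 → LI L) :
    linI a x =ᵐ[muI L] fun p => a p 0 * x 0 p + a p 1 * x 1 p := by
  rw [linI, Fin.sum_univ_two]
  filter_upwards [Lp.coeFn_add (mulOp (muI L) (fun p => a p 0) (x 0))
    (mulOp (muI L) (fun p => a p 1) (x 1)), coeFn_mulOp (isBddWeight_coordI ha 0) (x 0),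
    coeFn_mulOp (isBddWeight_coordI ha 1) (x 1)] with p h1 h2 h3
  rw [h1, Pi.add_apply, h2, h3]

theorem coeFn_quadQ {a b : ℝ → E2} (ha : Continuous a) (hb : Continuous b)
    (x : Fin 2 → Fin 2 → LQ L) :
    quadQ a b x =ᵐ[muQ L] fun p => a p.1 0 * (b p.1 0 * x 0 0 p + b p.1 1 * x 0 1 p) +
      a p.1 1 * (b p.1 0 * x 1 0 p + b p.1 1 * x 1 1 p) := by
  filter_upwards [coeFn_linQ ha fun i => linQ b (x i), coeFn_linQ hb (x 0), coeFn_linQ hb (x 1)]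
    with p h1 h2 h3
  rw [quadQ, h1, h2, h3]

theorem linQ_l2cls {a : ℝ → E2} (ha : Continuous a) {x : Fin 2 → ℝ × ℝ → ℝ}
    (hx : ∀ i, Continuous (x i)) :
    linQ a (fun i => l2cls (muQ L) (x i)) =
      l2cls (muQ L) fun p => a p.1 0 * x 0 p + a p.1 1 * x 1 p := by
  refine eq_l2cls ?_
  filter_upwards [coeFn_linQ ha fun i => l2cls (muQ L) (x i), coeFn_l2cls (memLp_Q (hx 0)),
    coeFn_l2cls (memLp_Q (hx 1))] with p h1 h2 h3
  rw [h1, h2, h3]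

end Frames

/-! ### Pull-back from the tube to the strip and from its boundary to the interval -/

section Pull

variable {L ε : ℝ} {γ n : ℝ → E2} {κ : ℝ → ℝ} {D : Set E2}

theorem continuous_tubeJac (hκ : Continuous κ) : Continuous (tubeJac κ ε) := by
  unfold tubeJac; fun_prop

theorem IsTube.continuous_jac (hT : IsTube L γ n κ ε D) : Continuous (tubeJac κ ε) :=
  continuous_tubeJac hT.smooth_curvature.continuous

theorem IsTube.continuous_map (hT : IsTube L γ n κ ε D) : Continuous (tubeMap γ n ε) :=
  (contDiff_tubeMap hT.smooth_curve hT.smooth_normal).continuous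

theorem IsTube.exists_jac_ge (hT : IsTube L γ n κ ε D) :
    ∃ c > 0, ∀ p ∈ Icc 0 L ×ˢ Icc (0 : ℝ) 1, c ≤ tubeJac κ ε p := by
  obtain ⟨p, hp, hmin⟩ := (isCompact_Icc.prod isCompact_Icc).exists_isMinOn
    (s := Icc 0 L ×ˢ Icc (0 : ℝ) 1) ⟨(0, 0), ⟨⟨le_rfl, hT.L_pos.le⟩, ⟨le_rfl, zero_le_one⟩⟩⟩
    hT.continuous_jac.continuousOn
  exact ⟨tubeJac κ ε p, hT.jac_pos p.1 p.2 hp.2, fun q hq => hmin hq⟩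

theorem IsTube.ae_jac_nonneg (hT : IsTube L γ n κ ε D) : ∀ᵐ p ∂(muQ L), 0 ≤ tubeJac κ ε p := by
  filter_upwards [ae_muQ_mem L] with p hp
  exact (hT.jac_pos p.1 p.2 (Ioo_subset_Icc_self hp.2)).le

theorem IsTube.isTame (hT : IsTube L γ n κ ε D) : IsTame D := by
  refine ⟨hT.isOpen, hT.bounded, ?_⟩
  have hc : Continuous fun s => tubeMap γ n ε (s, 1) := hT.continuous_map.comp (by fun_prop)
  have hj : Continuous fun s => tubeJac κ ε (s, 1) := hT.continuous_jac.comp (by fun_prop)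
  rw [hT.bdry, Measure.add_apply, Measure.map_apply hT.smooth_curve.continuous.measurable
    MeasurableSet.univ, Measure.map_apply hc.measurable MeasurableSet.univ, preimage_univ,
    preimage_univ, withDensity_apply _ MeasurableSet.univ, Measure.restrict_univ]
  exact ENNReal.add_ne_top.2 ⟨measure_ne_top _ _,
    (integrable_I hj).lintegral_lt_top.ne⟩

/-- Composition with the tube coordinates. -/
theorem IsTube.exists_pull (hT : IsTube L γ n κ ε D) :
    ∃ C, IsWComp (volume.restrict D) (muQ L) (tubeMap γ n ε) (fun _ => 1) C := by
  obtain ⟨c, hc, h⟩ := hT.exists_jac_ge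
  have hεc : 0 < ε * c := mul_pos hT.eps_pos hc
  refine ⟨1 * Real.sqrt (ε * c)⁻¹, IsWComp.of_map_le hT.continuous_map.measurable measurable_const
    zero_le_one (Real.sqrt_nonneg _) (by simp) ?_⟩
  rw [Real.sq_sqrt (by positivity), ← hT.area, ← Measure.map_smul]
  refine Measure.map_mono (le_smul_withDensity hεc ?_) hT.continuous_map.measurable
  filter_upwards [ae_muQ_mem L] with p hp
  exact mul_le_mul_of_nonneg_left
    (h p ⟨Ioo_subset_Icc_self hp.1, Ioo_subset_Icc_self hp.2⟩) hT.eps_pos.le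

/-- Composition with the outer boundary curve. -/
theorem IsTube.exists_pull_outer (hT : IsTube L γ n κ ε D) :
    ∃ C, IsWComp (bdryMeasure D) (muI L) γ (fun _ => 1) C := by
  refine ⟨1 * 1, IsWComp.of_map_le hT.smooth_curve.continuous.measurable measurable_const
    zero_le_one zero_le_one (by simp) ?_⟩
  rw [hT.bdry]
  simp only [one_pow, ENNReal.ofReal_one, one_smul]
  exact Measure.le_add_right le_rfl

/-- Composition with the inner boundary curve. -/
theorem IsTube.exists_pull_inner (hT : IsTube L γ n κ ε D) :
    ∃ C, IsWComp (bdryMeasure D) (muI L) (fun s => tubeMap γ n ε (s, 1)) (fun _ => 1) C := by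
  obtain ⟨c, hc, h⟩ := hT.exists_jac_ge
  have hcm : Continuous fun s => tubeMap γ n ε (s, 1) := hT.continuous_map.comp (by fun_prop)
  refine ⟨1 * Real.sqrt c⁻¹, IsWComp.of_map_le hcm.measurable measurable_const
    zero_le_one (Real.sqrt_nonneg _) (by simp) ?_⟩
  rw [Real.sq_sqrt (by positivity), hT.bdry, smul_add]
  refine le_trans ?_ (Measure.le_add_left le_rfl)
  rw [← Measure.map_smul]
  refine Measure.map_mono (le_smul_withDensity hc ?_) hcm.measurable
  filter_upwards [ae_restrict_mem measurableSet_Ioo] with s hs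
  exact h (s, 1) ⟨Ioo_subset_Icc_self hs, right_mem_Icc.2 zero_le_one⟩

/-- Pull-back of functions on the tube. -/
def IsTube.pull (hT : IsTube L γ n κ ε D) : LD D →L[ℝ] LQ L := hT.exists_pull.choose_spec.op

/-- Pull-back of functions on the boundary to the outer curve. -/
def IsTube.pullO (hT : IsTube L γ n κ ε D) : LB D →L[ℝ] LI L :=
  hT.exists_pull_outer.choose_spec.op

/-- Pull-back of functions on the boundary to the inner curve. -/
def IsTube.pullN (hT : IsTube L γ n κ ε D) : LB D →L[ℝ] LI L :=
  hT.exists_pull_inner.choose_spec.op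

theorem IsTube.coeFn_pull (hT : IsTube L γ n κ ε D) (f : LD D) :
    hT.pull f =ᵐ[muQ L] fun p => f (tubeMap γ n ε p) := by
  filter_upwards [hT.exists_pull.choose_spec.coeFn_op f] with p hp
  rw [IsTube.pull, hp, one_mul]

theorem IsTube.coeFn_pullO (hT : IsTube L γ n κ ε D) (f : LB D) :
    hT.pullO f =ᵐ[muI L] fun s => f (γ s) := by
  filter_upwards [hT.exists_pull_outer.choose_spec.coeFn_op f] with p hp
  rw [IsTube.pullO, hp, one_mul]

theorem IsTube.coeFn_pullN (hT : IsTube L γ n κ ε D) (f : LB D) :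
    hT.pullN f =ᵐ[muI L] fun s => f (tubeMap γ n ε (s, 1)) := by
  filter_upwards [hT.exists_pull_inner.choose_spec.coeFn_op f] with p hp
  rw [IsTube.pullN, hp, one_mul]

theorem IsTube.pull_l2cls (hT : IsTube L γ n κ ε D) {f : E2 → ℝ} (hf : Continuous f) :
    hT.pull (l2cls _ f) = l2cls (muQ L) fun p => f (tubeMap γ n ε p) := by
  rw [IsTube.pull, IsWComp.op_l2cls _ (hT.isTame.memLp hf)]
  simp only [one_mul]

theorem IsTube.pullO_l2cls (hT : IsTube L γ n κ ε D) {f : E2 → ℝ} (hf : Continuous f) :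
    hT.pullO (l2cls _ f) = l2cls (muI L) fun s => f (γ s) := by
  rw [IsTube.pullO, IsWComp.op_l2cls _ (hT.isTame.memLp_bdry hf)]
  simp only [one_mul]

theorem IsTube.pullN_l2cls (hT : IsTube L γ n κ ε D) {f : E2 → ℝ} (hf : Continuous f) :
    hT.pullN (l2cls _ f) = l2cls (muI L) fun s => f (tubeMap γ n ε (s, 1)) := by
  rw [IsTube.pullN, IsWComp.op_l2cls _ (hT.isTame.memLp_bdry hf)]
  simp only [one_mul]

/-- The weight of the inner boundary curve. -/
def innerJac (κ : ℝ → ℝ) (ε s : ℝ) : ℝ := tubeJac κ ε (s, 1)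

theorem IsTube.continuous_innerJac (hT : IsTube L γ n κ ε D) : Continuous (innerJac κ ε) :=
  hT.continuous_jac.comp (by fun_prop)

/-- The area formula dx = εJ ds dt. -/
theorem IsTube.inner_eq (hT : IsTube L γ n κ ε D) (f g : LD D) :
    inner ℝ f g = ε * inner ℝ (mulOp (muQ L) (tubeJac κ ε) (hT.pull f)) (hT.pull g) := by
  have hm : Measurable (tubeMap γ n ε) := hT.continuous_map.measurable
  rw [inner_eq_integral, inner_eq_integral, ← integral_const_mul]
  have h1 : AEStronglyMeasurable (fun x => f x * g x) (volume.restrict D) :=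
    (Lp.aestronglyMeasurable f).mul (Lp.aestronglyMeasurable g)
  have h2 : ∫ x, f x * g x ∂(volume.restrict D) = ∫ x, f x * g x ∂(Measure.map (tubeMap γ n ε)
      ((muQ L).withDensity fun p => ENNReal.ofReal (ε * tubeJac κ ε p))) := by rw [hT.area]
  rw [h2, integral_map hm.aemeasurable (by rw [hT.area]; exact h1),
    integral_withDensity_ofReal (hT.continuous_jac.measurable.const_mul ε)]
  · refine integral_congr_ae ?_
    filter_upwards [hT.coeFn_pull f, hT.coeFn_pull g,
      coeFn_mulOp (isBddWeight_Q hT.continuous_jac) (hT.pull f)] with p h3 h4 h5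
    rw [h5, h3, h4]; ring
  · filter_upwards [hT.ae_jac_nonneg] with p hp
    exact mul_nonneg hT.eps_pos.le hp

/-- Integrals over the boundary of a tube. -/
theorem IsTube.integral_bdry (hT : IsTube L γ n κ ε D) {f : E2 → ℝ}
    (hf : Integrable f (bdryMeasure D)) :
    ∫ x, f x ∂(bdryMeasure D) = (∫ s, f (γ s) ∂(muI L)) +
      ∫ s, innerJac κ ε s * f (tubeMap γ n ε (s, 1)) ∂(muI L) := by
  have hm : Measurable fun s => tubeMap γ n ε (s, 1) :=
    (hT.continuous_map.comp (by fun_prop)).measurable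
  have hj : Continuous fun s => tubeJac κ ε (s, 1) := hT.continuous_jac.comp (by fun_prop)
  rw [hT.bdry] at hf ⊢
  have hf1 := hf.left_of_add_measure
  have hf2 := hf.right_of_add_measure
  rw [integral_add_measure hf1 hf2,
    integral_map hT.smooth_curve.continuous.measurable.aemeasurable hf1.1,
    integral_map hm.aemeasurable hf2.1, integral_withDensity_ofReal hj.measurable]
  · rfl
  · exact Eventually.of_forall fun s => (hT.jac_pos s 1 (right_mem_Icc.2 zero_le_one)).le

theorem IsTube.inner_bdry_eq (hT : IsTube L γ n κ ε D) (f g : LB D) :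
    inner ℝ f g = (inner ℝ (hT.pullO f) (hT.pullO g) : ℝ) +
      inner ℝ (mulOp (muI L) (innerJac κ ε) (hT.pullN f)) (hT.pullN g) := by
  rw [inner_eq_integral, inner_eq_integral, inner_eq_integral,
    hT.integral_bdry (f := fun x => f x * g x) ((Lp.memLp f).integrable_mul (Lp.memLp g))]
  congr 1
  · refine integral_congr_ae ?_
    filter_upwards [hT.coeFn_pullO f, hT.coeFn_pullO g] with s h1 h2
    rw [h1, h2]
  · refine integral_congr_ae ?_
    filter_upwards [hT.coeFn_pullN f, hT.coeFn_pullN g,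
      coeFn_mulOp (isBddWeight_I hT.continuous_innerJac) (hT.pullN f)] with s h1 h2 h3
    rw [h3, h1, h2, mul_assoc]

theorem fderiv_eq_sum_pderiv (φ : E2 → ℝ) (x v : E2) :
    fderiv ℝ φ x v = v 0 * pderiv 0 φ x + v 1 * pderiv 1 φ x := by
  have h1 : v = v 0 • EuclideanSpace.single 0 1 + v 1 • EuclideanSpace.single 1 1 := by
    ext i; fin_cases i <;> simp
  conv_lhs => rw [h1]
  rw [map_add, map_smul, map_smul]
  rfl

theorem IsTube.isSmoothPeriodic_comp (hT : IsTube L γ n κ ε D) {φ : E2 → ℝ}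
    (hφ : ContDiff ℝ ∞ φ) : IsSmoothPeriodic L fun p => φ (tubeMap γ n ε p) := by
  refine ⟨hφ.comp (contDiff_tubeMap hT.smooth_curve hT.smooth_normal), fun s t => ?_⟩
  have := tubeMap_add_int_mul (ε := ε) hT.periodic_curve hT.periodic_normal s t 1
  rw [Int.cast_one, one_mul] at this
  simp only [this]

theorem IsTube.dS_comp (hT : IsTube L γ n κ ε D) {φ : E2 → ℝ} (hφ : ContDiff ℝ ∞ φ)
    (p : ℝ × ℝ) : dS (fun p => φ (tubeMap γ n ε p)) p = tubeJac κ ε p *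
      (deriv γ p.1 0 * pderiv 0 φ (tubeMap γ n ε p) +
        deriv γ p.1 1 * pderiv 1 φ (tubeMap γ n ε p)) := by
  have h1 := ((hφ.differentiable (by simp) _).hasFDerivAt.comp p
    (hasFDerivAt_tubeMap (ε := ε) hT.smooth_curve hT.smooth_normal hT.deriv_normal p)).fderiv
  rw [dS]
  change (fderiv ℝ (φ ∘ tubeMap γ n ε) p) (1, 0) = _
  rw [h1, ContinuousLinearMap.comp_apply, tubeDeriv_apply, one_smul, zero_smul, sub_zero, map_smul,
    fderiv_eq_sum_pderiv, smul_eq_mul]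

theorem IsTube.dT_comp (hT : IsTube L γ n κ ε D) {φ : E2 → ℝ} (hφ : ContDiff ℝ ∞ φ)
    (p : ℝ × ℝ) : dT (fun p => φ (tubeMap γ n ε p)) p = (-ε) *
      (n p.1 0 * pderiv 0 φ (tubeMap γ n ε p) + n p.1 1 * pderiv 1 φ (tubeMap γ n ε p)) := by
  have h1 := ((hφ.differentiable (by simp) _).hasFDerivAt.comp p
    (hasFDerivAt_tubeMap (ε := ε) hT.smooth_curve hT.smooth_normal hT.deriv_normal p)).fderiv
  rw [dT]
  change (fderiv ℝ (φ ∘ tubeMap γ n ε) p) (0, 1) = _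
  rw [h1, ContinuousLinearMap.comp_apply, tubeDeriv_apply, one_smul, zero_smul, zero_sub, map_neg,
    map_smul, fderiv_eq_sum_pderiv, smul_eq_mul, neg_mul]

/-- A function with gradient and trace, in tube coordinates. -/
def IsTube.pullStrip (hT : IsTube L γ n κ ε D) (x : TraceData D) : StripData L :=
  (hT.pull x.1, mulOp (muQ L) (tubeJac κ ε) (linQ (deriv γ) fun i => hT.pull (x.2.1 i)),
    (-ε) • linQ n (fun i => hT.pull (x.2.1 i)), hT.pullO x.2.2, hT.pullN x.2.2)

theorem IsTube.continuous_deriv (hT : IsTube L γ n κ ε D) : Continuous (deriv γ) :=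
  hT.smooth_curve.continuous_deriv (by simp)

/-- For smooth functions this is the chain rule: the coordinate curves have velocities Jγ' and −εn.
Pull-back is continuous on the data, so the closure follows. -/
theorem IsTube.isStrip_pullStrip (hT : IsTube L γ n κ ε D) {x : TraceData D}
    (hx : IsTraceData D x) : IsStrip L (hT.pullStrip x) := by
  refine hx.induction (P := fun x => IsStrip L (hT.pullStrip x))
    (isClosed_isStrip.preimage ?_) fun φ hφ => ?_
  · unfold IsTube.pullStrip linQ
    fun_prop
  · have h1 := isStrip_smooth (hT.isSmoothPeriodic_comp hφ)
    have hc := hT.continuous_map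
    have hp := fun i => continuous_pderiv hφ i
    have hj := hT.continuous_jac
    have hd := hT.continuous_deriv
    have hn := hT.smooth_normal.continuous
    convert h1 using 1
    simp only [IsTube.pullStrip, smoothTrace, smoothStrip]
    rw [hT.pull_l2cls hφ.continuous, hT.pullO_l2cls hφ.continuous, hT.pullN_l2cls hφ.continuous]
    simp_rw [hT.pull_l2cls (hp _)]
    rw [linQ_l2cls hd (x := fun i p => pderiv i φ (tubeMap γ n ε p)) (fun i => (hp i).comp hc),
      linQ_l2cls hn (x := fun i p => pderiv i φ (tubeMap γ n ε p)) (fun i => (hp i).comp hc),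
      mulOp_l2cls (isBddWeight_Q hj) (memLp_Q (by fun_prop)),
      l2cls_smul _ (memLp_Q (by fun_prop))]
    congr 3
    · funext p; exact (hT.dS_comp hφ p).symm
    · congr 1; funext p; exact (hT.dT_comp hφ p).symm
    · congr 1; simp [tubeMap]

end Pull

/-! ### Second order Sobolev functions in tube coordinates -/

/-- A function on the strip with the components of its gradient and Hessian in the moving frame,
and boundary values: `W` is the function, `r`, `q` are the tangential and normal derivatives,
`a`, `b`, `c` are the tangential, mixed and normal second derivatives. -/
structure FlatField (L : ℝ) where
  W : LQ L
  r : LQ L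
  q : LQ L
  a : LQ L
  b : LQ L
  c : LQ L
  W₀ : LI L
  W₁ : LI L
  r₀ : LI L
  r₁ : LI L
  q₀ : LI L
  q₁ : LI L

/-- Multiplication by the Jacobian. -/
abbrev jacOp (L : ℝ) (κ : ℝ → ℝ) (ε : ℝ) : LQ L →L[ℝ] LQ L := mulOp (muQ L) (tubeJac κ ε)

/-- Multiplication by a function of the longitudinal variable. -/
abbrev fstOp (L : ℝ) (m : ℝ → ℝ) : LQ L →L[ℝ] LQ L := mulOp (muQ L) (fun p => m p.1)

/-- The compatibility relations between a function and its derivatives in the moving frame. -/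
structure IsFlatField {L : ℝ} (κ : ℝ → ℝ) (ε : ℝ) (F : FlatField L) : Prop where
  strip_W : IsStrip L (F.W, jacOp L κ ε F.r, (-ε) • F.q, F.W₀, F.W₁)
  strip_r : IsStrip L (F.r, jacOp L κ ε F.a - fstOp L κ F.q, (-ε) • F.b, F.r₀, F.r₁)
  strip_q : IsStrip L (F.q, jacOp L κ ε F.b + fstOp L κ F.r, (-ε) • F.c, F.q₀, F.q₁)

section Parseval

variable {α : Type*} [MeasurableSpace α] {ν : Measure α}

theorem integrable_mul_Lp (x y : Lp ℝ 2 ν) : Integrable (fun p => x p * y p) ν :=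
  (Lp.memLp x).integrable_mul (Lp.memLp y)

theorem inner_add_inner_eq {x y z w x' y' z' w' : Lp ℝ 2 ν}
    (h : ∀ᵐ p ∂ν, x p * y p + z p * w p = x' p * y' p + z' p * w' p) :
    inner ℝ x y + inner ℝ z w = (inner ℝ x' y' + inner ℝ z' w' : ℝ) := by
  simp only [inner_eq_integral]
  rw [← integral_add (integrable_mul_Lp x y) (integrable_mul_Lp z w),
    ← integral_add (integrable_mul_Lp x' y') (integrable_mul_Lp z' w')]
  exact integral_congr_ae h

/-- Parseval's identity for two coordinates. -/
theorem parseval_E2 {a b : E2} (ha : ‖a‖ = 1) (hb : ‖b‖ = 1) (hab : inner ℝ a b = (0 : ℝ))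
    (x₀ x₁ y₀ y₁ : ℝ) : x₀ * y₀ + x₁ * y₁ =
      (a 0 * x₀ + a 1 * x₁) * (a 0 * y₀ + a 1 * y₁) +
        (b 0 * x₀ + b 1 * x₁) * (b 0 * y₀ + b 1 * y₁) := by
  have h1 := eq_inner_smul_add ha hb hab (!₂[x₀, x₁])
  have h2 := congrArg (fun v => inner ℝ v (!₂[y₀, y₁])) h1
  simp only [inner_add_left, inner_smul_left, inner_E2] at h2
  simpa using h2

end Parseval

/-! ### Components in the moving frame, and the energy -/

section Flat

variable {L ε : ℝ} {γ n : ℝ → E2} {κ : ℝ → ℝ} {D : Set E2}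

theorem parsevalQ {a b : ℝ → E2} (ha : Continuous a) (hb : Continuous b) (ha1 : ∀ s, ‖a s‖ = 1)
    (hb1 : ∀ s, ‖b s‖ = 1) (hab : ∀ s, inner ℝ (a s) (b s) = (0 : ℝ)) (x y : Fin 2 → LQ L) :
    inner ℝ (x 0) (y 0) + inner ℝ (x 1) (y 1) =
      (inner ℝ (linQ a x) (linQ a y) + inner ℝ (linQ b x) (linQ b y) : ℝ) := by
  refine inner_add_inner_eq ?_
  filter_upwards [coeFn_linQ ha x, coeFn_linQ ha y, coeFn_linQ hb x, coeFn_linQ hb y]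
    with p h1 h2 h3 h4
  rw [h1, h2, h3, h4]
  exact parseval_E2 (ha1 _) (hb1 _) (hab _) _ _ _ _

theorem parsevalI {a b : ℝ → E2} (ha : Continuous a) (hb : Continuous b) (ha1 : ∀ s, ‖a s‖ = 1)
    (hb1 : ∀ s, ‖b s‖ = 1) (hab : ∀ s, inner ℝ (a s) (b s) = (0 : ℝ)) (x y : Fin 2 → LI L) :
    inner ℝ (x 0) (y 0) + inner ℝ (x 1) (y 1) =
      (inner ℝ (linI a x) (linI a y) + inner ℝ (linI b x) (linI b y) : ℝ) := by
  refine inner_add_inner_eq ?_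
  filter_upwards [coeFn_linI ha x, coeFn_linI ha y, coeFn_linI hb x, coeFn_linI hb y]
    with p h1 h2 h3 h4
  rw [h1, h2, h3, h4]
  exact parseval_E2 (ha1 _) (hb1 _) (hab _) _ _ _ _

theorem linQ_mulOp {a : ℝ → E2} (ha : Continuous a) {w : ℝ × ℝ → ℝ} (hw : Continuous w)
    (x : Fin 2 → LQ L) :
    linQ a (fun i => mulOp (muQ L) w (x i)) = mulOp (muQ L) w (linQ a x) := by
  refine Lp.ext ?_
  filter_upwards [coeFn_linQ ha x, coeFn_linQ ha fun i => mulOp (muQ L) w (x i),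
    coeFn_mulOp (isBddWeight_Q hw) (linQ a x), coeFn_mulOp (isBddWeight_Q hw) (x 0),
    coeFn_mulOp (isBddWeight_Q hw) (x 1)] with p h1 h2 h3 h4 h5
  rw [h2, h3, h1, h4, h5]; ring

theorem linQ_smul_left {a : ℝ → E2} (ha : Continuous a) {m : ℝ → ℝ} (hm : Continuous m)
    (x : Fin 2 → LQ L) : linQ (fun s => m s • a s) x = fstOp L m (linQ a x) := by
  refine Lp.ext ?_
  filter_upwards [coeFn_linQ ha x, coeFn_linQ (a := fun s => m s • a s) (by fun_prop) x,
    coeFn_mulOp (isBddWeight_Q (L := L) (f := fun p => m p.1) (by fun_prop)) (linQ a x)]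
    with p h1 h2 h3
  rw [h2, h3, h1]
  simp only [PiLp.smul_apply, smul_eq_mul]; ring

/-- The scalar product of a vector field with a smooth periodic frame vector. -/
theorem IsTube.isStrip_comb (hT : IsTube L γ n κ ε D) {v : H2Data D} (hv : IsH2Data D v)
    {a : ℝ → E2} (ha : ContDiff ℝ ∞ a) (hp : Function.Periodic a L) :
    IsStrip L (linQ a (fun i => hT.pull (v.1.2.1 i)),
      linQ (deriv a) (fun i => hT.pull (v.1.2.1 i)) +
        jacOp L κ ε (quadQ a (deriv γ) fun i j => hT.pull ((v.2 i).2.1 j)),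
      (-ε) • quadQ a n (fun i j => hT.pull ((v.2 i).2.1 j)),
      linI a (fun i => hT.pullO (v.2 i).2.2), linI a (fun i => hT.pullN (v.2 i).2.2)) := by
  have hai : ∀ i : Fin 2, ContDiff ℝ ∞ fun s => a s i := fun i => by fun_prop
  have hdi : ∀ (i : Fin 2) s, deriv (fun s => a s i) s = deriv a s i := fun i s => by
    have h1 := (ha.differentiable (by simp) s).hasDerivAt
    exact ((EuclideanSpace.proj i : E2 →L[ℝ] ℝ).hasFDerivAt.comp_hasDerivAt s h1).deriv
  have hm : ∀ i : Fin 2, IsSmoothPeriodic L (fun p => a p.1 i) := fun i =>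
    isSmoothPeriodic_fst (hai i) fun s => by simp only [hp s]
  have hmul : ∀ i : Fin 2, mulStrip L (fun p => a p.1 i) (hT.pullStrip (v.2 i)) =
      (mulOp (muQ L) (fun p => a p.1 i) (hT.pull (v.1.2.1 i)),
        mulOp (muQ L) (fun p => deriv a p.1 i) (hT.pull (v.1.2.1 i)) +
          mulOp (muQ L) (fun p => a p.1 i) (jacOp L κ ε
            (linQ (deriv γ) fun j => hT.pull ((v.2 i).2.1 j))),
        (-ε) • mulOp (muQ L) (fun p => a p.1 i) (linQ n fun j => hT.pull ((v.2 i).2.1 j)),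
        mulOp (muI L) (fun s => a s i) (hT.pullO (v.2 i).2.2),
        mulOp (muI L) (fun s => a s i) (hT.pullN (v.2 i).2.2)) := by
    intro i
    have h1 : dS (fun p : ℝ × ℝ => a p.1 i) = fun p => deriv a p.1 i := by
      funext p; rw [dS_fst (hai i), hdi]
    have h2 : dT (fun p : ℝ × ℝ => a p.1 i) = fun p => 0 := by
      funext p; rw [dT_fst (hai i)]
    have h3 : mulOp (muQ L) (fun _ => (0 : ℝ)) (hT.pull (v.1.2.1 i)) = 0 := by
      refine Lp.ext ?_
      filter_upwards [coeFn_mulOp (isBddWeight_Q (L := L) (f := fun _ => (0 : ℝ)) (by fun_prop))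
        (hT.pull (v.1.2.1 i)), Lp.coeFn_zero ℝ 2 (muQ L)] with p h3 h4
      rw [h3, h4]; simp
    simp only [mulStrip, IsTube.pullStrip, h1, h2, hv.eq, h3, zero_add, map_smul]
  -- The component along `a` is the sum of the coordinates of `a` times the partial derivatives. By
  -- the product rule its s-derivative contains the gradient along a' besides the Hessian; since the
  -- frame does not depend on t, its t-derivative contains the Hessian only.
  have h := ((hT.isStrip_pullStrip (hv.snd 0)).mul (hm 0)).add
    ((hT.isStrip_pullStrip (hv.snd 1)).mul (hm 1))
  rw [hmul, hmul] at h
  convert h using 1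
  simp only [Prod.mk_add_mk, ← smul_add, quadQ]
  rw [← linQ_mulOp ha.continuous hT.continuous_jac]
  simp only [linQ, linI, Fin.sum_univ_two]
  congr 2
  abel

/-- An `H²` function in tube coordinates. -/
def IsTube.flat (hT : IsTube L γ n κ ε D) (v : H2Data D) : FlatField L where
  W := hT.pull v.1.1
  r := linQ (deriv γ) fun i => hT.pull (v.1.2.1 i)
  q := linQ n fun i => hT.pull (v.1.2.1 i)
  a := quadQ (deriv γ) (deriv γ) fun i j => hT.pull ((v.2 i).2.1 j)
  b := quadQ (deriv γ) n fun i j => hT.pull ((v.2 i).2.1 j)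
  c := quadQ n n fun i j => hT.pull ((v.2 i).2.1 j)
  W₀ := hT.pullO v.1.2.2
  W₁ := hT.pullN v.1.2.2
  r₀ := linI (deriv γ) fun i => hT.pullO (v.2 i).2.2
  r₁ := linI (deriv γ) fun i => hT.pullN (v.2 i).2.2
  q₀ := linI n fun i => hT.pullO (v.2 i).2.2
  q₁ := linI n fun i => hT.pullN (v.2 i).2.2

theorem IsTube.contDiff_deriv (hT : IsTube L γ n κ ε D) : ContDiff ℝ ∞ (deriv γ) := by
  have := hT.smooth_curve
  fun_prop

theorem IsTube.periodic_deriv (hT : IsTube L γ n κ ε D) : Function.Periodic (deriv γ) L := by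
  intro s
  rw [← deriv_comp_add_const]
  congr 1
  funext x
  exact hT.periodic_curve x

/-- By symmetry of the Hessian one mixed component suffices; it enters the energy with the factor 2
that ends up in front of the curvature term of the limit problem. -/
theorem IsTube.quad_symm (hT : IsTube L γ n κ ε D) {v : H2Data D} (hv : IsH2Data D v) :
    quadQ n (deriv γ) (fun i j => hT.pull ((v.2 i).2.1 j)) =
      quadQ (deriv γ) n (fun i j => hT.pull ((v.2 i).2.1 j)) := by
  refine Lp.ext ?_
  filter_upwards [coeFn_quadQ hT.smooth_normal.continuous hT.continuous_deriv
      (fun i j => hT.pull ((v.2 i).2.1 j)),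
    coeFn_quadQ hT.continuous_deriv hT.smooth_normal.continuous
      (fun i j => hT.pull ((v.2 i).2.1 j))] with p h1 h2
  rw [h1, h2, hv.hess_symm hT.isTame 0 1]
  ring

/-- The derivatives of the components along γ' and n, where the Frenet formulas γ'' = −κn and n' =
κγ' turn the derivative of the frame into −κq and κr. -/
theorem IsTube.isFlatField (hT : IsTube L γ n κ ε D) {v : H2Data D} (hv : IsH2Data D v) :
    IsFlatField κ ε (hT.flat v) := by
  have hκ := hT.smooth_curvature.continuous
  have hn := hT.smooth_normal.continuous
  refine ⟨hT.isStrip_pullStrip hv.fst, ?_, ?_⟩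
  · have h := hT.isStrip_comb hv hT.contDiff_deriv hT.periodic_deriv
    have h1 : deriv (deriv γ) = fun s => (-κ s) • n s := by
      funext s; exact hT.deriv_deriv s
    rw [h1, linQ_smul_left (m := fun s => -κ s) hn hκ.neg] at h
    have h2 : ∀ x, fstOp L (fun s => -κ s) x = -fstOp L κ x := by
      intro x
      refine Lp.ext ?_
      filter_upwards [Lp.coeFn_neg (fstOp L κ x),
        coeFn_mulOp (isBddWeight_Q (L := L) (f := fun p => κ p.1) (by fun_prop)) x,
        coeFn_mulOp (isBddWeight_Q (L := L) (f := fun p => -κ p.1) (by fun_prop)) x]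
        with p h1 h2 h3
      rw [h1, Pi.neg_apply, h2]
      exact h3.trans (by ring)
    rw [h2, neg_add_eq_sub] at h
    exact h
  · have h := hT.isStrip_comb hv hT.smooth_normal hT.periodic_normal
    have h1 : deriv n = fun s => κ s • deriv γ s := by
      funext s; exact hT.deriv_normal s
    rw [h1, linQ_smul_left hT.continuous_deriv hκ, hT.quad_symm hv, add_comm] at h
    exact h

/-- The function n(s)(1 − 2t) equals n on the outer curve and −n on the inner one. Its continuous
extension makes the normal derivative a sum of bounded multiplication operators. -/
theorem IsTube.exists_normal_extension (hT : IsTube L γ n κ ε D) :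
    ∃ N : Fin 2 → E2 → ℝ, (∀ i, Continuous (N i)) ∧
      ∀ x ∈ frontier D, ∀ i, outerNormal D x i = N i x := by
  have h : ∀ i : Fin 2, ∃ H : E2 → ℝ, ContDiff ℝ ∞ H ∧
      ∀ s, ∀ t ∈ Icc (0 : ℝ) 1, H (tubeMap γ n ε (s, t)) = n s i * (1 - 2 * t) := by
    intro i
    have hn := hT.smooth_normal
    refine hT.extend (fun p => n p.1 i * (1 - 2 * p.2)) (by fun_prop) fun s t => ?_
    simp only [hT.periodic_normal s]
  choose N hN hNe using h
  refine ⟨N, fun i => (hN i).continuous, fun x hx i => ?_⟩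
  rw [hT.frontier_eq] at hx
  rcases hx with ⟨s, -, rfl⟩ | ⟨s, -, rfl⟩
  · have h1 := hNe i s 0 (left_mem_Icc.2 zero_le_one)
    have h2 : tubeMap γ n ε (s, 0) = γ s := by simp [tubeMap]
    rw [hT.normal_outer, ← h2, h1]; ring
  · have h1 := hNe i s 1 (right_mem_Icc.2 zero_le_one)
    simp only [hT.normal_inner, h1, PiLp.neg_apply]; ring

/-- The components of the outer normal of a tube, extended to the plane. -/
def IsTube.normalExt (hT : IsTube L γ n κ ε D) : Fin 2 → E2 → ℝ :=
  hT.exists_normal_extension.choose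

theorem IsTube.continuous_normalExt (hT : IsTube L γ n κ ε D) (i : Fin 2) :
    Continuous (hT.normalExt i) := hT.exists_normal_extension.choose_spec.1 i

theorem IsTube.normalExt_eq (hT : IsTube L γ n κ ε D) {x : E2} (hx : x ∈ frontier D) (i : Fin 2) :
    outerNormal D x i = hT.normalExt i x := hT.exists_normal_extension.choose_spec.2 x hx i

/-- The normal derivative on the boundary. -/
def IsTube.nder (hT : IsTube L γ n κ ε D) (v : H2Data D) : LB D :=
  ∑ i, mulOp (bdryMeasure D) (hT.normalExt i) (v.2 i).2.2

theorem IsTube.coeFn_nder (hT : IsTube L γ n κ ε D) (v : H2Data D) :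
    hT.nder v =ᵐ[bdryMeasure D] fun x => ∑ i, (v.2 i).2.2 x * outerNormal D x i := by
  rw [IsTube.nder, Fin.sum_univ_two]
  filter_upwards [Lp.coeFn_add (mulOp (bdryMeasure D) (hT.normalExt 0) (v.2 0).2.2)
      (mulOp (bdryMeasure D) (hT.normalExt 1) (v.2 1).2.2),
    coeFn_mulOp (hT.isTame.isBddWeight_bdry (hT.continuous_normalExt 0)) (v.2 0).2.2,
    coeFn_mulOp (hT.isTame.isBddWeight_bdry (hT.continuous_normalExt 1)) (v.2 1).2.2,
    ae_mem_frontier D] with x h1 h2 h3 hx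
  rw [h1, Pi.add_apply, h2, h3, Fin.sum_univ_two, hT.normalExt_eq hx, hT.normalExt_eq hx]
  ring

theorem IsTube.pullO_nder (hT : IsTube L γ n κ ε D) (v : H2Data D) :
    hT.pullO (hT.nder v) = (hT.flat v).q₀ := by
  refine Lp.ext ?_
  filter_upwards [hT.coeFn_pullO (hT.nder v),
    hT.exists_pull_outer.choose_spec.qmp.ae (hT.coeFn_nder v),
    coeFn_linI hT.smooth_normal.continuous fun i => hT.pullO (v.2 i).2.2,
    hT.coeFn_pullO (v.2 0).2.2, hT.coeFn_pullO (v.2 1).2.2] with s h1 h2 h3 h4 h5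
  rw [h1, h2, Fin.sum_univ_two, hT.normal_outer]
  refine Eq.trans ?_ h3.symm
  rw [h4, h5]; ring

theorem IsTube.pullN_nder (hT : IsTube L γ n κ ε D) (v : H2Data D) :
    hT.pullN (hT.nder v) = -(hT.flat v).q₁ := by
  refine Lp.ext ?_
  filter_upwards [hT.coeFn_pullN (hT.nder v),
    hT.exists_pull_inner.choose_spec.qmp.ae (hT.coeFn_nder v),
    coeFn_linI hT.smooth_normal.continuous fun i => hT.pullN (v.2 i).2.2,
    hT.coeFn_pullN (v.2 0).2.2, hT.coeFn_pullN (v.2 1).2.2, Lp.coeFn_neg (hT.flat v).q₁]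
    with s h1 h2 h3 h4 h5 h6
  rw [h1, h2, Fin.sum_univ_two, hT.normal_inner, h6, Pi.neg_apply]
  refine Eq.trans ?_ (congrArg Neg.neg h3.symm)
  rw [h4, h5]
  simp only [PiLp.neg_apply]; ring

/-- The energy of a pair of fields in tube coordinates. -/
def energy {L : ℝ} (κ : ℝ → ℝ) (ε μ b : ℝ) (F G : FlatField L) : ℝ :=
  inner ℝ (jacOp L κ ε F.a) G.a + 2 * inner ℝ (jacOp L κ ε F.b) G.b + inner ℝ (jacOp L κ ε F.c) G.c +
  μ / ε * (inner ℝ F.q₀ G.q₀ + inner ℝ (mulOp (muI L) (innerJac κ ε) F.q₁) G.q₁) +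
  b * (inner ℝ F.W₀ G.W₀ + inner ℝ (mulOp (muI L) (innerJac κ ε) F.W₁) G.W₁)

/-- The bilinear form of the shifted Steklov problem. -/
def IsTube.form (hT : IsTube L γ n κ ε D) (μ b : ℝ) (v w : H2Data D) : ℝ :=
  (∑ i, ∑ j, inner ℝ ((v.2 i).2.1 j) ((w.2 i).2.1 j)) + μ * inner ℝ (hT.nder v) (hT.nder w) +
    ε * b * inner ℝ v.1.2.2 w.1.2.2

theorem IsTube.inner_deriv_normal (hT : IsTube L γ n κ ε D) (s : ℝ) :
    inner ℝ (deriv γ s) (n s) = (0 : ℝ) := by rw [real_inner_comm]; exact hT.inner_normal s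

/-- Parseval in the frame, applied to rows and columns of the Hessian. The area element carries a
factor ε which arclength does not, and therefore the coefficient μ becomes μ/ε in the energy. -/
theorem IsTube.form_eq (hT : IsTube L γ n κ ε D) (μ b : ℝ) {v w : H2Data D} (hv : IsH2Data D v)
    (hw : IsH2Data D w) :
    hT.form μ b v w = ε * energy κ ε μ b (hT.flat v) (hT.flat w) := by
  have hd := hT.continuous_deriv
  have hn := hT.smooth_normal.continuous
  have hj := hT.continuous_jac
  have hpar := fun (x y : Fin 2 → LQ L) => parsevalQ hd hn hT.norm_deriv hT.norm_normal
    hT.inner_deriv_normal x y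
  have key : ∀ x y : Fin 2 → Fin 2 → LQ L,
      inner ℝ (jacOp L κ ε (x 0 0)) (y 0 0) + inner ℝ (jacOp L κ ε (x 0 1)) (y 0 1) +
      (inner ℝ (jacOp L κ ε (x 1 0)) (y 1 0) + inner ℝ (jacOp L κ ε (x 1 1)) (y 1 1)) =
      inner ℝ (jacOp L κ ε (quadQ (deriv γ) (deriv γ) x)) (quadQ (deriv γ) (deriv γ) y) +
      inner ℝ (jacOp L κ ε (quadQ n (deriv γ) x)) (quadQ n (deriv γ) y) +
      (inner ℝ (jacOp L κ ε (quadQ (deriv γ) n x)) (quadQ (deriv γ) n y) +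
      inner ℝ (jacOp L κ ε (quadQ n n x)) (quadQ n n y) : ℝ) := by
    intro x y
    have h1 := fun i => hpar (fun j => jacOp L κ ε (x i j)) (y i)
    have h2 := hpar (fun i => jacOp L κ ε (linQ (deriv γ) (x i))) (fun i => linQ (deriv γ) (y i))
    have h3 := hpar (fun i => jacOp L κ ε (linQ n (x i))) (fun i => linQ n (y i))
    simp only [jacOp, linQ_mulOp hd hj, linQ_mulOp hn hj] at h1 h2 h3 ⊢
    have h10 := h1 0
    have h11 := h1 1
    simp only [quadQ]
    linarith
  have hk := key (fun i j => hT.pull ((v.2 i).2.1 j)) (fun i j => hT.pull ((w.2 i).2.1 j))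
  rw [hT.quad_symm hv, hT.quad_symm hw] at hk
  have hε := hT.eps_pos.ne'
  rw [IsTube.form, hT.inner_bdry_eq (hT.nder v), hT.inner_bdry_eq v.1.2.2]
  simp only [Fin.sum_univ_two, hT.inner_eq, hT.pullO_nder, hT.pullN_nder, map_neg, inner_neg_neg]
  simp only [energy, IsTube.flat] at hk ⊢
  have h1 : ∀ z : ℝ, ε * (μ / ε * z) = μ * z := fun z => by field_simp
  simp only [mul_add, h1] at hk ⊢
  linear_combination ε * hk

end Flat

/-! ### A priori bounds -/

theorem mul_norm_sq_le_inner_mulOp {α : Type*} [MeasurableSpace α] {ν : Measure α} {w : α → ℝ}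
    (hw : IsBddWeight ν w) {c : ℝ} (h : ∀ᵐ p ∂ν, c ≤ w p) (x : Lp ℝ 2 ν) :
    c * ‖x‖ ^ 2 ≤ inner ℝ (mulOp ν w x) x := by
  rw [norm_sq_eq_integral, inner_eq_integral, ← integral_const_mul]
  refine integral_mono_ae ((Lp.memLp x).integrable_sq.const_mul c) (integrable_mul_Lp _ _) ?_
  filter_upwards [h, coeFn_mulOp hw x] with p h1 h2
  rw [h2]
  nlinarith [sq_nonneg (x p)]

/-- Uniform bounds for the coefficients in tube coordinates. -/
structure IsCoeffBound (L : ℝ) (κ : ℝ → ℝ) (ε c M K : ℝ) : Prop where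
  continuous : Continuous κ
  jac_ge : ∀ p ∈ Icc 0 L ×ˢ Icc (0 : ℝ) 1, c ≤ tubeJac κ ε p
  jac_le : ∀ p ∈ Icc 0 L ×ˢ Icc (0 : ℝ) 1, tubeJac κ ε p ≤ M
  curv_le : ∀ s ∈ Icc 0 L, |κ s| ≤ K

/-- Bounds for all components of a field. -/
structure IsFieldBound {L : ℝ} (ε B : ℝ) (F : FlatField L) : Prop where
  a : ‖F.a‖ ≤ B
  b : ‖F.b‖ ≤ B
  c : ‖F.c‖ ≤ B
  r : ‖F.r‖ ≤ B
  W : ‖F.W‖ ≤ B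
  q : ‖F.q‖ ≤ Real.sqrt ε * B
  W₀ : ‖F.W₀‖ ≤ B
  W₁ : ‖F.W₁‖ ≤ B
  r₀ : ‖F.r₀‖ ≤ B
  r₁ : ‖F.r₁‖ ≤ B
  q₀ : ‖F.q₀‖ ≤ Real.sqrt ε * B
  q₁ : ‖F.q₁‖ ≤ Real.sqrt ε * B

section Bounds

variable {L ε c M K μ b : ℝ} {κ : ℝ → ℝ}

theorem IsCoeffBound.weight (h : IsCoeffBound L κ ε c M K) :
    IsBddWeight (muQ L) (tubeJac κ ε) := isBddWeight_Q (continuous_tubeJac h.continuous)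

theorem IsCoeffBound.weight_inner (h : IsCoeffBound L κ ε c M K) :
    IsBddWeight (muI L) (innerJac κ ε) :=
  isBddWeight_I ((continuous_tubeJac h.continuous).comp (by fun_prop))

theorem IsCoeffBound.norm_fstOp_le (h : IsCoeffBound L κ ε c M K) (x : LQ L) :
    ‖fstOp L κ x‖ ≤ K * ‖x‖ :=
  norm_mulOp_le (isBddWeight_Q (by have := h.continuous; fun_prop))
    (ae_bound_Q fun p hp => h.curv_le p.1 hp.1) x

theorem IsCoeffBound.norm_jacOp_le (h : IsCoeffBound L κ ε c M K) (hc : 0 ≤ c) (x : LQ L) :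
    ‖jacOp L κ ε x‖ ≤ M * ‖x‖ :=
  norm_mulOp_le h.weight (ae_bound_Q fun p hp => by
    rw [abs_of_nonneg (hc.trans (h.jac_ge p hp))]; exact h.jac_le p hp) x

theorem IsCoeffBound.norm_innerJac_le (h : IsCoeffBound L κ ε c M K) (hc : 0 ≤ c) (x : LI L) :
    ‖mulOp (muI L) (innerJac κ ε) x‖ ≤ M * ‖x‖ :=
  norm_mulOp_le h.weight_inner (ae_bound_I fun s hs => by
    have hs' : (s, (1 : ℝ)) ∈ Icc 0 L ×ˢ Icc (0 : ℝ) 1 := ⟨hs, right_mem_Icc.2 zero_le_one⟩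
    rw [innerJac, abs_of_nonneg (hc.trans (h.jac_ge _ hs'))]; exact h.jac_le _ hs') x

theorem IsCoeffBound.jacOp_ge (h : IsCoeffBound L κ ε c M K) (x : LQ L) :
    c * ‖x‖ ^ 2 ≤ inner ℝ (jacOp L κ ε x) x :=
  mul_norm_sq_le_inner_mulOp h.weight (by
    filter_upwards [ae_muQ_mem L] with p hp
    exact h.jac_ge p ⟨Ioo_subset_Icc_self hp.1, Ioo_subset_Icc_self hp.2⟩) x

theorem IsCoeffBound.innerJac_ge (h : IsCoeffBound L κ ε c M K) (x : LI L) :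
    c * ‖x‖ ^ 2 ≤ inner ℝ (mulOp (muI L) (innerJac κ ε) x) x :=
  mul_norm_sq_le_inner_mulOp h.weight_inner (by
    filter_upwards [ae_restrict_mem measurableSet_Ioo] with s hs
    exact h.jac_ge _ ⟨Ioo_subset_Icc_self hs, right_mem_Icc.2 zero_le_one⟩) x

theorem le_of_mul_sq_le {c x X m : ℝ} (hc : 0 < c) (hm : m = (Real.sqrt c)⁻¹) (hX : 0 ≤ X)
    (h : c * x ^ 2 ≤ X ^ 2) : x ≤ m * X := by
  rw [hm]
  have hs := Real.sqrt_pos.2 hc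
  rw [inv_mul_eq_div, le_div_iff₀ hs]
  refine abs_le_of_sq_le_sq' ?_ hX |>.2
  rw [mul_pow, Real.sq_sqrt hc.le]; linarith

theorem IsStrip.norm_le_of_lower {A As At : LQ L} {G₀ G₁ : LI L}
    (h : IsStrip L (A, As, At, G₀, G₁)) : ‖A‖ ≤ ‖G₀‖ + 2 * ‖At‖ := by
  have h1 := h.norm_sub_extI_le
  have h2 := norm_add_le (A - extI L G₀) (extI L G₀)
  rw [sub_add_cancel, norm_extI] at h2
  simp only at h1
  linarith

theorem IsStrip.norm_lower_le {A As At : LQ L} {G₀ G₁ : LI L}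
    (h : IsStrip L (A, As, At, G₀, G₁)) : ‖G₀‖ ≤ ‖A‖ + ‖At‖ := by
  have h1 := h.norm_lower_sub_avI_le
  have h2 := norm_add_le (G₀ - avI L A) (avI L A)
  rw [sub_add_cancel] at h2
  have h3 := norm_avI_le A
  simp only at h1
  linarith

theorem IsStrip.norm_upper_le {A As At : LQ L} {G₀ G₁ : LI L}
    (h : IsStrip L (A, As, At, G₀, G₁)) : ‖G₁‖ ≤ ‖G₀‖ + ‖At‖ := by
  have h1 := h.norm_upper_sub_lower_le
  have h2 := norm_add_le (G₁ - G₀) G₀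
  rw [sub_add_cancel] at h2
  simp only at h1
  linarith

set_option maxHeartbeats 1000000 in
/-- The energy controls all components of a field, uniformly for thin tubes. -/
theorem exists_field_bound (hL : 0 < L) {E : ℝ} (hc : 0 < c) (hM : 0 ≤ M) (hK : 0 ≤ K)
    (hE : 0 < E) (hμ : 0 < μ) (hb : 0 < b) :
    ∃ C, 0 ≤ C ∧ ∀ ε, 0 < ε → ε ≤ E → ∀ κ, IsCoeffBound L κ ε c M K →
      ∀ F : FlatField L, IsFlatField κ ε F → ∀ X, 0 ≤ X → energy κ ε μ b F F ≤ X ^ 2 →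
        IsFieldBound ε (C * X) F := by
  -- In units of `X`, the constants `m`, `m₁`, `m₂` bound the Hessian, ε^(−1/2) q₀ and W₀ directly
  -- from the energy, whereas `k₁`, `k₂`, `k₃` bound ε^(−1/2) q, W and r, each with the help of the
  -- preceding ones.
  set m := (Real.sqrt c)⁻¹ with hm
  set m₁ := (Real.sqrt μ)⁻¹ with hm₁
  set m₂ := (Real.sqrt b)⁻¹ with hm₂
  have hm0 : 0 ≤ m := by positivity
  have hm10 : 0 ≤ m₁ := by positivity
  have hm20 : 0 ≤ m₂ := by positivity
  set e := Real.sqrt E with he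
  have he0 : 0 ≤ e := Real.sqrt_nonneg _
  set k₁ := m₁ + 2 * e * m with hk₁
  have hk10 : 0 ≤ k₁ := by positivity
  set k₂ := m₂ + 2 * E * e * k₁ with hk₂
  have hk20 : 0 ≤ k₂ := by positivity
  set k₃ := m * Real.sqrt (k₂ * (M * m + K * (e * k₁))) with hk₃
  have hk30 : 0 ≤ k₃ := by positivity
  clear_value m m₁ m₂ k₁ k₂ k₃
  refine ⟨m + m₁ + m₂ + k₁ + k₂ + k₃ + 3 * E * m + e * m + E * e * k₁, by positivity, ?_⟩
  intro ε hε hεE κ hκ F hF X hX hen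
  set C := m + m₁ + m₂ + k₁ + k₂ + k₃ + 3 * E * m + e * m + E * e * k₁ with hC
  set σ := Real.sqrt ε with hσ
  have hσ0 : 0 < σ := Real.sqrt_pos.2 hε
  have hσσ : ε = σ * σ := (Real.mul_self_sqrt hε.le).symm
  have hσe : σ ≤ e := Real.sqrt_le_sqrt hεE
  clear_value σ e
  clear_value C
  have hemX : 0 ≤ m * X := by positivity
  have p1 : 0 ≤ m₁ * X := by positivity
  have p2 : 0 ≤ m₂ * X := by positivity
  have p3 : 0 ≤ k₁ * X := by positivity
  have p4 : 0 ≤ k₂ * X := by positivity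
  have p5 : 0 ≤ k₃ * X := by positivity
  have p6 : 0 ≤ E * (m * X) := by positivity
  have p7 : 0 ≤ e * (m * X) := by positivity
  have p8 : 0 ≤ E * e * (k₁ * X) := by positivity
  have hCX : C * X = m * X + m₁ * X + m₂ * X + k₁ * X + k₂ * X + k₃ * X + 3 * (E * (m * X)) +
      e * (m * X) + E * e * (k₁ * X) := by rw [hC]; ring
  have ja := hκ.jacOp_ge F.a
  have jb := hκ.jacOp_ge F.b
  have jc := hκ.jacOp_ge F.c
  have jq := hκ.innerJac_ge F.q₁
  have jW := hκ.innerJac_ge F.W₁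
  have za : 0 ≤ c * ‖F.a‖ ^ 2 := by positivity
  have zb : 0 ≤ c * ‖F.b‖ ^ 2 := by positivity
  have zc : 0 ≤ c * ‖F.c‖ ^ 2 := by positivity
  have zq : 0 ≤ c * ‖F.q₁‖ ^ 2 := by positivity
  have zW : 0 ≤ c * ‖F.W₁‖ ^ 2 := by positivity
  rw [energy, real_inner_self_eq_norm_sq, real_inner_self_eq_norm_sq] at hen
  have hμε : 0 < μ / ε := div_pos hμ hε
  have zq' : μ / ε * ‖F.q₀‖ ^ 2 ≤
      μ / ε * (‖F.q₀‖ ^ 2 + inner ℝ (mulOp (muI L) (innerJac κ ε) F.q₁) F.q₁) := by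
    gcongr; linarith only [jq, zq]
  have zW' : b * ‖F.W₀‖ ^ 2 ≤
      b * (‖F.W₀‖ ^ 2 + inner ℝ (mulOp (muI L) (innerJac κ ε) F.W₁) F.W₁) := by
    gcongr; linarith only [jW, zW]
  have zq0 : 0 ≤ μ / ε * ‖F.q₀‖ ^ 2 := by positivity
  have zW0 : 0 ≤ b * ‖F.W₀‖ ^ 2 := by positivity
  have ba : ‖F.a‖ ≤ m * X := le_of_mul_sq_le hc hm hX (x := ‖F.a‖)
    (by linarith only [hen, ja, jb, jc, za, zb, zc, zq', zq0, zW', zW0])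
  have bb : ‖F.b‖ ≤ m * X := le_of_mul_sq_le hc hm hX (x := ‖F.b‖)
    (by linarith only [hen, ja, jb, jc, za, zb, zc, zq', zq0, zW', zW0])
  have bc : ‖F.c‖ ≤ m * X := le_of_mul_sq_le hc hm hX (x := ‖F.c‖)
    (by linarith only [hen, ja, jb, jc, za, zb, zc, zq', zq0, zW', zW0])
  have bW0 : ‖F.W₀‖ ≤ m₂ * X := le_of_mul_sq_le hb hm₂ hX (x := ‖F.W₀‖)
    (by linarith only [hen, ja, jb, jc, za, zb, zc, zq', zq0, zW', zW0])
  -- The large boundary coefficient μ/ε is the source of the rate √ε of the normal derivative.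
  have bq0 : ‖F.q₀‖ ≤ σ * (m₁ * X) := by
    have := le_of_mul_sq_le hμε rfl hX (x := ‖F.q₀‖)
      (by linarith only [hen, ja, jb, jc, za, zb, zc, zq', zq0, zW', zW0])
    rw [Real.sqrt_div hμ.le, inv_div] at this
    calc _ ≤ _ := this
      _ = _ := by rw [hm₁, hσ]; ring
  have nq : ‖(-ε) • F.q‖ = ε * ‖F.q‖ := by rw [norm_smul, norm_neg, Real.norm_of_nonneg hε.le]
  have nb : ‖(-ε) • F.b‖ = ε * ‖F.b‖ := by rw [norm_smul, norm_neg, Real.norm_of_nonneg hε.le]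
  have nc : ‖(-ε) • F.c‖ = ε * ‖F.c‖ := by rw [norm_smul, norm_neg, Real.norm_of_nonneg hε.le]
  have eb : ε * ‖F.b‖ ≤ E * (m * X) := by gcongr
  -- Of ε = √ε·√ε one root is kept and the other is bounded by `e`, so that q on the strip inherits
  -- the rate √ε from q₀.
  have ec : ε * ‖F.c‖ ≤ σ * (e * (m * X)) := by
    calc ε * ‖F.c‖ ≤ ε * (m * X) := by gcongr
      _ = σ * (σ * (m * X)) := by rw [hσσ]; ring
      _ ≤ _ := by gcongr
  have bq : ‖F.q‖ ≤ σ * (k₁ * X) := by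
    have := hF.strip_q.norm_le_of_lower
    rw [nc] at this
    calc _ ≤ _ := this
      _ ≤ σ * (m₁ * X) + 2 * (σ * (e * (m * X))) := by gcongr
      _ = _ := by rw [hk₁]; ring
  have bq' : ‖F.q‖ ≤ e * (k₁ * X) := bq.trans (by gcongr)
  have eq : ε * ‖F.q‖ ≤ E * e * (k₁ * X) := by
    rw [mul_assoc]; gcongr
  have bW : ‖F.W‖ ≤ k₂ * X := by
    have := hF.strip_W.norm_le_of_lower
    rw [nq] at this
    calc _ ≤ _ := this
      _ ≤ m₂ * X + 2 * (E * e * (k₁ * X)) := by gcongr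
      _ = _ := by rw [hk₂]; ring
  -- The energy does not contain r. Longitudinal integration by parts gives ⟨Jr, r⟩ = −⟨W, Ja − κq⟩,
  -- an interpolation between W and the second derivatives.
  have br : ‖F.r‖ ≤ k₃ * X := by
    have h1 := hF.strip_W.inner_dS_add hL hF.strip_r
    simp only at h1
    have h2 := hκ.jacOp_ge F.r
    have h3 : -inner ℝ F.W (jacOp L κ ε F.a - fstOp L κ F.q) ≤
        ‖F.W‖ * (M * ‖F.a‖ + K * ‖F.q‖) := by
      refine (neg_le_abs _).trans ((abs_real_inner_le_norm _ _).trans ?_)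
      gcongr
      exact (norm_sub_le _ _).trans (add_le_add (hκ.norm_jacOp_le hc.le _) (hκ.norm_fstOp_le _))
    have h4 : ‖F.W‖ * (M * ‖F.a‖ + K * ‖F.q‖) ≤
        (k₂ * X) * (M * (m * X) + K * (e * (k₁ * X))) := by gcongr
    have h5 : c * ‖F.r‖ ^ 2 ≤ (Real.sqrt (k₂ * (M * m + K * (e * k₁))) * X) ^ 2 := by
      rw [mul_pow, Real.sq_sqrt (by positivity)]
      calc c * ‖F.r‖ ^ 2 ≤ (k₂ * X) * (M * (m * X) + K * (e * (k₁ * X))) := by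
            linarith only [h1, h2, h3, h4]
        _ = _ := by ring
    have := le_of_mul_sq_le hc hm (by positivity) h5
    rw [hk₃, mul_assoc]
    exact this
  have br0 : ‖F.r₀‖ ≤ k₃ * X + E * (m * X) := by
    have := hF.strip_r.norm_lower_le
    rw [nb] at this
    linarith only [this, br, eb]
  have br1 : ‖F.r₁‖ ≤ k₃ * X + 2 * (E * (m * X)) := by
    have := hF.strip_r.norm_upper_le
    rw [nb] at this
    linarith only [this, br0, eb]
  have bq1 : ‖F.q₁‖ ≤ σ * (m₁ * X + e * (m * X)) := by
    have := hF.strip_q.norm_upper_le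
    rw [nc] at this
    linarith only [this, bq0, ec]
  have bW1 : ‖F.W₁‖ ≤ m₂ * X + E * e * (k₁ * X) := by
    have := hF.strip_W.norm_upper_le
    rw [nq] at this
    linarith only [this, bW0, eq]
  have hup : ∀ y, y ≤ C * X → σ * y ≤ Real.sqrt ε * (C * X) := fun y hy => by
    rw [← hσ]; exact mul_le_mul_of_nonneg_left hy hσ0.le
  exact ⟨by linarith only [ba, p1, p2, p3, p4, p5, p6, p7, p8, hemX, hCX],
    by linarith only [bb, p1, p2, p3, p4, p5, p6, p7, p8, hemX, hCX],
    by linarith only [bc, p1, p2, p3, p4, p5, p6, p7, p8, hemX, hCX],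
    by linarith only [br, p1, p2, p3, p4, p5, p6, p7, p8, hemX, hCX],
    by linarith only [bW, p1, p2, p3, p4, p5, p6, p7, p8, hemX, hCX],
    bq.trans (hup _ (by linarith only [p1, p2, p3, p4, p5, p6, p7, p8, hemX, hCX])),
    by linarith only [bW0, p1, p2, p3, p4, p5, p6, p7, p8, hemX, hCX],
    by linarith only [bW1, p1, p2, p3, p4, p5, p6, p7, p8, hemX, hCX],
    by linarith only [br0, p1, p2, p3, p4, p5, p6, p7, p8, hemX, hCX],
    by linarith only [br1, p1, p2, p3, p4, p5, p6, p7, p8, hemX, hCX],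
    bq0.trans (hup _ (by linarith only [p1, p2, p3, p4, p5, p6, p7, p8, hemX, hCX])),
    bq1.trans (hup _ (by linarith only [p1, p2, p3, p4, p5, p6, p7, p8, hemX, hCX]))⟩

end Bounds

/-- Solvability of a variational problem whose form is a sum of squares. -/
theorem exists_solution_of_sum {V Y₁ Y₂ Z ι ι' : Type*} [Fintype ι] [Fintype ι'] [DecidableEq ι']
    [NormedAddCommGroup V] [NormedSpace ℝ V] [CompleteSpace V]
    [NormedAddCommGroup Y₁] [InnerProductSpace ℝ Y₁] [CompleteSpace Y₁]
    [NormedAddCommGroup Y₂] [InnerProductSpace ℝ Y₂] [CompleteSpace Y₂]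
    [NormedAddCommGroup Z] [NormedSpace ℝ Z] (A : ι → V →L[ℝ] Y₁) (B : ι' → V →L[ℝ] Y₂) {C : ℝ}
    (h : ∀ v X, 0 ≤ X → (∑ i, ‖A i v‖ ^ 2) + (∑ k, ‖B k v‖ ^ 2) = X ^ 2 → ‖v‖ ≤ C * X)
    (j : Z →L[ℝ] Y₂) (k₀ : ι') :
    ∃ S : Z →L[ℝ] V, ∀ f v, (∑ i, inner ℝ (A i (S f)) (A i v)) +
      (∑ k, inner ℝ (B k (S f)) (B k v)) = (inner ℝ (j f) (B k₀ v) : ℝ) := by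
  -- All terms of the form are stacked into one operator into a Hilbert product, and the load is
  -- placed in the component `k₀`.
  let X := WithLp 2 ((PiLp 2 fun _ : ι => Y₁) × (PiLp 2 fun _ : ι' => Y₂))
  let T : V →L[ℝ] X := ((WithLp.prodContinuousLinearEquiv 2 ℝ (PiLp 2 fun _ : ι => Y₁)
    (PiLp 2 fun _ : ι' => Y₂)).symm : _ →L[ℝ] X) ∘L
    ((((PiLp.continuousLinearEquiv 2 ℝ fun _ : ι => Y₁).symm : _ →L[ℝ] PiLp 2 fun _ : ι => Y₁) ∘L
      ContinuousLinearMap.pi A).prod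
    (((PiLp.continuousLinearEquiv 2 ℝ fun _ : ι' => Y₂).symm : _ →L[ℝ] PiLp 2 fun _ : ι' => Y₂) ∘L
      ContinuousLinearMap.pi B))
  let J : Z →L[ℝ] X := ((WithLp.prodContinuousLinearEquiv 2 ℝ (PiLp 2 fun _ : ι => Y₁)
    (PiLp 2 fun _ : ι' => Y₂)).symm : _ →L[ℝ] X) ∘L
    ((0 : Z →L[ℝ] PiLp 2 fun _ : ι => Y₁).prod
    (((PiLp.continuousLinearEquiv 2 ℝ fun _ : ι' => Y₂).symm : _ →L[ℝ] PiLp 2 fun _ : ι' => Y₂) ∘L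
      ContinuousLinearMap.pi fun k => if k = k₀ then j else 0))
  have hT : ∀ v w, inner ℝ (T v) (T w) = (∑ i, inner ℝ (A i v) (A i w)) +
      (∑ k, inner ℝ (B k v) (B k w) : ℝ) := by
    intro v w
    rw [WithLp.prod_inner_apply, PiLp.inner_apply, PiLp.inner_apply]
    rfl
  have hJ : ∀ f v, inner ℝ (J f) (T v) = (inner ℝ (j f) (B k₀ v) : ℝ) := by
    intro f v
    rw [WithLp.prod_inner_apply, PiLp.inner_apply, PiLp.inner_apply]
    have h1 : ∀ i : ι, inner ℝ ((J f).fst i) ((T v).fst i) = (0 : ℝ) := fun i => inner_zero_left _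
    have h2 : ∀ k : ι', inner ℝ ((J f).snd k) ((T v).snd k) =
        if k = k₀ then (inner ℝ (j f) (B k₀ v) : ℝ) else 0 := by
      intro k
      change inner ℝ ((if k = k₀ then j else 0) f) (B k v) = _
      split_ifs with hk
      · rw [hk]
      · simp
    change (∑ i, inner ℝ ((J f).fst i) ((T v).fst i)) + ∑ k, inner ℝ ((J f).snd k) ((T v).snd k) = _
    simp_rw [h1, h2]
    simp
  obtain ⟨S, hS⟩ := exists_variational_solution T C (fun v => h v _ (norm_nonneg _) (by
    rw [← real_inner_self_eq_norm_sq, hT]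
    simp only [real_inner_self_eq_norm_sq])) J
  refine ⟨S, fun f v => ?_⟩
  rw [← hT, hS, hJ]

/-! ### Functions on the two boundary curves -/

section Rescale

variable {α : Type*} [MeasurableSpace α]

theorem isWComp_smul_measure (ν : Measure α) {c : ℝ} (hc : 0 < c) :
    ∃ C, IsWComp ν (ENNReal.ofReal c • ν) id (fun _ => 1) C := by
  refine ⟨1 * Real.sqrt c, IsWComp.of_map_le measurable_id measurable_const zero_le_one
    (Real.sqrt_nonneg _) (by simp) ?_⟩
  rw [Measure.map_id, Real.sq_sqrt hc.le]

theorem isWComp_of_smul_measure (ν : Measure α) {c : ℝ} (hc : 0 < c) :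
    ∃ C, IsWComp (ENNReal.ofReal c • ν) ν id (fun _ => 1) C := by
  refine ⟨1 * Real.sqrt c⁻¹, IsWComp.of_map_le measurable_id measurable_const zero_le_one
    (Real.sqrt_nonneg _) (by simp) ?_⟩
  rw [Measure.map_id, Real.sq_sqrt (by positivity), smul_smul, ← ENNReal.ofReal_mul (by positivity),
    inv_mul_cancel₀ hc.ne', ENNReal.ofReal_one, one_smul]

open Classical in
/-- The identity from `L²(ν)` to `L²(c ν)`. -/
def toSmul (ν : Measure α) (c : ℝ) : Lp ℝ 2 ν →L[ℝ] Lp ℝ 2 (ENNReal.ofReal c • ν) :=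
  if h : 0 < c then (isWComp_smul_measure ν h).choose_spec.op else 0

open Classical in
/-- The identity from `L²(c ν)` to `L²(ν)`. -/
def ofSmul (ν : Measure α) (c : ℝ) : Lp ℝ 2 (ENNReal.ofReal c • ν) →L[ℝ] Lp ℝ 2 ν :=
  if h : 0 < c then (isWComp_of_smul_measure ν h).choose_spec.op else 0

theorem ae_of_ae_smul {ν : Measure α} {c : ℝ} (hc : 0 < c) {p : α → Prop}
    (h : ∀ᵐ x ∂(ENNReal.ofReal c • ν), p x) : ∀ᵐ x ∂ν, p x :=
  (Measure.ae_ennreal_smul_measure_iff (by simpa using hc)).1 h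

theorem ae_smul_of_ae {ν : Measure α} {c : ℝ} {p : α → Prop}
    (h : ∀ᵐ x ∂ν, p x) : ∀ᵐ x ∂(ENNReal.ofReal c • ν), p x :=
  Measure.ae_smul_measure h _

theorem coeFn_toSmul {ν : Measure α} {c : ℝ} (hc : 0 < c) (f : Lp ℝ 2 ν) :
    toSmul ν c f =ᵐ[ν] f := by
  refine ae_of_ae_smul hc ?_
  rw [toSmul, dif_pos hc]
  filter_upwards [(isWComp_smul_measure ν hc).choose_spec.coeFn_op f] with x hx
  rw [hx, one_mul, id]

theorem coeFn_ofSmul {ν : Measure α} {c : ℝ} (hc : 0 < c)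
    (f : Lp ℝ 2 (ENNReal.ofReal c • ν)) : ofSmul ν c f =ᵐ[ν] f := by
  rw [ofSmul, dif_pos hc]
  filter_upwards [(isWComp_of_smul_measure ν hc).choose_spec.coeFn_op f] with x hx
  rw [hx, one_mul, id]

theorem ofSmul_toSmul {ν : Measure α} {c : ℝ} (hc : 0 < c) (f : Lp ℝ 2 ν) :
    ofSmul ν c (toSmul ν c f) = f :=
  Lp.ext ((coeFn_ofSmul hc _).trans (coeFn_toSmul hc f))

theorem toSmul_ofSmul {ν : Measure α} {c : ℝ} (hc : 0 < c)
    (f : Lp ℝ 2 (ENNReal.ofReal c • ν)) : toSmul ν c (ofSmul ν c f) = f :=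
  Lp.ext (ae_smul_of_ae ((coeFn_toSmul hc _).trans (coeFn_ofSmul hc f)))

theorem norm_sq_eq_smul {ν : Measure α} {c : ℝ} (hc : 0 < c)
    (f : Lp ℝ 2 (ENNReal.ofReal c • ν)) : ‖f‖ ^ 2 = c * ‖ofSmul ν c f‖ ^ 2 := by
  rw [norm_sq_eq_integral, norm_sq_eq_integral, integral_smul_measure,
    ENNReal.toReal_ofReal hc.le, smul_eq_mul]
  congr 1
  refine integral_congr_ae ?_
  filter_upwards [coeFn_ofSmul hc f] with x hx
  rw [hx]

end Rescale

section Push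

variable {L ε : ℝ} {γ n : ℝ → E2} {κ : ℝ → ℝ} {D : Set E2}

/-- The longitudinal coordinate of boundary points. -/
theorem IsTube.exists_coordinate (hT : IsTube L γ n κ ε D) :
    ∃ Φ : E2 → ℝ, Measurable Φ ∧ (∀ s ∈ Ico 0 L, Φ (γ s) = s) ∧
      ∀ s ∈ Ico 0 L, Φ (tubeMap γ n ε (s, 1)) = s := by
  have hi : Continuous fun s => tubeMap γ n ε (s, 1) := hT.continuous_map.comp (by fun_prop)
  have h1 := hT.smooth_curve.continuous.continuousOn.measurableEmbedding measurableSet_Ico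
    hT.injOn_outer
  have h2 := hi.continuousOn.measurableEmbedding measurableSet_Ico hT.injOn_inner
  obtain ⟨Φ₁, hm1, he1⟩ := h1.exists_measurable_extend measurable_subtype_coe fun _ => ⟨(0 : ℝ)⟩
  obtain ⟨Φ₂, hm2, he2⟩ := h2.exists_measurable_extend measurable_subtype_coe fun _ => ⟨(0 : ℝ)⟩
  have hO : MeasurableSet (γ '' Ico 0 L) :=
    measurableSet_Ico.image_of_continuousOn_injOn hT.smooth_curve.continuous.continuousOn
      hT.injOn_outer
  classical
  refine ⟨(γ '' Ico 0 L).piecewise Φ₁ Φ₂, hm1.piecewise hO hm2, fun s hs => ?_, fun s hs => ?_⟩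
  · rw [piecewise_eq_of_mem _ _ _ (mem_image_of_mem γ hs)]
    exact congrFun he1 ⟨s, hs⟩
  · rw [piecewise_eq_of_notMem]
    · exact congrFun he2 ⟨s, hs⟩
    · rintro ⟨s', -, h⟩
      exact hT.disjoint_curves s' s h

/-- Weights on the boundary taking constant values on the two curves. -/
theorem IsTube.exists_push (hT : IsTube L γ n κ ε D) (w₀ w₁ : ℝ) :
    ∃ (Φ : E2 → ℝ) (w : E2 → ℝ) (C : ℝ), IsWComp (muI L) (bdryMeasure D) Φ w C ∧
      (∀ s ∈ Ico 0 L, Φ (γ s) = s ∧ w (γ s) = w₀) ∧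
      ∀ s ∈ Ico 0 L, Φ (tubeMap γ n ε (s, 1)) = s ∧ w (tubeMap γ n ε (s, 1)) = w₁ := by
  obtain ⟨Φ, hΦ, h0, h1⟩ := hT.exists_coordinate
  have hi : Continuous fun s => tubeMap γ n ε (s, 1) := hT.continuous_map.comp (by fun_prop)
  have hO : MeasurableSet (γ '' Ico 0 L) :=
    measurableSet_Ico.image_of_continuousOn_injOn hT.smooth_curve.continuous.continuousOn
      hT.injOn_outer
  classical
  set w : E2 → ℝ := (γ '' Ico 0 L).piecewise (fun _ => w₀) (fun _ => w₁) with hw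
  have hwm : Measurable w := measurable_const.piecewise hO measurable_const
  obtain ⟨M, hM, hMb⟩ := exists_bound_I L hT.continuous_innerJac
  -- The longitudinal coordinate sends the boundary measure to ds on the outer curve plus J(s, 1) ds
  -- on the inner one, together at most (1 + M) ds.
  refine ⟨Φ, w, _, IsWComp.of_map_le (c := |w₀| + |w₁|) (K := Real.sqrt (1 + M)) hΦ hwm
    (by positivity) (Real.sqrt_nonneg _) (Eventually.of_forall fun x => ?_) ?_, ?_, ?_⟩
  · rw [hw]
    by_cases hx : x ∈ γ '' Ico 0 L
    · rw [piecewise_eq_of_mem _ _ _ hx]; linarith [abs_nonneg w₁]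
    · rw [piecewise_eq_of_notMem _ _ _ hx]; linarith [abs_nonneg w₀]
  · have hae : ∀ᵐ s ∂(muI L), s ∈ Ico 0 L := by
      filter_upwards [ae_restrict_mem measurableSet_Ioo] with s hs
      exact Ioo_subset_Ico_self hs
    have e1 : Measure.map (Φ ∘ γ) (muI L) = muI L := by
      rw [Measure.map_congr (g := id), Measure.map_id]
      filter_upwards [hae] with s hs
      exact h0 s hs
    have e2 : Measure.map (Φ ∘ fun s => tubeMap γ n ε (s, 1)) ((muI L).withDensity
        fun s => ENNReal.ofReal (tubeJac κ ε (s, 1))) = (muI L).withDensity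
        fun s => ENNReal.ofReal (tubeJac κ ε (s, 1)) := by
      conv_rhs => rw [← Measure.map_id (μ := (muI L).withDensity
        fun s => ENNReal.ofReal (tubeJac κ ε (s, 1)))]
      refine Measure.map_congr ?_
      refine (withDensity_absolutelyContinuous _ _).ae_le ?_
      filter_upwards [hae] with s hs
      exact h1 s hs
    rw [hT.bdry, Measure.map_add _ _ hΦ, Measure.map_map hΦ hT.smooth_curve.continuous.measurable,
      Measure.map_map hΦ hi.measurable, e1, e2, Real.sq_sqrt (by positivity),
      ENNReal.ofReal_add zero_le_one hM, ENNReal.ofReal_one, add_smul, one_smul]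
    refine add_le_add le_rfl ?_
    rw [← withDensity_const]
    refine withDensity_mono ?_
    filter_upwards [ae_restrict_mem measurableSet_Ioo] with s hs
    exact ENNReal.ofReal_le_ofReal ((le_abs_self _).trans (hMb s (Ioo_subset_Icc_self hs)))
  · intro s hs
    exact ⟨h0 s hs, by rw [hw, piecewise_eq_of_mem _ _ _ (mem_image_of_mem γ hs)]⟩
  · intro s hs
    refine ⟨h1 s hs, ?_⟩
    rw [hw, piecewise_eq_of_notMem]
    rintro ⟨s', -, h⟩
    exact hT.disjoint_curves s' s h

/-- The function on the boundary with values `w₀ g(s)` on the outer and `w₁ g(s)` on the inner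
curve. -/
def IsTube.push (hT : IsTube L γ n κ ε D) (w₀ w₁ : ℝ) : LI L →L[ℝ] LB D :=
  (hT.exists_push w₀ w₁).choose_spec.choose_spec.choose_spec.1.op

theorem ae_mem_Ico (L : ℝ) : ∀ᵐ s ∂(muI L), s ∈ Ico 0 L := by
  filter_upwards [ae_restrict_mem measurableSet_Ioo] with s hs
  exact Ioo_subset_Ico_self hs

theorem IsTube.pullO_push (hT : IsTube L γ n κ ε D) (w₀ w₁ : ℝ) (g : LI L) :
    hT.pullO (hT.push w₀ w₁ g) = w₀ • g := by
  obtain ⟨h, h0, h1⟩ := (hT.exists_push w₀ w₁).choose_spec.choose_spec.choose_spec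
  refine Lp.ext ?_
  filter_upwards [hT.coeFn_pullO (hT.push w₀ w₁ g), hT.exists_pull_outer.choose_spec.qmp.ae
    (h.coeFn_op g), Lp.coeFn_smul w₀ g, ae_mem_Ico L] with s h2 h3 h4 hs
  rw [h2, IsTube.push, h3, h4, (h0 s hs).1, (h0 s hs).2]; rfl

theorem IsTube.pullN_push (hT : IsTube L γ n κ ε D) (w₀ w₁ : ℝ) (g : LI L) :
    hT.pullN (hT.push w₀ w₁ g) = w₁ • g := by
  obtain ⟨h, h0, h1⟩ := (hT.exists_push w₀ w₁).choose_spec.choose_spec.choose_spec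
  refine Lp.ext ?_
  filter_upwards [hT.coeFn_pullN (hT.push w₀ w₁ g), hT.exists_pull_inner.choose_spec.qmp.ae
    (h.coeFn_op g), Lp.coeFn_smul w₁ g, ae_mem_Ico L] with s h2 h3 h4 hs
  rw [h2, IsTube.push, h3, h4, (h1 s hs).1, (h1 s hs).2]; rfl

theorem IsTube.norm_sq_bdry (hT : IsTube L γ n κ ε D) (f : LB D) :
    ‖f‖ ^ 2 = ‖hT.pullO f‖ ^ 2 +
      inner ℝ (mulOp (muI L) (innerJac κ ε) (hT.pullN f)) (hT.pullN f) := by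
  rw [← real_inner_self_eq_norm_sq, hT.inner_bdry_eq, real_inner_self_eq_norm_sq]

theorem IsTube.bdry_ext (hT : IsTube L γ n κ ε D) {f g : LB D} (h0 : hT.pullO f = hT.pullO g)
    (h1 : hT.pullN f = hT.pullN g) : f = g := by
  rw [← sub_eq_zero, ← norm_eq_zero, ← sq_eq_zero_iff, hT.norm_sq_bdry, map_sub, map_sub, h0, h1,
    sub_self, sub_self]
  simp

theorem IsTube.eq_push_add_push (hT : IsTube L γ n κ ε D) (f : LB D) :
    f = hT.push 1 0 (hT.pullO f) + hT.push 0 1 (hT.pullN f) := by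
  refine hT.bdry_ext ?_ ?_ <;> simp [hT.pullO_push, hT.pullN_push]

/-- A bounded operator into `L²(∂D)` is compact if its components on the two curves are. -/
theorem IsTube.isCompactOperator_of_pull (hT : IsTube L γ n κ ε D) {V : Type*}
    [NormedAddCommGroup V] [NormedSpace ℝ V] {T : V →L[ℝ] LB D}
    (h0 : IsCompactOperator (hT.pullO.comp T)) (h1 : IsCompactOperator (hT.pullN.comp T)) :
    IsCompactOperator T := by
  have h : T = (hT.push 1 0).comp (hT.pullO.comp T) + (hT.push 0 1).comp (hT.pullN.comp T) :=
    ContinuousLinearMap.ext fun v => hT.eq_push_add_push (T v)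
  rw [h]
  exact (h0.clm_comp (hT.push 1 0)).add (h1.clm_comp (hT.push 0 1))

end Push

/-! ### The resolvent of the Steklov problem on a tube -/

section Coercive

variable {L ε μ b : ℝ} {γ n : ℝ → E2} {κ : ℝ → ℝ} {D : Set E2}

theorem IsTube.exists_coeffBound (hT : IsTube L γ n κ ε D) :
    ∃ c M K, 0 < c ∧ 0 ≤ M ∧ 0 ≤ K ∧ IsCoeffBound L κ ε c M K := by
  obtain ⟨c, hc, h1⟩ := hT.exists_jac_ge
  obtain ⟨M, hM, h2⟩ := exists_bound_Q L hT.continuous_jac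
  obtain ⟨K, hK, h3⟩ := exists_bound_I L hT.smooth_curvature.continuous
  exact ⟨c, M, K, hc, hM, hK, hT.smooth_curvature.continuous, h1,
    fun p hp => (le_abs_self _).trans (h2 p hp), h3⟩

theorem IsTube.norm_sq_le (hT : IsTube L γ n κ ε D) {c M K : ℝ} (hc : 0 ≤ c)
    (h : IsCoeffBound L κ ε c M K) (f : LD D) : ‖f‖ ^ 2 ≤ ε * (M * ‖hT.pull f‖ ^ 2) := by
  rw [← real_inner_self_eq_norm_sq, hT.inner_eq]
  refine mul_le_mul_of_nonneg_left ?_ hT.eps_pos.le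
  refine (real_inner_le_norm _ _).trans ?_
  rw [sq, ← mul_assoc]
  exact mul_le_mul_of_nonneg_right (h.norm_jacOp_le hc _) (norm_nonneg _)

theorem IsTube.norm_sq_bdry_le (hT : IsTube L γ n κ ε D) {c M K : ℝ} (hc : 0 ≤ c)
    (h : IsCoeffBound L κ ε c M K) (f : LB D) :
    ‖f‖ ^ 2 ≤ ‖hT.pullO f‖ ^ 2 + M * ‖hT.pullN f‖ ^ 2 := by
  rw [hT.norm_sq_bdry]
  refine add_le_add le_rfl ((real_inner_le_norm _ _).trans ?_)
  rw [sq, ← mul_assoc]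
  exact mul_le_mul_of_nonneg_right (h.norm_innerJac_le hc _) (norm_nonneg _)

theorem IsTube.form_self_nonneg_parts (hT : IsTube L γ n κ ε D) (hμ : 0 ≤ μ) (hb : 0 ≤ b)
    (v : H2Data D) (i j : Fin 2) : ‖(v.2 i).2.1 j‖ ^ 2 ≤ hT.form μ b v v := by
  have h1 : 0 ≤ ε := hT.eps_pos.le
  rw [IsTube.form]
  simp only [real_inner_self_eq_norm_sq]
  have h2 : ‖(v.2 i).2.1 j‖ ^ 2 ≤ ∑ i, ∑ j, ‖(v.2 i).2.1 j‖ ^ 2 :=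
    (Finset.single_le_sum (f := fun j => ‖(v.2 i).2.1 j‖ ^ 2) (fun _ _ => sq_nonneg _)
      (Finset.mem_univ j)).trans
    (Finset.single_le_sum (f := fun i => ∑ j, ‖(v.2 i).2.1 j‖ ^ 2)
      (fun _ _ => Finset.sum_nonneg fun _ _ => sq_nonneg _) (Finset.mem_univ i))
  have h3 : 0 ≤ μ * ‖hT.nder v‖ ^ 2 := by positivity
  have h4 : 0 ≤ ε * b * ‖v.1.2.2‖ ^ 2 := by positivity
  linarith

/-- Coercivity of the form. -/
theorem IsTube.exists_coercive (hT : IsTube L γ n κ ε D) (hμ : 0 < μ) (hb : 0 < b) :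
    ∃ C, 0 ≤ C ∧ ∀ v, IsH2Data D v → ∀ X, 0 ≤ X → hT.form μ b v v = X ^ 2 → ‖v‖ ≤ C * X := by
  obtain ⟨c, M, K, hc, hM, hK, hcoef⟩ := hT.exists_coeffBound
  obtain ⟨C, hC, hfield⟩ := exists_field_bound hT.L_pos hc hM hK hT.eps_pos hμ hb
  have hε := hT.eps_pos
  set σ := Real.sqrt ε with hσ
  have hσ0 : 0 < σ := Real.sqrt_pos.2 hε
  have hσσ : σ * σ = ε := Real.mul_self_sqrt hε.le
  set C₁ := C * σ⁻¹ with hC₁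
  have hC₁0 : 0 ≤ C₁ := by positivity
  set R := 1 + Real.sqrt (ε * (M * (C₁ ^ 2 + (σ * C₁) ^ 2))) +
    Real.sqrt (C₁ ^ 2 + (σ * C₁) ^ 2 + M * (C₁ ^ 2 + (σ * C₁) ^ 2)) with hR
  have hR0 : 0 ≤ R := by positivity
  refine ⟨R, hR0, fun v hv X hX hform => ?_⟩
  -- The form is ε times the energy, hence the energy is (X/√ε)². The width is fixed in this
  -- statement, so the constant may depend on ε.
  have hflat : IsFieldBound ε (C * (X / σ)) (hT.flat v) := by
    refine hfield ε hε le_rfl κ hcoef _ (hT.isFlatField hv) (X / σ) (by positivity) ?_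
    rw [hT.form_eq μ b hv hv] at hform
    rw [div_pow, ← hform, sq σ, hσσ, mul_div_cancel_left₀ _ hε.ne']
  have hCX : C * (X / σ) = C₁ * X := by rw [hC₁]; ring
  rw [hCX] at hflat
  have hd := hT.continuous_deriv
  have hn := hT.smooth_normal.continuous
  set k := C₁ ^ 2 + (σ * C₁) ^ 2 with hk
  have hk0 : 0 ≤ k := by positivity
  have sqle : ∀ {x y : ℝ}, 0 ≤ x → x ≤ y → x ^ 2 ≤ y ^ 2 := fun h0 h => pow_le_pow_left₀ h0 h 2
  have root : ∀ {x k : ℝ}, 0 ≤ k → x ^ 2 ≤ k * X ^ 2 → x ≤ Real.sqrt k * X := by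
    intro x k hk h
    refine (abs_le_of_sq_le_sq' ?_ (by positivity)).2
    rw [mul_pow, Real.sq_sqrt hk]; exact h
  have hRa : Real.sqrt (ε * (M * k)) * X ≤ R * X := by
    refine mul_le_mul_of_nonneg_right ?_ hX
    rw [hR]
    linarith [Real.sqrt_nonneg (k + M * k)]
  have hRb : Real.sqrt (k + M * k) * X ≤ R * X := by
    refine mul_le_mul_of_nonneg_right ?_ hX
    rw [hR]
    linarith [Real.sqrt_nonneg (ε * (M * k))]
  have hRc : X ≤ R * X := by
    have : 1 * X ≤ R * X := by
      refine mul_le_mul_of_nonneg_right ?_ hX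
      rw [hR]
      linarith [Real.sqrt_nonneg (ε * (M * k)), Real.sqrt_nonneg (k + M * k)]
    linarith
  have hk1 : C₁ ^ 2 ≤ k := by rw [hk]; linarith [sq_nonneg (σ * C₁)]
  have hX2 : 0 ≤ X ^ 2 := sq_nonneg X
  have bval : ‖v.1.1‖ ≤ R * X := by
    refine (root (by positivity) ?_).trans hRa
    have h1 := hT.norm_sq_le hc.le hcoef v.1.1
    have h2 := sqle (norm_nonneg _) hflat.W
    have h3 : ‖hT.pull v.1.1‖ ^ 2 ≤ k * X ^ 2 := by
      refine h2.trans ?_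
      rw [mul_pow]; exact mul_le_mul_of_nonneg_right hk1 hX2
    calc ‖v.1.1‖ ^ 2 ≤ ε * (M * ‖hT.pull v.1.1‖ ^ 2) := h1
      _ ≤ ε * (M * (k * X ^ 2)) := by gcongr
      _ = _ := by ring
  have bgrad : ∀ i, ‖v.1.2.1 i‖ ≤ R * X := by
    intro i
    refine (root (by positivity) ?_).trans hRa
    have h1 := hT.norm_sq_le hc.le hcoef (v.1.2.1 i)
    have h2 := parsevalQ hd hn hT.norm_deriv hT.norm_normal hT.inner_deriv_normal
      (fun i => hT.pull (v.1.2.1 i)) (fun i => hT.pull (v.1.2.1 i))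
    simp only [real_inner_self_eq_norm_sq] at h2
    have h3 := sqle (norm_nonneg _) hflat.r
    have h4 := sqle (norm_nonneg _) hflat.q
    have h5 : ‖hT.pull (v.1.2.1 i)‖ ^ 2 ≤ k * X ^ 2 := by
      have h6 : ‖hT.pull (v.1.2.1 i)‖ ^ 2 ≤
          ‖hT.pull (v.1.2.1 0)‖ ^ 2 + ‖hT.pull (v.1.2.1 1)‖ ^ 2 := by
        fin_cases i
        · exact le_add_of_nonneg_right (sq_nonneg _)
        · exact le_add_of_nonneg_left (sq_nonneg _)
      calc _ ≤ _ := h6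
        _ = ‖(hT.flat v).r‖ ^ 2 + ‖(hT.flat v).q‖ ^ 2 := h2
        _ ≤ _ := add_le_add h3 h4
        _ = _ := by rw [hk, hσ]; ring
    calc ‖v.1.2.1 i‖ ^ 2 ≤ ε * (M * ‖hT.pull (v.1.2.1 i)‖ ^ 2) := h1
      _ ≤ ε * (M * (k * X ^ 2)) := by gcongr
      _ = _ := by ring
  have bhess : ∀ i j, ‖(v.2 i).2.1 j‖ ≤ R * X := by
    intro i j
    refine le_trans ?_ hRc
    have := hT.form_self_nonneg_parts hμ.le hb.le v i j
    rw [hform] at this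
    exact (abs_le_of_sq_le_sq' this hX).2
  have btr : ‖v.1.2.2‖ ≤ R * X := by
    refine (root (by positivity) ?_).trans hRb
    have h1 := hT.norm_sq_bdry_le hc.le hcoef v.1.2.2
    have h2 := sqle (norm_nonneg _) hflat.W₀
    have h3 := sqle (norm_nonneg _) hflat.W₁
    have h4 : (C₁ * X) ^ 2 ≤ k * X ^ 2 := by
      rw [mul_pow]; exact mul_le_mul_of_nonneg_right hk1 hX2
    calc ‖v.1.2.2‖ ^ 2 ≤ _ := h1
      _ ≤ (C₁ * X) ^ 2 + M * (C₁ * X) ^ 2 := by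
          exact add_le_add h2 (mul_le_mul_of_nonneg_left h3 hM)
      _ ≤ k * X ^ 2 + M * (k * X ^ 2) := by gcongr
      _ = _ := by ring
  have btg : ∀ i, ‖(v.2 i).2.2‖ ≤ R * X := by
    intro i
    refine (root (by positivity) ?_).trans hRb
    have h1 := hT.norm_sq_bdry_le hc.le hcoef (v.2 i).2.2
    have ho := parsevalI hd hn hT.norm_deriv hT.norm_normal hT.inner_deriv_normal
      (fun i => hT.pullO (v.2 i).2.2) (fun i => hT.pullO (v.2 i).2.2)
    have hi := parsevalI hd hn hT.norm_deriv hT.norm_normal hT.inner_deriv_normal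
      (fun i => hT.pullN (v.2 i).2.2) (fun i => hT.pullN (v.2 i).2.2)
    simp only [real_inner_self_eq_norm_sq] at ho hi
    have ho' : ‖hT.pullO (v.2 i).2.2‖ ^ 2 ≤ k * X ^ 2 := by
      have h6 : ‖hT.pullO (v.2 i).2.2‖ ^ 2 ≤
          ‖hT.pullO (v.2 0).2.2‖ ^ 2 + ‖hT.pullO (v.2 1).2.2‖ ^ 2 := by
        fin_cases i
        · exact le_add_of_nonneg_right (sq_nonneg _)
        · exact le_add_of_nonneg_left (sq_nonneg _)
      calc _ ≤ _ := h6
        _ = ‖(hT.flat v).r₀‖ ^ 2 + ‖(hT.flat v).q₀‖ ^ 2 := ho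
        _ ≤ _ := add_le_add (sqle (norm_nonneg _) hflat.r₀) (sqle (norm_nonneg _) hflat.q₀)
        _ = _ := by rw [hk, hσ]; ring
    have hi' : ‖hT.pullN (v.2 i).2.2‖ ^ 2 ≤ k * X ^ 2 := by
      have h6 : ‖hT.pullN (v.2 i).2.2‖ ^ 2 ≤
          ‖hT.pullN (v.2 0).2.2‖ ^ 2 + ‖hT.pullN (v.2 1).2.2‖ ^ 2 := by
        fin_cases i
        · exact le_add_of_nonneg_right (sq_nonneg _)
        · exact le_add_of_nonneg_left (sq_nonneg _)
      calc _ ≤ _ := h6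
        _ = ‖(hT.flat v).r₁‖ ^ 2 + ‖(hT.flat v).q₁‖ ^ 2 := hi
        _ ≤ _ := add_le_add (sqle (norm_nonneg _) hflat.r₁) (sqle (norm_nonneg _) hflat.q₁)
        _ = _ := by rw [hk, hσ]; ring
    calc ‖(v.2 i).2.2‖ ^ 2 ≤ _ := h1
      _ ≤ k * X ^ 2 + M * (k * X ^ 2) := by gcongr
      _ = _ := by ring
  have hRX : 0 ≤ R * X := by positivity
  refine norm_prod_le_iff.2 ⟨norm_prod_le_iff.2 ⟨bval, norm_prod_le_iff.2
    ⟨(pi_norm_le_iff_of_nonneg hRX).2 bgrad, btr⟩⟩, (pi_norm_le_iff_of_nonneg hRX).2 fun i => ?_⟩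
  refine norm_prod_le_iff.2 ⟨?_, norm_prod_le_iff.2
    ⟨(pi_norm_le_iff_of_nonneg hRX).2 (bhess i), btg i⟩⟩
  rw [hv.eq]
  exact bgrad i

/-- The trace as a bounded operator. -/
def trL (D : Set E2) : H2Data D →L[ℝ] LB D :=
  (ContinuousLinearMap.snd ℝ _ _).comp ((ContinuousLinearMap.snd ℝ _ _).comp
    (ContinuousLinearMap.fst ℝ _ _))

/-- The second derivatives as bounded operators. -/
def hessL (D : Set E2) (i j : Fin 2) : H2Data D →L[ℝ] LD D :=
  (ContinuousLinearMap.proj (φ := fun _ : Fin 2 => LD D) j).comp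
    ((ContinuousLinearMap.fst ℝ _ (LB D)).comp
    ((ContinuousLinearMap.snd ℝ (LD D) _).comp
      ((ContinuousLinearMap.proj (φ := fun _ : Fin 2 => TraceData D) i).comp
      (ContinuousLinearMap.snd ℝ (TraceData D) _))))

/-- The traces of the first derivatives as bounded operators. -/
def trGradL (D : Set E2) (i : Fin 2) : H2Data D →L[ℝ] LB D :=
  (ContinuousLinearMap.snd ℝ _ _).comp
    ((ContinuousLinearMap.snd ℝ (LD D) _).comp ((ContinuousLinearMap.proj i).comp
      (ContinuousLinearMap.snd ℝ _ _)))

/-- The normal derivative as a bounded operator. -/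
def IsTube.nderL (hT : IsTube L γ n κ ε D) : H2Data D →L[ℝ] LB D :=
  ∑ i, (mulOp (bdryMeasure D) (hT.normalExt i)).comp (trGradL D i)

theorem IsTube.nderL_apply (hT : IsTube L γ n κ ε D) (v : H2Data D) :
    hT.nderL v = hT.nder v := by
  simp only [IsTube.nderL, IsTube.nder, Fin.sum_univ_two]
  rfl

/-- Solvability of the Steklov problem on a tube. -/
theorem IsTube.exists_solution (hT : IsTube L γ n κ ε D) (hμ : 0 < μ) (hb : 0 < b) :
    ∃ S : LB D →L[ℝ] h2Sub hT.isTame, ∀ f w, IsH2Data D w →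
      hT.form μ b (S f : H2Data D) w = inner ℝ f w.1.2.2 := by
  obtain ⟨C, hC, hcoer⟩ := hT.exists_coercive hμ hb
  have hε := hT.eps_pos
  have hεb : 0 < Real.sqrt (ε * b) := Real.sqrt_pos.2 (by positivity)
  have : CompleteSpace (h2Sub hT.isTame) := (isClosed_h2Sub hT.isTame).completeSpace_coe
  let A : Fin 2 × Fin 2 → h2Sub hT.isTame →L[ℝ] LD D := fun p =>
    (hessL D p.1 p.2).comp (h2Sub hT.isTame).subtypeL
  -- Square roots of the coefficients make the form a sum of squares; the root √(εb) on the trace is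
  -- undone by its inverse in the load.
  let B : Fin 2 → h2Sub hT.isTame →L[ℝ] LB D :=
    ![(Real.sqrt (ε * b) • trL D).comp (h2Sub hT.isTame).subtypeL,
      (Real.sqrt μ • hT.nderL).comp (h2Sub hT.isTame).subtypeL]
  have hform : ∀ v w : h2Sub hT.isTame, (∑ p, inner ℝ (A p v) (A p w)) +
      (∑ k, inner ℝ (B k v) (B k w)) = hT.form μ b (v : H2Data D) (w : H2Data D) := by
    intro v w
    rw [Fintype.sum_prod_type, Fin.sum_univ_two (f := fun k => inner ℝ (B k v) (B k w))]
    have h1 : inner ℝ (B 0 v) (B 0 w) = ε * b * inner ℝ (v : H2Data D).1.2.2 (w : H2Data D).1.2.2 := by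
      change inner ℝ (Real.sqrt (ε * b) • (v : H2Data D).1.2.2)
        (Real.sqrt (ε * b) • (w : H2Data D).1.2.2) = _
      rw [inner_smul_left, inner_smul_right, ← mul_assoc, RCLike.conj_to_real,
        Real.mul_self_sqrt (by positivity)]
    have h2 : inner ℝ (B 1 v) (B 1 w) = μ * inner ℝ (hT.nder v) (hT.nder w) := by
      change inner ℝ (Real.sqrt μ • hT.nderL v) (Real.sqrt μ • hT.nderL w) = _
      rw [inner_smul_left, inner_smul_right, ← mul_assoc, RCLike.conj_to_real,
        Real.mul_self_sqrt hμ.le, hT.nderL_apply, hT.nderL_apply]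
    rw [h1, h2, IsTube.form, add_comm (ε * b * _), ← add_assoc]
    rfl
  obtain ⟨S, hS⟩ := exists_solution_of_sum A B (C := C) (fun v X hX h => by
    refine hcoer v v.2 X hX ?_
    rw [← hform, ← h]
    simp only [real_inner_self_eq_norm_sq])
    ((Real.sqrt (ε * b))⁻¹ • ContinuousLinearMap.id ℝ (LB D)) 0
  refine ⟨S, fun f w hw => ?_⟩
  have h1 := hS f ⟨w, hw⟩
  rw [hform] at h1
  rw [h1]
  change inner ℝ ((Real.sqrt (ε * b))⁻¹ • f) (Real.sqrt (ε * b) • w.1.2.2) = _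
  rw [inner_smul_left, inner_smul_right, ← mul_assoc, RCLike.conj_to_real,
    inv_mul_cancel₀ hεb.ne', one_mul]

theorem IsTube.form_sub_left (hT : IsTube L γ n κ ε D) (v v' w : H2Data D) :
    hT.form μ b (v - v') w = hT.form μ b v w - hT.form μ b v' w := by
  simp only [IsTube.form, ← hT.nderL_apply, map_sub, Prod.fst_sub, Prod.snd_sub, Pi.sub_apply,
    inner_sub_left, Finset.sum_sub_distrib]
  ring

/-- Uniqueness for the Steklov problem on a tube. -/
theorem IsTube.eq_of_form_eq (hT : IsTube L γ n κ ε D) (hμ : 0 < μ) (hb : 0 < b) {v v' : H2Data D}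
    (hv : IsH2Data D v) (hv' : IsH2Data D v')
    (h : ∀ w, IsH2Data D w → hT.form μ b v w = hT.form μ b v' w) : v = v' := by
  obtain ⟨C, hC, hcoer⟩ := hT.exists_coercive hμ hb
  have hs : IsH2Data D (v - v') := (h2Sub hT.isTame).sub_mem hv hv'
  have h1 := hcoer (v - v') hs 0 le_rfl (by
    rw [hT.form_sub_left, h _ hs, sub_self]; simp)
  rw [mul_zero] at h1
  exact sub_eq_zero.1 (norm_le_zero_iff.1 h1)

end Coercive

/-! ### Compactness of the trace -/

section Compact

variable {L ε μ b : ℝ} {γ n : ℝ → E2} {κ : ℝ → ℝ} {D : Set E2}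

/-- The weighted average of a Sobolev function is a primitive. -/
theorem IsStrip.avI_mul_eq (hL : 0 < L) {x : StripData L} (hx : IsStrip L x) :
    avI L (mulOp (muQ L) (fun p => 1 - p.2) x.1) =
      primI L (avI L (mulOp (muQ L) (fun p => 1 - p.2) x.2.1)) +
        meanI L (avI L (mulOp (muQ L) (fun p => 1 - p.2) x.1)) • oneI L := by
  have hm : IsSmoothPeriodic L (fun p => 1 - p.2) := ⟨by fun_prop, fun _ _ => rfl⟩
  have h1 : dS (fun p : ℝ × ℝ => 1 - p.2) = fun _ => 0 := by
    funext p
    exact (hasDerivAt_dS hm.differentiable p.1 p.2).unique (hasDerivAt_const p.1 (1 - p.2))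
  have h2 : mulOp (muQ L) (fun _ => (0 : ℝ)) x.1 = 0 := by
    refine Lp.ext ?_
    filter_upwards [coeFn_mulOp (isBddWeight_Q (L := L) (f := fun _ => (0 : ℝ)) (by fun_prop)) x.1,
      Lp.coeFn_zero ℝ 2 (muQ L)] with p h3 h4
    rw [h3, h4]; simp
  have h := (hx.mul hm).avI_eq hL
  simp only [mulStrip, h1, h2, zero_add] at h
  exact h

/-- These four components are the ones from which the trace is reconstructed in
`IsTube.isCompactOperator_trace`; there they are needed as bounded operators. -/
theorem linear_flat (hT : IsTube L γ n κ ε D) :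
    (∃ T : H2Data D →L[ℝ] LQ L, ∀ v, T v = (hT.flat v).W) ∧
    (∃ T : H2Data D →L[ℝ] LQ L, ∀ v, T v = (hT.flat v).r) ∧
    (∃ T : H2Data D →L[ℝ] LQ L, ∀ v, T v = (hT.flat v).q) ∧
    (∃ T : H2Data D →L[ℝ] LQ L, ∀ v, T v = (hT.flat v).b) := by
  refine ⟨⟨⟨⟨⟨fun v => (hT.flat v).W, ?_⟩, ?_⟩, ?_⟩, fun v => rfl⟩,
    ⟨⟨⟨⟨fun v => (hT.flat v).r, ?_⟩, ?_⟩, ?_⟩, fun v => rfl⟩,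
    ⟨⟨⟨⟨fun v => (hT.flat v).q, ?_⟩, ?_⟩, ?_⟩, fun v => rfl⟩,
    ⟨⟨⟨⟨fun v => (hT.flat v).b, ?_⟩, ?_⟩, ?_⟩, fun v => rfl⟩⟩
  all_goals simp only [IsTube.flat, quadQ, linQ, Fin.sum_univ_two]
  all_goals first
    | fun_prop
    | (intro v w; simp only [Prod.fst_add, Prod.snd_add, Pi.add_apply, map_add]; done)
    | (intro c v; simp only [Prod.smul_fst, Prod.smul_snd, Pi.smul_apply, map_smul, smul_add,
        map_add, RingHom.id_apply]; done)
    | (intro v w; simp only [Prod.fst_add, Prod.snd_add, Pi.add_apply, map_add]; abel)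

/-- The trace on the boundary of a tube is a compact operator. -/
theorem IsTube.isCompactOperator_trace (hT : IsTube L γ n κ ε D) :
    IsCompactOperator ((trL D).comp (h2Sub hT.isTame).subtypeL) := by
  obtain ⟨⟨WL, hWL⟩, ⟨rL, hrL⟩, ⟨qL, hqL⟩, bL, hbL⟩ := linear_flat hT
  have hL := hT.L_pos
  have hprim : ∀ T U : H2Data D →L[ℝ] LI L, IsCompactOperator
      ((primI L).comp T + ((meanI L).comp U).smulRight (oneI L)) := fun T U =>
    ((isCompactOperator_primI hL).comp_clm T).add (isCompactOperator_smulRight _ _)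
  -- On the outer curve the trace is the average of W plus ε times the average of (1 − t)q; on the
  -- inner one ε times the average of q is subtracted. Each average is a primitive of L² data (W_s =
  -- Jr and q_s = Jb + κr) plus its mean value, that is, a compact operator of the data.
  let qsL : H2Data D →L[ℝ] LQ L := (jacOp L κ ε).comp bL + (fstOp L κ).comp rL
  let mL : LQ L →L[ℝ] LI L := (avI L).comp (mulOp (muQ L) (fun p => 1 - p.2))
  let T₁ := (primI L).comp ((avI L).comp ((jacOp L κ ε).comp rL)) +
    ((meanI L).comp ((avI L).comp WL)).smulRight (oneI L)
  let T₂ := (primI L).comp (mL.comp qsL) + ((meanI L).comp (mL.comp qL)).smulRight (oneI L)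
  let T₃ := (primI L).comp ((avI L).comp qsL) +
    ((meanI L).comp ((avI L).comp qL)).smulRight (oneI L)
  have h0 : ∀ v, IsH2Data D v → hT.pullO v.1.2.2 = (T₁ + ε • T₂) v := by
    intro v hv
    have hf := hT.isFlatField hv
    have h1 := hf.strip_W.lower_eq
    have h2 := hf.strip_W.avI_eq hL
    have h3 := hf.strip_q.avI_mul_eq hL
    simp only at h1 h2 h3
    change (hT.flat v).W₀ = _
    rw [h1, h2, map_smul, map_smul, neg_smul, sub_neg_eq_add, h3]
    simp only [T₁, T₂, qsL, mL, add_apply, FunLike.coe_smul, Pi.smul_apply, ContinuousLinearMap.comp_apply,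
      ContinuousLinearMap.smulRight_apply, hWL, hrL, hqL, hbL]
  have h1 : ∀ v, IsH2Data D v → hT.pullN v.1.2.2 = (T₁ + ε • T₂ - ε • T₃) v := by
    intro v hv
    have hf := hT.isFlatField hv
    have h1 := hf.strip_W.upper_sub_lower
    have h3 := hf.strip_q.avI_eq hL
    simp only at h1 h3
    have h4 : hT.pullN v.1.2.2 = hT.pullO v.1.2.2 - ε • avI L (hT.flat v).q := by
      have : hT.pullN v.1.2.2 - hT.pullO v.1.2.2 = _ := h1
      rw [sub_eq_iff_eq_add] at this
      rw [this, map_smul, neg_smul]; abel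
    rw [h4, h0 v hv, h3]
    simp only [T₁, T₂, T₃, qsL, mL, add_apply, sub_apply, FunLike.coe_smul, Pi.smul_apply,
      ContinuousLinearMap.comp_apply,
      ContinuousLinearMap.smulRight_apply, hWL, hrL, hqL, hbL]
  have c1 : IsCompactOperator T₁ := hprim _ _
  have c2 : IsCompactOperator T₂ := hprim _ _
  have c3 : IsCompactOperator T₃ := hprim _ _
  have c4 : IsCompactOperator (T₁ + ε • T₂) := c1.add (c2.smul ε)
  have c5 : IsCompactOperator (T₁ + ε • T₂ - ε • T₃) := c4.sub (c3.smul ε)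
  refine hT.isCompactOperator_of_pull ?_ ?_
  · have : hT.pullO.comp ((trL D).comp (h2Sub hT.isTame).subtypeL) =
        (T₁ + ε • T₂).comp (h2Sub hT.isTame).subtypeL :=
      ContinuousLinearMap.ext fun v => h0 v v.2
    rw [this]
    exact c4.comp_clm _
  · have : hT.pullN.comp ((trL D).comp (h2Sub hT.isTame).subtypeL) =
        (T₁ + ε • T₂ - ε • T₃).comp (h2Sub hT.isTame).subtypeL :=
      ContinuousLinearMap.ext fun v => h1 v v.2
    rw [this]
    exact c5.comp_clm _

end Compact

/-! ### The Steklov resolvent on the thin set -/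

section FormIntegral

variable {L ε μ b : ℝ} {γ n : ℝ → E2} {κ : ℝ → ℝ} {D : Set E2}

theorem inner_eq_integral_of_ae {α : Type*} [MeasurableSpace α] {ν : Measure α} {x y : Lp ℝ 2 ν}
    {f g : α → ℝ} (hf : x =ᵐ[ν] f) (hg : y =ᵐ[ν] g) : inner ℝ x y = ∫ p, f p * g p ∂ν := by
  rw [inner_eq_integral]
  refine integral_congr_ae ?_
  filter_upwards [hf, hg] with p h1 h2
  rw [h1, h2]

theorem integrable_mul_of_ae {α : Type*} [MeasurableSpace α] {ν : Measure α} {x y : Lp ℝ 2 ν}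
    {f g : α → ℝ} (hf : x =ᵐ[ν] f) (hg : y =ᵐ[ν] g) : Integrable (fun p => f p * g p) ν := by
  refine (integrable_mul_Lp x y).congr ?_
  filter_upwards [hf, hg] with p h1 h2
  rw [h1, h2]

theorem IsTube.form_eq_integral (hT : IsTube L γ n κ ε D) {v w : H2Data D}
    {h k : Fin 2 → Fin 2 → E2 → ℝ} {u₀ u₁ φ₀ φ₁ : E2 → ℝ}
    (hh : ∀ i j, (v.2 i).2.1 j =ᵐ[volume.restrict D] h i j)
    (hk : ∀ i j, (w.2 i).2.1 j =ᵐ[volume.restrict D] k i j)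
    (hu₀ : v.1.2.2 =ᵐ[bdryMeasure D] u₀) (hφ₀ : w.1.2.2 =ᵐ[bdryMeasure D] φ₀)
    (hu₁ : (fun x => ∑ i, (v.2 i).2.2 x * outerNormal D x i) =ᵐ[bdryMeasure D] u₁)
    (hφ₁ : (fun x => ∑ i, (w.2 i).2.2 x * outerNormal D x i) =ᵐ[bdryMeasure D] φ₁) :
    hT.form μ b v w = (∫ x in D, ∑ i, ∑ j, h i j x * k i j x) +
      μ * (∫ x, u₁ x * φ₁ x ∂(bdryMeasure D)) + ε * b * (∫ x, u₀ x * φ₀ x ∂(bdryMeasure D)) := by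
  rw [IsTube.form, inner_eq_integral_of_ae hu₀ hφ₀,
    inner_eq_integral_of_ae ((hT.coeFn_nder v).trans hu₁) ((hT.coeFn_nder w).trans hφ₁),
    integral_finsetSum _ fun i _ => integrable_finsetSum _ fun j _ =>
      integrable_mul_of_ae (hh i j) (hk i j)]
  congr 2
  refine Finset.sum_congr rfl fun i _ => ?_
  rw [integral_finsetSum _ fun j _ => integrable_mul_of_ae (hh i j) (hk i j)]
  exact Finset.sum_congr rfl fun j _ => inner_eq_integral_of_ae (hh i j) (hk i j)

end FormIntegral

section Resolvent

variable {L ε μ b : ℝ} {γ n : ℝ → E2} {κ : ℝ → ℝ} {Ω : Set E2}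

/-- The weak formulation in terms of data in `L²` spaces. -/
theorem IsTube.isSteklovSolution_of_form (hT : IsTube L γ n κ ε (thinSet Ω ε))
    {v : H2Data (thinSet Ω ε)} (hv : IsH2Data _ v) {f : LB (thinSet Ω ε)} {F : E2 → ℝ}
    (hF : f =ᵐ[bdryMeasure (thinSet Ω ε)] F)
    (h : ∀ w, IsH2Data _ w → hT.form μ b v w = inner ℝ f w.1.2.2) :
    IsSteklovSolution Ω μ b ε F (hv.toH2 hT.isTame) v.1.2.2
      (fun x => ∑ i, (v.2 i).2.2 x * outerNormal (thinSet Ω ε) x i) := by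
  refine ⟨hv.hasBoundaryValues hT.isTame, fun φ φ₀ φ₁ hφ => ?_⟩
  obtain ⟨w, hw, hh, h0, h1⟩ := exists_isH2Data hT.isTame hφ
  rw [← inner_eq_integral_of_ae hF h0, ← h w hw]
  exact (hT.form_eq_integral (fun i j => EventuallyEq.rfl) hh EventuallyEq.rfl h0
    EventuallyEq.rfl h1).symm

theorem IsTube.exists_form_of_isSteklovSolution (hT : IsTube L γ n κ ε (thinSet Ω ε))
    {f : LB (thinSet Ω ε)} {F : E2 → ℝ} (hF : f =ᵐ[bdryMeasure (thinSet Ω ε)] F)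
    {u : H2 (thinSet Ω ε)} {u₀ u₁ : E2 → ℝ} (h : IsSteklovSolution Ω μ b ε F u u₀ u₁) :
    ∃ v, IsH2Data _ v ∧ (∀ w, IsH2Data _ w → hT.form μ b v w = inner ℝ f w.1.2.2) ∧
      v.1.2.2 =ᵐ[bdryMeasure (thinSet Ω ε)] u₀ := by
  obtain ⟨v, hv, hh, h0, h1⟩ := exists_isH2Data hT.isTame h.1
  refine ⟨v, hv, fun w hw => ?_, h0⟩
  rw [inner_eq_integral_of_ae hF EventuallyEq.rfl,
    ← h.2 _ _ _ (hw.hasBoundaryValues hT.isTame)]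
  exact hT.form_eq_integral hh (fun i j => EventuallyEq.rfl) h0 EventuallyEq.rfl h1
    EventuallyEq.rfl

theorem inv_sq_pos {ε : ℝ} (hε : 0 < ε) : 0 < (ε ^ 2)⁻¹ := by positivity

/-- The identity from `L²(∂ω_ε; ε⁻² dσ)` to `L²(∂ω_ε)`. -/
abbrev ofHeps (Ω : Set E2) (ε : ℝ) : Heps Ω ε →L[ℝ] LB (thinSet Ω ε) :=
  ofSmul (bdryMeasure (thinSet Ω ε)) (ε ^ 2)⁻¹

/-- The identity from `L²(∂ω_ε)` to `L²(∂ω_ε; ε⁻² dσ)`. -/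
abbrev toHeps (Ω : Set E2) (ε : ℝ) : LB (thinSet Ω ε) →L[ℝ] Heps Ω ε :=
  toSmul (bdryMeasure (thinSet Ω ε)) (ε ^ 2)⁻¹

/-- Values of the resolvent. -/
theorem IsSteklovResolvent.exists_data {B : Heps Ω ε →L[ℝ] Heps Ω ε}
    (hB : IsSteklovResolvent Ω μ b ε B) (hT : IsTube L γ n κ ε (thinSet Ω ε)) (f : Heps Ω ε) :
    ∃ v, IsH2Data _ v ∧ (∀ w, IsH2Data _ w → hT.form μ b v w = inner ℝ (ofHeps Ω ε f) w.1.2.2) ∧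
      ofHeps Ω ε (B f) = ε • v.1.2.2 := by
  have hε := inv_sq_pos hT.eps_pos
  obtain ⟨⟨u, u₀, u₁, hu⟩, huniq⟩ := hB f
  obtain ⟨v, hv, hform, h0⟩ := hT.exists_form_of_isSteklovSolution (coeFn_ofSmul hε f) hu
  refine ⟨v, hv, hform, Lp.ext ?_⟩
  filter_upwards [huniq u u₀ u₁ hu, coeFn_ofSmul hε (B f), Lp.coeFn_smul ε v.1.2.2, h0]
    with x h1 h2 h3 h4
  rw [h2, h1, h3, Pi.smul_apply, h4, smul_eq_mul]

/-- The resolvent of the Steklov problem exists and is a compact operator. -/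
theorem IsTube.exists_resolvent (hT : IsTube L γ n κ ε (thinSet Ω ε)) (hμ : 0 < μ) (hb : 0 < b) :
    ∃ B : Heps Ω ε →L[ℝ] Heps Ω ε, IsSteklovResolvent Ω μ b ε B ∧ IsCompactOperator B := by
  have hε := inv_sq_pos hT.eps_pos
  obtain ⟨S, hS⟩ := hT.exists_solution hμ hb
  let T : h2Sub hT.isTame →L[ℝ] LB (thinSet Ω ε) :=
    (trL (thinSet Ω ε)).comp (h2Sub hT.isTame).subtypeL
  let R : Heps Ω ε →L[ℝ] h2Sub hT.isTame := ε • S.comp (ofHeps Ω ε)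
  refine ⟨(toHeps Ω ε).comp (T.comp R), fun f => ⟨?_, fun u u₀ u₁ hu => ?_⟩,
    (hT.isCompactOperator_trace.comp_clm R).clm_comp (toHeps Ω ε)⟩
  · exact ⟨_, _, _, hT.isSteklovSolution_of_form (S (ofHeps Ω ε f)).2 (coeFn_ofSmul hε f)
      (hS (ofHeps Ω ε f))⟩
  · obtain ⟨v, hv, hform, h0⟩ := hT.exists_form_of_isSteklovSolution (coeFn_ofSmul hε f) hu
    have hvS : v = S (ofHeps Ω ε f) := hT.eq_of_form_eq hμ hb hv (S (ofHeps Ω ε f)).2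
      fun w hw => by rw [hform w hw, hS _ w hw]
    have h1 : T (R f) = ε • v.1.2.2 := by
      rw [hvS]; rfl
    change toHeps Ω ε (T (R f)) =ᵐ[_] _
    filter_upwards [coeFn_toSmul hε (T (R f)), Lp.coeFn_smul ε v.1.2.2, h0] with x h2 h3 h4
    rw [h2, h1, h3, Pi.smul_apply, h4, smul_eq_mul]

/-- A solution exists for each datum, and both operators have to agree with its trace. -/
theorem IsSteklovResolvent.unique {B B' : Heps Ω ε →L[ℝ] Heps Ω ε}
    (hB : IsSteklovResolvent Ω μ b ε B) (hB' : IsSteklovResolvent Ω μ b ε B') : B = B' := by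
  refine ContinuousLinearMap.ext fun f => Lp.ext (ae_smul_of_ae ?_)
  obtain ⟨⟨u, u₀, u₁, hu⟩, huniq⟩ := hB f
  exact (huniq u u₀ u₁ hu).trans ((hB' f).2 u u₀ u₁ hu).symm

end Resolvent

/-! ### The connecting maps -/

section Connecting

variable {L ε : ℝ} {γ : ℝ → E2} {Ω : Set E2}

/-- The identity from `L²((0, L), 2 ds)` to `L²(0, L)`. -/
theorem exists_ofHzero (L : ℝ) : ∃ C, IsWComp ((2 : ℝ≥0∞) • (muI L)) (muI L) id (fun _ => 1) C := by
  have := isWComp_of_smul_measure (muI L) (c := 2) two_pos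
  rwa [show ENNReal.ofReal 2 = 2 by simp] at this

theorem exists_toHzero (L : ℝ) : ∃ C, IsWComp (muI L) ((2 : ℝ≥0∞) • (muI L)) id (fun _ => 1) C := by
  have := isWComp_smul_measure (muI L) (c := 2) two_pos
  rwa [show ENNReal.ofReal 2 = 2 by simp] at this

/-- The identity from `L²((0, L), 2 ds)` to `L²(0, L)`. -/
def ofHzero (L : ℝ) : Hzero L →L[ℝ] LI L := (exists_ofHzero L).choose_spec.op

/-- The identity from `L²(0, L)` to `L²((0, L), 2 ds)`. -/
def toHzero (L : ℝ) : LI L →L[ℝ] Hzero L := (exists_toHzero L).choose_spec.op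

theorem ae_of_ae_two_smul {p : ℝ → Prop} (h : ∀ᵐ x ∂((2 : ℝ≥0∞) • (muI L)), p x) :
    ∀ᵐ x ∂(muI L), p x :=
  (Measure.ae_ennreal_smul_measure_iff two_ne_zero).1 h

theorem coeFn_ofHzero (f : Hzero L) : ofHzero L f =ᵐ[muI L] f := by
  filter_upwards [(exists_ofHzero L).choose_spec.coeFn_op f] with x hx
  rw [ofHzero, hx, one_mul, id]

theorem coeFn_toHzero (f : LI L) : toHzero L f =ᵐ[muI L] f := by
  refine ae_of_ae_two_smul ?_
  filter_upwards [(exists_toHzero L).choose_spec.coeFn_op f] with x hx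
  rw [toHzero, hx, one_mul, id]

theorem ofHzero_toHzero (f : LI L) : ofHzero L (toHzero L f) = f :=
  Lp.ext ((coeFn_ofHzero _).trans (coeFn_toHzero f))

theorem Hzero.ext_ae {f g : Hzero L} (h : f =ᵐ[muI L] g) : f = g :=
  Lp.ext (Measure.ae_smul_measure h _)

theorem norm_sq_Hzero (f : Hzero L) : ‖f‖ ^ 2 = 2 * ‖ofHzero L f‖ ^ 2 := by
  rw [norm_sq_eq_integral, norm_sq_eq_integral, integral_smul_measure]
  simp only [ENNReal.toReal_ofNat, smul_eq_mul]
  congr 1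
  refine integral_congr_ae ?_
  filter_upwards [coeFn_ofHzero f] with x hx
  rw [hx]

variable {n : ℝ → E2} {κ : ℝ → ℝ}

theorem tubeMap_zero_right (γ n : ℝ → E2) (ε s : ℝ) : tubeMap γ n ε (s, 0) = γ s := by
  simp [tubeMap]

theorem IsTube.isConnectingMap_iff
    (hT : IsTube L γ (fun s => outerNormal Ω (γ s)) κ ε (thinSet Ω ε)) (E : Hzero L →L[ℝ] Heps Ω ε) :
    IsConnectingMap Ω L γ ε E ↔ ∀ u, hT.pullO (ofHeps Ω ε (E u)) = ε • ofHzero L u ∧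
      hT.pullN (ofHeps Ω ε (E u)) = ε • ofHzero L u := by
  have hε := inv_sq_pos hT.eps_pos
  have hO : ∀ u, hT.pullO (ofHeps Ω ε (E u)) =ᵐ[muI L] fun s => E u (fermi Ω γ ε s 0) := by
    intro u
    filter_upwards [hT.coeFn_pullO (ofHeps Ω ε (E u)),
      hT.exists_pull_outer.choose_spec.qmp.ae (coeFn_ofSmul hε (E u))] with s h1 h2
    rw [h1, h2, ← tubeMap_zero_right γ (fun s => outerNormal Ω (γ s)) ε s]; rfl
  have hN : ∀ u, hT.pullN (ofHeps Ω ε (E u)) =ᵐ[muI L] fun s => E u (fermi Ω γ ε s 1) := by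
    intro u
    filter_upwards [hT.coeFn_pullN (ofHeps Ω ε (E u)),
      hT.exists_pull_inner.choose_spec.qmp.ae (coeFn_ofSmul hε (E u))] with s h1 h2
    rw [h1, h2]; rfl
  have hz : ∀ u, (ε • ofHzero L u : LI L) =ᵐ[muI L] fun s => ε * u s := by
    intro u
    filter_upwards [Lp.coeFn_smul ε (ofHzero L u), coeFn_ofHzero u] with s h1 h2
    rw [h1, Pi.smul_apply, h2, smul_eq_mul]
  refine forall_congr' fun u => ⟨fun h => ⟨Lp.ext ?_, Lp.ext ?_⟩, fun h => ?_⟩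
  · filter_upwards [hO u, hz u, h] with s h1 h2 h3
    rw [h1, h2, h3.1]
  · filter_upwards [hN u, hz u, h] with s h1 h2 h3
    rw [h1, h2, h3.2]
  · have hO' := hO u
    rw [h.1] at hO'
    have hN' := hN u
    rw [h.2] at hN'
    filter_upwards [hO', hN', hz u] with s h1 h2 h3
    exact ⟨h1.symm.trans h3, h2.symm.trans h3⟩

theorem IsTube.exists_isConnectingMap
    (hT : IsTube L γ (fun s => outerNormal Ω (γ s)) κ ε (thinSet Ω ε)) :
    ∃ E : Hzero L →L[ℝ] Heps Ω ε, IsConnectingMap Ω L γ ε E := by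
  have hε := inv_sq_pos hT.eps_pos
  refine ⟨(toHeps Ω ε).comp ((hT.push ε ε).comp (ofHzero L)),
    (hT.isConnectingMap_iff _).2 fun u => ?_⟩
  simp only [ContinuousLinearMap.comp_apply]
  rw [ofSmul_toSmul hε, hT.pullO_push, hT.pullN_push]
  exact ⟨rfl, rfl⟩

theorem IsTube.connectingMap_unique
    (hT : IsTube L γ (fun s => outerNormal Ω (γ s)) κ ε (thinSet Ω ε))
    {E E' : Hzero L →L[ℝ] Heps Ω ε} (hE : IsConnectingMap Ω L γ ε E)
    (hE' : IsConnectingMap Ω L γ ε E') : E = E' := by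
  have hε := inv_sq_pos hT.eps_pos
  rw [hT.isConnectingMap_iff] at hE hE'
  refine ContinuousLinearMap.ext fun u => ?_
  rw [← toSmul_ofSmul hε (E u), ← toSmul_ofSmul hε (E' u)]
  congr 1
  exact hT.bdry_ext ((hE u).1.trans (hE' u).1.symm) ((hE u).2.trans (hE' u).2.symm)

end Connecting

/-! ### Periodic Sobolev functions -/

section Periodic

variable {L : ℝ}

theorem contDiff_deriv_of_smooth {ψ : ℝ → ℝ} (h : ContDiff ℝ ∞ ψ) : ContDiff ℝ ∞ (deriv ψ) :=
  (contDiff_infty_iff_deriv.1 h).2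

/-- Functions orthogonal to the trigonometric system vanish. -/
theorem eq_zero_of_inner_trig (hL : 0 < L) (f : LI L)
    (h : ∀ n : ℤ, inner ℝ f (l2cls (muI L) fun s => Real.cos (2 * Real.pi * n / L * s)) = (0 : ℝ) ∧
      inner ℝ f (l2cls (muI L) fun s => Real.sin (2 * Real.pi * n / L * s)) = (0 : ℝ)) : f = 0 := by
  have hae : volume.restrict (Ioc 0 L) = muI L := (Measure.restrict_congr_set Ioo_ae_eq_Ioc).symm
  have hF : MemLp (fun s => (f s : ℂ)) 2 (volume.restrict (Ioc 0 L)) := by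
    rw [hae]; exact (Lp.memLp f).ofReal
  have hcoef : ∀ n : ℤ, fourierCoeffOn hL (fun s => (f s : ℂ)) n = 0 := by
    intro n
    have h1 := (h (-n)).1
    have h2 := (h (-n)).2
    have hc : Continuous fun s => Real.cos (2 * Real.pi * ((-n : ℤ) : ℝ) / L * s) := by fun_prop
    have hs : Continuous fun s => Real.sin (2 * Real.pi * ((-n : ℤ) : ℝ) / L * s) := by fun_prop
    rw [inner_eq_integral_of_ae EventuallyEq.rfl (coeFn_l2cls (memLp_I hc))] at h1
    rw [inner_eq_integral_of_ae EventuallyEq.rfl (coeFn_l2cls (memLp_I hs))] at h2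
    have i1 := integrable_mul_of_ae (x := f) EventuallyEq.rfl (coeFn_l2cls (memLp_I (L := L) hc))
    have i2 := integrable_mul_of_ae (x := f) EventuallyEq.rfl (coeFn_l2cls (memLp_I (L := L) hs))
    have key : ∫ s, ((f s * Real.cos (2 * Real.pi * ((-n : ℤ) : ℝ) / L * s) : ℝ) : ℂ) +
        ((f s * Real.sin (2 * Real.pi * ((-n : ℤ) : ℝ) / L * s) : ℝ) : ℂ) * Complex.I ∂(muI L)
        = 0 := by
      rw [integral_add i1.ofReal (i2.ofReal.mul_const _), integral_mul_const, integral_complex_ofReal,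
        integral_complex_ofReal, h1, h2]
      simp
    rw [fourierCoeffOn_eq_integral, intervalIntegral.integral_of_le hL.le, hae]
    refine smul_eq_zero_of_right _ (Eq.trans (integral_congr_ae (Eventually.of_forall fun s => ?_))
      key)
    simp only [fourier_coe_apply, smul_eq_mul, sub_zero]
    rw [show 2 * (Real.pi : ℂ) * Complex.I * ((-n : ℤ) : ℂ) * (s : ℂ) / (L : ℂ) =
      ((2 * Real.pi * ((-n : ℤ) : ℝ) / L * s : ℝ) : ℂ) * Complex.I by push_cast; ring,
      Complex.exp_mul_I, ← Complex.ofReal_cos, ← Complex.ofReal_sin]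
    push_cast
    ring
  -- Parseval's identity: the norm is the sum of the squares of the Fourier coefficients, all of
  -- which vanish.
  have h0 := hasSum_sq_fourierCoeffOn hL hF
  simp only [hcoef, norm_zero, ne_eq, OfNat.ofNat_ne_zero, not_false_eq_true, zero_pow] at h0
  have h1 := h0.unique hasSum_zero
  rw [sub_zero, smul_eq_mul, mul_eq_zero, or_iff_right (inv_ne_zero hL.ne'),
    intervalIntegral.integral_of_le hL.le, hae] at h1
  rw [← norm_eq_zero, ← sq_eq_zero_iff, norm_sq_eq_integral, ← h1]
  refine integral_congr_ae (Eventually.of_forall fun s => ?_)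
  simp

/-- A function with its first two derivatives. -/
abbrev PerData (L : ℝ) : Type := LI L × LI L × LI L

/-- The data of a smooth function. -/
def smoothPer (L : ℝ) (ψ : ℝ → ℝ) : PerData L :=
  (l2cls _ ψ, l2cls _ (deriv ψ), l2cls _ (deriv (deriv ψ)))

/-- The space `H²_p` as a subspace of `L²`. -/
def perSub (L : ℝ) : Submodule ℝ (PerData L) :=
  Submodule.topologicalClosure
    { carrier := {x | ∃ ψ : ℝ → ℝ, ContDiff ℝ ∞ ψ ∧ Function.Periodic ψ L ∧ smoothPer L ψ = x}
      add_mem' := by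
        rintro _ _ ⟨f, hf, hfp, rfl⟩ ⟨g, hg, hgp, rfl⟩
        have h1 : deriv (fun s => f s + g s) = fun s => deriv f s + deriv g s := funext fun s =>
          deriv_fun_add (hf.differentiable (by simp) s) (hg.differentiable (by simp) s)
        have h2 : deriv (fun s => deriv f s + deriv g s) =
            fun s => deriv (deriv f) s + deriv (deriv g) s := funext fun s =>
          deriv_fun_add ((contDiff_deriv_of_smooth hf).differentiable (by simp) s)
            ((contDiff_deriv_of_smooth hg).differentiable (by simp) s)
        refine ⟨fun s => f s + g s, hf.add hg, fun s => by simp only [hfp s, hgp s], ?_⟩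
        simp only [smoothPer, h1, h2, Prod.mk_add_mk]
        have hf1 := contDiff_deriv_of_smooth hf
        have hg1 := contDiff_deriv_of_smooth hg
        rw [l2cls_add (memLp_I hf.continuous) (memLp_I hg.continuous),
          l2cls_add (memLp_I hf1.continuous) (memLp_I hg1.continuous),
          l2cls_add (memLp_I (contDiff_deriv_of_smooth hf1).continuous)
            (memLp_I (contDiff_deriv_of_smooth hg1).continuous)]
      zero_mem' := by
        refine ⟨fun _ => 0, contDiff_const, fun _ => rfl, ?_⟩
        have : l2cls (muI L) (fun _ => (0 : ℝ)) = 0 :=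
          (eq_l2cls (Lp.coeFn_zero ℝ 2 (muI L))).symm
        simp [smoothPer, this]
      smul_mem' := by
        rintro c _ ⟨f, hf, hfp, rfl⟩
        have h1 : deriv (fun s => c * f s) = fun s => c * deriv f s := funext fun s =>
          deriv_const_mul c (hf.differentiable (by simp) s)
        have h2 : deriv (fun s => c * deriv f s) = fun s => c * deriv (deriv f) s := funext fun s =>
          deriv_const_mul c ((contDiff_deriv_of_smooth hf).differentiable (by simp) s)
        have hf1 := contDiff_deriv_of_smooth hf
        refine ⟨fun s => c * f s, contDiff_const.mul hf, fun s => by simp only [hfp s], ?_⟩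
        simp only [smoothPer, h1, h2, Prod.smul_mk]
        rw [l2cls_smul c (memLp_I hf.continuous), l2cls_smul c (memLp_I hf1.continuous),
          l2cls_smul c (memLp_I (contDiff_deriv_of_smooth hf1).continuous)] }

theorem mem_perSub_iff {x : PerData L} : x ∈ perSub L ↔
    x ∈ closure {x | ∃ ψ : ℝ → ℝ, ContDiff ℝ ∞ ψ ∧ Function.Periodic ψ L ∧ smoothPer L ψ = x} :=
  Iff.rfl

theorem smoothPer_mem {ψ : ℝ → ℝ} (hψ : ContDiff ℝ ∞ ψ) (hp : Function.Periodic ψ L) :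
    smoothPer L ψ ∈ perSub L := subset_closure ⟨ψ, hψ, hp, rfl⟩

theorem isClosed_perSub (L : ℝ) : IsClosed (perSub L : Set (PerData L)) := isClosed_closure

theorem perSub_induction {x : PerData L} {P : PerData L → Prop} (hx : x ∈ perSub L)
    (hP : IsClosed {x | P x})
    (h : ∀ ψ : ℝ → ℝ, ContDiff ℝ ∞ ψ → Function.Periodic ψ L → P (smoothPer L ψ)) : P x := by
  refine closure_minimal ?_ hP hx
  rintro _ ⟨ψ, h1, h2, rfl⟩
  exact h ψ h1 h2

/-- The data of an element of `H²_p`. -/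
theorem H2p.exists_data (u : H2p L) : ∃ x ∈ perSub L, x.1 =ᵐ[muI L] u.val ∧
    x.2.1 =ᵐ[muI L] u.d1 ∧ x.2.2 =ᵐ[muI L] u.d2 := by
  refine ⟨(l2cls _ u.val, l2cls _ u.d1, l2cls _ u.d2), ?_, coeFn_l2cls u.memLp_val,
    coeFn_l2cls u.memLp_d1, coeFn_l2cls u.memLp_d2⟩
  obtain ⟨φ, hφ, hp, h1, h2, h3⟩ := u.approx
  have hφ1 := fun n => contDiff_deriv_of_smooth (hφ n)
  refine mem_perSub_iff.2 (mem_closure_iff_seq_limit.2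
    ⟨fun n => smoothPer L (φ n), fun n => ⟨φ n, hφ n, hp n, rfl⟩,
      Tendsto.prodMk_nhds ?_ (Tendsto.prodMk_nhds ?_ ?_)⟩)
  · exact (tendsto_l2cls_iff (fun n => memLp_I (hφ n).continuous) u.memLp_val).2 h1
  · exact (tendsto_l2cls_iff (fun n => memLp_I (hφ1 n).continuous) u.memLp_d1).2 h2
  · exact (tendsto_l2cls_iff (fun n => memLp_I (contDiff_deriv_of_smooth (hφ1 n)).continuous)
      u.memLp_d2).2 h3

/-- The element of `H²_p` with given data. -/
def toH2p (x : PerData L) (hx : x ∈ perSub L) : H2p L where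
  val := x.1
  d1 := x.2.1
  d2 := x.2.2
  memLp_val := Lp.memLp _
  memLp_d1 := Lp.memLp _
  memLp_d2 := Lp.memLp _
  approx := by
    obtain ⟨y, hy, hlim⟩ := mem_closure_iff_seq_limit.1 (mem_perSub_iff.1 hx)
    choose φ hφ hp hy using hy
    obtain rfl : (fun n => smoothPer L (φ n)) = y := funext hy
    have hφ1 := fun n => contDiff_deriv_of_smooth (hφ n)
    have hx' : x = (l2cls _ x.1, l2cls _ x.2.1, l2cls _ x.2.2) := by
      simp only [l2cls_coeFn]
    rw [hx'] at hlim
    exact ⟨φ, hφ, hp, (tendsto_l2cls_iff (fun n => memLp_I (hφ n).continuous) (Lp.memLp _)).1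
      ((continuous_fst.tendsto _).comp hlim),
      (tendsto_l2cls_iff (fun n => memLp_I (hφ1 n).continuous) (Lp.memLp _)).1
        (((continuous_fst.comp continuous_snd).tendsto _).comp hlim),
      (tendsto_l2cls_iff (fun n => memLp_I (contDiff_deriv_of_smooth (hφ1 n)).continuous)
        (Lp.memLp _)).1 (((continuous_snd.comp continuous_snd).tendsto _).comp hlim)⟩

theorem periodic_deriv_real {ψ : ℝ → ℝ} (h : Function.Periodic ψ L) :
    Function.Periodic (deriv ψ) L := fun s => by
  have : (fun t => ψ (t + L)) = ψ := funext h
  rw [← deriv_comp_add_const, this]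

theorem l2cls_eq_volterra_add {ψ : ℝ → ℝ} (hψ : ContDiff ℝ ∞ ψ) :
    l2cls (muI L) ψ = volterra L (l2cls _ (deriv ψ)) + ψ 0 • oneI L := by
  have hd := (contDiff_deriv_of_smooth hψ).continuous
  refine Lp.ext ?_
  filter_upwards [coeFn_l2cls (memLp_I (L := L) hψ.continuous),
    coeFn_volterra (l2cls (muI L) (deriv ψ)),
    Lp.coeFn_add (volterra L (l2cls _ (deriv ψ))) (ψ 0 • oneI L),
    Lp.coeFn_smul (ψ 0) (oneI L), coeFn_oneI (L := L), ae_restrict_mem measurableSet_Ioo]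
    with s h1 h2 h3 h4 h5 hs
  rw [h1, h3, Pi.add_apply, h2, h4, Pi.smul_apply, h5, smul_eq_mul, mul_one, prim,
    setIntegral_congr_ae (g := deriv ψ) measurableSet_Iic]
  · rw [Measure.restrict_restrict measurableSet_Iic]
    have : Iic s ∩ Ioo 0 L = Ioc 0 s := by
      ext t; simp only [mem_inter_iff, mem_Iic, mem_Ioo, mem_Ioc]
      exact ⟨fun h => ⟨h.2.1, h.1⟩, fun h => ⟨h.2, h.1, h.2.trans_lt hs.2⟩⟩
    rw [this, ← intervalIntegral.integral_of_le hs.1.le,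
      intervalIntegral.integral_deriv_eq_sub (fun t _ => hψ.differentiable (by simp) t)
      (hd.intervalIntegrable _ _)]
    ring
  · filter_upwards [coeFn_l2cls (memLp_I (L := L) hd)] with t ht _ using ht

theorem meanI_deriv (hL : 0 < L) {ψ : ℝ → ℝ} (hψ : ContDiff ℝ ∞ ψ) (hp : Function.Periodic ψ L) :
    meanI L (l2cls _ (deriv ψ)) = 0 := by
  have hd := (contDiff_deriv_of_smooth hψ).continuous
  have h0 : ψ L = ψ 0 := by simpa using hp 0
  rw [meanI_apply, inner_eq_integral_of_ae coeFn_oneI (coeFn_l2cls (memLp_I hd))]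
  simp only [one_mul]
  rw [integral_muI hL, intervalIntegral.integral_deriv_eq_sub
    (fun t _ => hψ.differentiable (by simp) t) (hd.intervalIntegrable _ _), h0, sub_self, mul_zero]

/-- An element of `H²_p` is a primitive of its derivative. -/
theorem perSub_fst_eq (hL : 0 < L) {x : PerData L} (hx : x ∈ perSub L) :
    x.1 = primI L x.2.1 + meanI L x.1 • oneI L := by
  refine perSub_induction (P := fun x => x.1 = primI L x.2.1 + meanI L x.1 • oneI L) hx
    (isClosed_eq (by fun_prop) (by fun_prop)) fun ψ hψ _ => ?_
  exact eq_primI_add_of_eq hL (l2cls_eq_volterra_add hψ)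

/-- The derivative of a periodic function has mean value zero, so there is no constant to add. In
particular u'' alone controls u'. -/
theorem perSub_snd_eq (hL : 0 < L) {x : PerData L} (hx : x ∈ perSub L) :
    x.2.1 = primI L x.2.2 := by
  refine perSub_induction (P := fun x => x.2.1 = primI L x.2.2) hx
    (isClosed_eq (by fun_prop) (by fun_prop)) fun ψ hψ hp => ?_
  have h := eq_primI_add_of_eq hL (l2cls_eq_volterra_add (L := L) (contDiff_deriv_of_smooth hψ))
  rw [meanI_deriv hL hψ hp, zero_smul, add_zero] at h
  exact h

theorem perSub_meanI_eq (hL : 0 < L) {x : PerData L} (hx : x ∈ perSub L) :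
    meanI L x.2.2 = 0 := by
  refine perSub_induction (P := fun x => meanI L x.2.2 = 0) hx
    (isClosed_eq (by fun_prop) (by fun_prop)) fun ψ hψ hp => ?_
  exact meanI_deriv hL (contDiff_deriv_of_smooth hψ) (periodic_deriv_real hp)

theorem smoothPer_one_mem : ((oneI L, 0, 0) : PerData L) ∈ perSub L := by
  have h := smoothPer_mem (L := L) (ψ := fun _ => 1) contDiff_const fun _ => rfl
  have h0 : l2cls (muI L) (fun _ => (0 : ℝ)) = 0 := (eq_l2cls (Lp.coeFn_zero ℝ 2 (muI L))).symm
  have h1 : l2cls (muI L) (fun _ => (1 : ℝ)) = oneI L := (eq_l2cls coeFn_oneI).symm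
  simpa [smoothPer, h0, h1] using h

/-- Second primitives of functions with mean value zero belong to `H²_p`. -/
theorem mem_perSub_of_meanI (hL : 0 < L) (g : LI L) (c : ℝ) (hg : meanI L g = 0) :
    ((primI L (primI L g) + c • oneI L, primI L g, g) : PerData L) ∈ perSub L := by
  let P : LI L →L[ℝ] LI L :=
    ContinuousLinearMap.id ℝ (LI L) - (meanI L).smulRight (oneI L)
  let T : LI L →L[ℝ] PerData L := ((primI L).comp (primI L)).prod ((primI L).prod
    (ContinuousLinearMap.id ℝ (LI L)))
  -- The functions whose mean-free part has its second primitive in H²_p. This closed subspace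
  -- contains the constants and the second derivatives of smooth periodic functions, hence all sines
  -- and cosines of period `L`; its orthogonal complement is therefore zero and it is the whole
  -- space.
  let S : Submodule ℝ (LI L) := (perSub L).comap ((T.comp P : LI L →L[ℝ] PerData L) : _ →ₗ[ℝ] _)
  have hS : IsClosed (S : Set (LI L)) := (isClosed_perSub L).preimage (T.comp P).continuous
  have hone : ∀ c : ℝ, ((c • oneI L, 0, 0) : PerData L) ∈ perSub L := fun c => by
    simpa using (perSub L).smul_mem c smoothPer_one_mem
  have hmean : ∀ h ∈ S, meanI L h = 0 → T h ∈ perSub L := by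
    intro h hh h0
    have : T (P h) ∈ perSub L := hh
    simpa [P, h0] using this
  have hdd : ∀ ψ : ℝ → ℝ, ContDiff ℝ ∞ ψ → Function.Periodic ψ L →
      l2cls (muI L) (deriv (deriv ψ)) ∈ S := by
    intro ψ hψ hp
    have hm := smoothPer_mem hψ hp
    have h1 := perSub_fst_eq hL hm
    have h2 := perSub_snd_eq hL hm
    have h3 := perSub_meanI_eq hL hm
    simp only [smoothPer] at h1 h2 h3
    change T (P _) ∈ perSub L
    have hP : P (l2cls (muI L) (deriv (deriv ψ))) = l2cls (muI L) (deriv (deriv ψ)) := by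
      simp [P, h3]
    rw [hP]
    have hT : T (l2cls (muI L) (deriv (deriv ψ))) =
        smoothPer L ψ - (meanI L (l2cls _ ψ) • oneI L, 0, 0) := by
      simp only [T, smoothPer, ContinuousLinearMap.prod_apply, ContinuousLinearMap.comp_apply,
        Prod.mk_sub_mk, sub_zero, ← h2, ContinuousLinearMap.id_apply]
      rw [sub_eq_of_eq_add h1]
    rw [hT]
    exact (perSub L).sub_mem hm (hone _)
  have hconst : oneI L ∈ S := by
    change T (P _) ∈ perSub L
    have : P (oneI L) = 0 := by simp [P, meanI_oneI hL]
    rw [this, map_zero]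
    exact zero_mem _
  have htop : Sᗮ = ⊥ := by
    rw [Submodule.eq_bot_iff]
    intro f hf
    have hperp : ∀ h ∈ S, inner ℝ f h = (0 : ℝ) := fun h hh => by
      rw [real_inner_comm]; exact (Submodule.mem_orthogonal S f).1 hf h hh
    refine eq_zero_of_inner_trig hL f fun n => ?_
    rcases eq_or_ne n 0 with rfl | hn
    · have h1 : l2cls (muI L) (fun _ => (1 : ℝ)) = oneI L := (eq_l2cls coeFn_oneI).symm
      have h0 : l2cls (muI L) (fun _ => (0 : ℝ)) = 0 :=
        (eq_l2cls (Lp.coeFn_zero ℝ 2 (muI L))).symm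
      simp [h1, h0, hperp _ hconst]
    · set w : ℝ := 2 * Real.pi * n / L with hw
      have hw0 : w ≠ 0 := by
        have : (n : ℝ) ≠ 0 := by exact_mod_cast hn
        rw [hw]; positivity
      have hwL : w * L = n * (2 * Real.pi) := by rw [hw]; field_simp
      constructor
      · have hd : deriv (deriv fun s => -(w ^ 2)⁻¹ * Real.cos (w * s)) =
            fun s => Real.cos (w * s) := by
          have h1 : deriv (fun s => -(w ^ 2)⁻¹ * Real.cos (w * s)) =
              fun s => w⁻¹ * Real.sin (w * s) := funext fun s => by
            have := (((hasDerivAt_id s).const_mul w).cos.const_mul (-(w ^ 2)⁻¹)).deriv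
            simp only [id] at this
            rw [this]; field_simp
          rw [h1]
          funext s
          have := (((hasDerivAt_id s).const_mul w).sin.const_mul (w⁻¹)).deriv
          simp only [id] at this
          rw [this]; field_simp
        rw [← hd]
        refine hperp _ (hdd _ (by fun_prop) fun s => ?_)
        rw [mul_add, hwL, Real.cos_add_int_mul_two_pi]
      · have hd : deriv (deriv fun s => -(w ^ 2)⁻¹ * Real.sin (w * s)) =
            fun s => Real.sin (w * s) := by
          have h1 : deriv (fun s => -(w ^ 2)⁻¹ * Real.sin (w * s)) =
              fun s => -w⁻¹ * Real.cos (w * s) := funext fun s => by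
            have := (((hasDerivAt_id s).const_mul w).sin.const_mul (-(w ^ 2)⁻¹)).deriv
            simp only [id] at this
            rw [this]; field_simp
          rw [h1]
          funext s
          have := (((hasDerivAt_id s).const_mul w).cos.const_mul (-w⁻¹)).deriv
          simp only [id] at this
          rw [this]; field_simp
        rw [← hd]
        refine hperp _ (hdd _ (by fun_prop) fun s => ?_)
        rw [mul_add, hwL, Real.sin_add_int_mul_two_pi]
  have hgS : g ∈ S := by
    have : S.topologicalClosure = ⊤ := (Submodule.topologicalClosure_eq_top_iff).2 htop
    rw [hS.submodule_topologicalClosure_eq] at this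
    rw [this]; trivial
  have := (perSub L).add_mem (hmean g hgS hg) (hone c)
  simpa [T] using this

end Periodic

/-! ### The limit problem -/

section Limit

variable {L b : ℝ} {κ : ℝ → ℝ}

/-- The bilinear form of the limit problem. -/
def limitForm (L : ℝ) (κ : ℝ → ℝ) (b : ℝ) (x y : PerData L) : ℝ :=
  inner ℝ x.2.2 y.2.2 + 2 * inner ℝ (mulOp (muI L) κ x.2.1) (mulOp (muI L) κ y.2.1) +
    2 * b * inner ℝ x.1 y.1

theorem limitForm_sub_left (x x' y : PerData L) :
    limitForm L κ b (x - x') y = limitForm L κ b x y - limitForm L κ b x' y := by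
  simp only [limitForm, Prod.snd_sub, Prod.fst_sub, map_sub, inner_sub_left]
  ring

theorem limitForm_eq_integral (hκ : Continuous κ) {x y : PerData L}
    {u u' u'' φ φ' φ'' : ℝ → ℝ} (hx : x.1 =ᵐ[muI L] u) (hx' : x.2.1 =ᵐ[muI L] u')
    (hx'' : x.2.2 =ᵐ[muI L] u'') (hy : y.1 =ᵐ[muI L] φ) (hy' : y.2.1 =ᵐ[muI L] φ')
    (hy'' : y.2.2 =ᵐ[muI L] φ'') :
    limitForm L κ b x y = ∫ s in Ioo 0 L, (u'' s * φ'' s + 2 * κ s ^ 2 * (u' s * φ' s) +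
      2 * b * (u s * φ s)) := by
  have hw := isBddWeight_I (L := L) hκ
  have h1 : mulOp (muI L) κ x.2.1 =ᵐ[muI L] fun s => κ s * u' s := by
    filter_upwards [coeFn_mulOp hw x.2.1, hx'] with s h1 h2
    rw [h1, h2]
  have h2 : mulOp (muI L) κ y.2.1 =ᵐ[muI L] fun s => κ s * φ' s := by
    filter_upwards [coeFn_mulOp hw y.2.1, hy'] with s h1 h2
    rw [h1, h2]
  rw [limitForm, inner_eq_integral_of_ae hx'' hy'', inner_eq_integral_of_ae h1 h2,
    inner_eq_integral_of_ae hx hy, ← integral_const_mul, ← integral_const_mul, ← integral_add,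
    ← integral_add]
  · refine integral_congr_ae (Eventually.of_forall fun s => ?_)
    ring
  · exact (integrable_mul_of_ae hx'' hy'').add ((integrable_mul_of_ae h1 h2).const_mul _)
  · exact (integrable_mul_of_ae hx hy).const_mul _
  · exact integrable_mul_of_ae hx'' hy''
  · exact (integrable_mul_of_ae h1 h2).const_mul _

theorem isLimitSolution_iff (hκ : Continuous κ) {F : ℝ → ℝ} {f : LI L} (hF : f =ᵐ[muI L] F)
    {u : H2p L} {x : PerData L} (h0 : x.1 =ᵐ[muI L] u.val) (h1 : x.2.1 =ᵐ[muI L] u.d1)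
    (h2 : x.2.2 =ᵐ[muI L] u.d2) : IsLimitSolution L κ b F u ↔
      ∀ y ∈ perSub L, limitForm L κ b x y = 2 * inner ℝ f y.1 := by
  constructor
  · intro h y hy
    rw [inner_eq_integral_of_ae hF (y := y.1) EventuallyEq.rfl,
      limitForm_eq_integral hκ h0 h1 h2 (y := y) EventuallyEq.rfl EventuallyEq.rfl EventuallyEq.rfl]
    exact h (toH2p y hy)
  · intro h φ
    obtain ⟨y, hy, hy0, hy1, hy2⟩ := φ.exists_data
    rw [← limitForm_eq_integral hκ h0 h1 h2 hy0 hy1 hy2, ← inner_eq_integral_of_ae hF hy0]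
    exact h y hy

theorem isLimitSolution_toH2p (hκ : Continuous κ) {F : ℝ → ℝ} {f : LI L} (hF : f =ᵐ[muI L] F)
    {x : PerData L} (hx : x ∈ perSub L)
    (h : ∀ y ∈ perSub L, limitForm L κ b x y = 2 * inner ℝ f y.1) :
    IsLimitSolution L κ b F (toH2p x hx) :=
  (isLimitSolution_iff hκ hF (u := toH2p x hx) EventuallyEq.rfl EventuallyEq.rfl
    EventuallyEq.rfl).2 h

/-- Testing the difference with itself makes a sum of squares vanish. This kills the function and
its second derivative, and the first derivative is a primitive of the second. -/
theorem eq_of_limitForm_eq (hL : 0 < L) (hb : 0 < b) {x x' : PerData L} (hx : x ∈ perSub L)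
    (hx' : x' ∈ perSub L) (h : ∀ y ∈ perSub L, limitForm L κ b x y = limitForm L κ b x' y) :
    x = x' := by
  have hm := (perSub L).sub_mem hx hx'
  have h1 := h _ hm
  rw [← sub_eq_zero, ← limitForm_sub_left, limitForm, real_inner_self_eq_norm_sq,
    real_inner_self_eq_norm_sq, real_inner_self_eq_norm_sq] at h1
  have h3 : ‖(x - x').2.2‖ ^ 2 = 0 := by
    have := mul_nonneg hb.le (sq_nonneg ‖(x - x').1‖)
    nlinarith [sq_nonneg ‖(x - x').2.2‖, sq_nonneg ‖mulOp (muI L) κ (x - x').2.1‖]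
  have h4 : b * ‖(x - x').1‖ ^ 2 = 0 := by
    have := mul_nonneg hb.le (sq_nonneg ‖(x - x').1‖)
    nlinarith [sq_nonneg ‖(x - x').2.2‖, sq_nonneg ‖mulOp (muI L) κ (x - x').2.1‖]
  rw [sq_eq_zero_iff, norm_eq_zero] at h3
  rw [mul_eq_zero, or_iff_right hb.ne', sq_eq_zero_iff, norm_eq_zero] at h4
  have h5 := perSub_snd_eq hL hm
  rw [h3, map_zero] at h5
  rw [← sub_eq_zero]
  exact Prod.ext h4 (Prod.ext h5 h3)

/-- Coercivity uses only u'' and √(2b) u, since u' is the mean-free primitive of u''; the curvature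
term just has to be nonnegative. -/
theorem exists_limit_solution (hL : 0 < L) (hb : 0 < b) :
    ∃ S : LI L →L[ℝ] perSub L, ∀ f, ∀ y : perSub L,
      limitForm L κ b (S f) y = 2 * inner ℝ f (y : PerData L).1 := by
  have : CompleteSpace (perSub L) := (isClosed_perSub L).completeSpace_coe
  let p0 : perSub L →L[ℝ] LI L :=
    (ContinuousLinearMap.fst ℝ (LI L) (LI L × LI L)).comp (perSub L).subtypeL
  let p12 : perSub L →L[ℝ] LI L × LI L :=
    (ContinuousLinearMap.snd ℝ (LI L) (LI L × LI L)).comp (perSub L).subtypeL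
  let p1 : perSub L →L[ℝ] LI L := (ContinuousLinearMap.fst ℝ (LI L) (LI L)).comp p12
  let p2 : perSub L →L[ℝ] LI L := (ContinuousLinearMap.snd ℝ (LI L) (LI L)).comp p12
  let r : ℝ := Real.sqrt (2 * b)
  have hr : 0 < r := Real.sqrt_pos.2 (by positivity)
  have hr2 : r * r = 2 * b := Real.mul_self_sqrt (by positivity)
  have h22 : Real.sqrt 2 * Real.sqrt 2 = 2 := Real.mul_self_sqrt (by norm_num)
  let A : Fin 2 → perSub L →L[ℝ] LI L := ![p2, Real.sqrt 2 • (mulOp (muI L) κ).comp p1]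
  let B : Unit → perSub L →L[ℝ] LI L := fun _ => r • p0
  obtain ⟨S, hS⟩ := exists_solution_of_sum A B (C := max (r⁻¹) (max (‖primI L‖) 1)) (by
    intro v X hX h
    simp only [Fin.sum_univ_two, A, B, Matrix.cons_val_zero, Matrix.cons_val_one,
      Finset.univ_unique, Finset.sum_singleton] at h
    have a2 : ‖p2 v‖ ≤ X := by
      refine abs_le_of_sq_le_sq' ?_ hX |>.2
      nlinarith [sq_nonneg ‖(Real.sqrt 2 • (mulOp (muI L) κ).comp p1) v‖, sq_nonneg ‖(r • p0) v‖]
    have a0 : ‖(r • p0) v‖ ≤ X := by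
      refine abs_le_of_sq_le_sq' ?_ hX |>.2
      nlinarith [sq_nonneg ‖(Real.sqrt 2 • (mulOp (muI L) κ).comp p1) v‖, sq_nonneg ‖p2 v‖]
    rw [FunLike.coe_smul, Pi.smul_apply, norm_smul, Real.norm_eq_abs, abs_of_pos hr] at a0
    have a1 : p1 v = primI L (p2 v) := perSub_snd_eq hL v.2
    have hle : ∀ {c d : ℝ}, d ≤ max (r⁻¹) (max (‖primI L‖) 1) → c ≤ d * X →
        c ≤ max (r⁻¹) (max (‖primI L‖) 1) * X := fun h1 h2 =>
      h2.trans (mul_le_mul_of_nonneg_right h1 hX)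
    change ‖(v : PerData L)‖ ≤ _
    rw [Prod.norm_def, Prod.norm_def]
    refine max_le (hle (le_max_left _ _) ?_) (max_le (hle ((le_max_left _ _).trans
      (le_max_right _ _)) ?_) (hle ((le_max_right _ _).trans (le_max_right _ _)) ?_))
    · rw [inv_mul_eq_div, le_div_iff₀ hr, mul_comm]; exact a0
    · change ‖p1 v‖ ≤ _
      rw [a1]
      exact ((primI L).le_opNorm _).trans (mul_le_mul_of_nonneg_left a2 (norm_nonneg _))
    · rw [one_mul]; exact a2)
    ((2 / r) • ContinuousLinearMap.id ℝ (LI L)) ()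
  refine ⟨S, fun f y => ?_⟩
  have h := hS f y
  simp only [Fin.sum_univ_two, A, B, Matrix.cons_val_zero, Matrix.cons_val_one,
      Finset.univ_unique, Finset.sum_singleton, FunLike.coe_smul, Pi.smul_apply,
      inner_smul_left, inner_smul_right, RCLike.conj_to_real, ContinuousLinearMap.id_apply] at h
  have e1 : r * (2 / r * inner ℝ f (p0 y)) = 2 * inner ℝ f (p0 y) := by field_simp
  have e2 : ∀ z : ℝ, r * (r * z) = 2 * b * z := fun z => by rw [← mul_assoc, hr2]
  have e3 : ∀ z : ℝ, Real.sqrt 2 * (Real.sqrt 2 * z) = 2 * z := fun z => by rw [← mul_assoc, h22]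
  rw [e1, e2, e3] at h
  exact h

/-- The function is the primitive of its derivative plus its mean value: a compact operator plus one
of rank one. -/
theorem isCompactOperator_perSub_fst (hL : 0 < L) : IsCompactOperator
    ((ContinuousLinearMap.fst ℝ (LI L) (LI L × LI L)).comp (perSub L).subtypeL) := by
  let p : perSub L →L[ℝ] LI L :=
    (ContinuousLinearMap.fst ℝ (LI L) (LI L × LI L)).comp (perSub L).subtypeL
  let q : perSub L →L[ℝ] LI L := (ContinuousLinearMap.fst ℝ (LI L) (LI L)).comp
    ((ContinuousLinearMap.snd ℝ (LI L) (LI L × LI L)).comp (perSub L).subtypeL)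
  have h : p = (primI L).comp q + ((meanI L).comp p).smulRight (oneI L) :=
    ContinuousLinearMap.ext fun v => perSub_fst_eq hL v.2
  change IsCompactOperator p
  rw [h]
  exact ((isCompactOperator_primI hL).comp_clm q).add (isCompactOperator_smulRight _ _)

/-- The resolvent of the limit problem exists and is a compact operator. -/
theorem exists_limitResolvent (hL : 0 < L) (hb : 0 < b) (hκ : Continuous κ) :
    ∃ B₀ : Hzero L →L[ℝ] Hzero L, IsLimitResolvent L κ b B₀ ∧ IsCompactOperator B₀ := by
  obtain ⟨S, hS⟩ := exists_limit_solution (κ := κ) hL hb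
  let p : perSub L →L[ℝ] LI L :=
    (ContinuousLinearMap.fst ℝ (LI L) (LI L × LI L)).comp (perSub L).subtypeL
  let R : Hzero L →L[ℝ] perSub L := S.comp (ofHzero L)
  refine ⟨(toHzero L).comp (p.comp R), fun f => ⟨⟨toH2p _ (R f).2,
    isLimitSolution_toH2p hκ (coeFn_ofHzero f) (R f).2 fun y hy => hS _ ⟨y, hy⟩⟩,
    fun u hu => ?_⟩, ((isCompactOperator_perSub_fst hL).comp_clm R).clm_comp (toHzero L)⟩
  obtain ⟨x, hx, h0, h1, h2⟩ := u.exists_data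
  have hform := (isLimitSolution_iff hκ (coeFn_ofHzero f) h0 h1 h2).1 hu
  have hxR : x = R f := eq_of_limitForm_eq hL hb hx (R f).2 fun y hy => by
    rw [hform y hy]; exact (hS _ ⟨y, hy⟩).symm
  have h3 : p (R f) = x.1 := by rw [hxR]; rfl
  change toHzero L (p (R f)) =ᵐ[_] _
  rw [h3]
  exact (coeFn_toHzero _).trans h0

theorem IsLimitResolvent.exists_data (hκ : Continuous κ) {B₀ : Hzero L →L[ℝ] Hzero L}
    (h : IsLimitResolvent L κ b B₀) (f : Hzero L) : ∃ x ∈ perSub L,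
      (∀ y ∈ perSub L, limitForm L κ b x y = 2 * inner ℝ (ofHzero L f) y.1) ∧
      ofHzero L (B₀ f) = x.1 := by
  obtain ⟨⟨u, hu⟩, huniq⟩ := h f
  obtain ⟨x, hx, h0, h1, h2⟩ := u.exists_data
  exact ⟨x, hx, (isLimitSolution_iff hκ (coeFn_ofHzero f) h0 h1 h2).1 hu,
    Lp.ext ((coeFn_ofHzero _).trans ((huniq u hu).trans h0.symm))⟩

theorem IsLimitResolvent.unique {B₀ B₀' : Hzero L →L[ℝ] Hzero L}
    (h : IsLimitResolvent L κ b B₀) (h' : IsLimitResolvent L κ b B₀') : B₀ = B₀' := by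
  refine ContinuousLinearMap.ext fun f => Hzero.ext_ae ?_
  obtain ⟨⟨u, hu⟩, huniq⟩ := h f
  exact (huniq u hu).trans ((h' f).2 u hu).symm

end Limit

/-! ### Extension of functions of the arclength to the tube -/

section Extension

variable {L ε : ℝ} {γ n : ℝ → E2} {κ : ℝ → ℝ} {D : Set E2}

theorem dS_eq_of_eqOn_strip {f g : ℝ × ℝ → ℝ} (h : ∀ s, ∀ t ∈ Ioo (0 : ℝ) 1, f (s, t) = g (s, t))
    {p : ℝ × ℝ} (hp : p.2 ∈ Ioo (0 : ℝ) 1) : dS f p = dS g p ∧ dT f p = dT g p := by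
  have : f =ᶠ[𝓝 p] g := by
    filter_upwards [continuous_snd.continuousAt.preimage_mem_nhds (isOpen_Ioo.mem_nhds hp)]
      with q hq
    exact h q.1 q.2 hq
  rw [dS, dS, dT, dT, this.fderiv_eq]
  exact ⟨rfl, rfl⟩

theorem contDiff_coord {a : ℝ → E2} (ha : ContDiff ℝ ∞ a) (i : Fin 2) :
    ContDiff ℝ ∞ fun s => a s i := by fun_prop

theorem deriv_coord {a : ℝ → E2} (ha : ContDiff ℝ ∞ a) (i : Fin 2) (s : ℝ) :
    deriv (fun s => a s i) s = deriv a s i :=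
  ((EuclideanSpace.proj i : E2 →L[ℝ] ℝ).hasFDerivAt.comp_hasDerivAt s
    (ha.differentiable (by simp) s).hasDerivAt).deriv

/-- Derivatives of the component of a vector field with respect to a frame. -/
theorem dS_dT_frame {a : ℝ → E2} (ha : ContDiff ℝ ∞ a) {g : Fin 2 → ℝ × ℝ → ℝ}
    (hg : ∀ i, Differentiable ℝ (g i)) (p : ℝ × ℝ) :
    dS (fun p => a p.1 0 * g 0 p + a p.1 1 * g 1 p) p =
      deriv a p.1 0 * g 0 p + deriv a p.1 1 * g 1 p +
        (a p.1 0 * dS (g 0) p + a p.1 1 * dS (g 1) p) ∧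
    dT (fun p => a p.1 0 * g 0 p + a p.1 1 * g 1 p) p =
      a p.1 0 * dT (g 0) p + a p.1 1 * dT (g 1) p := by
  have hd : ∀ i, Differentiable ℝ fun p : ℝ × ℝ => a p.1 i := fun i =>
    ((contDiff_coord ha i).comp contDiff_fst).differentiable (by simp)
  have hm : ∀ i, Differentiable ℝ fun p : ℝ × ℝ => a p.1 i * g i p := fun i => (hd i).mul (hg i)
  have hS := dS_mul (hd 0) (hg 0) p
  have hS' := dS_mul (hd 1) (hg 1) p
  have hT := dT_mul (hd 0) (hg 0) p
  have hT' := dT_mul (hd 1) (hg 1) p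
  rw [dS_fst (contDiff_coord ha 0), deriv_coord ha] at hS
  rw [dS_fst (contDiff_coord ha 1), deriv_coord ha] at hS'
  rw [dT_fst (contDiff_coord ha 0)] at hT
  rw [dT_fst (contDiff_coord ha 1)] at hT'
  constructor
  · rw [dS, fderiv_fun_add (hm 0 p) (hm 1 p), add_apply]
    change dS _ p + dS _ p = _
    rw [hS, hS']; ring
  · rw [dT, fderiv_fun_add (hm 0 p) (hm 1 p), add_apply]
    change dT _ p + dT _ p = _
    rw [hT, hT']; ring

/-- A function of the arclength has an extension to the tube which is constant along the
normals. -/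
theorem IsTube.exists_extension (hT : IsTube L γ n κ ε D) {ψ : ℝ → ℝ} (hψ : ContDiff ℝ ∞ ψ)
    (hp : Function.Periodic ψ L) : ∃ (v : H2Data D) (R A B : ℝ × ℝ → ℝ), IsH2Data D v ∧
      Continuous A ∧ Continuous B ∧ (hT.flat v).a = l2cls _ A ∧ (hT.flat v).b = l2cls _ B ∧
      (hT.flat v).c = 0 ∧ (hT.flat v).q₀ = 0 ∧ (hT.flat v).q₁ = 0 ∧
      (hT.flat v).W₀ = l2cls _ ψ ∧ (hT.flat v).W₁ = l2cls _ ψ ∧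
      ∀ p : ℝ × ℝ, p.2 ∈ Ioo (0 : ℝ) 1 → tubeJac κ ε p * R p = deriv ψ p.1 ∧
        tubeJac κ ε p * B p = -(κ p.1 * R p) ∧
        tubeJac κ ε p * (tubeJac κ ε p * A p) =
          deriv (deriv ψ) p.1 + ε * p.2 * deriv κ p.1 * R p := by
  obtain ⟨H, hH, hHψ⟩ := hT.extend (fun p => ψ p.1) (hψ.comp contDiff_fst) fun s _ => hp s
  have hε := hT.eps_pos
  have hcd := hT.contDiff_deriv
  have hcn := hT.smooth_normal
  have hd := hT.continuous_deriv
  have hn := hT.smooth_normal.continuous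
  have hΓ := hT.continuous_map
  let g : Fin 2 → ℝ × ℝ → ℝ := fun i p => pderiv i H (tubeMap γ n ε p)
  let h : Fin 2 → Fin 2 → ℝ × ℝ → ℝ := fun i j p => pderiv j (pderiv i H) (tubeMap γ n ε p)
  have hgs : ∀ i, IsSmoothPeriodic L (g i) := fun i =>
    hT.isSmoothPeriodic_comp (contDiff_pderiv hH i)
  have hhc : ∀ i j, Continuous (h i j) := fun i j =>
    (hT.isSmoothPeriodic_comp (contDiff_pderiv (contDiff_pderiv hH i) j)).continuous
  have hgS : ∀ i p, dS (g i) p =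
      tubeJac κ ε p * (deriv γ p.1 0 * h i 0 p + deriv γ p.1 1 * h i 1 p) := fun i p =>
    hT.dS_comp (contDiff_pderiv hH i) p
  have hgT : ∀ i p, dT (g i) p = (-ε) * (n p.1 0 * h i 0 p + n p.1 1 * h i 1 p) := fun i p =>
    hT.dT_comp (contDiff_pderiv hH i) p
  let C2 : (ℝ → E2) → (ℝ → E2) → ℝ × ℝ → ℝ := fun a b p =>
    a p.1 0 * (b p.1 0 * h 0 0 p + b p.1 1 * h 0 1 p) +
      a p.1 1 * (b p.1 0 * h 1 0 p + b p.1 1 * h 1 1 p)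
  let R : ℝ × ℝ → ℝ := fun p => deriv γ p.1 0 * g 0 p + deriv γ p.1 1 * g 1 p
  let Q : ℝ × ℝ → ℝ := fun p => n p.1 0 * g 0 p + n p.1 1 * g 1 p
  have hC2 : ∀ {a b : ℝ → E2}, Continuous a → Continuous b → Continuous (C2 a b) := by
    intro a b ha hb
    have := hhc 0 0
    have := hhc 0 1
    have := hhc 1 0
    have := hhc 1 1
    simp only [C2]; fun_prop
  have hquad : ∀ {a b : ℝ → E2}, Continuous a → Continuous b →
      quadQ a b (fun i j => hT.pull (((smoothH2 D H).2 i).2.1 j)) = l2cls _ (C2 a b) := by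
    intro a b ha hb
    refine eq_l2cls ?_
    have hx : ∀ i j, hT.pull (((smoothH2 D H).2 i).2.1 j) =ᵐ[muQ L] h i j := fun i j => by
      change hT.pull (l2cls _ (pderiv j (pderiv i H))) =ᵐ[_] _
      rw [hT.pull_l2cls (continuous_pderiv (contDiff_pderiv hH i) j)]
      exact coeFn_l2cls (memLp_Q (hhc i j))
    filter_upwards [coeFn_quadQ ha hb (fun i j => hT.pull (((smoothH2 D H).2 i).2.1 j)), hx 0 0,
      hx 0 1, hx 1 0, hx 1 1] with p e e1 e2 e3 e4
    rw [e, e1, e2, e3, e4]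
  have hRS : ∀ p, dS R p = -κ p.1 * Q p + tubeJac κ ε p * C2 (deriv γ) (deriv γ) p := fun p => by
    rw [(dS_dT_frame hcd (fun i => (hgs i).differentiable) p).1, hgS, hgS, hT.deriv_deriv]
    simp only [PiLp.smul_apply, smul_eq_mul, Q, C2]; ring
  have hRT : ∀ p, dT R p = -ε * C2 (deriv γ) n p := fun p => by
    rw [(dS_dT_frame hcd (fun i => (hgs i).differentiable) p).2, hgT, hgT]
    simp only [C2]; ring
  have hQT : ∀ p, dT Q p = -ε * C2 n n p := fun p => by
    rw [(dS_dT_frame hcn (fun i => (hgs i).differentiable) p).2, hgT, hgT]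
    simp only [C2]; ring
  have hR : Differentiable ℝ R := by
    have := fun i => (hgs i).smooth
    have := contDiff_coord hcd
    refine ContDiff.differentiable (n := ∞) ?_ (by simp)
    exact ((((contDiff_coord hcd 0).comp contDiff_fst).mul (hgs 0).smooth).add
      (((contDiff_coord hcd 1).comp contDiff_fst).mul (hgs 1).smooth))
  have hQc : Continuous Q := by
    have h0 := (hgs 0).continuous
    have h1 := (hgs 1).continuous
    simp only [Q]; fun_prop
  have hJd : Differentiable ℝ (tubeJac κ ε) := by
    have h1 : ContDiff ℝ ∞ fun p : ℝ × ℝ => κ p.1 := hT.smooth_curvature.comp contDiff_fst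
    have h2 : ContDiff ℝ ∞ (tubeJac κ ε) := 
      contDiff_const.sub ((contDiff_const.mul contDiff_snd).mul h1)
    exact h2.differentiable (by simp)
  have hJS : ∀ p, dS (tubeJac κ ε) p = -(ε * p.2 * deriv κ p.1) := fun p => by
    refine (hasDerivAt_dS hJd p.1 p.2).unique ?_
    have h1 := (hT.smooth_curvature.differentiable (by simp) p.1).hasDerivAt
    simpa [tubeJac] using (h1.const_mul (ε * p.2)).const_sub 1
  have hJT : ∀ p, dT (tubeJac κ ε) p = -(ε * κ p.1) := fun p => by
    refine (hasDerivAt_dT hJd p.1 p.2).unique ?_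
    have h1 := ((((hasDerivAt_id p.2).const_mul ε).mul_const (κ p.1))).const_sub 1
    simpa [tubeJac] using h1
  have hdψ := contDiff_deriv_of_smooth hψ
  have hH0 : ∀ s, ∀ t ∈ Ioo (0 : ℝ) 1, H (tubeMap γ n ε (s, t)) = ψ s := fun s t ht =>
    hHψ s t (Ioo_subset_Icc_self ht)
  -- Differentiating H(γ(s) − εtn(s)) = ψ(s) in s gives JR = ψ'; in t it gives Q = 0. The identities
  -- hold on the open strip, where equality determines derivatives, and pass to its sides by
  -- continuity.
  have hJR : ∀ p : ℝ × ℝ, p.2 ∈ Ioo (0 : ℝ) 1 → tubeJac κ ε p * R p = deriv ψ p.1 := by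
    intro p hp
    have h1 := (dS_eq_of_eqOn_strip (f := fun p => H (tubeMap γ n ε p)) (g := fun p => ψ p.1)
      hH0 hp).1
    rwa [hT.dS_comp hH, dS_fst hψ] at h1
  have hQ0 : ∀ p : ℝ × ℝ, p.2 ∈ Ioo (0 : ℝ) 1 → Q p = 0 := by
    intro p hp
    have h1 := (dS_eq_of_eqOn_strip (f := fun p => H (tubeMap γ n ε p)) (g := fun p => ψ p.1)
      hH0 hp).2
    rw [hT.dT_comp hH, dT_fst hψ] at h1
    exact (mul_eq_zero.1 h1).resolve_left (by linarith)
  have hQ1 : ∀ s, ∀ t ∈ Icc (0 : ℝ) 1, Q (s, t) = 0 := by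
    intro s t ht
    have hcl : IsClosed {t : ℝ | Q (s, t) = 0} :=
      isClosed_eq (hQc.comp (by fun_prop)) continuous_const
    rw [← closure_Ioo zero_ne_one] at ht
    exact closure_minimal (fun t ht => hQ0 (s, t) ht) hcl ht
  -- Differentiating JR = ψ' once more determines A (in s) and B (in t), because R_s = −κQ + JA, R_t
  -- = −εB and Q = 0.
  have hJR2 : ∀ p : ℝ × ℝ, p.2 ∈ Ioo (0 : ℝ) 1 →
      dS (tubeJac κ ε) p * R p + tubeJac κ ε p * dS R p = deriv (deriv ψ) p.1 ∧
      dT (tubeJac κ ε) p * R p + tubeJac κ ε p * dT R p = 0 := by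
    intro p hp
    have h1 := dS_eq_of_eqOn_strip (f := fun p => tubeJac κ ε p * R p) (g := fun p => deriv ψ p.1)
      (fun s t ht => hJR (s, t) ht) hp
    rwa [dS_mul hJd hR, dT_mul hJd hR, dS_fst hdψ, dT_fst hdψ] at h1
  have hC0 : ∀ p : ℝ × ℝ, p.2 ∈ Ioo (0 : ℝ) 1 → C2 n n p = 0 := by
    intro p hp
    have h1 := (dS_eq_of_eqOn_strip (f := Q) (g := fun _ => 0)
      (fun s t ht => hQ0 (s, t) ht) hp).2
    rw [hQT, show dT (fun _ : ℝ × ℝ => (0 : ℝ)) p = 0 by simp [dT]] at h1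
    exact (mul_eq_zero.1 h1).resolve_left (by linarith)
  have hzero : ∀ {x : LI L}, x =ᵐ[muI L] (fun _ => 0) → x = 0 := fun {x} hx =>
    Lp.ext (hx.trans (Lp.coeFn_zero ℝ 2 (muI L)).symm)
  refine ⟨smoothH2 D H, R, C2 (deriv γ) (deriv γ), C2 (deriv γ) n, isH2Data_smooth hH, hC2 hd hd,
    hC2 hd hn, hquad hd hd, hquad hd hn, ?_, hzero ?_, hzero ?_, ?_, ?_, fun p hp =>
    ⟨hJR p hp, ?_, ?_⟩⟩
  · refine (hquad hn hn).trans (Lp.ext ?_)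
    filter_upwards [coeFn_l2cls (memLp_Q (L := L) (hC2 hn hn)), Lp.coeFn_zero ℝ 2 (muQ L),
      ae_muQ_mem L] with p h1 h2 h3
    rw [h1, h2, hC0 p h3.2]; rfl
  · have hx : ∀ i, hT.pullO ((smoothH2 D H).2 i).2.2 =ᵐ[muI L] fun s => g i (s, 0) := fun i => by
      change hT.pullO (l2cls _ (pderiv i H)) =ᵐ[_] _
      rw [hT.pullO_l2cls (continuous_pderiv hH i)]
      simp only [g, tubeMap_zero_right]
      exact coeFn_l2cls (memLp_I ((continuous_pderiv hH i).comp hT.smooth_curve.continuous))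
    filter_upwards [coeFn_linI hn fun i => hT.pullO ((smoothH2 D H).2 i).2.2, hx 0, hx 1]
      with s h1 h2 h3
    rw [IsTube.flat, h1, h2, h3]
    exact hQ1 s 0 (left_mem_Icc.2 zero_le_one)
  · have hx : ∀ i, hT.pullN ((smoothH2 D H).2 i).2.2 =ᵐ[muI L] fun s => g i (s, 1) := fun i => by
      change hT.pullN (l2cls _ (pderiv i H)) =ᵐ[_] _
      rw [hT.pullN_l2cls (continuous_pderiv hH i)]
      exact coeFn_l2cls (memLp_I ((continuous_pderiv hH i).comp (hΓ.comp (by fun_prop))))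
    filter_upwards [coeFn_linI hn fun i => hT.pullN ((smoothH2 D H).2 i).2.2, hx 0, hx 1]
      with s h1 h2 h3
    rw [IsTube.flat, h1, h2, h3]
    exact hQ1 s 1 (right_mem_Icc.2 zero_le_one)
  · change hT.pullO (l2cls _ H) = _
    rw [hT.pullO_l2cls hH.continuous]
    congr 1
    funext s
    rw [← tubeMap_zero_right γ n ε s, hHψ s 0 (left_mem_Icc.2 zero_le_one)]
  · change hT.pullN (l2cls _ H) = _
    rw [hT.pullN_l2cls hH.continuous]
    congr 1
    funext s
    rw [hHψ s 1 (right_mem_Icc.2 zero_le_one)]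
  · have h1 := (hJR2 p hp).2
    rw [hJT, hRT] at h1
    refine mul_left_cancel₀ hε.ne' ?_
    linarith
  · have h1 := (hJR2 p hp).1
    rw [hJS, hRS, hQ0 p hp, mul_zero, zero_add] at h1
    linarith

theorem exists_norm_le_of_ae_Q (L : ℝ) : ∃ m, 0 ≤ m ∧ ∀ (f : LQ L) (C : ℝ), 0 ≤ C →
    (∀ᵐ p ∂(muQ L), |f p| ≤ C) → ‖f‖ ≤ m * C :=
  ⟨_, by positivity, fun _ _ hC h => Lp.norm_le_of_ae_bound hC h⟩

/-- Pointwise estimates for the second derivatives of the extension. -/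
theorem extension_estimates {J R A B ψ₁ ψ₂ k k' t ε K K₁ P₁ P₂ : ℝ} (hε : 0 ≤ ε) (hε1 : ε ≤ 1)
    (ht : t ∈ Icc (0 : ℝ) 1) (hJ : 1 / 2 ≤ J) (hJ1 : J = 1 - ε * t * k) (hk : |k| ≤ K)
    (hk' : |k'| ≤ K₁) (h1 : |ψ₁| ≤ P₁) (h2 : |ψ₂| ≤ P₂) (hR : J * R = ψ₁) (hB : J * B = -(k * R))
    (hA : J * (J * A) = ψ₂ + ε * t * k' * R) :
    |A - ψ₂| ≤ (6 * (P₂ + 2 * K₁ * P₁) * K + 2 * K₁ * P₁) * ε ∧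
      |B + k * ψ₁| ≤ 6 * K ^ 2 * P₁ * ε := by
  have hK : 0 ≤ K := (abs_nonneg _).trans hk
  have hK1 : 0 ≤ K₁ := (abs_nonneg _).trans hk'
  have hP1 : 0 ≤ P₁ := (abs_nonneg _).trans h1
  have hP2 : 0 ≤ P₂ := (abs_nonneg _).trans h2
  -- Dividing by J ≥ 1/2 costs a factor 2. Every error below carries a factor 1 − J or εt, hence is
  -- of order ε.
  have hdiv : ∀ {x y c : ℝ}, J * x = y → |y| ≤ c → |x| ≤ 2 * c := by
    intro x y c hx hy
    rw [← hx, abs_mul, abs_of_nonneg (by linarith)] at hy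
    nlinarith [abs_nonneg x]
  have hmul : ∀ {x y c d : ℝ}, |x| ≤ c → |y| ≤ d → |x * y| ≤ c * d := by
    intro x y c d hx hy
    rw [abs_mul]
    exact mul_le_mul hx hy (abs_nonneg _) ((abs_nonneg _).trans hx)
  have hεt : |ε * t| ≤ ε := by
    rw [abs_of_nonneg (mul_nonneg hε ht.1)]
    nlinarith [ht.2]
  have hJd : |1 - J| ≤ ε * K := by
    rw [hJ1, sub_sub_cancel]; exact hmul hεt hk
  have bR := hdiv hR h1
  have bRd : |R - ψ₁| ≤ 2 * P₁ * (ε * K) := by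
    rw [← hR, show R - J * R = R * (1 - J) by ring]; exact hmul bR hJd
  have bkR : |-(k * R)| ≤ K * (2 * P₁) := by rw [abs_neg]; exact hmul hk bR
  have bB := hdiv hB bkR
  have bS : |ε * t * k' * R| ≤ ε * K₁ * (2 * P₁) := hmul (hmul hεt hk') bR
  have bJJA : |ψ₂ + ε * t * k' * R| ≤ P₂ + 2 * K₁ * P₁ := by
    refine (abs_add_le _ _).trans (add_le_add h2 (bS.trans ?_))
    have : 0 ≤ K₁ * P₁ := mul_nonneg hK1 hP1
    nlinarith
  have bJA := hdiv hA bJJA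
  have bA := hdiv rfl bJA
  constructor
  · have e : A - ψ₂ = A * (1 - J) + J * A * (1 - J) + ε * t * k' * R := by linarith
    rw [e]
    refine (abs_add_le _ _).trans ((add_le_add ((abs_add_le _ _).trans (add_le_add
      (hmul bA hJd) (hmul bJA hJd))) bS).trans (le_of_eq ?_))
    ring
  · have e : B + k * ψ₁ = B * (1 - J) + -(k * (R - ψ₁)) := by linarith
    rw [e]
    have e2 : |-(k * (R - ψ₁))| ≤ K * (2 * P₁ * (ε * K)) := by rw [abs_neg]; exact hmul hk bRd
    refine (abs_add_le _ _).trans ((add_le_add (hmul bB hJd) e2).trans (le_of_eq ?_))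
    ring

/-- Extensions of functions of the arclength, with estimates which are uniform in the width. -/
theorem exists_extension_bound (hκ : ContDiff ℝ ∞ κ) {ψ : ℝ → ℝ} (hψ : ContDiff ℝ ∞ ψ)
    (hp : Function.Periodic ψ L) (K : ℝ) : ∃ C, 0 ≤ C ∧ ∀ (ε M : ℝ) (D : Set E2)
      (hT : IsTube L γ n κ ε D), ε ≤ 1 → IsCoeffBound L κ ε (1 / 2) M K →
      ∃ v : H2Data D, IsH2Data D v ∧ (hT.flat v).c = 0 ∧ (hT.flat v).q₀ = 0 ∧
        (hT.flat v).q₁ = 0 ∧ (hT.flat v).W₀ = l2cls _ ψ ∧ (hT.flat v).W₁ = l2cls _ ψ ∧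
        ‖(hT.flat v).a - extI L (l2cls _ (deriv (deriv ψ)))‖ ≤ C * ε ∧
        ‖(hT.flat v).b + fstOp L κ (extI L (l2cls _ (deriv ψ)))‖ ≤ C * ε := by
  have hd := contDiff_deriv_of_smooth hψ
  have hdd := contDiff_deriv_of_smooth hd
  have hκd := contDiff_deriv_of_smooth hκ
  obtain ⟨m, hm, hnorm⟩ := exists_norm_le_of_ae_Q L
  obtain ⟨P₁, hP1, hψ1⟩ := exists_bound_I L hd.continuous
  obtain ⟨P₂, hP2, hψ2⟩ := exists_bound_I L hdd.continuous
  obtain ⟨K₁, hK1, hκ1⟩ := exists_bound_I L hκd.continuous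
  -- The bound `K` is not known to be nonnegative here, hence the absolute value.
  set C₁ := 6 * (P₂ + 2 * K₁ * P₁) * |K| + 2 * K₁ * P₁ with hC1
  set C₂ := 6 * |K| ^ 2 * P₁ with hC2
  have hC1' : 0 ≤ C₁ := by positivity
  have hC2' : 0 ≤ C₂ := by positivity
  refine ⟨m * C₁ + m * C₂, by positivity, fun ε M D hT hε1 hcoef => ?_⟩
  obtain ⟨v, R, A, B, hv, hA, hB, ha, hb, hc, hq0, hq1, hW0, hW1, hpt⟩ := hT.exists_extension hψ hp
  have hε := hT.eps_pos.le
  have est : ∀ᵐ p ∂(muQ L), |A p - deriv (deriv ψ) p.1| ≤ C₁ * ε ∧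
      |B p + κ p.1 * deriv ψ p.1| ≤ C₂ * ε := by
    filter_upwards [ae_muQ_mem L] with p hp
    have hp1 := Ioo_subset_Icc_self hp.1
    have hp2 := Ioo_subset_Icc_self hp.2
    obtain ⟨e1, e2, e3⟩ := hpt p hp.2
    exact extension_estimates hε hε1 hp2 (hcoef.jac_ge p ⟨hp1, hp2⟩) rfl
      ((hcoef.curv_le _ hp1).trans (le_abs_self K)) (hκ1 _ hp1) (hψ1 _ hp1) (hψ2 _ hp1) e1 e2 e3
  have hext : ∀ {f : ℝ → ℝ}, Continuous f → extI L (l2cls _ f) =ᵐ[muQ L] fun p => f p.1 := by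
    intro f hf
    filter_upwards [coeFn_extI (l2cls (muI L) f),
      (measurePreserving_fst_Q L).quasiMeasurePreserving.ae (coeFn_l2cls (memLp_I hf))] with p h1 h2
    rw [h1, h2]
  refine ⟨v, hv, hc, hq0, hq1, hW0, hW1, (hnorm _ (C₁ * ε) (by positivity) ?_).trans ?_,
    (hnorm _ (C₂ * ε) (by positivity) ?_).trans ?_⟩
  · rw [ha]
    filter_upwards [est, Lp.coeFn_sub (l2cls _ A) (extI L (l2cls _ (deriv (deriv ψ)))),
      coeFn_l2cls (memLp_Q (L := L) hA), hext hdd.continuous] with p h1 h2 h3 h4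
    rw [h2, Pi.sub_apply, h3, h4]
    exact h1.1
  · have : 0 ≤ m * C₂ * ε := by positivity
    linarith
  · rw [hb]
    filter_upwards [est, Lp.coeFn_add (l2cls _ B) (fstOp L κ (extI L (l2cls _ (deriv ψ)))),
      coeFn_l2cls (memLp_Q (L := L) hB), hext hd.continuous,
      coeFn_mulOp (isBddWeight_Q (L := L) (f := fun p => κ p.1) (hκ.continuous.comp continuous_fst))
        (extI L (l2cls _ (deriv ψ)))] with p h1 h2 h3 h4 h5
    rw [h2, Pi.add_apply, h3, h5, h4]
    exact h1.2
  · have : 0 ≤ m * C₁ * ε := by positivity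
    linarith

end Extension

/-! ### Comparison of the thin set problem with the limit problem -/

theorem abs_inner_le_of_le {X : Type*} [NormedAddCommGroup X] [InnerProductSpace ℝ X] {x y : X}
    {c d : ℝ} (hx : ‖x‖ ≤ c) (hy : ‖y‖ ≤ d) : |inner ℝ x y| ≤ c * d :=
  (abs_real_inner_le_norm x y).trans
    (mul_le_mul hx hy (norm_nonneg _) ((norm_nonneg _).trans hx))

section Comparison

variable {L ε c M K μ b B : ℝ} {κ : ℝ → ℝ} {F : FlatField L}

theorem IsCoeffBound.abs_one_sub_tubeJac_le (h : IsCoeffBound L κ ε c M K) (hε : 0 ≤ ε)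
    {p : ℝ × ℝ} (hp : p ∈ Icc 0 L ×ˢ Icc (0 : ℝ) 1) : |tubeJac κ ε p - 1| ≤ ε * K := by
  have h1 := h.curv_le p.1 hp.1
  rw [tubeJac, sub_sub_cancel_left, abs_neg, abs_mul, abs_mul, abs_of_nonneg hε,
    abs_of_nonneg hp.2.1]
  have : p.2 * |κ p.1| ≤ 1 * K := mul_le_mul hp.2.2 h1 (abs_nonneg _) zero_le_one
  nlinarith

theorem norm_mulOp_sub_le {α : Type*} [MeasurableSpace α] {ν : Measure α} {w : α → ℝ}
    (hw : IsBddWeight ν w) {C : ℝ} (hC : ∀ᵐ p ∂ν, |w p - 1| ≤ C) (f : Lp ℝ 2 ν) :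
    ‖mulOp ν w f - f‖ ≤ C * ‖f‖ := by
  obtain ⟨C', hC', hb⟩ := hw.bound
  have hw1 : IsBddWeight ν fun p => w p - 1 := by
    refine ⟨hw.measurable.sub_const 1, C' + 1, by positivity, ?_⟩
    filter_upwards [hb] with p hp
    exact (abs_sub _ _).trans (by rw [abs_one]; linarith)
  have : mulOp ν w f - f = mulOp ν (fun p => w p - 1) f := by
    refine Lp.ext ?_
    filter_upwards [Lp.coeFn_sub (mulOp ν w f) f, coeFn_mulOp hw f, coeFn_mulOp hw1 f]
      with p h1 h2 h3
    rw [h1, Pi.sub_apply, h2, h3]; ring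
  rw [this]
  exact norm_mulOp_le hw1 hC f

theorem IsCoeffBound.norm_jacOp_sub_le (h : IsCoeffBound L κ ε c M K) (hε : 0 ≤ ε) (x : LQ L) :
    ‖jacOp L κ ε x - x‖ ≤ ε * K * ‖x‖ :=
  norm_mulOp_sub_le h.weight (by
    filter_upwards [ae_muQ_mem L] with p hp
    exact h.abs_one_sub_tubeJac_le hε ⟨Ioo_subset_Icc_self hp.1, Ioo_subset_Icc_self hp.2⟩) x

theorem IsCoeffBound.norm_innerJac_sub_le (h : IsCoeffBound L κ ε c M K) (hε : 0 ≤ ε) (x : LI L) :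
    ‖mulOp (muI L) (innerJac κ ε) x - x‖ ≤ ε * K * ‖x‖ :=
  norm_mulOp_sub_le h.weight_inner (by
    filter_upwards [ae_restrict_mem measurableSet_Ioo] with s hs
    exact h.abs_one_sub_tubeJac_le (p := (s, 1)) hε
      ⟨Ioo_subset_Icc_self hs, right_mem_Icc.2 zero_le_one⟩) x

theorem extI_l2cls {f : ℝ → ℝ} (hf : Continuous f) :
    extI L (l2cls _ f) = l2cls (muQ L) fun p => f p.1 := by
  refine eq_l2cls ?_
  filter_upwards [coeFn_extI (l2cls (muI L) f),
    (measurePreserving_fst_Q L).quasiMeasurePreserving.ae (coeFn_l2cls (memLp_I hf))] with p h1 h2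
  rw [h1, h2]

theorem fstOp_extI (hκ : Continuous κ) (g : LI L) :
    fstOp L κ (extI L g) = extI L (mulOp (muI L) κ g) := by
  have hg : g = l2cls (muI L) g := (l2cls_coeFn g).symm
  refine Lp.ext ?_
  filter_upwards [coeFn_mulOp (isBddWeight_Q (L := L) (f := fun p => κ p.1)
      (hκ.comp continuous_fst)) (extI L g), coeFn_extI g, coeFn_extI (mulOp (muI L) κ g),
    (measurePreserving_fst_Q L).quasiMeasurePreserving.ae
      (coeFn_mulOp (isBddWeight_I (L := L) hκ) g)] with p h1 h2 h3 h4
  rw [h1, h2, h3, h4]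

/-- Longitudinal integration by parts against the constant 1. -/
theorem IsStrip.meanI_avI_dS (hL : 0 < L) {x : StripData L} (hx : IsStrip L x) :
    meanI L (avI L x.2.1) = 0 := by
  have h1 := hx.inner_dS_add hL (isStrip_smooth (isSmoothPeriodic_const (L := L) 1))
  have h0 : dS (fun _ : ℝ × ℝ => (1 : ℝ)) = fun _ => 0 := by funext p; simp [dS]
  have hz : l2cls (muQ L) (fun _ => (0 : ℝ)) = 0 := (eq_l2cls (Lp.coeFn_zero ℝ 2 (muQ L))).symm
  have ho : oneI L = l2cls (muI L) fun _ => (1 : ℝ) := eq_l2cls coeFn_oneI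
  simp only [smoothStrip, h0, hz, inner_zero_right, add_zero] at h1
  rw [meanI_apply, real_inner_comm, inner_avI, ho, extI_l2cls continuous_const, h1, mul_zero]

/-- The element of `H²_p` associated with a function on the thin set. -/
def limitData (κ : ℝ → ℝ) (ε : ℝ) (F : FlatField L) : PerData L :=
  (primI L (primI L (avI L (jacOp L κ ε F.a - fstOp L κ F.q))) + meanI L (avI L F.W) • oneI L,
    primI L (avI L (jacOp L κ ε F.a - fstOp L κ F.q)), avI L (jacOp L κ ε F.a - fstOp L κ F.q))

/-- The averaged second derivative is the average of r_s and has mean value zero by periodicity,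
which is the condition for its second primitive to be periodic. -/
theorem limitData_mem (hL : 0 < L) (hF : IsFlatField κ ε F) : limitData κ ε F ∈ perSub L :=
  mem_perSub_of_meanI hL _ _ (hF.strip_r.meanI_avI_dS hL)

/-- The average of r differs from the mean-free primitive only by its mean value. The mean of Jr =
W_s is zero, and J − 1 = O(ε). -/
theorem norm_avI_r_sub_le (hL : 0 < L) (hε : 0 < ε) (hF : IsFlatField κ ε F)
    (hB : IsFieldBound ε B F) (hcoef : IsCoeffBound L κ ε c M K) :
    ‖avI L F.r - (limitData κ ε F).2.1‖ ≤ ‖meanI L‖ * K * ‖oneI L‖ * ε * B := by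
  have hK : 0 ≤ K := (abs_nonneg _).trans (hcoef.curv_le 0 ⟨le_rfl, hL.le⟩)
  have h1 := hF.strip_r.avI_eq hL
  have h2 := hF.strip_W.meanI_avI_dS hL
  simp only at h1 h2
  have h3 : avI L F.r - (limitData κ ε F).2.1 = meanI L (avI L F.r) • oneI L := by
    rw [sub_eq_iff_eq_add', limitData]; exact h1
  have h4 : meanI L (avI L F.r) = -meanI L (avI L (jacOp L κ ε F.r - F.r)) := by
    rw [map_sub, map_sub, h2]; ring
  have h5 : ‖meanI L (avI L (jacOp L κ ε F.r - F.r))‖ ≤ ‖meanI L‖ * (ε * K * B) :=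
    ((meanI L).le_opNorm _).trans (mul_le_mul_of_nonneg_left ((norm_avI_le _).trans
      ((hcoef.norm_jacOp_sub_le hε.le _).trans
        (mul_le_mul_of_nonneg_left hB.r (by positivity)))) (norm_nonneg _))
  rw [h3, norm_smul, h4, norm_neg]
  refine (mul_le_mul_of_nonneg_right h5 (norm_nonneg _)).trans (le_of_eq ?_)
  ring

theorem IsFieldBound.nonneg (hB : IsFieldBound ε B F) : 0 ≤ B := (norm_nonneg _).trans hB.a

theorem IsFieldBound.norm_q_le (hB : IsFieldBound ε B F) (hε1 : ε ≤ 1) : ‖F.q‖ ≤ B :=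
  hB.q.trans (by
    have := Real.sqrt_le_one.2 hε1
    have := hB.nonneg
    nlinarith)

/-- The traces of a function on the thin set are close to an element of `H²_p`. -/
theorem exists_norm_trace_sub_le (hL : 0 < L) (M K : ℝ) (hM : 0 ≤ M) (hK : 0 ≤ K) :
    ∃ C, 0 ≤ C ∧ ∀ ε κ c B, 0 < ε → ε ≤ 1 → 0 ≤ c → IsCoeffBound L κ ε c M K →
      ∀ F : FlatField L, IsFlatField κ ε F → IsFieldBound ε B F →
      ‖F.W₀ - (limitData κ ε F).1‖ ≤ C * ε * B ∧ ‖F.W₁ - (limitData κ ε F).1‖ ≤ C * ε * B ∧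
      ‖avI L F.r - (limitData κ ε F).2.1‖ ≤ C * ε * B ∧ ‖limitData κ ε F‖ ≤ C * B := by
  set p := ‖primI L‖
  set m := ‖meanI L‖
  set o := ‖oneI L‖
  have hp : 0 ≤ p := norm_nonneg _
  have hm : 0 ≤ m := norm_nonneg _
  have ho : 0 ≤ o := norm_nonneg _
  set C₁ := p * (K + m * K * o) + 2
  set C₂ := (p * (p * (M + K)) + m * o) + p * (M + K) + (M + K)
  have hC1 : 0 ≤ C₁ := by positivity
  have hC2 : 0 ≤ C₂ := by positivity
  have hmo : 0 ≤ m * K * o := by positivity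
  refine ⟨C₁ + C₂ + m * K * o, by positivity, fun ε κ c B hε hε1 hc hcoef F hF hB => ?_⟩
  have hB0 := hB.nonneg
  have hq := hB.norm_q_le hε1
  have hr := norm_avI_r_sub_le hL hε hF hB hcoef
  have hεB : 0 ≤ ε * B := by positivity
  have mono : ∀ {D x : ℝ}, D ≤ C₁ + C₂ + m * K * o → x ≤ D * ε * B →
      x ≤ (C₁ + C₂ + m * K * o) * ε * B := fun {D x} h1 h2 => h2.trans (by
    rw [mul_assoc, mul_assoc]; exact mul_le_mul_of_nonneg_right h1 hεB)
  -- Both functions have the same mean value, and they are primitives of functions at distance O(ε),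
  -- namely the average of Jr and the first derivative of the companion.
  have hW : ‖avI L F.W - (limitData κ ε F).1‖ ≤ p * (K + m * K * o) * ε * B := by
    have h1 := hF.strip_W.avI_eq hL
    simp only at h1
    have h2 : avI L F.W - (limitData κ ε F).1 =
        primI L (avI L (jacOp L κ ε F.r) - (limitData κ ε F).2.1) := by
      conv_lhs => rw [h1]
      simp only [limitData, map_sub]; abel
    have h3 : ‖avI L (jacOp L κ ε F.r) - (limitData κ ε F).2.1‖ ≤
        ε * K * B + m * K * o * ε * B := by
      have : avI L (jacOp L κ ε F.r) - (limitData κ ε F).2.1 =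
          avI L (jacOp L κ ε F.r - F.r) + (avI L F.r - (limitData κ ε F).2.1) := by
        rw [map_sub]; abel
      rw [this]
      exact (norm_add_le _ _).trans (add_le_add ((norm_avI_le _).trans
        ((hcoef.norm_jacOp_sub_le hε.le _).trans
          (mul_le_mul_of_nonneg_left hB.r (by positivity)))) hr)
    rw [h2]
    refine ((primI L).le_opNorm _).trans ((mul_le_mul_of_nonneg_left h3 hp).trans (le_of_eq ?_))
    ring
  have hεq : ‖(-ε) • F.q‖ ≤ ε * B := by
    rw [norm_smul, norm_neg, Real.norm_eq_abs, abs_of_pos hε]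
    exact mul_le_mul_of_nonneg_left hq hε.le
  have hW0 : ‖F.W₀ - avI L F.W‖ ≤ ε * B := hF.strip_W.norm_lower_sub_avI_le.trans hεq
  have hW1 : ‖F.W₁ - F.W₀‖ ≤ ε * B := hF.strip_W.norm_upper_sub_lower_le.trans hεq
  have hW0' : ‖F.W₀ - (limitData κ ε F).1‖ ≤ ε * B + p * (K + m * K * o) * ε * B := by
    rw [← sub_add_sub_cancel _ (avI L F.W)]
    exact (norm_add_le _ _).trans (add_le_add hW0 hW)
  refine ⟨mono (D := C₁) (by linarith) (hW0'.trans ?_), mono (D := C₁) (by linarith) ?_,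
    mono (D := m * K * o) (by linarith) hr, ?_⟩
  · simp only [C₁]; linarith
  · rw [← sub_add_sub_cancel _ F.W₀]
    refine (norm_add_le _ _).trans ((add_le_add hW1 hW0').trans (le_of_eq ?_))
    simp only [C₁]; ring
  · have h2 : ‖(limitData κ ε F).2.2‖ ≤ (M + K) * B := by
      refine (norm_avI_le _).trans ((norm_sub_le _ _).trans ?_)
      rw [add_mul]
      exact add_le_add ((hcoef.norm_jacOp_le hc _).trans (mul_le_mul_of_nonneg_left hB.a hM))
        ((hcoef.norm_fstOp_le _).trans (mul_le_mul_of_nonneg_left hq hK))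
    have h1 : ‖(limitData κ ε F).2.1‖ ≤ p * ((M + K) * B) :=
      ((primI L).le_opNorm _).trans (mul_le_mul_of_nonneg_left h2 hp)
    have h0 : ‖(limitData κ ε F).1‖ ≤ p * (p * ((M + K) * B)) + m * B * o := by
      refine (norm_add_le _ _).trans (add_le_add (((primI L).le_opNorm _).trans
        (mul_le_mul_of_nonneg_left h1 hp)) ?_)
      rw [norm_smul]
      exact mul_le_mul_of_nonneg_right (((meanI L).le_opNorm _).trans
        (mul_le_mul_of_nonneg_left ((norm_avI_le _).trans hB.W) hm)) ho
    have a1 : 0 ≤ p * (p * (M + K)) * B := by positivity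
    have a2 : 0 ≤ m * o * B := by positivity
    have a3 : 0 ≤ p * (M + K) * B := by positivity
    have a4 : 0 ≤ (M + K) * B := by positivity
    have a5 : 0 ≤ (C₁ + m * K * o) * B := by positivity
    have a6 : (C₁ + C₂ + m * K * o) * B = p * (p * (M + K)) * B + m * o * B + p * (M + K) * B +
      (M + K) * B + (C₁ + m * K * o) * B := by simp only [C₂]; ring
    rw [a6, Prod.norm_def, Prod.norm_def]
    refine max_le ?_ (max_le ?_ ?_)
    · linarith only [h0, a1, a2, a3, a4, a5]
    · linarith only [h1, a1, a2, a3, a4, a5]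
    · linarith only [h2, a1, a2, a3, a4, a5]

end Comparison

/-! ### Consistency of the energy and of the load with the limit problem -/

section Consistency

variable {L ε c M K μ b B : ℝ} {κ : ℝ → ℝ} {F : FlatField L}

/-- The right-hand side of the thin set problem is close to the one of the limit problem. -/
theorem abs_load_sub_le {C : ℝ} (hε : 0 ≤ ε) (hc : 0 ≤ c)
    (hcoef : IsCoeffBound L κ ε c M K)
    (hB : IsFieldBound ε B F) {χ g f₀ f₁ : LI L} (h0 : ‖F.W₀ - χ‖ ≤ C * ε * B)
    (h1 : ‖F.W₁ - χ‖ ≤ C * ε * B) :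
    |inner ℝ f₀ F.W₀ + inner ℝ (mulOp (muI L) (innerJac κ ε) f₁) F.W₁ - 2 * inner ℝ g χ| ≤
      (‖f₀ - g‖ + M * ‖f₁ - g‖ + (2 * C + K) * ε * ‖g‖) * B := by
  have e : inner ℝ f₀ F.W₀ + inner ℝ (mulOp (muI L) (innerJac κ ε) f₁) F.W₁ - 2 * inner ℝ g χ =
      inner ℝ (f₀ - g) F.W₀ + inner ℝ g (F.W₀ - χ) +
        inner ℝ (mulOp (muI L) (innerJac κ ε) (f₁ - g)) F.W₁ +
        inner ℝ (mulOp (muI L) (innerJac κ ε) g - g) F.W₁ + (inner ℝ g (F.W₁ - χ) : ℝ) := by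
    simp only [inner_sub_left, inner_sub_right, map_sub]; ring
  have b1 := abs_inner_le_of_le (le_refl ‖f₀ - g‖) hB.W₀
  have b2 := abs_inner_le_of_le (le_refl ‖g‖) h0
  have b3 := abs_inner_le_of_le (hcoef.norm_innerJac_le hc (f₁ - g)) hB.W₁
  have b4 := abs_inner_le_of_le (hcoef.norm_innerJac_sub_le hε g) hB.W₁
  have b5 := abs_inner_le_of_le (le_refl ‖g‖) h1
  rw [e]
  refine (abs_add_le _ _).trans ((add_le_add ((abs_add_le _ _).trans (add_le_add
    ((abs_add_le _ _).trans (add_le_add ((abs_add_le _ _).trans (add_le_add b1 b2)) b3)) b4))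
    b5).trans (le_of_eq ?_))
  ring

/-- Longitudinal integration by parts against a function of the arclength. -/
theorem abs_inner_extI_strip_le (hL : 0 < L) {x : StripData L} (hx : IsStrip L x) {ψ : ℝ → ℝ}
    (hψ : ContDiff ℝ ∞ ψ) (hp : Function.Periodic ψ L) :
    |inner ℝ (extI L (l2cls _ ψ)) x.2.1| ≤ ‖l2cls (muI L) (deriv ψ)‖ * ‖x.1‖ := by
  have h1 := hx.inner_dS_add hL (isStrip_smooth (isSmoothPeriodic_fst hψ hp))
  have h0 : dS (fun p : ℝ × ℝ => ψ p.1) = fun p => deriv ψ p.1 := funext fun p => dS_fst hψ p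
  simp only [smoothStrip, h0] at h1
  rw [← extI_l2cls hψ.continuous, ← extI_l2cls (contDiff_deriv_of_smooth hψ).continuous] at h1
  have h2 : inner ℝ (extI L (l2cls _ ψ)) x.2.1 =
      -(inner ℝ (extI L (l2cls _ (deriv ψ))) x.1 : ℝ) := by
    rw [real_inner_comm, real_inner_comm x.1]; linarith
  rw [h2, abs_neg]
  exact abs_inner_le_of_le (norm_extI _).le le_rfl

/-- The energy of the extension of a function of the arclength against a function on the thin set
is close to the limit form. -/
theorem exists_abs_energy_sub_le (hL : 0 < L) (hM : 0 ≤ M) (hK : 0 ≤ K) (hb : 0 ≤ b)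
    (hκ : ContDiff ℝ ∞ κ) (hκp : Function.Periodic κ L) {ψ : ℝ → ℝ} (hψ : ContDiff ℝ ∞ ψ)
    (hp : Function.Periodic ψ L) {C₀ C₁ : ℝ} (hC0 : 0 ≤ C₀) (hC1 : 0 ≤ C₁) :
    ∃ C, 0 ≤ C ∧ ∀ ε c B, 0 < ε → ε ≤ 1 → 0 ≤ c → IsCoeffBound L κ ε c M K →
      ∀ P F : FlatField L, P.c = 0 → P.q₀ = 0 → P.q₁ = 0 → P.W₀ = l2cls _ ψ → P.W₁ = l2cls _ ψ →
      ‖P.a - extI L (l2cls _ (deriv (deriv ψ)))‖ ≤ C₀ * ε →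
      ‖P.b + fstOp L κ (extI L (l2cls _ (deriv ψ)))‖ ≤ C₀ * ε →
      IsFlatField κ ε F → IsFieldBound ε B F →
      ‖F.W₀ - (limitData κ ε F).1‖ ≤ C₁ * ε * B → ‖F.W₁ - (limitData κ ε F).1‖ ≤ C₁ * ε * B →
      ‖avI L F.r - (limitData κ ε F).2.1‖ ≤ C₁ * ε * B →
      |energy κ ε μ b P F - limitForm L κ b (smoothPer L ψ) (limitData κ ε F)| ≤
        C * Real.sqrt ε * B := by
  have hd := contDiff_deriv_of_smooth hψ
  have hκd : ContDiff ℝ ∞ fun s => κ s * deriv ψ s := hκ.mul hd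
  have hκdp : Function.Periodic (fun s => κ s * deriv ψ s) L := fun s => by
    simp only [hκp s, periodic_deriv_real hp s]
  set w₀ := l2cls (muI L) ψ with hw0
  set w₁ := l2cls (muI L) (deriv ψ) with hw1
  set w₂ := l2cls (muI L) (deriv (deriv ψ)) with hw2
  have hκw : l2cls (muI L) (fun s => κ s * deriv ψ s) = mulOp (muI L) κ w₁ :=
    (mulOp_l2cls (isBddWeight_I hκ.continuous) (memLp_I hd.continuous)).symm
  set w₃ := l2cls (muI L) (deriv fun s => κ s * deriv ψ s) with hw3
  set w₄ := mulOp (muI L) κ (mulOp (muI L) κ w₁) with hw4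
  refine ⟨(C₀ * M + K * ‖w₂‖) + 2 * (C₀ * M + ‖w₃‖ + ‖w₄‖ * C₁) + b * (‖w₀‖ * (2 * C₁ + K)),
    by positivity, ?_⟩
  intro ε c B hε hε1 hc hcoef P F hPc hPq0 hPq1 hPW0 hPW1 hPa hPb hF hB h0 h1 hr
  have hB0 := hB.nonneg
  set σ := Real.sqrt ε with hσ
  have hσ0 : 0 ≤ σ := Real.sqrt_nonneg _
  have hεσ : ε ≤ σ := by
    have h1 : σ * σ = ε := Real.mul_self_sqrt hε.le
    have h2 : σ ≤ 1 := Real.sqrt_le_one.2 hε1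
    nlinarith
  have up : ∀ {x : ℝ}, 0 ≤ x → x * ε * B ≤ x * σ * B := fun hx =>
    mul_le_mul_of_nonneg_right (mul_le_mul_of_nonneg_left hεσ hx) hB0
  set χ := limitData κ ε F with hχ
  have hJ : ∀ x y : LQ L, inner ℝ (jacOp L κ ε x) y = (inner ℝ x (jacOp L κ ε y) : ℝ) := fun x y =>
    inner_mulOp_left hcoef.weight x y
  have hκI := isBddWeight_I (L := L) hκ.continuous
  -- The second derivative of the companion is the average of Ja − κq, so besides the error of the
  -- extension only κq = O(√ε) is left over.
  have tA : |inner ℝ (jacOp L κ ε P.a) F.a - inner ℝ w₂ χ.2.2| ≤ (C₀ * M + K * ‖w₂‖) * σ * B := by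
    have e : inner ℝ (jacOp L κ ε P.a) F.a - inner ℝ w₂ χ.2.2 =
        inner ℝ (P.a - extI L w₂) (jacOp L κ ε F.a) +
          (inner ℝ (extI L w₂) (fstOp L κ F.q) : ℝ) := by
      have : inner ℝ w₂ χ.2.2 = (inner ℝ (extI L w₂) (jacOp L κ ε F.a - fstOp L κ F.q) : ℝ) := by
        rw [real_inner_comm, hχ, limitData, inner_avI, real_inner_comm]
      rw [this, hJ, inner_sub_left, inner_sub_right]; ring
    have b1 := abs_inner_le_of_le hPa ((hcoef.norm_jacOp_le hc F.a).trans
      (mul_le_mul_of_nonneg_left hB.a hM))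
    have b2 := abs_inner_le_of_le (norm_extI w₂).le ((hcoef.norm_fstOp_le F.q).trans
      (mul_le_mul_of_nonneg_left hB.q hK))
    have b3 := up (mul_nonneg hC0 hM)
    rw [e]
    refine (abs_add_le _ _).trans ((add_le_add b1 b2).trans ?_)
    calc C₀ * ε * (M * B) + ‖w₂‖ * (K * (σ * B)) = C₀ * M * ε * B + K * ‖w₂‖ * σ * B := by ring
      _ ≤ C₀ * M * σ * B + K * ‖w₂‖ * σ * B := by linarith
      _ = _ := by ring
  -- The origin of the curvature term. The extension has mixed derivative close to −κψ', and Jb =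
  -- q_s − κr for the field. The derivative q_s is moved onto the smooth function κψ', at the price
  -- of ‖q‖ = O(√ε); what remains is ⟨κψ', κr⟩, whose r is replaced by the derivative of the
  -- companion after averaging.
  have tB : |inner ℝ (jacOp L κ ε P.b) F.b -
      inner ℝ (mulOp (muI L) κ w₁) (mulOp (muI L) κ χ.2.1)| ≤
      (C₀ * M + ‖w₃‖ + ‖w₄‖ * C₁) * σ * B := by
    have e1 : inner ℝ (extI L (mulOp (muI L) κ w₁)) (fstOp L κ F.r) =
        (inner ℝ w₄ (avI L F.r) : ℝ) := by
      rw [fstOp, ← inner_mulOp_left (isBddWeight_Q (f := fun p => κ p.1)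
        (hκ.continuous.comp continuous_fst)), ← fstOp, fstOp_extI hκ.continuous, real_inner_comm,
        ← inner_avI, real_inner_comm]
    have e : inner ℝ (jacOp L κ ε P.b) F.b -
        inner ℝ (mulOp (muI L) κ w₁) (mulOp (muI L) κ χ.2.1) =
        inner ℝ (P.b + fstOp L κ (extI L w₁)) (jacOp L κ ε F.b) -
          inner ℝ (extI L (mulOp (muI L) κ w₁)) (jacOp L κ ε F.b + fstOp L κ F.r) +
          (inner ℝ w₄ (avI L F.r - χ.2.1) : ℝ) := by
      have e2 : inner ℝ (mulOp (muI L) κ w₁) (mulOp (muI L) κ χ.2.1) = (inner ℝ w₄ χ.2.1 : ℝ) :=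
        (inner_mulOp_left hκI _ _).symm
      rw [e2, hJ, inner_add_left, inner_add_right, inner_sub_right, e1, fstOp_extI hκ.continuous]
      ring
    have b1 := abs_inner_le_of_le hPb ((hcoef.norm_jacOp_le hc F.b).trans
      (mul_le_mul_of_nonneg_left hB.b hM))
    have b2 := abs_inner_extI_strip_le hL hF.strip_q hκd hκdp
    rw [hκw] at b2
    have b3 := abs_inner_le_of_le (le_refl ‖w₄‖) hr
    have b4 : ‖w₃‖ * ‖F.q‖ ≤ ‖w₃‖ * (σ * B) := mul_le_mul_of_nonneg_left hB.q (norm_nonneg _)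
    have b5 := up (mul_nonneg hC0 hM)
    have b6 := up (mul_nonneg (norm_nonneg w₄) hC1)
    rw [e]
    refine (abs_add_le _ _).trans ((add_le_add ((abs_sub _ _).trans
      (add_le_add b1 (b2.trans b4))) b3).trans ?_)
    calc C₀ * ε * (M * B) + ‖w₃‖ * (σ * B) + ‖w₄‖ * (C₁ * ε * B)
        = C₀ * M * ε * B + ‖w₃‖ * σ * B + ‖w₄‖ * C₁ * ε * B := by ring
      _ ≤ C₀ * M * σ * B + ‖w₃‖ * σ * B + ‖w₄‖ * C₁ * σ * B := by linarith
      _ = _ := by ring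
  -- Both boundary curves contribute the same limit, whence the factor 2.
  have tW : |inner ℝ w₀ F.W₀ + inner ℝ (mulOp (muI L) (innerJac κ ε) w₀) F.W₁ -
      2 * inner ℝ w₀ χ.1| ≤ ‖w₀‖ * (2 * C₁ + K) * σ * B := by
    have h := abs_load_sub_le hε.le hc hcoef hB (g := w₀) (f₀ := w₀) (f₁ := w₀) h0 h1
    rw [sub_self, norm_zero, mul_zero, zero_add, zero_add] at h
    refine h.trans ?_
    have := up (x := ‖w₀‖ * (2 * C₁ + K)) (by positivity)
    linarith
  have e : energy κ ε μ b P F - limitForm L κ b (smoothPer L ψ) χ =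
      (inner ℝ (jacOp L κ ε P.a) F.a - inner ℝ w₂ χ.2.2) +
      2 * (inner ℝ (jacOp L κ ε P.b) F.b -
        inner ℝ (mulOp (muI L) κ w₁) (mulOp (muI L) κ χ.2.1)) +
      b * (inner ℝ w₀ F.W₀ + inner ℝ (mulOp (muI L) (innerJac κ ε) w₀) F.W₁ -
        2 * inner ℝ w₀ χ.1) := by
    simp only [energy, limitForm, smoothPer, hPc, hPq0, hPq1, hPW0, hPW1, map_zero,
      inner_zero_left, ← hw0, ← hw1, ← hw2]
    ring
  rw [e]
  refine (abs_add_le _ _).trans ((add_le_add ((abs_add_le _ _).trans (add_le_add tA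
    (?_ : _ ≤ 2 * ((C₀ * M + ‖w₃‖ + ‖w₄‖ * C₁) * σ * B))))
    (?_ : _ ≤ b * (‖w₀‖ * (2 * C₁ + K) * σ * B))).trans (le_of_eq ?_))
  · rw [abs_mul, abs_of_pos two_pos]; linarith
  · rw [abs_mul, abs_of_nonneg hb]; exact mul_le_mul_of_nonneg_left tW hb
  · ring

end Consistency

/-! ### Components of functions on the boundary of the thin set -/

section Components

variable {L ε M K μ b : ℝ} {γ n : ℝ → E2} {κ : ℝ → ℝ} {Ω : Set E2}

/-- For ε ≤ 1/(2(K + 1)) one has |εtκ| ≤ 1/2, so J is between 1/2 and 3/2; the bound 2 leaves room.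
-/
theorem exists_uniform_coeffBound (L : ℝ) (hκ : Continuous κ) :
    ∃ K ε₁, 0 ≤ K ∧ 0 < ε₁ ∧ ε₁ ≤ 1 ∧ ∀ ε, 0 < ε → ε ≤ ε₁ → IsCoeffBound L κ ε (1 / 2) 2 K := by
  obtain ⟨K, hK, hb⟩ := exists_bound_I L hκ
  refine ⟨K, (2 * (K + 1))⁻¹, hK, by positivity, inv_le_one_of_one_le₀ (by linarith),
    fun ε hε hε1 => ?_⟩
  have h1 : ε * K ≤ 1 / 2 := by
    have : (2 * (K + 1))⁻¹ * (K + 1) = 1 / 2 := by field_simp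
    nlinarith
  have h2 : ∀ p ∈ Icc 0 L ×ˢ Icc (0 : ℝ) 1, |ε * p.2 * κ p.1| ≤ 1 / 2 := fun p hp => by
    rw [abs_mul, abs_mul, abs_of_pos hε, abs_of_nonneg hp.2.1]
    have h3 : p.2 * |κ p.1| ≤ 1 * K := mul_le_mul hp.2.2 (hb _ hp.1) (abs_nonneg _) zero_le_one
    nlinarith
  refine ⟨hκ, fun p hp => ?_, fun p hp => ?_, hb⟩ <;>
  · have := abs_le.1 (h2 p hp)
    rw [tubeJac]; linarith [this.1, this.2]

/-- The rescaled restriction to the outer curve. -/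
def IsTube.outerPart (hT : IsTube L γ n κ ε (thinSet Ω ε)) : Heps Ω ε →L[ℝ] LI L :=
  ε⁻¹ • hT.pullO.comp (ofHeps Ω ε)

/-- The rescaled restriction to the inner curve. -/
def IsTube.innerPart (hT : IsTube L γ n κ ε (thinSet Ω ε)) : Heps Ω ε →L[ℝ] LI L :=
  ε⁻¹ • hT.pullN.comp (ofHeps Ω ε)

theorem IsTube.smul_outerPart (hT : IsTube L γ n κ ε (thinSet Ω ε)) (f : Heps Ω ε) :
    hT.pullO (ofHeps Ω ε f) = ε • hT.outerPart f := by
  rw [IsTube.outerPart, FunLike.coe_smul, Pi.smul_apply, smul_inv_smul₀ hT.eps_pos.ne']; rfl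

theorem IsTube.smul_innerPart (hT : IsTube L γ n κ ε (thinSet Ω ε)) (f : Heps Ω ε) :
    hT.pullN (ofHeps Ω ε f) = ε • hT.innerPart f := by
  rw [IsTube.innerPart, FunLike.coe_smul, Pi.smul_apply, smul_inv_smul₀ hT.eps_pos.ne']; rfl

/-- The weight ε⁻² of the measure cancels the factor ε extracted from the two components. In these
terms the connecting map is u ↦ (u, u), asymptotically isometric because J(s, 1) tends to 1. -/
theorem IsTube.norm_sq_eq_parts (hT : IsTube L γ n κ ε (thinSet Ω ε)) (f : Heps Ω ε) :
    ‖f‖ ^ 2 = ‖hT.outerPart f‖ ^ 2 +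
      inner ℝ (mulOp (muI L) (innerJac κ ε) (hT.innerPart f)) (hT.innerPart f) := by
  have hε := inv_sq_pos hT.eps_pos
  rw [norm_sq_eq_smul hε, hT.norm_sq_bdry, hT.smul_outerPart, hT.smul_innerPart]
  have := hT.eps_pos
  simp only [map_smul, norm_smul, inner_smul_left, inner_smul_right, Real.norm_eq_abs, mul_pow,
    sq_abs, RCLike.conj_to_real]
  field_simp

theorem IsTube.norm_le_parts (hT : IsTube L γ n κ ε (thinSet Ω ε))
    (hcoef : IsCoeffBound L κ ε (1 / 2) 2 K) (f : Heps Ω ε) :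
    ‖f‖ ≤ 2 * (‖hT.outerPart f‖ + ‖hT.innerPart f‖) := by
  have h1 := hT.norm_sq_eq_parts f
  have h2 := (real_inner_le_norm (mulOp (muI L) (innerJac κ ε) (hT.innerPart f))
    (hT.innerPart f)).trans (mul_le_mul_of_nonneg_right (hcoef.norm_innerJac_le (by norm_num) _)
      (norm_nonneg _))
  have h3 := norm_nonneg (hT.outerPart f)
  have h4 := norm_nonneg (hT.innerPart f)
  refine abs_le_of_sq_le_sq' ?_ (by positivity) |>.2
  nlinarith

theorem IsTube.norm_parts_le (hT : IsTube L γ n κ ε (thinSet Ω ε))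
    (hcoef : IsCoeffBound L κ ε (1 / 2) 2 K) (f : Heps Ω ε) :
    ‖hT.outerPart f‖ ≤ ‖f‖ ∧ ‖hT.innerPart f‖ ≤ 2 * ‖f‖ := by
  have h1 := hT.norm_sq_eq_parts f
  have h2 := hcoef.innerJac_ge (hT.innerPart f)
  have h3 := norm_nonneg (hT.outerPart f)
  have h4 := norm_nonneg (hT.innerPart f)
  have h5 := norm_nonneg f
  constructor
  · refine abs_le_of_sq_le_sq' ?_ h5 |>.2
    nlinarith
  · refine abs_le_of_sq_le_sq' ?_ (by positivity) |>.2
    nlinarith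

theorem IsTube.parts_of_isConnectingMap
    (hT : IsTube L γ (fun s => outerNormal Ω (γ s)) κ ε (thinSet Ω ε))
    {E : Hzero L →L[ℝ] Heps Ω ε} (hE : IsConnectingMap Ω L γ ε E) (u : Hzero L) :
    hT.outerPart (E u) = ofHzero L u ∧ hT.innerPart (E u) = ofHzero L u := by
  have h := (hT.isConnectingMap_iff E).1 hE u
  rw [hT.smul_outerPart, hT.smul_innerPart] at h
  exact ⟨smul_right_injective _ hT.eps_pos.ne' h.1, smul_right_injective _ hT.eps_pos.ne' h.2⟩

/-- The resolvent in tube coordinates. -/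
theorem IsTube.exists_parts_of_isSteklovResolvent (hT : IsTube L γ n κ ε (thinSet Ω ε))
    {B : Heps Ω ε →L[ℝ] Heps Ω ε} (hB : IsSteklovResolvent Ω μ b ε B) (f : Heps Ω ε) :
    ∃ v, IsH2Data _ v ∧ hT.outerPart (B f) = (hT.flat v).W₀ ∧
      hT.innerPart (B f) = (hT.flat v).W₁ ∧
      ∀ w, IsH2Data _ w → energy κ ε μ b (hT.flat v) (hT.flat w) =
        inner ℝ (hT.outerPart f) (hT.flat w).W₀ +
          inner ℝ (mulOp (muI L) (innerJac κ ε) (hT.innerPart f)) (hT.flat w).W₁ := by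
  obtain ⟨v, hv, hform, htr⟩ := hB.exists_data hT f
  have hε := hT.eps_pos.ne'
  refine ⟨v, hv, ?_, ?_, fun w hw => ?_⟩
  · refine smul_right_injective _ hε ?_
    dsimp only
    rw [← hT.smul_outerPart, htr, map_smul]; rfl
  · refine smul_right_injective _ hε ?_
    dsimp only
    rw [← hT.smul_innerPart, htr, map_smul]; rfl
  · have h := hform w hw
    rw [hT.form_eq μ b hv hw, hT.inner_bdry_eq, hT.smul_outerPart, hT.smul_innerPart, map_smul,
      inner_smul_left, inner_smul_left, RCLike.conj_to_real, ← mul_add] at h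
    exact mul_left_cancel₀ hε h

theorem IsTube.energy_flat_sub (hT : IsTube L γ n κ ε (thinSet Ω ε)) {v w u : H2Data (thinSet Ω ε)}
    (hv : IsH2Data _ v) (hw : IsH2Data _ w) (hu : IsH2Data _ u) :
    energy κ ε μ b (hT.flat (v - w)) (hT.flat u) =
      energy κ ε μ b (hT.flat v) (hT.flat u) - energy κ ε μ b (hT.flat w) (hT.flat u) := by
  have hvw : IsH2Data _ (v - w) := (h2Sub hT.isTame).sub_mem hv hw
  refine mul_left_cancel₀ hT.eps_pos.ne' ?_
  rw [mul_sub, ← hT.form_eq μ b hvw hu, ← hT.form_eq μ b hv hu, ← hT.form_eq μ b hw hu,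
    hT.form_sub_left]

/-- Uniform bounds for fields whose energy is controlled by a linear functional. -/
theorem exists_bound_of_energy_le (hL : 0 < L) (hK : 0 ≤ K) (hμ : 0 < μ) (hb : 0 < b) :
    ∃ C, 0 ≤ C ∧ ∀ ε, 0 < ε → ε ≤ 1 → ∀ κ, IsCoeffBound L κ ε (1 / 2) 2 K →
      ∀ F : FlatField L, IsFlatField κ ε F → ∀ N, 0 ≤ N →
      (∀ B, IsFieldBound ε B F → energy κ ε μ b F F ≤ N * B) → IsFieldBound ε (C * N) F := by
  obtain ⟨C, hC, h⟩ := exists_field_bound hL (c := 1 / 2) (M := 2) (K := K) (E := 1)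
    (by norm_num) (by norm_num) hK one_pos hμ hb
  refine ⟨C * C, by positivity, fun ε hε hε1 κ hcoef F hF N hN hen => ?_⟩
  rw [mul_assoc]
  refine h ε hε hε1 κ hcoef F hF (C * N) (by positivity) ?_
  rcases le_or_gt (energy κ ε μ b F F) 0 with h0 | h0
  · exact h0.trans (sq_nonneg _)
  · have hs := Real.sq_sqrt h0.le
    have hp := Real.sqrt_pos.2 h0
    -- The a priori bound with X = √energy is inserted into the hypothesis: energy ≤ NC√energy,
    -- hence √energy ≤ CN, and the a priori bound is applied a second time with this value.
    have h1 := hen _ (h ε hε hε1 κ hcoef F hF _ hp.le hs.ge)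
    have h2 : Real.sqrt (energy κ ε μ b F F) ≤ C * N := by
      refine le_of_mul_le_mul_right ?_ hp
      rw [← sq, hs]; linarith
    rw [← hs]
    exact pow_le_pow_left₀ hp.le h2 2

end Components

/-! ### Asymptotic isometry and precompactness -/

section Convergence

variable {L μ b ε₀ : ℝ} {γ : ℝ → E2} {κ : ℝ → ℝ} {Ω : Set E2}

/-- The connecting maps are asymptotically isometric. -/
theorem isConnectingSystem_of_isTube (hκ : Continuous κ) (hε₀ : 0 < ε₀)
    (hT : ∀ ε ∈ Ioo 0 ε₀, IsTube L γ (fun s => outerNormal Ω (γ s)) κ ε (thinSet Ω ε))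
    {E : ∀ ε, Hzero L →L[ℝ] Heps Ω ε} (hE : ∀ ε ∈ Ioo 0 ε₀, IsConnectingMap Ω L γ ε (E ε)) :
    IsConnectingSystem E := by
  intro f
  obtain ⟨K, ε₁, hK, hε1, hε11, hcoef⟩ := exists_uniform_coeffBound L hκ
  set g := ofHzero L f
  have hev : ∀ᶠ ε in 𝓝[>] (0 : ℝ), ε ∈ Ioo 0 (min ε₀ ε₁) :=
    Ioo_mem_nhdsGT (lt_min hε₀ hε1)
  have h1 : Tendsto (fun ε => ‖E ε f‖ ^ 2 - ‖f‖ ^ 2) (𝓝[>] 0) (𝓝 0) := by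
    refine squeeze_zero_norm' (a := fun ε => ε * (K * ‖g‖ ^ 2)) ?_ ?_
    · filter_upwards [hev] with ε hε
      have hε0 : ε ∈ Ioo 0 ε₀ := ⟨hε.1, hε.2.trans_le (min_le_left _ _)⟩
      have hp := (hT ε hε0).parts_of_isConnectingMap (hE ε hε0) f
      have hc := hcoef ε hε.1 (hε.2.le.trans (min_le_right _ _))
      rw [(hT ε hε0).norm_sq_eq_parts, norm_sq_Hzero, hp.1, hp.2]
      have e : ‖g‖ ^ 2 + inner ℝ (mulOp (muI L) (innerJac κ ε) g) g - 2 * ‖g‖ ^ 2 =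
          (inner ℝ (mulOp (muI L) (innerJac κ ε) g - g) g : ℝ) := by
        rw [inner_sub_left, real_inner_self_eq_norm_sq]; ring
      rw [e, Real.norm_eq_abs]
      refine (abs_inner_le_of_le (hc.norm_innerJac_sub_le hε.1.le g) le_rfl).trans (le_of_eq ?_)
      ring
    · have : Tendsto (fun ε : ℝ => ε * (K * ‖g‖ ^ 2)) (𝓝[>] 0) (𝓝 (0 * (K * ‖g‖ ^ 2))) :=
        (tendsto_id.mul_const _).mono_left nhdsWithin_le_nhds
      rwa [zero_mul] at this
  have h2 : Tendsto (fun ε => ‖E ε f‖ ^ 2) (𝓝[>] 0) (𝓝 (‖f‖ ^ 2)) := by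
    have h := h1.add_const (‖f‖ ^ 2)
    rw [zero_add] at h
    exact h.congr fun ε => by ring
  have h3 := (Real.continuous_sqrt.tendsto _).comp h2
  simpa [Function.comp_def, Real.sqrt_sq (norm_nonneg _)] using h3

/-- The solutions of the thin set problems are bounded uniformly. -/
theorem exists_resolvent_bound (hL : 0 < L) (hμ : 0 < μ) (hb : 0 < b) {K : ℝ} (hK : 0 ≤ K) :
    ∃ C, 0 ≤ C ∧ ∀ ε n (hT : IsTube L γ n κ ε (thinSet Ω ε)), ε ≤ 1 →
      IsCoeffBound L κ ε (1 / 2) 2 K → ∀ (v : H2Data (thinSet Ω ε)), IsH2Data _ v →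
      ∀ f : Heps Ω ε, (∀ w, IsH2Data _ w → energy κ ε μ b (hT.flat v) (hT.flat w) =
        inner ℝ (hT.outerPart f) (hT.flat w).W₀ +
          inner ℝ (mulOp (muI L) (innerJac κ ε) (hT.innerPart f)) (hT.flat w).W₁) →
      IsFieldBound ε (C * ‖f‖) (hT.flat v) := by
  obtain ⟨C, hC, h⟩ := exists_bound_of_energy_le (K := K) hL hK hμ hb
  -- The load is at most 5‖f‖: 1 from the outer curve, and on the inner curve 2 from the bound of J
  -- times 2 from the bound of the component.
  refine ⟨C * 5, by positivity, fun ε n hT hε1 hcoef v hv f hen => ?_⟩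
  rw [mul_assoc]
  refine h ε hT.eps_pos hε1 κ hcoef _ (hT.isFlatField hv) _ (by positivity) fun B hB => ?_
  rw [hen v hv]
  obtain ⟨h1, h2⟩ := hT.norm_parts_le hcoef f
  have b1 := abs_inner_le_of_le h1 hB.W₀
  have b2 := abs_inner_le_of_le ((hcoef.norm_innerJac_le (by norm_num) _).trans
    (mul_le_mul_of_nonneg_left h2 zero_le_two)) hB.W₁
  linarith [le_abs_self (inner ℝ (hT.outerPart f) (hT.flat v).W₀),
    le_abs_self (inner ℝ (mulOp (muI L) (innerJac κ ε) (hT.innerPart f)) (hT.flat v).W₁)]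

/-- Resolvents of normalized families are precompact. -/
theorem ePrecompact_of_isTube (hL : 0 < L) (hμ : 0 < μ) (hb : 0 < b) (hκ : Continuous κ)
    (hT : ∀ ε ∈ Ioo 0 ε₀, IsTube L γ (fun s => outerNormal Ω (γ s)) κ ε (thinSet Ω ε))
    {E : ∀ ε, Hzero L →L[ℝ] Heps Ω ε} (hE : ∀ ε ∈ Ioo 0 ε₀, IsConnectingMap Ω L γ ε (E ε))
    {B : ∀ ε, Heps Ω ε →L[ℝ] Heps Ω ε} (hB : ∀ ε ∈ Ioo 0 ε₀, IsSteklovResolvent Ω μ b ε (B ε))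
    {f : ∀ ε, Heps Ω ε} (hf : ∀ ε ∈ Ioo 0 ε₀, ‖f ε‖ = 1) :
    EPrecompact ε₀ E fun ε => B ε (f ε) := by
  intro e he hlim
  obtain ⟨K, ε₁, hK, hε1, hε11, hcoef⟩ := exists_uniform_coeffBound L hκ
  obtain ⟨C, hC, hbound⟩ := exists_resolvent_bound (γ := γ) (κ := κ) (Ω := Ω) hL hμ hb hK
  obtain ⟨C₁, hC1, htrace⟩ := exists_norm_trace_sub_le hL 2 K zero_le_two hK
  choose v hv hv0 hv1 hven using fun j =>
    (hT (e j) (he j)).exists_parts_of_isSteklovResolvent (hB (e j) (he j)) (f (e j))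
  have hflat := fun j => (hT (e j) (he j)).isFlatField (hv j)
  -- The companions of the solutions in H²_p: eventually bounded there and O(ε)-close to both
  -- traces, so a limit in L² of a subsequence of their values is also the limit of the traces.
  let x : ℕ → perSub L := fun j =>
    ⟨limitData κ (e j) ((hT (e j) (he j)).flat (v j)), limitData_mem hL (hflat j)⟩
  have hev : ∀ᶠ j in atTop, e j ≤ ε₁ := by
    filter_upwards [hlim.eventually (gt_mem_nhds hε1)] with j hj using hj.le
  have hdata : ∀ᶠ j in atTop,
      ‖(hT (e j) (he j)).outerPart (B (e j) (f (e j))) - (x j : PerData L).1‖ ≤ C₁ * e j * C ∧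
      ‖(hT (e j) (he j)).innerPart (B (e j) (f (e j))) - (x j : PerData L).1‖ ≤ C₁ * e j * C ∧
      ‖x j‖ ≤ C₁ * C := by
    filter_upwards [hev] with j hj
    have hc := hcoef (e j) (he j).1 hj
    have h1 := hbound (e j) _ (hT (e j) (he j)) (hj.trans hε11) hc (v j) (hv j) (f (e j)) (hven j)
    rw [hf _ (he j), mul_one] at h1
    obtain ⟨h2, h3, -, h4⟩ := htrace (e j) κ (1 / 2) C (he j).1 (hj.trans hε11) (by norm_num) hc _
      (hflat j) h1
    rw [hv0, hv1]
    exact ⟨h2, h3, h4⟩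
  have hcomp := (isCompactOperator_perSub_fst hL).isCompact_closure_image_closedBall (C₁ * C)
  obtain ⟨g, -, k, hk, hkg⟩ := hcomp.tendsto_subseq'
    (x := fun j => (x j : PerData L).1) (Eventually.frequently (by
      filter_upwards [hdata] with j hj
      exact subset_closure ⟨x j, by simpa using hj.2.2, rfl⟩))
  refine ⟨k, hk, toHzero L g, ?_⟩
  have hkt := hk.tendsto_atTop
  have hsub : Tendsto (fun j => ‖(x (k j) : PerData L).1 - g‖) atTop (𝓝 0) :=
    tendsto_iff_norm_sub_tendsto_zero.1 hkg
  refine squeeze_zero' (g := fun j => 2 * ((C₁ * e (k j) * C + ‖(x (k j) : PerData L).1 - g‖) +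
    (C₁ * e (k j) * C + ‖(x (k j) : PerData L).1 - g‖)))
    (Eventually.of_forall fun _ => norm_nonneg _) ?_ ?_
  · filter_upwards [hkt.eventually hev, hkt.eventually hdata] with j h1 h2
    have hp := (hT _ (he (k j))).parts_of_isConnectingMap (hE _ (he (k j))) (toHzero L g)
    rw [ofHzero_toHzero] at hp
    refine ((hT _ (he (k j))).norm_le_parts (hcoef _ (he (k j)).1 h1) _).trans
      (mul_le_mul_of_nonneg_left (add_le_add ?_ ?_) zero_le_two)
    · rw [map_sub, hp.1, ← sub_add_sub_cancel _ (x (k j) : PerData L).1]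
      exact (norm_add_le _ _).trans (add_le_add h2.1 le_rfl)
    · rw [map_sub, hp.2, ← sub_add_sub_cancel _ (x (k j) : PerData L).1]
      exact (norm_add_le _ _).trans (add_le_add h2.2.1 le_rfl)
  · have h1 : Tendsto (fun j => C₁ * e (k j) * C) atTop (𝓝 (C₁ * 0 * C)) :=
      ((hlim.comp hkt).const_mul C₁).mul_const C
    have h2 := ((h1.add hsub).add (h1.add hsub)).const_mul 2
    simpa using h2

end Convergence

/-! ### Convergence of the resolvents -/

section Limit

variable {L μ b ε₀ : ℝ} {γ : ℝ → E2} {κ : ℝ → ℝ} {Ω : Set E2}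

theorem exists_abs_limitForm_le (hb : 0 ≤ b) :
    ∃ C, 0 ≤ C ∧ ∀ x y : PerData L, |limitForm L κ b x y| ≤ C * ‖x‖ * ‖y‖ := by
  set T := mulOp (muI L) κ
  refine ⟨1 + 2 * (‖T‖ * ‖T‖) + 2 * b, by positivity, fun x y => ?_⟩
  have hx0 := norm_fst_le x
  have hx1 := (norm_fst_le x.2).trans (norm_snd_le x)
  have hx2 := (norm_snd_le x.2).trans (norm_snd_le x)
  have hy0 := norm_fst_le y
  have hy1 := (norm_fst_le y.2).trans (norm_snd_le y)
  have hy2 := (norm_snd_le y.2).trans (norm_snd_le y)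
  have b2 := abs_inner_le_of_le hx2 hy2
  have b1 := abs_inner_le_of_le
    ((T.le_opNorm x.2.1).trans (mul_le_mul_of_nonneg_left hx1 (norm_nonneg T)))
    ((T.le_opNorm y.2.1).trans (mul_le_mul_of_nonneg_left hy1 (norm_nonneg T)))
  have b0 := abs_inner_le_of_le hx0 hy0
  rw [limitForm]
  refine (abs_add_le _ _).trans ((add_le_add ((abs_add_le _ _).trans (add_le_add b2
    (?_ : _ ≤ 2 * (‖T‖ * ‖x‖ * (‖T‖ * ‖y‖))))) (?_ : _ ≤ 2 * b * (‖x‖ * ‖y‖))).trans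
    (le_of_eq ?_))
  · rw [abs_mul, abs_of_pos two_pos]; linarith
  · rw [abs_mul, abs_of_nonneg (by positivity)]
    exact mul_le_mul_of_nonneg_left b0 (by positivity)
  · ring

/-- Resolvents of convergent families converge to the resolvent of the limit problem. -/
theorem opEConverges_of_isTube (hL : 0 < L) (hμ : 0 < μ) (hb : 0 < b) (hκ : ContDiff ℝ ∞ κ)
    (hκp : Function.Periodic κ L) (hε₀ : 0 < ε₀)
    (hT : ∀ ε ∈ Ioo 0 ε₀, IsTube L γ (fun s => outerNormal Ω (γ s)) κ ε (thinSet Ω ε))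
    {E : ∀ ε, Hzero L →L[ℝ] Heps Ω ε} (hE : ∀ ε ∈ Ioo 0 ε₀, IsConnectingMap Ω L γ ε (E ε))
    {B : ∀ ε, Heps Ω ε →L[ℝ] Heps Ω ε} (hB : ∀ ε ∈ Ioo 0 ε₀, IsSteklovResolvent Ω μ b ε (B ε))
    {B₀ : Hzero L →L[ℝ] Hzero L} (hB₀ : IsLimitResolvent L κ b B₀) : OpEConverges E B B₀ := by
  intro f f₀ hf
  obtain ⟨K, ε₁, hK, hε1, hε11, hcoef⟩ := exists_uniform_coeffBound L hκ.continuous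
  obtain ⟨C, hC, hbound⟩ := exists_bound_of_energy_le (K := K) hL hK hμ hb
  obtain ⟨C₁, hC1, htrace⟩ := exists_norm_trace_sub_le hL 2 K zero_le_two hK
  obtain ⟨C₂, hC2, hlimit⟩ := exists_abs_limitForm_le (L := L) (κ := κ) hb.le
  obtain ⟨x, hx, hxform, hxB⟩ := hB₀.exists_data hκ.continuous f₀
  set g := ofHzero L f₀ with hg
  -- Total amplification of the tolerance δ: `C` from stability, applied to the error δ of load and
  -- energy and to the error C₂C₁δ of replacing the limit solution by ψ in the form, plus 1 for the
  -- distance of ψ from the solution itself. With δ = η/(8A) each of the two components is at most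
  -- η/8, and `IsTube.norm_le_parts` gives at most η/2 in total.
  set A := C * (C₂ * C₁ + 1) + 1 with hA
  have hApos : 0 < A := by positivity
  rw [EConverges, Metric.tendsto_nhds]
  intro η hη
  set δ := η / (8 * A) with hδ
  have hδ0 : 0 < δ := by positivity
  obtain ⟨_, ⟨ψ, hψ, hψp, rfl⟩, hdist⟩ := Metric.mem_closure_iff.1 (mem_perSub_iff.1 hx) δ hδ0
  rw [dist_eq_norm] at hdist
  obtain ⟨C₃, hC3, hext⟩ := exists_extension_bound (γ := γ)
    (n := fun s => outerNormal Ω (γ s)) hκ hψ hψp K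
  obtain ⟨C₄, hC4, hcons⟩ := exists_abs_energy_sub_le (μ := μ) (C₀ := C₃) (C₁ := C₁) hL zero_le_two
    hK hb.le hκ hκp hψ hψp hC3 hC1
  -- The three consistency errors for fixed ψ: convergence of the data, of the load, and of the
  -- energy. The function ψ is chosen before ε, since `C₄` depends on it.
  let N : ℝ → ℝ := fun ε => 5 * ‖f ε - E ε f₀‖ + (2 * C₁ + K) * ε * ‖g‖ + C₄ * Real.sqrt ε
  have hN : Tendsto N (𝓝[>] 0) (𝓝 0) := by
    have h1 : Tendsto (fun ε : ℝ => (2 * C₁ + K) * ε * ‖g‖ + C₄ * Real.sqrt ε) (𝓝[>] 0)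
        (𝓝 ((2 * C₁ + K) * 0 * ‖g‖ + C₄ * Real.sqrt 0)) := by
      have : Continuous fun ε : ℝ => (2 * C₁ + K) * ε * ‖g‖ + C₄ * Real.sqrt ε := by fun_prop
      exact (this.tendsto 0).mono_left nhdsWithin_le_nhds
    have h2 := (Tendsto.const_mul 5 hf).add h1
    simp only [mul_zero, zero_mul, Real.sqrt_zero, add_zero] at h2
    exact h2.congr fun ε => by simp only [N]; ring
  filter_upwards [Ioo_mem_nhdsGT (lt_min hε₀ hε1), hN.eventually (gt_mem_nhds hδ0)] with ε hε hNε
  have hε0 : ε ∈ Ioo 0 ε₀ := ⟨hε.1, hε.2.trans_le (min_le_left _ _)⟩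
  have hεε1 : ε ≤ ε₁ := hε.2.le.trans (min_le_right _ _)
  have hεle : ε ≤ 1 := hεε1.trans hε11
  have hc := hcoef ε hε.1 hεε1
  have hTε := hT ε hε0
  obtain ⟨v, hv, hv0, hv1, hven⟩ := hTε.exists_parts_of_isSteklovResolvent (hB ε hε0) (f ε)
  obtain ⟨w, hw, hwc, hwq0, hwq1, hwW0, hwW1, hwa, hwb⟩ := hext ε 2 _ hTε hεle hc
  have hvw : IsH2Data _ (v - w) := (h2Sub hTε.isTame).sub_mem hv hw
  have hF := hTε.isFlatField hvw
  have hpE := hTε.parts_of_isConnectingMap (hE ε hε0)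
  have hpf := hTε.norm_parts_le hc (f ε - E ε f₀)
  rw [map_sub, map_sub, (hpE f₀).1, (hpE f₀).2, ← hg] at hpf
  have hmem := limitData_mem hL hF
  have hN0 : 0 ≤ N ε + C₂ * δ * C₁ := by
    have := hε.1.le
    simp only [N]; positivity
  -- The energy of v − w is the load on v − w minus the energy of w against v − w. These are close
  -- to the right-hand side of the limit problem and to the limit form of ψ, both evaluated at the
  -- companion of v − w; the companion lies in H²_p, so the limit equation for the exact solution
  -- makes the two main terms cancel up to the error of ψ.
  have key := hbound ε hε.1 hεle κ hc _ hF (N ε + C₂ * δ * C₁) hN0 fun B' hB' => by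
    have hB0 := hB'.nonneg
    obtain ⟨t0, t1, t2, t3⟩ := htrace ε κ (1 / 2) B' hε.1 hεle (by norm_num) hc _ hF hB'
    have h1 := hcons ε (1 / 2) B' hε.1 hεle (by norm_num) hc (hTε.flat w) _ hwc hwq0 hwq1 hwW0 hwW1
      hwa hwb hF hB' t0 t1 t2
    have h2 := abs_load_sub_le (g := g) (f₀ := hTε.outerPart (f ε)) (f₁ := hTε.innerPart (f ε))
      hε.1.le (by norm_num) hc hB' t0 t1
    have h3 := hlimit (x - smoothPer L ψ) (limitData κ ε (hTε.flat (v - w)))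
    rw [limitForm_sub_left, hxform _ hmem] at h3
    have h4 : C₂ * ‖x - smoothPer L ψ‖ * ‖limitData κ ε (hTε.flat (v - w))‖ ≤
        C₂ * δ * (C₁ * B') :=
      mul_le_mul (mul_le_mul_of_nonneg_left hdist.le hC2) t3 (norm_nonneg _) (by positivity)
    have h5 : (‖hTε.outerPart (f ε) - g‖ + 2 * ‖hTε.innerPart (f ε) - g‖ +
        (2 * C₁ + K) * ε * ‖g‖) * B' ≤
        (5 * ‖f ε - E ε f₀‖ + (2 * C₁ + K) * ε * ‖g‖) * B' :=
      mul_le_mul_of_nonneg_right (by linarith [hpf.1, hpf.2]) hB0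
    rw [hTε.energy_flat_sub hv hw hvw, hven _ hvw]
    have e : (N ε + C₂ * δ * C₁) * B' = (5 * ‖f ε - E ε f₀‖ + (2 * C₁ + K) * ε * ‖g‖) * B' +
        C₄ * Real.sqrt ε * B' + C₂ * δ * (C₁ * B') := by simp only [N]; ring
    rw [e]
    linarith only [(abs_le.1 h1).1, (abs_le.1 h2).2, (abs_le.1 h3).2, h4, h5]
  have hsmall : C * (N ε + C₂ * δ * C₁) + δ ≤ A * δ := by
    have : C * (N ε + C₂ * δ * C₁) ≤ C * (δ + C₂ * δ * C₁) :=
      mul_le_mul_of_nonneg_left (by linarith) hC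
    rw [hA]; linarith
  have hfst : ‖l2cls (muI L) ψ - x.1‖ ≤ δ := by
    rw [norm_sub_rev]
    exact (norm_fst_le (x - smoothPer L ψ)).trans hdist.le
  rw [dist_zero_right, norm_norm]
  have hpB := hpE (B₀ f₀)
  rw [hxB] at hpB
  have q0 : ‖hTε.outerPart (B ε (f ε) - E ε (B₀ f₀))‖ ≤ A * δ := by
    rw [map_sub, hpB.1, hv0, ← sub_add_sub_cancel _ (l2cls (muI L) ψ)]
    refine (norm_add_le _ _).trans ((add_le_add ?_ hfst).trans hsmall)
    have := key.W₀
    simp only [IsTube.flat, Prod.fst_sub, Prod.snd_sub, map_sub] at this hwW0 ⊢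
    rwa [hwW0] at this
  have q1 : ‖hTε.innerPart (B ε (f ε) - E ε (B₀ f₀))‖ ≤ A * δ := by
    rw [map_sub, hpB.2, hv1, ← sub_add_sub_cancel _ (l2cls (muI L) ψ)]
    refine (norm_add_le _ _).trans ((add_le_add ?_ hfst).trans hsmall)
    have := key.W₁
    simp only [IsTube.flat, Prod.fst_sub, Prod.snd_sub, map_sub] at this hwW1 ⊢
    rwa [hwW1] at this
  have hAδ : A * δ = η / 8 := by rw [hδ]; field_simp
  have := hTε.norm_le_parts hc (B ε (f ε) - E ε (B₀ f₀))
  linarith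

end Limit

end ThinSteklov

end

/-! ### The main theorem -/

theorem theorem3p1 (Ω : Set E2) (hΩ_open : IsOpen Ω) (hΩ_conn : IsConnected Ω)
    (hΩ_bdd : Bornology.IsBounded Ω) (hΩ_smooth : HasSmoothBoundary Ω)
    (L : ℝ) (γ : ℝ → E2) (hγ : IsArclengthParam Ω L γ)
    (μ b : ℝ) (hμ : 0 < μ) (hb : 0 < b) :
    0 < tubularRadius Ω ∧
    (∀ ε ∈ Ioo 0 (tubularRadius Ω),
      (∃! E : Hzero L →L[ℝ] Heps Ω ε, IsConnectingMap Ω L γ ε E) ∧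
      (∃! B : Heps Ω ε →L[ℝ] Heps Ω ε, IsSteklovResolvent Ω μ b ε B)) ∧
    (∃! B₀ : Hzero L →L[ℝ] Hzero L, IsLimitResolvent L (curvature Ω γ) b B₀) ∧
    ∀ (E : ∀ ε, Hzero L →L[ℝ] Heps Ω ε) (B : ∀ ε, Heps Ω ε →L[ℝ] Heps Ω ε)
      (B₀ : Hzero L →L[ℝ] Hzero L),
      (∀ ε ∈ Ioo 0 (tubularRadius Ω), IsConnectingMap Ω L γ ε (E ε)) →
      (∀ ε ∈ Ioo 0 (tubularRadius Ω), IsSteklovResolvent Ω μ b ε (B ε)) →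
      IsLimitResolvent L (curvature Ω γ) b B₀ →
      IsConnectingSystem E ∧ ConvergesCompactly (tubularRadius Ω) E B B₀ := by
  obtain ⟨hpos, htub⟩ := isTubular_of_lt hΩ_open hΩ_conn.nonempty hΩ_bdd hγ
  have hT : ∀ ε ∈ Ioo 0 (tubularRadius Ω),
      IsTube L γ (fun s => outerNormal Ω (γ s)) (curvature Ω γ) ε (thinSet Ω ε) := by
    intro ε hε
    obtain ⟨ε', h1, h2⟩ := htub ε hε.2
    exact isTube_thinSet hΩ_open hΩ_bdd hΩ_smooth hγ h2 hε.1 h1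
  have hκ := contDiff_curvature hΩ_open hΩ_smooth hγ
  have hκp : Function.Periodic (curvature Ω γ) L :=
    -- Periodicity of the curvature is part of the tube data for any admissible width; half the
    -- radius is one.
    (hT (tubularRadius Ω / 2) ⟨half_pos hpos, half_lt_self hpos⟩).periodic_curvature
  obtain ⟨R₀, hR₀, hR₀c⟩ := exists_limitResolvent (κ := curvature Ω γ) hγ.pos hb hκ.continuous
  refine ⟨hpos, fun ε hε => ⟨?_, ?_⟩, ⟨R₀, hR₀, fun R h => h.unique hR₀⟩,
    fun E B B₀ hE hB hB₀ => ⟨?_, fun ε hε => ?_, ?_, ?_, fun f hf => ?_⟩⟩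
  · obtain ⟨E, hE⟩ := (hT ε hε).exists_isConnectingMap
    exact ⟨E, hE, fun E' hE' => (hT ε hε).connectingMap_unique hE' hE⟩
  · obtain ⟨B, hB, -⟩ := (hT ε hε).exists_resolvent hμ hb
    exact ⟨B, hB, fun B' hB' => hB'.unique hB⟩
  · exact isConnectingSystem_of_isTube hκ.continuous hpos hT hE
  · obtain ⟨B', hB', hc⟩ := (hT ε hε).exists_resolvent hμ hb
    rwa [(hB ε hε).unique hB']
  · rwa [hB₀.unique hR₀]
  · exact opEConverges_of_isTube hγ.pos hμ hb hκ hκp hpos hT hE hB hB₀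
  · exact ePrecompact_of_isTube hγ.pos hμ hb hκ.continuous hT hE hB hf
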